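/- Let $K$ be a field of characteristic $0$, let $X$ be a $K$-scheme of finite type, and let $U=(U_{(0)},\dots,U_{(m)})$ be a finite covering of $X$ by affine open sets. **Notation.** Let $\mathcal P_X$ be the completion of $\mathcal O_{X\times_K X}$ along the diagonal, regarded as a sheaf on $X$, with the two algebra homomorphisms $p_1^*,p_2^*:\mathcal O_X\to\mathcal P_X$, and let $\mathcal I_X$ be the kernel of $\mathcal P_X\to\mathcal O_X$. Let $\Omega_X^p$ be the sheaf of Kähler $p$-forms over $K$. For an $\mathcal O_X$-module $\mathcal M$ consider $\Omega^p_X\otimes\mathcal P_X\otimes\mathcal M$, where the left tensor product is over $\mathcal O_X$ via $p_1^*$ and the right one via $p_2^*$. The operator $\nabla$ on it is determined by the following: on $\mathcal P_X$ it is the continuous extension of $a\otimes b\mapsto da\otimes b$, it is linear over the right factor $\mathcal M$, and $\nabla(\alpha\otimes b)=d\alpha\otimes b+(-1)^p\alpha\wedge\nabla b$ for $\alpha\in\Omega^p_X$. For $\mathcal M$ quasi-coherent and $W\subset X$ open, $\Gamma(W,\Omega^p_X\otimes\mathcal P_X\otimes\mathcal M)$ carries the $\mathcal I_X$-adic dir-inv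 structure: the directed system of the $\Gamma(W,\mathcal F)$, for the coherent $\mathcal P_X$-submodules $\mathcal F$, each filtered by the $\Gamma(W,\mathcal I_X^{i+1}\mathcal F)$, $i\ge 0$. For a $K$-module $S$ with the discrete structure and a dir-inv module $N=(F_jN,\{F^iF_jN\})$ put $S\hat\otimes N=\varinjlim_{j}\varprojlim_i\,(S\otimes F_jN)/(S\otimes F^iF_jN)$, where $S\otimes(-)$ is over $K$ (this is the completed tensor product). Let $\Omega^q(\Delta^l_K)$ be the polynomial $q$-forms on the algebraic $l$-simplex $\operatorname{Spec}K[t_0,\dots,t_l]/(t_0+\dots+t_l-1)$, let $\Delta^m_l$ be the set of monotone sequences $\boldsymbol i=(i_0\le\dots\le i_l)$ in $\{0,\dots,m\}$, and put $U_{\boldsymbol i}=U_{(i_0)}\cap\dots\cap U_{(i_l)}$. For $V\subset X$ open, $\mathrm{Mix}^{p,q}_U(\mathcal M)(V)$ is the $K$-module of sequences $(u_l)_{l\ge 0}$ with $$u_l\in\prod_{\boldsymbol i\in\Delta^m_l}\Omega^q(\Delta^l_K)\,\hat\otimes\,\Gamma\big(V\cap U_{\boldsymbol i},\ \Omega^p_X\otimes\mathcal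 P_X\otimes\mathcal M\big)$$ such that for every monotone map $\alpha:\{0,\dots,k\}\to\{0,\dots,l\}$ the image of $u_k$ under the cosimplicial map of $\alpha$ (the restriction from $V\cap U_{\boldsymbol i\circ\alpha}$ to $V\cap U_{\boldsymbol i}$, for each $\boldsymbol i\in\Delta^m_l$) equals the image of $u_l$ under the pullback $\Omega^q(\Delta^l_K)\to\Omega^q(\Delta^k_K)$ given by $\alpha$. Put $\mathrm{Mix}^i_U(\mathcal M)=\bigoplus_{p+q=i}\mathrm{Mix}^{p,q}_U(\mathcal M)$ and $\mathrm{Mix}_U(\mathcal M)=\bigoplus_i\mathrm{Mix}^i_U(\mathcal M)$. The differential $d_{\mathrm{mix}}$ is, in each simplicial degree, the continuous extension of $\omega\otimes n\mapsto d\omega\otimes n+(-1)^q\,\omega\otimes\nabla n$ for $\omega\in\Omega^q(\Delta^l_K)$. The product $\mathrm{Mix}_U(\mathcal O_X)\times\mathrm{Mix}_U(\mathcal M)\to\mathrm{Mix}_U(\mathcal M)$ is, in each simplicial degree, the continuous extension of $(\omega\otimes a)(\omega'\otimes n)=(-1)^{pq'}\,(\omega\wedge\omega')\otimes(a\,n)$,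 where $p$ is the degree of $a$ in $\Omega_X$ and $q'$ is the degree of $\omega'$. The map $\mathcal P_X\otimes\mathcal M\to\mathrm{Mix}^0_U(\mathcal M)$ that sends a section $n$ over $V$ to the sequence $u_l=(1\otimes n|_{V\cap U_{\boldsymbol i}})_{\boldsymbol i}$ gives, by composition with $p_1^*,p_2^*:\mathcal O_X\to\mathcal P_X$ and with $\mathcal M\to\mathcal P_X\otimes\mathcal M$, $m\mapsto1\otimes m$, maps $p_1^*,p_2^*:\mathcal O_X\to\mathrm{Mix}^0_U(\mathcal O_X)$ and $\mathcal M\to\mathrm{Mix}_U^0(\mathcal M)$, $m\mapsto 1\otimes m$. **Proposition.** 1. With this product and the differential $d_{\mathrm{mix}}$, $\mathrm{Mix}_U(\mathcal O_X)$ is a sheaf of super-commutative associative unital DG $K$-algebras, and $p_1^*,p_2^*:\mathcal O_X\to\mathrm{Mix}^0_U(\mathcal O_X)$ are homomorphisms of sheaves of unital $K$-algebras. 2. For every quasi-coherent $\mathcal O_X$-module $\mathcal M$, $\mathrm{Mix}_U(\mathcal M)$ is a sheaf, and with this product and differential it is a left DG $\mathrm{Mix}_U(\mathcal O_X)$-module.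 3. If $\mathcal M$ is moreover locally free of finite rank, then the multiplication map $$\mathrm{Mix}_U(\mathcal O_X)\otimes_{\mathcal O_X}\mathcal M\to\mathrm{Mix}_U(\mathcal M),\qquad u\otimes m\mapsto u\cdot(1\otimes m),$$ is an isomorphism of sheaves of $\mathcal O_X$-modules. Here $\mathrm{Mix}_U(\mathcal O_X)$ and $\mathrm{Mix}_U(\mathcal M)$ are $\mathcal O_X$-modules through $p_2^*$. -/

import Mathlib

open CategoryTheory TopologicalSpace AlgebraicGeometry TensorProduct

universe u

noncomputable section

namespace MixRes

/-! ## The de Rham algebra of a commutative algebra -/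

section DeRham

variable (K : Type*) [CommRing K] (R : Type*) [CommRing R] [Algebra K R]

/-- The algebra `Ω_{R/K} = ⨁ Ω^p_{R/K}` of differential forms: the exterior algebra of the
module of Kähler differentials. -/
abbrev DR : Type _ := ExteriorAlgebra R Ω[R⁄K]

namespace DR

variable {R}

/-- The form `dr` of degree one. -/
abbrev ofD (r : R) : DR K R := ExteriorAlgebra.ι R (KaehlerDifferential.D K R r)

variable (R)

/-- The sign involution: `ω ↦ (-1)^p ω` on forms of degree `p`. -/
def sgn : DR K R →ₐ[R] DR K R := CliffordAlgebra.involute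

/-- The forms of degree `p`. -/
def deg (p : ℕ) : Submodule K (DR K R) :=
  (⋀[R]^p Ω[R⁄K] : Submodule R (DR K R)).restrictScalars K

variable {R}

theorem sgn_ι (w : Ω[R⁄K]) : sgn K R (ExteriorAlgebra.ι R w) = -ExteriorAlgebra.ι R w :=
  CliffordAlgebra.involute_ι w

theorem ι_mul (w : Ω[R⁄K]) (a : DR K R) :
    ExteriorAlgebra.ι R w * a = sgn K R a * ExteriorAlgebra.ι R w := by
  induction a using ExteriorAlgebra.induction with
  | algebraMap r => rw [AlgHom.commutes]; exact (Algebra.commutes r _).symm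
  | ι v =>
    rw [sgn_ι, neg_mul]
    have h := ExteriorAlgebra.ι_sq_zero (R := R) (w + v)
    rw [map_add, add_mul, mul_add, mul_add, ExteriorAlgebra.ι_sq_zero,
      ExteriorAlgebra.ι_sq_zero, zero_add, add_zero] at h
    exact eq_neg_of_add_eq_zero_left h
  | mul a b ha hb => rw [map_mul, mul_assoc, ← hb, ← mul_assoc, ha, mul_assoc]
  | add a b ha hb => rw [map_add, mul_add, add_mul, ha, hb]

variable (R)

/-- An auxiliary ring: pairs of forms with the product
`(a, b) (a', b') = (a a', b a' + sgn(a) b')`.  A graded derivation `d` of the algebra of forms is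
the same as a ring homomorphism of the form `a ↦ (a, d a)` into this ring. -/
@[ext] structure Tw where
  /-- first component -/
  fst : DR K R
  /-- second component -/
  snd : DR K R

namespace Tw

variable {K R}

instance : Zero (Tw K R) := ⟨⟨0, 0⟩⟩
instance : One (Tw K R) := ⟨⟨1, 0⟩⟩
instance : Add (Tw K R) := ⟨fun x y => ⟨x.1 + y.1, x.2 + y.2⟩⟩
instance : Neg (Tw K R) := ⟨fun x => ⟨-x.1, -x.2⟩⟩
instance : Mul (Tw K R) := ⟨fun x y => ⟨x.1 * y.1, x.2 * y.1 + sgn K R x.1 * y.2⟩⟩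

@[simp] theorem zero_fst : (0 : Tw K R).1 = 0 := rfl
@[simp] theorem zero_snd : (0 : Tw K R).2 = 0 := rfl
@[simp] theorem one_fst : (1 : Tw K R).1 = 1 := rfl
@[simp] theorem one_snd : (1 : Tw K R).2 = 0 := rfl
@[simp] theorem add_fst (x y : Tw K R) : (x + y).1 = x.1 + y.1 := rfl
@[simp] theorem add_snd (x y : Tw K R) : (x + y).2 = x.2 + y.2 := rfl
@[simp] theorem neg_fst (x : Tw K R) : (-x).1 = -x.1 := rfl
@[simp] theorem neg_snd (x : Tw K R) : (-x).2 = -x.2 := rfl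
@[simp] theorem mul_fst (x y : Tw K R) : (x * y).1 = x.1 * y.1 := rfl
@[simp] theorem mul_snd (x y : Tw K R) : (x * y).2 = x.2 * y.1 + sgn K R x.1 * y.2 := rfl

instance : Ring (Tw K R) where
  add_assoc x y z := by ext <;> simp [add_assoc]
  zero_add x := by ext <;> simp
  add_zero x := by ext <;> simp
  add_comm x y := by ext <;> simp [add_comm]
  neg_add_cancel x := by ext <;> simp
  mul_assoc x y z := by ext <;> simp [mul_assoc, add_mul, mul_add, add_assoc]
  one_mul x := by ext <;> simp
  mul_one x := by ext <;> simp
  left_distrib x y z := by ext <;> simp [mul_add]; abel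
  right_distrib x y z := by ext <;> simp [add_mul]; abel
  zero_mul x := by ext <;> simp
  mul_zero x := by ext <;> simp
  nsmul := nsmulRec
  zsmul := zsmulRec

instance : Algebra R (Tw K R) := RingHom.toAlgebra'
  { toFun := fun r => ⟨algebraMap R _ r, ofD K r⟩
    map_one' := by ext <;> simp
    map_zero' := by ext <;> simp
    map_add' := fun r s => by ext <;> simp [ofD]
    map_mul' := fun r s => by
      ext
      · simp
      · simp [ofD, Algebra.smul_def, AlgHom.commutes, add_comm, Algebra.commutes] }
  (fun r x => by
    ext
    · exact Algebra.commutes r x.1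
    · change ofD K r * x.1 + sgn K R (algebraMap R _ r) * x.2 =
        x.2 * algebraMap R _ r + sgn K R x.1 * ofD K r
      rw [AlgHom.commutes, ι_mul, Algebra.commutes r x.2, add_comm])

theorem algebraMap_fst (r : R) : (algebraMap R (Tw K R) r).1 = algebraMap R _ r := rfl
theorem algebraMap_snd (r : R) : (algebraMap R (Tw K R) r).2 = ofD K r := rfl
theorem smul_fst (r : R) (x : Tw K R) : (r • x).1 = r • x.1 := by
  rw [Algebra.smul_def, mul_fst, algebraMap_fst, ← Algebra.smul_def]
theorem smul_snd (r : R) (x : Tw K R) : (r • x).2 = ofD K r * x.1 + r • x.2 := by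
  rw [Algebra.smul_def, mul_snd, algebraMap_fst, algebraMap_snd, AlgHom.commutes,
    ← Algebra.smul_def]

instance : Algebra K (Tw K R) := Algebra.compHom _ (algebraMap K R)

instance : IsScalarTower K R (Tw K R) := IsScalarTower.of_algebraMap_eq fun _ => rfl

/-- The derivation `r ↦ (dr, 0)`. -/
def der : Derivation K R (Tw K R) where
  toFun r := ⟨ofD K r, 0⟩
  map_add' r s := by ext <;> simp [ofD]
  map_smul' k r := by
    ext
    · rw [RingHom.id_apply, ← algebraMap_smul R k (⟨ofD K r, 0⟩ : Tw K R), smul_fst]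
      simp [ofD]
    · rw [RingHom.id_apply, ← algebraMap_smul R k (⟨ofD K r, 0⟩ : Tw K R), smul_snd]
      simp [ofD]
  map_one_eq_zero' := by ext <;> simp
  leibniz' r s := by
    ext
    · change ofD K (r * s) = (r • (⟨ofD K s, 0⟩ : Tw K R)).1 + (s • (⟨ofD K r, 0⟩ : Tw K R)).1
      rw [smul_fst, smul_fst]
      simp [ofD]
    · change (0 : DR K R) = (r • (⟨ofD K s, 0⟩ : Tw K R)).2 + (s • (⟨ofD K r, 0⟩ : Tw K R)).2
      rw [smul_snd, smul_snd]
      simp [ofD, ι_mul K _ (ExteriorAlgebra.ι R (KaehlerDifferential.D K R s)), sgn_ι]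

/-- The linear map on one-forms which lifts to the ring homomorphism `a ↦ (a, d a)`. -/
def lin : Ω[R⁄K] →ₗ[R] Tw K R := der.liftKaehlerDifferential

theorem lin_props (w : Ω[R⁄K]) :
    (lin w : Tw K R).1 = ExteriorAlgebra.ι R w ∧ sgn K R (lin w).2 = (lin w).2 := by
  have hw : w ∈ Submodule.span R (Set.range (KaehlerDifferential.D K R)) := by
    rw [KaehlerDifferential.span_range_derivation]; trivial
  induction hw using Submodule.span_induction with
  | mem x hx =>
    obtain ⟨r, rfl⟩ := hx
    rw [lin, Derivation.liftKaehlerDifferential_comp_D]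
    exact ⟨rfl, map_zero _⟩
  | zero => simp
  | add x y _ _ hx hy => simp [hx.1, hy.1, hx.2, hy.2]
  | smul r x _ hx =>
    rw [map_smul, smul_fst, smul_snd, hx.1, map_smul]
    refine ⟨rfl, ?_⟩
    simp [sgn_ι, hx.2, map_smul]

/-- The ring homomorphism `a ↦ (a, d a)`. -/
def hom : DR K R →ₐ[R] Tw K R := ExteriorAlgebra.lift R ⟨lin, fun w => by
  ext
  · rw [mul_fst, (lin_props w).1]; exact ExteriorAlgebra.ι_sq_zero w
  · rw [mul_snd, (lin_props w).1, sgn_ι, neg_mul, ι_mul, (lin_props w).2]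
    simp⟩

theorem hom_fst (a : DR K R) : (hom a : Tw K R).1 = a := by
  induction a using ExteriorAlgebra.induction with
  | algebraMap r => rw [AlgHom.commutes]; rfl
  | ι v => rw [hom, ExteriorAlgebra.lift_ι_apply, (lin_props v).1]
  | mul a b ha hb => rw [map_mul, mul_fst, ha, hb]
  | add a b ha hb => rw [map_add, add_fst, ha, hb]

end Tw

/-- The exterior derivative. -/
def d : DR K R →ₗ[K] DR K R where
  toFun a := (Tw.hom a : Tw K R).2
  map_add' a b := by rw [map_add, Tw.add_snd]
  map_smul' k a := by
    rw [RingHom.id_apply, ← algebraMap_smul R k, map_smul, Tw.smul_snd]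
    simp [ofD]

variable {R}

@[simp] theorem d_algebraMap (r : R) : d K R (algebraMap R _ r) = ofD K r := by
  change (Tw.hom _ : Tw K R).2 = _
  rw [AlgHom.commutes]; rfl

@[simp] theorem d_ofD (r : R) : d K R (ofD K r) = 0 := by
  change (Tw.hom _ : Tw K R).2 = _
  rw [Tw.hom, ExteriorAlgebra.lift_ι_apply, Tw.lin, Derivation.liftKaehlerDifferential_comp_D]
  rfl

theorem d_mul (a b : DR K R) : d K R (a * b) = d K R a * b + sgn K R a * d K R b := by
  change (Tw.hom _ : Tw K R).2 = _
  rw [map_mul, Tw.mul_snd, Tw.hom_fst, Tw.hom_fst]; rfl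

theorem d_smul (r : R) (a : DR K R) : d K R (r • a) = ofD K r * a + r • d K R a := by
  rw [Algebra.smul_def, d_mul, d_algebraMap, AlgHom.commutes, ← Algebra.smul_def]

/-- Every form is a sum of products of functions and differentials of functions. -/
theorem induction' {P : DR K R → Prop} (h0 : ∀ r, P (algebraMap R _ r)) (h1 : ∀ r, P (ofD K r))
    (hm : ∀ a b, P a → P b → P (a * b)) (ha : ∀ a b, P a → P b → P (a + b)) (a : DR K R) :
    P a := by
  induction a using ExteriorAlgebra.induction with
  | algebraMap r => exact h0 r
  | ι w =>
    have hw : w ∈ Submodule.span R (Set.range (KaehlerDifferential.D K R)) := by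
      rw [KaehlerDifferential.span_range_derivation]; trivial
    induction hw using Submodule.span_induction with
    | mem x hx => obtain ⟨r, rfl⟩ := hx; exact h1 r
    | zero => simpa using h0 0
    | add x y _ _ hx hy => rw [map_add]; exact ha _ _ hx hy
    | smul r x _ hx => rw [map_smul, Algebra.smul_def]; exact hm _ _ (h0 r) hx
  | mul a b h h' => exact hm _ _ h h'
  | add a b h h' => exact ha _ _ h h'

variable {S : Type*} [CommRing S] [Algebra K S]

variable {K}

/-- The homomorphism of algebras of forms (pullback of forms) induced by a homomorphism of
algebras. -/
def map (f : R →ₐ[K] S) : DR K R →ₐ[K] DR K S :=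
  letI : Algebra R S := f.toRingHom.toAlgebra
  haveI : IsScalarTower K R S := IsScalarTower.of_algebraMap_eq fun k => (f.commutes k).symm
  haveI : IsScalarTower K R (DR K S) := IsScalarTower.of_algebraMap_eq fun k => by
    rw [IsScalarTower.algebraMap_apply R S, ← IsScalarTower.algebraMap_apply K R S,
      ← IsScalarTower.algebraMap_apply K S]
  AlgHom.restrictScalars K (ExteriorAlgebra.lift R
    ⟨((ExteriorAlgebra.ι S).restrictScalars R).comp (KaehlerDifferential.map K K R S),
      fun w => ExteriorAlgebra.ι_sq_zero _⟩)

theorem map_algebraMap (f : R →ₐ[K] S) (r : R) :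
    map f (algebraMap R _ r) = algebraMap S _ (f r) := by
  let _ : Algebra R S := f.toRingHom.toAlgebra
  have : IsScalarTower K R S := IsScalarTower.of_algebraMap_eq fun k => (f.commutes k).symm
  refine (AlgHom.commutes (ExteriorAlgebra.lift R (A := DR K S) _) r).trans ?_
  rw [IsScalarTower.algebraMap_apply R S]
  rfl

theorem map_ofD (f : R →ₐ[K] S) (r : R) : map f (ofD K r) = ofD K (f r) := by
  let _ : Algebra R S := f.toRingHom.toAlgebra
  have : IsScalarTower K R S := IsScalarTower.of_algebraMap_eq fun k => (f.commutes k).symm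
  refine (ExteriorAlgebra.lift_ι_apply R (A := DR K S) _ _ _).trans ?_
  change ExteriorAlgebra.ι S (KaehlerDifferential.map K K R S _) = _
  rw [KaehlerDifferential.map_D]
  rfl

theorem map_smul' (f : R →ₐ[K] S) (r : R) (a : DR K R) : map f (r • a) = f r • map f a := by
  rw [Algebra.smul_def, map_mul, map_algebraMap, ← Algebra.smul_def]

theorem map_sgn (f : R →ₐ[K] S) (a : DR K R) : map f (sgn K R a) = sgn K S (map f a) := by
  induction a using induction' with
  | h0 r => rw [AlgHom.commutes, map_algebraMap, AlgHom.commutes]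
  | h1 r => rw [sgn_ι, map_neg, map_ofD, sgn_ι]
  | hm a b ha hb => simp only [map_mul, ha, hb]
  | ha a b ha hb => simp only [map_add, ha, hb]

theorem map_d (f : R →ₐ[K] S) (a : DR K R) : map f (d K R a) = d K S (map f a) := by
  induction a using induction' with
  | h0 r => rw [d_algebraMap, map_ofD, map_algebraMap, d_algebraMap]
  | h1 r => rw [d_ofD, map_ofD, d_ofD, map_zero]
  | hm a b ha hb => simp only [map_mul, map_add, d_mul, ha, hb, map_sgn]
  | ha a b ha hb => simp only [map_add, ha, hb]

end DR

end DeRham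

/-! ## Principal parts and the Grothendieck connection over an affine open set -/

section PrincipalParts

variable (K : Type*) [Field K] (C : Type*) [CommRing C] [Algebra K C]

/-- Sections of the sheaf of principal parts over `Spec C`: the completion of `C ⊗ C` at the
kernel of the multiplication `C ⊗ C → C`. -/
abbrev PP : Type _ := AdicCompletion (KaehlerDifferential.ideal K C) (C ⊗[K] C)

namespace PP

/-- The canonical homomorphism `C ⊗ C → PP`. -/
def of : C ⊗[K] C →ₐ[K] PP K C := (Algebra.ofId (C ⊗[K] C) (PP K C)).restrictScalars K

/-- The first projection `p₁^*`. The instance `Algebra C (PP K C)` is the one given by `p₁^*`. -/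
def p₁ : C →ₐ[K] PP K C := (of K C).comp Algebra.TensorProduct.includeLeft

/-- The second projection `p₂^*`. -/
def p₂ : C →ₐ[K] PP K C := (of K C).comp Algebra.TensorProduct.includeRight

theorem p₁_eq (c : C) : p₁ K C c = algebraMap C (PP K C) c := rfl

/-- The ideal `Ker (PP → C)` of the diagonal. -/
def aug : Ideal (PP K C) :=
  (KaehlerDifferential.ideal K C).map (algebraMap (C ⊗[K] C) (PP K C))

variable {K C} {C' : Type*} [CommRing C'] [Algebra K C'] (f : C →ₐ[K] C')

/-- The homomorphism `C ⊗ C → C' ⊗ C'` induced by `f`. -/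
abbrev sq : C ⊗[K] C →ₐ[K] C' ⊗[K] C' := Algebra.TensorProduct.map f f

theorem sq_mem {a : C ⊗[K] C} (ha : a ∈ KaehlerDifferential.ideal K C) :
    sq f a ∈ KaehlerDifferential.ideal K C' := by
  have h : (Algebra.TensorProduct.lmul' K (S := C')).comp (sq f) =
      f.comp (Algebra.TensorProduct.lmul' K (S := C)) := by
    ext <;> simp
  have h' := DFunLike.congr_fun h a
  rw [KaehlerDifferential.ideal, RingHom.mem_ker] at ha ⊢
  change Algebra.TensorProduct.lmul' K (sq f a) = 0
  change Algebra.TensorProduct.lmul' K a = 0 at ha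
  rw [AlgHom.comp_apply, AlgHom.comp_apply, ha, map_zero] at h'
  exact h'

theorem sq_map_le : (KaehlerDifferential.ideal K C).map (sq f) ≤ KaehlerDifferential.ideal K C' :=
  Ideal.map_le_iff_le_comap.2 fun _ ha => sq_mem f ha

theorem sq_pow_le (n : ℕ) :
    KaehlerDifferential.ideal K C ^ n ≤ (KaehlerDifferential.ideal K C' ^ n).comap (sq f) := by
  rw [← Ideal.map_le_iff_le_comap, Ideal.map_pow]
  exact Ideal.pow_right_mono (sq_map_le f) n

/-- The homomorphism from `PP K C` to the quotient of `C' ⊗ C'` by the `n`-th power of the ideal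
of the diagonal. -/
def mapLevel (n : ℕ) : PP K C →ₐ[K] (C' ⊗[K] C') ⧸ KaehlerDifferential.ideal K C' ^ n :=
  (Ideal.quotientMapₐ (KaehlerDifferential.ideal K C' ^ n) (sq f) (sq_pow_le f n)).comp
    ((AdicCompletion.evalₐ (KaehlerDifferential.ideal K C) n).restrictScalars K)

theorem mapLevel_mk (n : ℕ) (y : AdicCompletion.AdicCauchySequence
    (KaehlerDifferential.ideal K C) (C ⊗[K] C)) :
    mapLevel f n (AdicCompletion.mk _ _ y) = Ideal.Quotient.mk _ (sq f (y n)) := by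
  rw [mapLevel, AlgHom.comp_apply, AlgHom.restrictScalars_apply, AdicCompletion.evalₐ_mk]
  rfl

theorem mapLevel_compat {m n : ℕ} (h : m ≤ n) :
    (Ideal.Quotient.factorₐ K (Ideal.pow_le_pow_right h)).comp (mapLevel f n) = mapLevel f m := by
  refine AlgHom.ext fun x => ?_
  obtain ⟨y, rfl⟩ := AdicCompletion.mk_surjective _ _ x
  rw [AlgHom.comp_apply, mapLevel_mk, mapLevel_mk, Ideal.Quotient.factorₐ_apply_mk,
    Ideal.Quotient.mk_eq_mk_iff_sub_mem, ← map_sub]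
  refine sq_pow_le f m ?_
  rw [← Ideal.Quotient.mk_eq_mk_iff_sub_mem]
  exact AdicCompletion.Ideal.mk_eq_mk _ h y

/-- Functoriality of principal parts. -/
def map : PP K C →ₐ[K] PP K C' :=
  AdicCompletion.liftAlgHom (KaehlerDifferential.ideal K C') (mapLevel f) (mapLevel_compat f)

theorem eval_map (n : ℕ) (x : PP K C) :
    AdicCompletion.evalₐ _ n (map f x) = mapLevel f n x :=
  AdicCompletion.evalₐ_liftAlgHom _ (mapLevel f) (mapLevel_compat f) _ _

theorem map_of (a : C ⊗[K] C) : map f (of K C a) = of K C' (sq f a) := by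
  refine AdicCompletion.ext_evalₐ fun n => ?_
  rw [eval_map]
  rfl

theorem map_p₂ (c : C) : map f (p₂ K C c) = p₂ K C' (f c) := by
  simp [p₂, map_of]

theorem map_p₁ (c : C) : map f (p₁ K C c) = p₁ K C' (f c) := by
  simp [p₁, map_of]

end PP

/-- Sections over `Spec C` of `Ω ⊗ P`, the tensor product being taken with respect to the first
projection. -/
def OmegaP : Type _ := PP K C ⊗[C] DR K C

namespace OmegaP

instance : Ring (OmegaP K C) := inferInstanceAs (Ring (PP K C ⊗[C] DR K C))
instance : Algebra (PP K C) (OmegaP K C) :=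
  inferInstanceAs (Algebra (PP K C) (PP K C ⊗[C] DR K C))
instance : Algebra K (OmegaP K C) := inferInstanceAs (Algebra K (PP K C ⊗[C] DR K C))
instance : IsScalarTower K (PP K C) (OmegaP K C) :=
  inferInstanceAs (IsScalarTower K (PP K C) (PP K C ⊗[C] DR K C))

/-- The right `C`-module structure of `Ω ⊗ P`, given by the second projection `p₂^*`. -/
instance : Algebra C (OmegaP K C) :=
  ((algebraMap (PP K C) (OmegaP K C)).comp (PP.p₂ K C).toRingHom).toAlgebra'
    fun c x => Algebra.commutes (PP.p₂ K C c) x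

theorem smul_def (c : C) (x : OmegaP K C) : c • x = PP.p₂ K C c • x := by
  rw [Algebra.smul_def, Algebra.smul_def]; rfl

instance : IsScalarTower K C (OmegaP K C) := IsScalarTower.of_algebraMap_eq fun k => by
  change _ = algebraMap (PP K C) (OmegaP K C) (PP.p₂ K C (algebraMap K C k))
  rw [AlgHom.commutes, ← IsScalarTower.algebraMap_apply]

instance : SMulCommClass C (PP K C) (OmegaP K C) where
  smul_comm c b x := by rw [smul_def, smul_def, smul_comm]

variable {K C}

/-- The pure tensor `b ⊗ ω`. -/
def tmul (b : PP K C) (w : DR K C) : OmegaP K C := b ⊗ₜ[C] w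

end OmegaP

end PrincipalParts

section Grad

variable (K : Type*) [Field K] (C : Type*) [CommRing C] [Algebra K C]

namespace PP

/-- The module `(C ⊗ C) ⊗ Ω¹_C = Ω¹_C ⊗_K C` over `C ⊗ C`. -/
abbrev Y : Type _ := (C ⊗[K] C) ⊗[C] Ω[C⁄K]

/-- The derivation `d ⊗ 1 : C ⊗ C → Ω¹_C ⊗ C`. -/
def dOne : C ⊗[K] C →ₗ[K] Y K C :=
  TensorProduct.lift (LinearMap.mk₂ K
    (fun x y => ((1 : C) ⊗ₜ[K] y : C ⊗[K] C) ⊗ₜ[C] KaehlerDifferential.D K C x)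
    (fun x x' y => by rw [map_add, tmul_add])
    (fun k x y => by rw [Derivation.map_smul, ← algebraMap_smul C k, ← algebraMap_smul C k,
      tmul_smul])
    (fun x y y' => by rw [tmul_add, add_tmul])
    (fun k x y => by rw [tmul_smul, ← smul_tmul']))

theorem dOne_tmul (x y : C) :
    dOne K C (x ⊗ₜ y) = ((1 : C) ⊗ₜ[K] y : C ⊗[K] C) ⊗ₜ[C] KaehlerDifferential.D K C x := rfl

theorem dOne_mul (a b : C ⊗[K] C) : dOne K C (a * b) = a • dOne K C b + b • dOne K C a := by
  induction a using TensorProduct.induction_on with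
  | zero => simp
  | add a a' ha ha' => rw [add_mul, map_add, ha, ha', map_add, add_smul, smul_add]; abel
  | tmul x y =>
    induction b using TensorProduct.induction_on with
    | zero => simp
    | add b b' hb hb' => rw [mul_add, map_add, hb, hb', map_add, add_smul, smul_add]; abel
    | tmul x' y' =>
      have key : ∀ (r s t : C) (w : Ω[C⁄K]), (r ⊗ₜ[K] s : C ⊗[K] C) •
          (((1 : C) ⊗ₜ[K] t : C ⊗[K] C) ⊗ₜ[C] w) =
          ((1 : C) ⊗ₜ[K] (s * t) : C ⊗[K] C) ⊗ₜ[C] (r • w) := by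
        intro r s t w
        rw [tmul_smul, smul_tmul', smul_tmul', smul_tmul', smul_eq_mul, smul_eq_mul,
          Algebra.TensorProduct.tmul_mul_tmul, mul_one]
      rw [Algebra.TensorProduct.tmul_mul_tmul, dOne_tmul, dOne_tmul, dOne_tmul, key, key,
        Derivation.leibniz, tmul_add, mul_comm y' y]

theorem dOne_mem (n : ℕ) (a : C ⊗[K] C) (ha : a ∈ KaehlerDifferential.ideal K C ^ (n + 1)) :
    dOne K C a ∈ (KaehlerDifferential.ideal K C ^ n • ⊤ : Submodule (C ⊗[K] C) (Y K C)) := by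
  induction n generalizing a with
  | zero => simp
  | succ n ih =>
    rw [pow_succ] at ha
    induction ha using Submodule.mul_induction_on' with
    | mem_mul_mem x hx y hy =>
      rw [dOne_mul]
      refine Submodule.add_mem _ (Submodule.smul_mem_smul hx trivial) ?_
      rw [pow_succ', ← smul_eq_mul, Submodule.smul_assoc]
      exact Submodule.smul_mem_smul hy (ih x hx)
    | add x _ y _ hx hy => rw [map_add]; exact Submodule.add_mem _ hx hy

/-- The map `(C ⊗ C) / I^(n+1) → (Ω¹_C ⊗ C) / I^n` induced by `d ⊗ 1`. -/
def gradLevel (n : ℕ) :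
    (C ⊗[K] C ⧸ (KaehlerDifferential.ideal K C ^ (n + 1) • ⊤ : Submodule (C ⊗[K] C) (C ⊗[K] C)))
      →ₗ[K] Y K C ⧸ (KaehlerDifferential.ideal K C ^ n • ⊤ : Submodule (C ⊗[K] C) (Y K C)) :=
  (Submodule.liftQ ((KaehlerDifferential.ideal K C ^ (n + 1) • ⊤ :
      Submodule (C ⊗[K] C) (C ⊗[K] C)).restrictScalars K)
    (((Submodule.mkQ (KaehlerDifferential.ideal K C ^ n • ⊤ :
      Submodule (C ⊗[K] C) (Y K C))).restrictScalars K).comp (dOne K C)) (fun a ha => by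
        rw [LinearMap.mem_ker, LinearMap.comp_apply, LinearMap.restrictScalars_apply,
          Submodule.mkQ_apply, Submodule.Quotient.mk_eq_zero]
        refine dOne_mem K C n a ?_
        simpa using ha)).comp
    (Submodule.Quotient.restrictScalarsEquiv K _).symm.toLinearMap

theorem gradLevel_mk (n : ℕ) (a : C ⊗[K] C) :
    gradLevel K C n (Submodule.Quotient.mk a) = Submodule.Quotient.mk (dOne K C a) := rfl

/-- The completion of `d ⊗ 1`, with values in the completion of `Ω¹_C ⊗ C`. -/
def gradHat : PP K C →ₗ[K] AdicCompletion (KaehlerDifferential.ideal K C) (Y K C) where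
  toFun b := ⟨fun n => gradLevel K C n (b.val (n + 1)), fun {m n} h => by
    obtain ⟨y, rfl⟩ := AdicCompletion.mk_surjective _ _ b
    change Submodule.Quotient.mk (dOne K C (y (n + 1))) = Submodule.Quotient.mk (dOne K C (y (m + 1)))
    rw [Submodule.Quotient.eq, ← map_sub]
    refine dOne_mem K C m _ ?_
    have hy := AdicCompletion.Ideal.mk_eq_mk (KaehlerDifferential.ideal K C)
      (Nat.succ_le_succ h) y
    rwa [Ideal.Quotient.mk_eq_mk_iff_sub_mem] at hy⟩
  map_add' b b' := by
    refine AdicCompletion.ext fun n => ?_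
    exact map_add (gradLevel K C n) _ _
  map_smul' k b := by
    refine AdicCompletion.ext fun n => ?_
    exact map_smul (gradLevel K C n) k _

theorem gradHat_of_smul (a : C ⊗[K] C) (b : PP K C) :
    gradHat K C (a • b) = a • gradHat K C b +
      b • AdicCompletion.of (KaehlerDifferential.ideal K C) _ (dOne K C a) := by
  obtain ⟨y, rfl⟩ := AdicCompletion.mk_surjective _ _ b
  refine AdicCompletion.ext fun n => ?_
  have h : (AdicCompletion.mk (KaehlerDifferential.ideal K C) (C ⊗[K] C) y •
      AdicCompletion.of (KaehlerDifferential.ideal K C) _ (dOne K C a)).val n =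
      Submodule.Quotient.mk (y (n + 1) • dOne K C a) := by
    have hy := AdicCompletion.Ideal.mk_eq_mk (KaehlerDifferential.ideal K C) (Nat.le_succ n) y
    rw [Ideal.Quotient.mk_eq_mk_iff_sub_mem] at hy
    change Submodule.Quotient.mk (y n • dOne K C a) = _
    refine (((Submodule.Quotient.eq _).2 ?_)).symm
    have h' := Submodule.smul_mem_smul hy (show dOne K C a ∈ (⊤ : Submodule (C ⊗[K] C) _) from
      trivial)
    rwa [sub_smul] at h'
  rw [AdicCompletion.val_add_apply, h]
  change gradLevel K C n (Submodule.Quotient.mk (a • y (n + 1))) =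
    a • gradLevel K C n (Submodule.Quotient.mk (y (n + 1))) + _
  rw [gradLevel_mk, gradLevel_mk, smul_eq_mul, dOne_mul]
  rfl

instance : IsScalarTower K (PP K C)
    (AdicCompletion (KaehlerDifferential.ideal K C) (Y K C)) where
  smul_assoc k b x := by
    obtain ⟨y, rfl⟩ := AdicCompletion.mk_surjective _ _ b
    obtain ⟨z, rfl⟩ := AdicCompletion.mk_surjective _ _ x
    refine AdicCompletion.ext fun n => ?_
    change Submodule.Quotient.mk ((k • y n) • z n) = Submodule.Quotient.mk (k • (y n • z n))
    rw [smul_assoc]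

variable [Algebra.FiniteType K C]

instance : IsNoetherianRing (C ⊗[K] C) :=
  haveI : Algebra.FiniteType C (C ⊗[K] C) := inferInstance
  haveI : Algebra.FiniteType K (C ⊗[K] C) := Algebra.FiniteType.trans (S := C) ‹_› ‹_›
  Algebra.FiniteType.isNoetherianRing K _

/-- For `C` of finite type the completion of `Ω¹_C ⊗ C` is `P ⊗ Ω¹_C`. -/
def eqv : (PP K C ⊗[C] Ω[C⁄K]) ≃ₗ[PP K C]
    AdicCompletion (KaehlerDifferential.ideal K C) (Y K C) :=
  (TensorProduct.AlgebraTensorModule.cancelBaseChange C (C ⊗[K] C) (PP K C) (PP K C)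
    Ω[C⁄K]).symm.trans
    (AdicCompletion.ofTensorProductEquivOfFiniteNoetherian
      (KaehlerDifferential.ideal K C) (Y K C))

theorem eqv_tmul (b : PP K C) (w : Ω[C⁄K]) : eqv K C (b ⊗ₜ w) =
    b • AdicCompletion.of (KaehlerDifferential.ideal K C) _ (1 ⊗ₜ w) := by
  simp [eqv]

theorem eqv_symm_of (a : C ⊗[K] C) (w : Ω[C⁄K]) :
    (eqv K C).symm (AdicCompletion.of (KaehlerDifferential.ideal K C) _ (a ⊗ₜ w)) =
      of K C a ⊗ₜ w := by
  rw [LinearEquiv.symm_apply_eq, eqv_tmul]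
  have h : (a ⊗ₜ[C] w : Y K C) = a • (1 ⊗ₜ w) := by rw [smul_tmul', smul_eq_mul, mul_one]
  rw [h, map_smul]
  refine AdicCompletion.ext fun n => ?_
  rfl

end PP

namespace OmegaP

open PP

variable {K C}

theorem tmul_mul (b b' : PP K C) (w w' : DR K C) :
    tmul b w * tmul b' w' = tmul (b * b') (w * w') :=
  Algebra.TensorProduct.tmul_mul_tmul _ _ _ _

theorem smul_tmul (b b' : PP K C) (w : DR K C) : b • tmul b' w = tmul (b * b') w := rfl

theorem tmul_smul (b : PP K C) (c : C) (w : DR K C) : tmul b (c • w) = tmul (p₁ K C c * b) w := by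
  change b ⊗ₜ[C] (c • w) = _
  rw [← TensorProduct.smul_tmul, Algebra.smul_def]
  rfl

theorem tmul_add (b : PP K C) (w w' : DR K C) : tmul b (w + w') = tmul b w + tmul b w' :=
  TensorProduct.tmul_add _ _ _

theorem add_tmul (b b' : PP K C) (w : DR K C) : tmul (b + b') w = tmul b w + tmul b' w :=
  TensorProduct.add_tmul _ _ _

theorem induction {P : OmegaP K C → Prop} (h0 : P 0) (ht : ∀ b w, P (tmul b w))
    (ha : ∀ x y, P x → P y → P (x + y)) (x : OmegaP K C) : P x :=
  TensorProduct.induction_on (motive := P) x h0 ht ha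

variable (K C)

/-- The inclusion of `Ω¹ ⊗ P` into `Ω ⊗ P`. -/
def ofOne : PP K C ⊗[C] Ω[C⁄K] →ₗ[PP K C] OmegaP K C :=
  AlgebraTensorModule.lTensor (PP K C) (PP K C) (ExteriorAlgebra.ι C)

theorem ofOne_tmul (b : PP K C) (w : Ω[C⁄K]) :
    ofOne K C (b ⊗ₜ w) = tmul b (ExteriorAlgebra.ι C w) := rfl

variable [Algebra.FiniteType K C]

/-- The Grothendieck connection `∇ : P → Ω¹ ⊗ P`, the completion of `d ⊗ 1`. -/
def gradP : PP K C →ₗ[K] OmegaP K C :=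
  ((ofOne K C).restrictScalars K).comp
    (((eqv K C).symm.toLinearMap.restrictScalars K).comp (gradHat K C))

theorem gradP_of_mul (a : C ⊗[K] C) (b : PP K C) : gradP K C (of K C a * b) =
    of K C a • gradP K C b +
      b • ofOne K C ((eqv K C).symm (AdicCompletion.of _ _ (dOne K C a))) := by
  have h : of K C a * b = a • b := rfl
  rw [h]
  simp only [gradP, LinearMap.comp_apply, LinearMap.restrictScalars_apply, gradHat_of_smul,
    LinearEquiv.coe_coe, map_add, map_smul]
  congr 1
  have h' : a • gradHat K C b = of K C a • gradHat K C b := by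
    refine AdicCompletion.ext fun n => ?_
    rfl
  rw [h', map_smul, map_smul]

theorem gradP_p₁_mul (c : C) (b : PP K C) : gradP K C (p₁ K C c * b) =
    p₁ K C c • gradP K C b + tmul b (DR.ofD K c) := by
  have h := gradP_of_mul K C (c ⊗ₜ 1) b
  rw [dOne_tmul, eqv_symm_of, ofOne_tmul, ← Algebra.TensorProduct.one_def, map_one, smul_tmul,
    mul_one] at h
  exact h

theorem gradP_p₂_mul (c : C) (b : PP K C) : gradP K C (p₂ K C c * b) =
    p₂ K C c • gradP K C b := by
  have h := gradP_of_mul K C (1 ⊗ₜ c) b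
  rw [dOne_tmul, eqv_symm_of, Derivation.map_one_eq_zero, TensorProduct.tmul_zero, map_zero,
    smul_zero, add_zero] at h
  exact h

/-- The map underlying `nabla`. -/
def nablaAux : OmegaP K C →+ OmegaP K C :=
  TensorProduct.liftAddHom (R := C) (M := PP K C) (N := DR K C)
    (AddMonoidHom.mk' (fun b => AddMonoidHom.mk'
      (fun w => gradP K C b * tmul 1 w + tmul b (DR.d K C w))
      (fun w w' => by rw [map_add, tmul_add, tmul_add, mul_add]; abel))
      (fun b b' => by
        ext w
        change gradP K C (b + b') * tmul 1 w + tmul (b + b') (DR.d K C w) =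
          (gradP K C b * tmul 1 w + tmul b (DR.d K C w)) +
          (gradP K C b' * tmul 1 w + tmul b' (DR.d K C w))
        rw [map_add, add_tmul, add_mul]; abel))
    (fun c b w => by
      change gradP K C (c • b) * tmul 1 w + tmul (c • b) (DR.d K C w) =
        gradP K C b * tmul 1 (c • w) + tmul b (DR.d K C (c • w))
      have h : c • b = p₁ K C c * b := Algebra.smul_def c b
      rw [h, gradP_p₁_mul, DR.d_smul, tmul_add, tmul_smul, tmul_smul, mul_one, add_mul, tmul_mul,
        mul_one, add_assoc, smul_mul_assoc]
      congr 1
      rw [← mul_smul_comm, smul_tmul, mul_one])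

theorem nablaAux_tmul (b : PP K C) (w : DR K C) :
    nablaAux K C (tmul b w) = gradP K C b * tmul 1 w + tmul b (DR.d K C w) := rfl

/-- The connection `∇` on `Ω ⊗ P`, given by
`∇(b ⊗ ω) = (∇ b) ω + b ⊗ dω`; it is linear for the right module structure. -/
def nabla : OmegaP K C →ₗ[C] OmegaP K C where
  toFun := nablaAux K C
  map_add' := map_add _
  map_smul' c x := by
    rw [smul_def, RingHom.id_apply, smul_def]
    induction x using OmegaP.induction with
    | h0 => simp
    | ht b w =>
      rw [smul_tmul, nablaAux_tmul, nablaAux_tmul, gradP_p₂_mul, smul_add, smul_tmul,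
        smul_mul_assoc]
    | ha x y hx hy => rw [smul_add, map_add, hx, hy, map_add, smul_add]

theorem nabla_tmul (b : PP K C) (w : DR K C) :
    nabla K C (tmul b w) = gradP K C b * tmul 1 w + tmul b (DR.d K C w) := rfl

end OmegaP

end Grad

section Functoriality

variable {K : Type*} [Field K] {C : Type*} [CommRing C] [Algebra K C]
  {C' : Type*} [CommRing C'] [Algebra K C'] (f : C →ₐ[K] C')

namespace PP

/-- Pullback of one-forms. -/
def mapForm : Ω[C⁄K] →ₛₗ[(f : C →+* C')] Ω[C'⁄K] :=
  letI : Algebra C C' := f.toRingHom.toAlgebra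
  haveI : IsScalarTower K C C' := IsScalarTower.of_algebraMap_eq fun k => (f.commutes k).symm
  { toFun := KaehlerDifferential.map K K C C'
    map_add' := map_add _
    map_smul' := fun c w => by rw [map_smul, ← algebraMap_smul C' c]; rfl }

theorem mapForm_D (c : C) :
    mapForm f (KaehlerDifferential.D K C c) = KaehlerDifferential.D K C' (f c) :=
  letI : Algebra C C' := f.toRingHom.toAlgebra
  haveI : IsScalarTower K C C' := IsScalarTower.of_algebraMap_eq fun k => (f.commutes k).symm
  KaehlerDifferential.map_D K K C C' c

theorem ι_mapForm (w : Ω[C⁄K]) :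
    ExteriorAlgebra.ι C' (mapForm f w) = DR.map f (ExteriorAlgebra.ι C w) := by
  have hw : w ∈ Submodule.span C (Set.range (KaehlerDifferential.D K C)) := by
    rw [KaehlerDifferential.span_range_derivation]; trivial
  induction hw using Submodule.span_induction with
  | mem x hx => obtain ⟨r, rfl⟩ := hx; rw [mapForm_D]; exact (DR.map_ofD f r).symm
  | zero => simp
  | add x y _ _ hx hy => simp only [map_add, hx, hy]
  | smul r x _ hx =>
    rw [LinearMap.map_smulₛₗ, map_smul, map_smul, DR.map_smul', ← hx]; rfl

theorem sq_smul (c : C) (a : C ⊗[K] C) : sq f (c • a) = f c • sq f a := by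
  have h : c • a = (c ⊗ₜ[K] (1 : C)) * a := Algebra.smul_def c a
  have h' : f c • sq f a = (f c ⊗ₜ[K] (1 : C')) * sq f a := Algebra.smul_def (f c) _
  rw [h, h', map_mul, Algebra.TensorProduct.map_tmul, map_one]

/-- The map underlying `mapY`. -/
def mapYAux : Y K C →+ Y K C' :=
  TensorProduct.liftAddHom (R := C) (M := C ⊗[K] C) (N := Ω[C⁄K])
    (AddMonoidHom.mk' (fun a => AddMonoidHom.mk' (fun w => sq f a ⊗ₜ[C'] mapForm f w)
      (fun w w' => by rw [map_add, tmul_add]))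
      (fun a a' => by
        ext w
        change sq f (a + a') ⊗ₜ[C'] mapForm f w = sq f a ⊗ₜ mapForm f w + sq f a' ⊗ₜ mapForm f w
        rw [map_add, add_tmul]))
    (fun c a w => by
      change sq f (c • a) ⊗ₜ[C'] mapForm f w = sq f a ⊗ₜ[C'] mapForm f (c • w)
      rw [LinearMap.map_smulₛₗ, sq_smul, smul_tmul]
      rfl)

theorem mapYAux_tmul (a : C ⊗[K] C) (w : Ω[C⁄K]) :
    mapYAux f (a ⊗ₜ w) = sq f a ⊗ₜ[C'] mapForm f w := rfl

/-- The homomorphism `Ω¹_C ⊗ C → Ω¹_C' ⊗ C'` induced by `f`. -/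
def mapY : Y K C →ₛₗ[(sq f : C ⊗[K] C →+* C' ⊗[K] C')] Y K C' where
  toFun := mapYAux f
  map_add' := map_add _
  map_smul' a x := by
    induction x using TensorProduct.induction_on with
    | zero => simp
    | add x y hx hy => rw [smul_add, map_add, hx, hy, map_add, smul_add]
    | tmul b w =>
      rw [smul_tmul', smul_eq_mul, mapYAux_tmul, mapYAux_tmul, map_mul, smul_tmul']
      rfl

theorem mapY_tmul (a : C ⊗[K] C) (w : Ω[C⁄K]) :
    mapY f (a ⊗ₜ w) = sq f a ⊗ₜ[C'] mapForm f w := rfl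

theorem mapY_dOne (a : C ⊗[K] C) : mapY f (dOne K C a) = dOne K C' (sq f a) := by
  induction a using TensorProduct.induction_on with
  | zero => simp
  | add x y hx hy => simp only [map_add, hx, hy]
  | tmul x y =>
    rw [dOne_tmul, mapY_tmul, Algebra.TensorProduct.map_tmul, Algebra.TensorProduct.map_tmul,
      dOne_tmul, mapForm_D, map_one]

theorem mapY_mem (n : ℕ) (x : Y K C)
    (hx : x ∈ (KaehlerDifferential.ideal K C ^ n • ⊤ : Submodule (C ⊗[K] C) (Y K C))) :
    mapY f x ∈ (KaehlerDifferential.ideal K C' ^ n • ⊤ : Submodule (C' ⊗[K] C') (Y K C')) := by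
  induction hx using Submodule.smul_induction_on' with
  | smul a ha y _ =>
    rw [LinearMap.map_smulₛₗ]
    exact Submodule.smul_mem_smul (sq_pow_le f n ha) trivial
  | add x _ y _ hx hy => rw [map_add]; exact Submodule.add_mem _ hx hy

/-- The completion of `mapY`. -/
def mapYHat : AdicCompletion (KaehlerDifferential.ideal K C) (Y K C) →+
    AdicCompletion (KaehlerDifferential.ideal K C') (Y K C') where
  toFun x := ⟨fun n => Submodule.mapQ _ _ (mapY f) (mapY_mem f n) (x.val n), fun {m n} h => by
    obtain ⟨y, rfl⟩ := AdicCompletion.mk_surjective _ _ x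
    change Submodule.Quotient.mk (mapY f (y n)) = Submodule.Quotient.mk (mapY f (y m))
    rw [Submodule.Quotient.eq, ← map_sub]
    refine mapY_mem f m _ ?_
    rw [← Submodule.Quotient.eq]
    exact (y.2 h).symm⟩
  map_zero' := AdicCompletion.ext fun n => map_zero (Submodule.mapQ _ _ (mapY f) (mapY_mem f n))
  map_add' x y := AdicCompletion.ext fun n =>
    map_add (Submodule.mapQ _ _ (mapY f) (mapY_mem f n)) _ _

theorem val_map (n : ℕ) (y : AdicCompletion.AdicCauchySequence
    (KaehlerDifferential.ideal K C) (C ⊗[K] C)) :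
    (map f (AdicCompletion.mk _ _ y)).val n = Submodule.Quotient.mk (sq f (y n)) := by
  have h := eval_map f n (AdicCompletion.mk _ _ y)
  rw [mapLevel_mk] at h
  obtain ⟨z, hz⟩ := AdicCompletion.mk_surjective _ _ (map f (AdicCompletion.mk _ _ y))
  rw [← hz] at h ⊢
  rw [AdicCompletion.evalₐ_mk, Ideal.Quotient.mk_eq_mk_iff_sub_mem] at h
  change Submodule.Quotient.mk (z n) = _
  rw [Submodule.Quotient.eq]
  simpa using h

theorem mapYHat_gradHat (b : PP K C) :
    mapYHat f (gradHat K C b) = gradHat K C' (map f b) := by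
  obtain ⟨y, rfl⟩ := AdicCompletion.mk_surjective _ _ b
  refine AdicCompletion.ext fun n => ?_
  change Submodule.Quotient.mk (mapY f (dOne K C (y (n + 1)))) = gradLevel K C' n ((map f (AdicCompletion.mk _ _ y)).val (n + 1))
  rw [val_map, gradLevel_mk, mapY_dOne]

theorem mapYHat_smul_of (b : PP K C) (x : Y K C) :
    mapYHat f (b • AdicCompletion.of _ _ x) = map f b • AdicCompletion.of _ _ (mapY f x) := by
  obtain ⟨y, rfl⟩ := AdicCompletion.mk_surjective _ _ b
  refine AdicCompletion.ext fun n => ?_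
  change Submodule.Quotient.mk (mapY f (y n • x)) =
    (map f (AdicCompletion.mk _ _ y)).val n • Submodule.Quotient.mk (mapY f x)
  rw [val_map, LinearMap.map_smulₛₗ]
  rfl

end PP

namespace OmegaP

open PP

/-- The homomorphism of graded algebras `Ω_C ⊗ P_C → Ω_C' ⊗ P_C'` induced by `f`. -/
def mapHom : OmegaP K C →+* OmegaP K C' :=
  letI : Algebra C (PP K C' ⊗[C'] DR K C') := Algebra.compHom _ (f : C →+* C')
  (Algebra.TensorProduct.lift (R := C) (S := C) (A := PP K C) (B := DR K C)
    (C := PP K C' ⊗[C'] DR K C')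
    { toRingHom := (Algebra.TensorProduct.includeLeftRingHom (R := C') (A := PP K C')
        (B := DR K C')).comp (map f).toRingHom
      commutes' := fun c => congrArg (fun b => b ⊗ₜ[C'] (1 : DR K C')) (map_p₁ f c) }
    { toRingHom := (Algebra.TensorProduct.includeRight (R := C') (A := PP K C')
        (B := DR K C')).toRingHom.comp (DR.map f).toRingHom
      commutes' := fun c => by
        change (1 : PP K C') ⊗ₜ[C'] DR.map f (algebraMap C _ c) = p₁ K C' (f c) ⊗ₜ[C'] (1 : DR K C')
        rw [DR.map_algebraMap, Algebra.algebraMap_eq_smul_one, ← TensorProduct.smul_tmul,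
          Algebra.smul_def, mul_one]
        rfl }
    (fun b w => by
      change _ * _ = _ * _
      change (map f b ⊗ₜ[C'] (1 : DR K C')) * ((1 : PP K C') ⊗ₜ[C'] DR.map f w) =
        ((1 : PP K C') ⊗ₜ[C'] DR.map f w) * (map f b ⊗ₜ[C'] (1 : DR K C'))
      simp)).toRingHom

theorem mapHom_tmul (b : PP K C) (w : DR K C) :
    mapHom f (tmul b w) = tmul (PP.map f b) (DR.map f w) := by
  change (map f b ⊗ₜ[C'] (1 : DR K C')) * ((1 : PP K C') ⊗ₜ[C'] DR.map f w) = _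
  rw [Algebra.TensorProduct.tmul_mul_tmul, one_mul, mul_one]
  rfl

theorem mapHom_smulP (b : PP K C) (x : OmegaP K C) :
    mapHom f (b • x) = PP.map f b • mapHom f x := by
  induction x using OmegaP.induction with
  | h0 => simp
  | ht b' w => rw [smul_tmul, mapHom_tmul, mapHom_tmul, smul_tmul, map_mul]
  | ha x y hx hy => rw [smul_add, map_add, hx, hy, map_add, smul_add]

/-- The map `mapHom f` as a semilinear map for the right module structures. -/
def map : OmegaP K C →ₛₗ[(f : C →+* C')] OmegaP K C' where
  toFun := mapHom f
  map_add' := map_add _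
  map_smul' c x := by
    rw [smul_def, mapHom_smulP, map_p₂, smul_def]; rfl

theorem map_tmul (b : PP K C) (w : DR K C) :
    map f (tmul b w) = tmul (PP.map f b) (DR.map f w) := mapHom_tmul f b w

theorem map_mul (x y : OmegaP K C) : map f (x * y) = map f x * map f y :=
  RingHom.map_mul (mapHom f) x y

theorem map_smulP (b : PP K C) (x : OmegaP K C) : map f (b • x) = PP.map f b • map f x :=
  mapHom_smulP f b x

variable (K C) in
/-- The sign involution: multiplication by `(-1)^p` on `Ω^p ⊗ P`. -/
def sgn : OmegaP K C →ₐ[PP K C] OmegaP K C :=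
  Algebra.TensorProduct.map (AlgHom.id (PP K C) (PP K C)) (DR.sgn K C)

theorem sgn_tmul (b : PP K C) (w : DR K C) : sgn K C (tmul b w) = tmul b (DR.sgn K C w) := rfl

variable (K C) in
/-- The sign involution as a linear map for the right module structure. -/
def sgnR : OmegaP K C →ₗ[C] OmegaP K C where
  toFun := sgn K C
  map_add' := map_add _
  map_smul' c x := by
    rw [smul_def, _root_.map_smul]; exact (smul_def K C c _).symm

theorem map_sgnR (x : OmegaP K C) : map f (sgnR K C x) = sgnR K C' (map f x) := by
  induction x using OmegaP.induction with
  | h0 => simp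
  | ht b w =>
    change map f (tmul b (DR.sgn K C w)) = sgn K C' (map f (tmul b w))
    rw [map_tmul, map_tmul, sgn_tmul, DR.map_sgn]
  | ha x y hx hy => simp only [map_add, hx, hy]

variable (K C) in
/-- The inclusion of `Ω^p ⊗ P` into `Ω ⊗ P`. -/
def ofDeg (p : ℕ) : PP K C ⊗[C] (⋀[C]^p Ω[C⁄K] : Submodule C (DR K C)) →ₗ[PP K C] OmegaP K C :=
  AlgebraTensorModule.lTensor (PP K C) (PP K C)
    (⋀[C]^p Ω[C⁄K] : Submodule C (DR K C)).subtype

variable (K C) in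
/-- The part `Ω^p ⊗ P`. -/
def degP (p : ℕ) : Submodule C (OmegaP K C) where
  carrier := LinearMap.range (ofDeg K C p)
  add_mem' := fun hx hy => Submodule.add_mem (LinearMap.range _) hx hy
  zero_mem' := Submodule.zero_mem (LinearMap.range _)
  smul_mem' := fun c _ hx => by
    rw [smul_def]
    exact Submodule.smul_mem (LinearMap.range (ofDeg K C p)) (p₂ K C c) hx

variable [Algebra.FiniteType K C] [Algebra.FiniteType K C']

theorem map_ofOne (z : PP K C ⊗[C] Ω[C⁄K]) : map f (ofOne K C z) =
    ofOne K C' ((eqv K C').symm (mapYHat f (eqv K C z))) := by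
  induction z using TensorProduct.induction_on with
  | zero => simp
  | add x y hx hy => simp only [map_add, hx, hy]
  | tmul b w =>
    rw [ofOne_tmul, map_tmul, eqv_tmul, mapYHat_smul_of, mapY_tmul, map_one, ← eqv_tmul,
      LinearEquiv.symm_apply_apply, ofOne_tmul, ι_mapForm]

theorem map_gradP (b : PP K C) : map f (gradP K C b) = gradP K C' (PP.map f b) := by
  change map f (ofOne K C ((eqv K C).symm (gradHat K C b))) =
    ofOne K C' ((eqv K C').symm (gradHat K C' (PP.map f b)))
  rw [map_ofOne, LinearEquiv.apply_symm_apply, mapYHat_gradHat]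

theorem map_nabla (x : OmegaP K C) : map f (nabla K C x) = nabla K C' (map f x) := by
  induction x using OmegaP.induction with
  | h0 => simp
  | ht b w =>
    rw [map_tmul, nabla_tmul, nabla_tmul, map_add, map_mul, map_gradP, map_tmul, map_tmul,
      map_one, DR.map_d]
  | ha x y hx hy => simp only [map_add, hx, hy]

end OmegaP

end Functoriality

section Coefficients

variable (K : Type*) [Field K] (C : Type*) [CommRing C] [Algebra K C]
  (N : Type*) [AddCommGroup N] [Module C N]

/-- Sections over `Spec C` of `Ω ⊗ P ⊗ M`, where `N` is the module of sections of `M`.  The first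
tensor product is with respect to `p₁^*` and the second one with respect to `p₂^*`. -/
def NN : Type _ := OmegaP K C ⊗[C] N

namespace NN

instance : AddCommGroup (NN K C N) := inferInstanceAs (AddCommGroup (OmegaP K C ⊗[C] N))
instance : Module C (NN K C N) := inferInstanceAs (Module C (OmegaP K C ⊗[C] N))
instance : Module (OmegaP K C) (NN K C N) :=
  inferInstanceAs (Module (OmegaP K C) (OmegaP K C ⊗[C] N))
instance : Module (PP K C) (NN K C N) := inferInstanceAs (Module (PP K C) (OmegaP K C ⊗[C] N))
instance : Module K (NN K C N) := Module.compHom _ (algebraMap K C)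
instance : IsScalarTower K C (NN K C N) where
  smul_assoc k c x := by
    rw [Algebra.smul_def, mul_smul]; rfl

variable {K C N}

/-- The pure tensor `a ⊗ n`. -/
def tmul (a : OmegaP K C) (n : N) : NN K C N := a ⊗ₜ[C] n

theorem smul_tmul (a b : OmegaP K C) (n : N) : a • tmul b n = tmul (a * b) n := rfl

theorem induction {P : NN K C N → Prop} (h0 : P 0) (ht : ∀ a n, P (tmul a n))
    (ha : ∀ x y, P x → P y → P (x + y)) (x : NN K C N) : P x :=
  TensorProduct.induction_on (motive := P) x h0 ht ha

theorem smul_eq (c : C) (x : NN K C N) : c • x = algebraMap C (OmegaP K C) c • x := by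
  induction x using NN.induction with
  | h0 => rw [smul_zero, smul_zero]
  | ht a n =>
    rw [smul_tmul, ← Algebra.smul_def]; rfl
  | ha x y hx hy => rw [smul_add, smul_add, hx, hy]

theorem smul_smul_comm (a : OmegaP K C) (k : K) (x : NN K C N) : a • (k • x) = k • (a • x) := by
  change a • (algebraMap K C k • x) = algebraMap K C k • (a • x)
  rw [smul_eq, smul_eq, ← mul_smul, ← mul_smul, Algebra.commutes]

theorem smul_smul_assoc (a : OmegaP K C) (k : K) (x : NN K C N) : (k • a) • x = k • (a • x) := by
  change (k • a) • x = algebraMap K C k • (a • x)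
  rw [smul_eq, ← mul_smul, ← IsScalarTower.algebraMap_apply, Algebra.smul_def]

variable (K C N)

/-- The action of `Ω ⊗ P` on `Ω ⊗ P ⊗ M` as a bilinear map. -/
def act : OmegaP K C →ₗ[K] NN K C N →ₗ[K] NN K C N :=
  LinearMap.mk₂ K (fun a x => a • x) (fun a b x => add_smul a b x)
    (fun k a x => smul_smul_assoc a k x) (fun a x y => smul_add a x y)
    (fun k a x => smul_smul_comm a k x)

/-- The connection `∇ ⊗ 1_M`. -/
def nabla [Algebra.FiniteType K C] : NN K C N →ₗ[C] NN K C N :=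
  LinearMap.rTensor N (OmegaP.nabla K C)

/-- The sign involution: multiplication by `(-1)^p` on `Ω^p ⊗ P ⊗ M`. -/
def sgn : NN K C N →ₗ[C] NN K C N := LinearMap.rTensor N (OmegaP.sgnR K C)

/-- The inclusion of `Ω^p ⊗ P ⊗ M` into `Ω ⊗ P ⊗ M`. -/
def ofDeg (p : ℕ) : OmegaP.degP K C p ⊗[C] N →ₗ[C] NN K C N :=
  LinearMap.rTensor N (OmegaP.degP K C p).subtype

/-- The part `Ω^p ⊗ P ⊗ M`. -/
def deg (p : ℕ) : Submodule C (NN K C N) := LinearMap.range (ofDeg K C N p)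

variable {K C N}
  {C' : Type*} [CommRing C'] [Algebra K C'] (f : C →ₐ[K] C')
  {N' : Type*} [AddCommGroup N'] [Module C' N'] (g : N →ₛₗ[(f : C →+* C')] N')

/-- The map `Ω_C ⊗ P_C ⊗ N → Ω_C' ⊗ P_C' ⊗ N'` as a semilinear map. -/
def mapS : NN K C N →ₛₗ[(f : C →+* C')] NN K C' N' := TensorProduct.map (OmegaP.map f) g

/-- The map `Ω_C ⊗ P_C ⊗ N → Ω_C' ⊗ P_C' ⊗ N'`. -/
def map : NN K C N →ₗ[K] NN K C' N' where
  toFun := mapS f g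
  map_add' := map_add _
  map_smul' k x := by
    change mapS f g (algebraMap K C k • x) = algebraMap K C' k • mapS f g x
    rw [LinearMap.map_smulₛₗ]
    congr 1
    exact f.commutes k

theorem map_tmul (a : OmegaP K C) (n : N) : map f g (tmul a n) = tmul (OmegaP.map f a) (g n) := rfl

theorem map_smulC (c : C) (x : NN K C N) : map f g (c • x) = f c • map f g x :=
  LinearMap.map_smulₛₗ (mapS f g) c x

theorem map_smulO (a : OmegaP K C) (x : NN K C N) :
    map f g (a • x) = OmegaP.map f a • map f g x := by
  induction x using NN.induction with
  | h0 => rw [smul_zero, map_zero, smul_zero]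
  | ht b n => rw [smul_tmul, map_tmul, map_tmul, OmegaP.map_mul, smul_tmul]
  | ha x y hx hy => rw [smul_add, map_add, hx, hy, map_add, smul_add]

theorem nabla_tmul [Algebra.FiniteType K C] (a : OmegaP K C) (n : N) :
    nabla K C N (tmul a n) = tmul (OmegaP.nabla K C a) n := rfl

theorem sgn_tmul (a : OmegaP K C) (n : N) :
    sgn K C N (tmul a n) = tmul (OmegaP.sgnR K C a) n := rfl

theorem map_nabla [Algebra.FiniteType K C] [Algebra.FiniteType K C'] (x : NN K C N) :
    map f g (nabla K C N x) = nabla K C' N' (map f g x) := by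
  induction x using NN.induction with
  | h0 => simp
  | ht b n => rw [nabla_tmul, map_tmul, map_tmul, nabla_tmul, OmegaP.map_nabla]
  | ha x y hx hy => simp only [map_add, hx, hy]

theorem map_sgn (x : NN K C N) : map f g (sgn K C N x) = sgn K C' N' (map f g x) := by
  induction x using NN.induction with
  | h0 => simp
  | ht b n => rw [sgn_tmul, map_tmul, map_tmul, sgn_tmul, OmegaP.map_sgnR]
  | ha x y hx hy => simp only [map_add, hx, hy]

variable (K C)

/-- The identification of `Ω ⊗ P ⊗ 𝒪` with `Ω ⊗ P`. -/
def toOmegaP : NN K C C →ₗ[C] OmegaP K C := (TensorProduct.rid C (OmegaP K C)).toLinearMap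

variable {K C}

theorem map_toOmegaP (g : C →ₛₗ[(f : C →+* C')] C') (hg : ∀ c, g c = f c) (x : NN K C C) :
    OmegaP.map f (toOmegaP K C x) = toOmegaP K C' (map f g x) := by
  induction x using NN.induction with
  | h0 => simp
  | ht a c =>
    change OmegaP.map f (c • a) = g c • OmegaP.map f a
    rw [LinearMap.map_smulₛₗ, hg]; rfl
  | ha x y hx hy => simp only [map_add, hx, hy]

end NN

end Coefficients

section Schemes

variable (K : Type u) [Field K] (X : Scheme.{u}) [X.Over (Spec (CommRingCat.of K))]

/-- The structure homomorphism `K → Γ(X, U)`. -/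
def structHom (U : X.Opens) : K →+* Γ(X, U) :=
  ((X ↘ Spec (CommRingCat.of K)).appLE ⊤ U le_top).hom.comp
    (Scheme.ΓSpecIso (CommRingCat.of K)).inv.hom

variable {K X}

theorem map_structHom {U V : X.Opens} (i : V ⟶ U) (k : K) :
    X.presheaf.map i.op (structHom K X U k) = structHom K X V k := by
  have h := Scheme.Hom.appLE_map (X ↘ Spec (CommRingCat.of K)) (U := ⊤) (V := U) le_top i.op
  exact congrArg (fun φ => φ.hom ((Scheme.ΓSpecIso (CommRingCat.of K)).inv.hom k)) h

instance algSections (U : X.Opens) : Algebra K Γ(X, U) := (structHom K X U).toAlgebra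

variable (K) in
/-- The restriction of functions as a homomorphism of `K`-algebras. -/
def resA {U V : X.Opens} (i : V ≤ U) : Γ(X, U) →ₐ[K] Γ(X, V) :=
  { (X.presheaf.map (homOfLE i).op).hom with
    commutes' := fun k => map_structHom (homOfLE i) k }

/-- The restriction of sections of a module as a semilinear map. -/
def resM (M : X.Modules) {U V : X.Opens} (i : V ≤ U) :
    Γ(M, U) →ₛₗ[(resA K i : Γ(X, U) →+* Γ(X, V))] Γ(M, V) where
  toFun := M.presheaf.map (homOfLE i).op
  map_add' := map_add _
  map_smul' c m := Scheme.Modules.map_smul M (homOfLE i) c m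

instance [LocallyOfFiniteType (X ↘ Spec (CommRingCat.of K))] (V : X.affineOpens) :
    Algebra.FiniteType K Γ(X, V.1) := by
  have h := (X ↘ Spec (CommRingCat.of K)).finiteType_appLE (isAffineOpen_top _) V.2 le_top
  have h' : (structHom K X V.1).FiniteType := by
    refine RingHom.FiniteType.comp h (RingHom.FiniteType.of_surjective _ ?_)
    exact (ConcreteCategory.bijective_of_isIso (Scheme.ΓSpecIso (CommRingCat.of K)).inv).2
  exact h'

end Schemes

/-! ## Dir-inv modules and their completions -/

section DirInvModules

theorem lTensor_range_mono {K : Type*} [Field K] {B : Type*} [AddCommGroup B] [Module K B]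
    (O : Type*) [AddCommGroup O] [Module K O] {S T : Submodule K B} (h : S ≤ T) :
    LinearMap.range (LinearMap.lTensor O S.subtype) ≤
      LinearMap.range (LinearMap.lTensor O T.subtype) := by
  have e : S.subtype = T.subtype.comp (Submodule.inclusion h) := rfl
  rw [e, LinearMap.lTensor_comp]
  exact LinearMap.range_comp_le_range _ _

theorem map_range_lTensor {K : Type*} [Field K] {B : Type*} [AddCommGroup B] [Module K B]
    {B' : Type*} [AddCommGroup B'] [Module K B'] {O O' : Type*} [AddCommGroup O] [Module K O]
    [AddCommGroup O'] [Module K O'] (a : O →ₗ[K] O') (f : B →ₗ[K] B') {S : Submodule K B}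
    {T : Submodule K B'} (h : ∀ x ∈ S, f x ∈ T) (x : O ⊗[K] B)
    (hx : x ∈ LinearMap.range (LinearMap.lTensor O S.subtype)) :
    TensorProduct.map a f x ∈ LinearMap.range (LinearMap.lTensor O' T.subtype) := by
  obtain ⟨z, rfl⟩ := hx
  refine ⟨TensorProduct.map a (f.restrict h) z, ?_⟩
  induction z using TensorProduct.induction_on with
  | zero => simp
  | add x y hx hy => simp only [map_add, hx, hy]
  | tmul x y => rfl

/-- A dir-inv structure on the module `B`: a directed system of submodules `F j`, each with a
descending filtration `fil j`, such that the inclusions are continuous. -/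
structure DirInv (K : Type*) [Field K] (B : Type*) [AddCommGroup B] [Module K B] where
  /-- the index set -/
  J : Type u
  /-- the order of the index set -/
  preorder : Preorder J
  nonempty : Nonempty J
  directed : ∀ j j' : J, ∃ j'', preorder.le j j'' ∧ preorder.le j' j''
  /-- the submodules of the direct system -/
  F : J → Submodule K B
  /-- the filtrations of the submodules -/
  fil : J → ℕ → Submodule K B
  fil_le : ∀ j i, fil j i ≤ F j
  fil_anti : ∀ j {i i' : ℕ}, i ≤ i' → fil j i' ≤ fil j i
  F_mono : ∀ {j j' : J}, preorder.le j j' → F j ≤ F j'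
  fil_mono : ∀ {j j' : J}, preorder.le j j' → ∀ i, ∃ i', fil j i' ≤ fil j' i

namespace DirInv

variable {K : Type*} [Field K] {B : Type*} [AddCommGroup B] [Module K B] (D : DirInv.{u} K B)

/-- Eventually constant modulo each step of the filtration. -/
def IsCauchyAt (j : D.J) (x : ℕ → B) : Prop :=
  (∀ n, x n ∈ D.F j) ∧ ∀ i, ∃ n₀, ∀ n, n₀ ≤ n → x n - x n₀ ∈ D.fil j i

/-- Eventually zero modulo each step of the filtration. -/
def IsNullAt (j : D.J) (x : ℕ → B) : Prop :=
  (∀ n, x n ∈ D.F j) ∧ ∀ i, ∃ n₀, ∀ n, n₀ ≤ n → x n ∈ D.fil j i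

variable {D}

theorem IsCauchyAt.mono {j j' : D.J} (h : D.preorder.le j j') {x : ℕ → B}
    (hx : D.IsCauchyAt j x) : D.IsCauchyAt j' x := by
  refine ⟨fun n => D.F_mono h (hx.1 n), fun i => ?_⟩
  obtain ⟨i', hi'⟩ := D.fil_mono h i
  obtain ⟨n₀, hn₀⟩ := hx.2 i'
  exact ⟨n₀, fun n hn => hi' (hn₀ n hn)⟩

theorem IsNullAt.mono {j j' : D.J} (h : D.preorder.le j j') {x : ℕ → B}
    (hx : D.IsNullAt j x) : D.IsNullAt j' x := by
  refine ⟨fun n => D.F_mono h (hx.1 n), fun i => ?_⟩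
  obtain ⟨i', hi'⟩ := D.fil_mono h i
  obtain ⟨n₀, hn₀⟩ := hx.2 i'
  exact ⟨n₀, fun n hn => hi' (hn₀ n hn)⟩

theorem IsCauchyAt.add {j : D.J} {x y : ℕ → B} (hx : D.IsCauchyAt j x) (hy : D.IsCauchyAt j y) :
    D.IsCauchyAt j (x + y) := by
  refine ⟨fun n => Submodule.add_mem _ (hx.1 n) (hy.1 n), fun i => ?_⟩
  obtain ⟨n₀, h₀⟩ := hx.2 i
  obtain ⟨n₁, h₁⟩ := hy.2 i
  refine ⟨max n₀ n₁, fun n hn => ?_⟩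
  have hx' := Submodule.sub_mem _ (h₀ n (le_trans (le_max_left _ _) hn))
    (h₀ (max n₀ n₁) (le_max_left _ _))
  have hy' := Submodule.sub_mem _ (h₁ n (le_trans (le_max_right _ _) hn))
    (h₁ (max n₀ n₁) (le_max_right _ _))
  have h := Submodule.add_mem _ hx' hy'
  have e : (x n - x n₀ - (x (max n₀ n₁) - x n₀)) + (y n - y n₁ - (y (max n₀ n₁) - y n₁)) =
      (x + y) n - (x + y) (max n₀ n₁) := by
    rw [Pi.add_apply, Pi.add_apply]; abel
  rwa [e] at h

theorem IsNullAt.add {j : D.J} {x y : ℕ → B} (hx : D.IsNullAt j x) (hy : D.IsNullAt j y) :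
    D.IsNullAt j (x + y) := by
  refine ⟨fun n => Submodule.add_mem _ (hx.1 n) (hy.1 n), fun i => ?_⟩
  obtain ⟨n₀, h₀⟩ := hx.2 i
  obtain ⟨n₁, h₁⟩ := hy.2 i
  exact ⟨max n₀ n₁, fun n hn => Submodule.add_mem _ (h₀ n (le_trans (le_max_left _ _) hn))
    (h₁ n (le_trans (le_max_right _ _) hn))⟩

variable (D)

/-- The module of all sequences which lie in some `F j` and are Cauchy there. -/
def cauchy : Submodule K (ℕ → B) where
  carrier := {x | ∃ j, D.IsCauchyAt j x}
  zero_mem' := by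
    obtain ⟨j⟩ := D.nonempty
    exact ⟨j, fun _ => Submodule.zero_mem _, fun _ => ⟨0, fun _ _ => by simp⟩⟩
  add_mem' := by
    rintro x y ⟨j, hx⟩ ⟨j', hy⟩
    obtain ⟨k, h, h'⟩ := D.directed j j'
    exact ⟨k, (hx.mono h).add (hy.mono h')⟩
  smul_mem' := by
    rintro c x ⟨j, hx⟩
    refine ⟨j, fun n => Submodule.smul_mem _ c (hx.1 n), fun i => ?_⟩
    obtain ⟨n₀, h₀⟩ := hx.2 i
    refine ⟨n₀, fun n hn => ?_⟩
    rw [Pi.smul_apply, Pi.smul_apply, ← smul_sub]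
    exact Submodule.smul_mem _ c (h₀ n hn)

/-- The module of all sequences which lie in some `F j` and tend to zero there. -/
def null : Submodule K (ℕ → B) where
  carrier := {x | ∃ j, D.IsNullAt j x}
  zero_mem' := by
    obtain ⟨j⟩ := D.nonempty
    exact ⟨j, fun _ => Submodule.zero_mem _, fun _ => ⟨0, fun _ _ => Submodule.zero_mem _⟩⟩
  add_mem' := by
    rintro x y ⟨j, hx⟩ ⟨j', hy⟩
    obtain ⟨k, h, h'⟩ := D.directed j j'
    exact ⟨k, (hx.mono h).add (hy.mono h')⟩
  smul_mem' := by
    rintro c x ⟨j, hx⟩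
    refine ⟨j, fun n => Submodule.smul_mem _ c (hx.1 n), fun i => ?_⟩
    obtain ⟨n₀, h₀⟩ := hx.2 i
    exact ⟨n₀, fun n hn => Submodule.smul_mem _ c (h₀ n hn)⟩

/-- The completion `lim_{j →} lim_{← i} F j / fil j i` of a dir-inv module: Cauchy sequences modulo
null sequences. -/
def Compl : Type _ := D.cauchy ⧸ D.null.comap D.cauchy.subtype

instance : AddCommGroup D.Compl :=
  inferInstanceAs (AddCommGroup (D.cauchy ⧸ D.null.comap D.cauchy.subtype))
instance : Module K D.Compl :=
  inferInstanceAs (Module K (D.cauchy ⧸ D.null.comap D.cauchy.subtype))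

/-- The class of a Cauchy sequence. -/
def cls : D.cauchy →ₗ[K] D.Compl := Submodule.mkQ (D.null.comap D.cauchy.subtype)

theorem cls_surjective : Function.Surjective D.cls := Submodule.mkQ_surjective _

/-- The sequence `x` is Cauchy and converges to `b`. -/
def Lim (x : ℕ → B) (b : D.Compl) : Prop := ∃ h : x ∈ D.cauchy, D.cls ⟨x, h⟩ = b

variable {D}
variable {B' : Type*} [AddCommGroup B'] [Module K B'] {D' : DirInv.{u} K B'}
  {B'' : Type*} [AddCommGroup B''] [Module K B''] {D'' : DirInv.{u} K B''}

/-- A homomorphism of dir-inv modules. -/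
def IsCont (D : DirInv.{u} K B) (D' : DirInv.{u} K B') (f : B →ₗ[K] B') : Prop :=
  ∀ j, ∃ j', (∀ x ∈ D.F j, f x ∈ D'.F j') ∧ ∀ i', ∃ i, ∀ x ∈ D.fil j i, f x ∈ D'.fil j' i'

theorem IsCont.cauchy {f : B →ₗ[K] B'} (hf : IsCont D D' f) {x : ℕ → B} (hx : x ∈ D.cauchy) :
    (fun n => f (x n)) ∈ D'.cauchy := by
  obtain ⟨j, hx⟩ := hx
  obtain ⟨j', h, h'⟩ := hf j
  refine ⟨j', fun n => h _ (hx.1 n), fun i' => ?_⟩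
  obtain ⟨i, hi⟩ := h' i'
  obtain ⟨n₀, hn₀⟩ := hx.2 i
  refine ⟨n₀, fun n hn => ?_⟩
  rw [← map_sub]
  exact hi _ (hn₀ n hn)

theorem IsCont.null {f : B →ₗ[K] B'} (hf : IsCont D D' f) {x : ℕ → B} (hx : x ∈ D.null) :
    (fun n => f (x n)) ∈ D'.null := by
  obtain ⟨j, hx⟩ := hx
  obtain ⟨j', h, h'⟩ := hf j
  refine ⟨j', fun n => h _ (hx.1 n), fun i' => ?_⟩
  obtain ⟨i, hi⟩ := h' i'
  obtain ⟨n₀, hn₀⟩ := hx.2 i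
  exact ⟨n₀, fun n hn => hi _ (hn₀ n hn)⟩

/-- The homomorphism of completions induced by a homomorphism of dir-inv modules. -/
def Compl.map (f : B →ₗ[K] B') (hf : IsCont D D' f) : D.Compl →ₗ[K] D'.Compl :=
  Submodule.mapQ (D.null.comap D.cauchy.subtype) (D'.null.comap D'.cauchy.subtype)
    { toFun := fun x => ⟨fun n => f (x.1 n), hf.cauchy x.2⟩
      map_add' := fun _ _ => Subtype.ext (funext fun _ => map_add f _ _)
      map_smul' := fun c _ => Subtype.ext (funext fun _ => map_smul f c _) }
    (fun _ hx => hf.null hx)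

theorem Compl.map_cls (f : B →ₗ[K] B') (hf : IsCont D D' f) (x : D.cauchy) :
    Compl.map f hf (D.cls x) = D'.cls ⟨fun n => f (x.1 n), hf.cauchy x.2⟩ := rfl

theorem Lim.map {f : B →ₗ[K] B'} (hf : IsCont D D' f) {x : ℕ → B} {b : D.Compl}
    (h : D.Lim x b) : D'.Lim (fun n => f (x n)) (Compl.map f hf b) := by
  obtain ⟨hx, rfl⟩ := h
  exact ⟨hf.cauchy hx, rfl⟩

theorem Lim.unique {x : ℕ → B} {b b' : D.Compl} (h : D.Lim x b) (h' : D.Lim x b') : b = b' := by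
  obtain ⟨_, rfl⟩ := h
  obtain ⟨_, rfl⟩ := h'
  rfl

theorem Lim.add {x x' : ℕ → B} {b b' : D.Compl} (h : D.Lim x b) (h' : D.Lim x' b') :
    D.Lim (x + x') (b + b') := by
  obtain ⟨hx, rfl⟩ := h
  obtain ⟨hx', rfl⟩ := h'
  exact ⟨Submodule.add_mem _ hx hx', (map_add D.cls ⟨x, hx⟩ ⟨x', hx'⟩)⟩

theorem Lim.smul (c : K) {x : ℕ → B} {b : D.Compl} (h : D.Lim x b) :
    D.Lim (c • x) (c • b) := by
  obtain ⟨hx, rfl⟩ := h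
  exact ⟨Submodule.smul_mem _ c hx, (map_smul D.cls c ⟨x, hx⟩)⟩

theorem Lim.zero : D.Lim 0 (0 : D.Compl) := ⟨Submodule.zero_mem _, map_zero D.cls⟩

theorem exists_lim (b : D.Compl) : ∃ x, D.Lim x b := by
  obtain ⟨x, rfl⟩ := D.cls_surjective b
  exact ⟨x.1, x.2, rfl⟩

/-- The tensor product of a discrete module with a dir-inv module. -/
def tens (O : Type*) [AddCommGroup O] [Module K O] (D : DirInv.{u} K B) :
    DirInv.{u} K (O ⊗[K] B) where
  J := D.J
  preorder := D.preorder
  nonempty := D.nonempty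
  directed := D.directed
  F j := LinearMap.range (LinearMap.lTensor O (D.F j).subtype)
  fil j i := LinearMap.range (LinearMap.lTensor O (D.fil j i).subtype)
  fil_le j i := lTensor_range_mono O (D.fil_le j i)
  fil_anti j _ _ h := lTensor_range_mono O (D.fil_anti j h)
  F_mono h := lTensor_range_mono O (D.F_mono h)
  fil_mono h i := by
    obtain ⟨i', hi'⟩ := D.fil_mono h i
    exact ⟨i', lTensor_range_mono O hi'⟩

theorem IsCont.tens {O O' : Type*} [AddCommGroup O] [Module K O] [AddCommGroup O'] [Module K O']
    (a : O →ₗ[K] O') {f : B →ₗ[K] B'} (hf : IsCont D D' f) :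
    IsCont (D.tens O) (D'.tens O') (TensorProduct.map a f) := by
  intro j
  obtain ⟨j', h, h'⟩ := hf j
  refine ⟨j', map_range_lTensor a f h, fun i' => ?_⟩
  obtain ⟨i, hi⟩ := h' i'
  exact ⟨i, map_range_lTensor a f hi⟩

end DirInv

end DirInvModules

/-! ## Differential forms on simplices -/

section Simplices

variable (K : Type*) [Field K]

/-- The coordinate ring of the simplex: `K[t_0, …, t_l] / (t_0 + ⋯ + t_l - 1)`. -/
abbrev SimplexRing (l : ℕ) : Type _ :=
  MvPolynomial (Fin (l + 1)) K ⧸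
    Ideal.span {(∑ i : Fin (l + 1), MvPolynomial.X i - 1 : MvPolynomial (Fin (l + 1)) K)}

namespace SimplexRing

/-- The coordinate function `t_i`. -/
def t (l : ℕ) (i : Fin (l + 1)) : SimplexRing K l := Ideal.Quotient.mk _ (MvPolynomial.X i)

theorem sum_t (l : ℕ) : ∑ i, t K l i = 1 := by
  have h : Ideal.Quotient.mk (Ideal.span
      {(∑ i : Fin (l + 1), MvPolynomial.X i - 1 : MvPolynomial (Fin (l + 1)) K)})
      (∑ i : Fin (l + 1), MvPolynomial.X i - 1) = 0 :=
    Ideal.Quotient.eq_zero_iff_mem.2 (Ideal.subset_span rfl)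
  rw [map_sub, map_sum, map_one, sub_eq_zero] at h
  exact h

/-- The homomorphism of coordinate rings given by a monotone map `α : [k] → [l]`; it maps `t_j` to
the sum of the `t_i` with `α i = j`. -/
def pull {k l : ℕ} (α : Fin (k + 1) →o Fin (l + 1)) : SimplexRing K l →ₐ[K] SimplexRing K k :=
  Ideal.Quotient.liftₐ _
    (MvPolynomial.aeval fun j => ∑ i, if α i = j then t K k i else 0) (fun a ha => by
      rw [← RingHom.mem_ker]
      refine (Ideal.span_le.2 ?_ : Ideal.span _ ≤ RingHom.ker _) ha
      rintro _ rfl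
      rw [SetLike.mem_coe, RingHom.mem_ker, map_sub, map_sum, map_one, sub_eq_zero]
      simp only [MvPolynomial.aeval_X]
      rw [Finset.sum_comm]
      simp only [Finset.sum_ite_eq, Finset.mem_univ, if_true]
      exact sum_t K k)

end SimplexRing

/-- The algebra of polynomial differential forms on the `l`-dimensional simplex. -/
abbrev Sx (l : ℕ) : Type _ := DR K (SimplexRing K l)

/-- The pullback of differential forms on simplices. -/
def Sx.pull {k l : ℕ} (α : Fin (k + 1) →o Fin (l + 1)) : Sx K l →ₗ[K] Sx K k :=
  (DR.map (SimplexRing.pull K α)).toLinearMap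

end Simplices

/-! ## Sections of `Ω ⊗ P ⊗ M` -/

section Sections

variable (K : Type u) [Field K] {X : Scheme.{u}} [X.Over (Spec (CommRingCat.of K))]

/-- The structure sheaf as a sheaf of modules. -/
abbrev OX (X : Scheme.{u}) : X.Modules := SheafOfModules.unit X.ringCatSheaf

/-- The sections of `Ω ⊗ P ⊗ M` over an affine open set. -/
abbrev NV (M : X.Modules) (V : X.affineOpens) : Type u := NN K Γ(X, V.1) Γ(M, V.1)

namespace NV

variable (M : X.Modules) {V V' : X.affineOpens} (h : V'.1 ≤ V.1)

/-- The restriction of sections of `Ω ⊗ P ⊗ M` to a smaller affine open set. -/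
def res : NV K M V →ₗ[K] NV K M V' :=
  NN.map (resA K h) (resM M h)

/-- The sign involution. -/
def sgn (V : X.affineOpens) : NV K M V →ₗ[K] NV K M V :=
  (NN.sgn K Γ(X, V.1) Γ(M, V.1)).restrictScalars K

theorem res_sgn (n : NV K M V) : res K M h (sgn K M V n) = sgn K M V' (res K M h n) :=
  NN.map_sgn _ _ _

/-- The connection `∇ ⊗ 1_M`. -/
def nabla [LocallyOfFiniteType (X ↘ Spec (CommRingCat.of K))] (V : X.affineOpens) :
    NV K M V →ₗ[K] NV K M V :=
  (NN.nabla K Γ(X, V.1) Γ(M, V.1)).restrictScalars K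

theorem res_nabla [LocallyOfFiniteType (X ↘ Spec (CommRingCat.of K))] (n : NV K M V) :
    res K M h (nabla K M V n) = nabla K M V' (res K M h n) :=
  NN.map_nabla _ _ _

/-- The identification of `Ω ⊗ P ⊗ 𝒪` with `Ω ⊗ P`. -/
def toOmegaP (V : X.affineOpens) : NV K (OX X) V →ₗ[K] OmegaP K Γ(X, V.1) :=
  (NN.toOmegaP K Γ(X, V.1)).restrictScalars K

theorem map_toOmegaP (a : NV K (OX X) V) :
    OmegaP.map (resA K h) (toOmegaP K V a) = toOmegaP K V' (res K (OX X) h a) :=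
  NN.map_toOmegaP (resA K h) (resM (OX X) h) (fun _ => rfl) a

/-- The product of a section of `Ω ⊗ P ⊗ 𝒪` with a section of `Ω ⊗ P ⊗ M`. -/
def act (V : X.affineOpens) : NV K (OX X) V →ₗ[K] NV K M V →ₗ[K] NV K M V :=
  (NN.act K Γ(X, V.1) Γ(M, V.1)).comp (toOmegaP K V)

theorem res_act (a : NV K (OX X) V) (n : NV K M V) :
    res K M h (act K M V a n) = act K M V' (res K (OX X) h a) (res K M h n) := by
  refine (NN.map_smulO (resA K h) (resM M h) (toOmegaP K V a) n).trans ?_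
  rw [map_toOmegaP]
  rfl

theorem res_smul (c : Γ(X, V.1)) (n : NV K M V) :
    res K M h (c • n) = resA K h c • res K M h n :=
  NN.map_smulC (resA K h) (resM M h) c n

/-- The section `1 ⊗ m` of `P ⊗ M`. -/
def const (V : X.affineOpens) (m : Γ(M, V.1)) : NV K M V := NN.tmul 1 m

theorem res_const (m : Γ(M, V.1)) :
    res K M h (const K M V m) = const K M V' (resM (K := K) M h m) := by
  refine (NN.map_tmul (resA K h) (resM M h) 1 m).trans ?_
  have h1 : OmegaP.map (resA K h) (1 : OmegaP K Γ(X, V.1)) = 1 := map_one (OmegaP.mapHom (resA K h))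
  rw [h1]
  rfl

/-- The section `p₁^*(c)` of `P`. -/
def const₁ (V : X.affineOpens) (c : Γ(X, V.1)) : NV K (OX X) V :=
  NN.tmul (OmegaP.tmul (PP.p₁ K _ c) 1) (1 : Γ(X, V.1))

theorem res_const₁ (c : Γ(X, V.1)) :
    res K (OX X) h (const₁ K V c) = const₁ K V' (resA K h c) := by
  refine (NN.map_tmul (resA K h) (resM (OX X) h) _ (1 : Γ(X, V.1))).trans ?_
  rw [OmegaP.map_tmul, PP.map_p₁, map_one]
  exact congrArg (NN.tmul _) (map_one (resA K h))

end NV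

theorem resM_resM (M : X.Modules) {U V W : X.Opens} (h : V ≤ U) (h' : W ≤ V) (m : Γ(M, U)) :
    resM (K := K) M h' (resM (K := K) M h m) = resM (K := K) M (h'.trans h) m := by
  change M.presheaf.map _ (M.presheaf.map _ m) = M.presheaf.map _ m
  rw [← ConcreteCategory.comp_apply, ← Functor.map_comp]
  rfl

theorem resA_resA {U V W : X.Opens} (h : V ≤ U) (h' : W ≤ V) (c : Γ(X, U)) :
    resA K h' (resA K h c) = resA K (h'.trans h) c := by
  change X.presheaf.map _ (X.presheaf.map _ c) = X.presheaf.map _ c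
  rw [← ConcreteCategory.comp_apply, ← Functor.map_comp]
  rfl

/-- The affine open sets contained in `W`. -/
abbrev AffIn (W : X.Opens) : Type u := {V : X.affineOpens // V.1 ≤ W}

/-- The sections of the sheaf `Ω ⊗ P ⊗ M` over an open set `W`: the compatible families of
sections over the affine open sets contained in `W`. -/
def sec (M : X.Modules) (W : X.Opens) : Submodule K (∀ V : AffIn W, NV K M V.1) where
  carrier := {n | ∀ (V V' : AffIn W) (h : V'.1.1 ≤ V.1.1), NV.res K M h (n V) = n V'}
  zero_mem' := fun _ _ _ => map_zero _
  add_mem' := fun hx hy V V' h => by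
    rw [Pi.add_apply, Pi.add_apply, map_add, hx V V' h, hy V V' h]
  smul_mem' := fun k x hx V V' h => by
    rw [Pi.smul_apply, Pi.smul_apply, map_smul, hx V V' h]

namespace sec

variable {M : X.Modules} {W : X.Opens}

theorem ext {x y : sec K M W} (h : ∀ V, x.1 V = y.1 V) : x = y := Subtype.ext (funext h)

/-- Restriction of sections. -/
def res (M : X.Modules) {W W' : X.Opens} (h : W' ≤ W) : sec K M W →ₗ[K] sec K M W' where
  toFun n := ⟨fun V => n.1 ⟨V.1, V.2.trans h⟩,
    fun V V' i => n.2 ⟨V.1, V.2.trans h⟩ ⟨V'.1, V'.2.trans h⟩ i⟩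
  map_add' _ _ := rfl
  map_smul' _ _ := rfl

/-- The operator on sections given by a family of operators which commute with restrictions. -/
def ofFamily (M : X.Modules) (W : X.Opens) (f : ∀ V : AffIn W, NV K M V.1 →ₗ[K] NV K M V.1)
    (hf : ∀ (V V' : AffIn W) (h : V'.1.1 ≤ V.1.1) (n : NV K M V.1),
      NV.res K M h (f V n) = f V' (NV.res K M h n)) : sec K M W →ₗ[K] sec K M W where
  toFun n := ⟨fun V => f V (n.1 V), fun V V' h => by rw [hf V V' h, n.2 V V' h]⟩
  map_add' x y := ext K fun V => map_add (f V) (x.1 V) (y.1 V)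
  map_smul' k x := ext K fun V => map_smul (f V) k (x.1 V)

/-- The sign involution. -/
def sgn (M : X.Modules) (W : X.Opens) : sec K M W →ₗ[K] sec K M W :=
  ofFamily K M W (fun V => NV.sgn K M V.1) fun _ _ h n => NV.res_sgn K M h n

/-- The connection `∇ ⊗ 1_M`. -/
def nabla [LocallyOfFiniteType (X ↘ Spec (CommRingCat.of K))] (M : X.Modules) (W : X.Opens) :
    sec K M W →ₗ[K] sec K M W :=
  ofFamily K M W (fun V => NV.nabla K M V.1) fun _ _ h n => NV.res_nabla K M h n

/-- The sections of `Ω^p ⊗ P ⊗ M`. -/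
def deg (M : X.Modules) (W : X.Opens) (p : ℕ) : Submodule K (sec K M W) where
  carrier := {n | ∀ V : AffIn W, n.1 V ∈ NN.deg K Γ(X, V.1.1) Γ(M, V.1.1) p}
  zero_mem' := fun _ => Submodule.zero_mem _
  add_mem' := fun hx hy V => Submodule.add_mem _ (hx V) (hy V)
  smul_mem' := fun k x hx V => by
    change k • x.1 V ∈ _
    rw [← algebraMap_smul Γ(X, V.1.1) k]
    exact Submodule.smul_mem _ _ (hx V)

/-- The product of a section of `Ω ⊗ P ⊗ 𝒪` with a section of `Ω ⊗ P ⊗ M`. -/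
def act (M : X.Modules) (W : X.Opens) : sec K (OX X) W →ₗ[K] sec K M W →ₗ[K] sec K M W :=
  LinearMap.mk₂ K (fun a n => ⟨fun V => NV.act K M V.1 (a.1 V) (n.1 V), fun V V' h => by
      rw [NV.res_act K M h, n.2 V V' h, a.2 V V' h]⟩)
    (fun a b n => ext K fun V => LinearMap.map_add₂ (NV.act K M V.1) (a.1 V) (b.1 V) (n.1 V))
    (fun k a n => ext K fun V => LinearMap.map_smul₂ (NV.act K M V.1) k (a.1 V) (n.1 V))
    (fun a n n' => ext K fun V => map_add (NV.act K M V.1 (a.1 V)) (n.1 V) (n'.1 V))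
    (fun k a n => ext K fun V => map_smul (NV.act K M V.1 (a.1 V)) k (n.1 V))

/-- The section `1 ⊗ m` of `P ⊗ M`. -/
def const (M : X.Modules) (W : X.Opens) (m : Γ(M, W)) : sec K M W :=
  ⟨fun V => NV.const K M V.1 (resM (K := K) M V.2 m), fun V V' h => by
    rw [NV.res_const, resM_resM]⟩

/-- The section `p₁^*(c)` of `P`. -/
def const₁ (W : X.Opens) (c : Γ(X, W)) : sec K (OX X) W :=
  ⟨fun V => NV.const₁ K V.1 (resA K V.2 c), fun V V' h => by
    rw [NV.res_const₁, resA_resA]⟩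

/-- Multiplication by a function, using the right module structure given by `p₂^*`. -/
def smulC (M : X.Modules) (W : X.Opens) : Γ(X, W) →+* Module.End K (sec K M W) where
  toFun c := ofFamily K M W (fun V => (LinearMap.lsmul Γ(X, V.1.1) (NV K M V.1)
    (resA K V.2 c)).restrictScalars K) fun V V' h n => by
      change NV.res K M h (resA K V.2 c • n) = resA K V'.2 c • NV.res K M h n
      rw [NV.res_smul, resA_resA]
  map_one' := LinearMap.ext fun n => ext K fun V => by
    change resA K V.2 1 • n.1 V = n.1 V
    rw [map_one, one_smul]
  map_zero' := LinearMap.ext fun n => ext K fun V => by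
    change resA K V.2 0 • n.1 V = 0
    rw [map_zero, zero_smul]
  map_add' c c' := LinearMap.ext fun n => ext K fun V => by
    change resA K V.2 (c + c') • n.1 V = resA K V.2 c • n.1 V + resA K V.2 c' • n.1 V
    rw [map_add, add_smul]
  map_mul' c c' := LinearMap.ext fun n => ext K fun V => by
    change resA K V.2 (c * c') • n.1 V = resA K V.2 c • resA K V.2 c' • n.1 V
    rw [map_mul, mul_smul]

theorem res_smulC {W' : X.Opens} (h : W' ≤ W) (c : Γ(X, W)) (n : sec K M W) :
    res K M h (smulC K M W c n) = smulC K M W' (resA K h c) (res K M h n) := ext K fun V => by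
  change resA K (V.2.trans h) c • n.1 ⟨V.1, V.2.trans h⟩ =
    resA K V.2 (resA K h c) • n.1 ⟨V.1, V.2.trans h⟩
  rw [resA_resA]

end sec

end Sections

section Coherent

variable (K : Type u) [Field K] {X : Scheme.{u}} [X.Over (Spec (CommRingCat.of K))]

theorem NV.smul_eq_p₂ {M : X.Modules} {V : X.affineOpens} (c : Γ(X, V.1)) (x : NV K M V) :
    c • x = PP.p₂ K Γ(X, V.1) c • x := by
  induction x using NN.induction with
  | h0 => rw [smul_zero, smul_zero]
  | ht a n => exact congrArg (fun b => NN.tmul b n) (OmegaP.smul_def K _ c a)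
  | ha x y hx hy => rw [smul_add, smul_add, hx, hy]

theorem NV.smulP_mem {M : X.Modules} {V : X.affineOpens}
    (L : Submodule (PP K Γ(X, V.1)) (NV K M V)) (k : K) {x : NV K M V} (hx : x ∈ L) :
    k • x ∈ L := by
  rw [← algebraMap_smul Γ(X, V.1) k, NV.smul_eq_p₂]
  exact L.smul_mem _ hx

/-- A coherent `P`-submodule of `Ω ⊗ P ⊗ M`: a finitely generated submodule of the module of
sections over each affine open set, compatible with localization. -/
structure Coh (M : X.Modules) where
  /-- the submodule of the module of sections over an affine open set -/
  L : ∀ V : X.affineOpens, Submodule (PP K Γ(X, V.1)) (NV K M V)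
  fg : ∀ V, (L V).FG
  res_eq : ∀ (V V' : X.affineOpens) (h : V'.1 ≤ V.1),
    L V' = Submodule.span (PP K Γ(X, V'.1)) (NV.res K M h '' (L V : Set (NV K M V)))

namespace Coh

variable {K} {M : X.Modules}

/-- The submodule `I^i F` of a coherent submodule `F`, where `I` is the ideal of the diagonal. -/
def pow (F : Coh K M) (V : X.affineOpens) (i : ℕ) : Submodule (PP K Γ(X, V.1)) (NV K M V) :=
  PP.aug K Γ(X, V.1) ^ i • F.L V

instance : Preorder (Coh K M) := Preorder.lift Coh.L

theorem le_def {F G : Coh K M} : F ≤ G ↔ ∀ V, F.L V ≤ G.L V := Iff.rfl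

theorem pow_le (F : Coh K M) (V : X.affineOpens) (i : ℕ) : F.pow V i ≤ F.L V :=
  Submodule.smul_le_right

theorem pow_anti (F : Coh K M) (V : X.affineOpens) {i i' : ℕ} (h : i ≤ i') :
    F.pow V i' ≤ F.pow V i :=
  Submodule.smul_mono_left (Ideal.pow_le_pow_right h)

theorem pow_mono {F G : Coh K M} (h : F ≤ G) (V : X.affineOpens) (i : ℕ) :
    F.pow V i ≤ G.pow V i :=
  Submodule.smul_mono le_rfl (h V)

instance : Bot (Coh K M) where
  bot :=
    { L := fun _ => ⊥
      fg := fun _ => Submodule.fg_bot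
      res_eq := fun V V' h => by
        refine ((Submodule.span_eq_bot).2 ?_).symm
        rintro _ ⟨x, hx, rfl⟩
        rw [(Submodule.mem_bot _).1 hx, map_zero] }

instance : Max (Coh K M) where
  max F G :=
    { L := fun V => F.L V ⊔ G.L V
      fg := fun V => (F.fg V).sup (G.fg V)
      res_eq := fun V V' h => by
        refine le_antisymm (sup_le ?_ ?_) (Submodule.span_le.2 ?_)
        · rw [F.res_eq V V' h]
          exact Submodule.span_mono (Set.image_mono fun x hx => Submodule.mem_sup_left hx)
        · rw [G.res_eq V V' h]
          exact Submodule.span_mono (Set.image_mono fun x hx => Submodule.mem_sup_right hx)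
        · rintro _ ⟨x, hx, rfl⟩
          obtain ⟨y, hy, z, hz, rfl⟩ := Submodule.mem_sup.1 hx
          rw [map_add]
          refine Submodule.add_mem_sup ?_ ?_
          · rw [F.res_eq V V' h]; exact Submodule.subset_span ⟨y, hy, rfl⟩
          · rw [G.res_eq V V' h]; exact Submodule.subset_span ⟨z, hz, rfl⟩ }

theorem le_sup_left (F G : Coh K M) : F ≤ F ⊔ G := fun _ => _root_.le_sup_left
theorem le_sup_right (F G : Coh K M) : G ≤ F ⊔ G := fun _ => _root_.le_sup_right

end Coh

namespace sec

variable (M : X.Modules) (W : X.Opens)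

/-- The sections which over each affine open set belong to a given submodule. -/
def within (L : ∀ V : X.affineOpens, Submodule (PP K Γ(X, V.1)) (NV K M V)) :
    Submodule K (sec K M W) where
  carrier := {n | ∀ V : AffIn W, n.1 V ∈ L V.1}
  zero_mem' := fun _ => Submodule.zero_mem _
  add_mem' := fun hx hy V => Submodule.add_mem _ (hx V) (hy V)
  smul_mem' := fun k _ hx V => NV.smulP_mem K (L V.1) k (hx V)

/-- The dir-inv structure on the sections of `Ω ⊗ P ⊗ M` over `W`: the system of the modules of
sections of the coherent submodules `F`, filtered by the sections of the `I^(i+1) F`. -/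
def dirInv : DirInv.{u} K (sec K M W) where
  J := Coh K M
  preorder := inferInstance
  nonempty := ⟨⊥⟩
  directed F G := ⟨F ⊔ G, Coh.le_sup_left F G, Coh.le_sup_right F G⟩
  F F := within K M W F.L
  fil F i := within K M W fun V => F.pow V (i + 1)
  fil_le F _ _ hn V := F.pow_le V.1 _ (hn V)
  fil_anti F _ _ h _ hn V := F.pow_anti V.1 (Nat.succ_le_succ h) (hn V)
  F_mono h _ hn V := h V.1 (hn V)
  fil_mono h i := ⟨i, fun _ hn V => Coh.pow_mono h V.1 _ (hn V)⟩

variable {M W}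

theorem isCont_res {W' : X.Opens} (h : W' ≤ W) :
    DirInv.IsCont (dirInv K M W) (dirInv K M W') (res K M h) := fun F =>
  ⟨F, fun _ hn V => hn ⟨V.1, V.2.trans h⟩, fun i => ⟨i, fun _ hn V => hn ⟨V.1, V.2.trans h⟩⟩⟩

theorem isCont_smulC (c : Γ(X, W)) :
    DirInv.IsCont (dirInv K M W) (dirInv K M W) (smulC K M W c) := by
  have key : ∀ (V : AffIn W) (L : Submodule (PP K Γ(X, V.1.1)) (NV K M V.1)) (x : NV K M V.1),
      x ∈ L → resA K V.2 c • x ∈ L := by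
    intro V L x hx
    rw [NV.smul_eq_p₂]
    exact L.smul_mem _ hx
  exact fun F => ⟨F, fun _ hn V => key V _ _ (hn V), fun i => ⟨i, fun _ hn V => key V _ _ (hn V)⟩⟩

end sec

end Coherent

/-! ## The mixed resolution -/

section Mixed

variable (K : Type u) [Field K] {X : Scheme.{u}} [X.Over (Spec (CommRingCat.of K))]

/-- The completed tensor product of the forms on the `l`-simplex with the sections of
`Ω ⊗ P ⊗ M` over `W`. -/
def Cell (M : X.Modules) (W : X.Opens) (l : ℕ) : Type u :=
  ((sec.dirInv K M W).tens (Sx K l)).Compl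

namespace Cell

variable {M : X.Modules} {W W' W'' : X.Opens} {k l : ℕ}

instance : AddCommGroup (Cell K M W l) :=
  inferInstanceAs (AddCommGroup ((sec.dirInv K M W).tens (Sx K l)).Compl)
instance : Module K (Cell K M W l) :=
  inferInstanceAs (Module K ((sec.dirInv K M W).tens (Sx K l)).Compl)

/-- The Cauchy sequence `x` of elements of the tensor product converges to `b`. -/
def Lim (x : ℕ → Sx K l ⊗[K] sec K M W) (b : Cell K M W l) : Prop :=
  DirInv.Lim ((sec.dirInv K M W).tens (Sx K l)) x b

/-- The map given by a map of forms on simplices and by the restriction of sections. -/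
def map (a : Sx K l →ₗ[K] Sx K k) (h : W' ≤ W) : Cell K M W l →ₗ[K] Cell K M W' k :=
  DirInv.Compl.map (TensorProduct.map a (sec.res K M h)) ((sec.isCont_res K h).tens a)

variable {K}

theorem map_lim (a : Sx K l →ₗ[K] Sx K k) (h : W' ≤ W) {x : ℕ → Sx K l ⊗[K] sec K M W}
    {b : Cell K M W l} (hx : Lim K x b) :
    Lim K (fun n => TensorProduct.map a (sec.res K M h) (x n)) (map K a h b) :=
  DirInv.Lim.map _ hx

theorem exists_lim (b : Cell K M W l) : ∃ x, Lim K x b := DirInv.exists_lim b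

theorem Lim.unique {x : ℕ → Sx K l ⊗[K] sec K M W} {b b' : Cell K M W l} (h : Lim K x b)
    (h' : Lim K x b') : b = b' :=
  DirInv.Lim.unique h h'

theorem map_map {j : ℕ} (a : Sx K l →ₗ[K] Sx K k) (a' : Sx K k →ₗ[K] Sx K j) (h : W' ≤ W)
    (h' : W'' ≤ W') (b : Cell K M W l) :
    map K a' h' (map K a h b) = map K (a'.comp a) (h'.trans h) b := by
  obtain ⟨x, hx⟩ := exists_lim b
  refine Lim.unique (map_lim a' h' (map_lim a h hx)) ?_
  have e : ∀ n, TensorProduct.map a' (sec.res K M h') (TensorProduct.map a (sec.res K M h) (x n)) =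
      TensorProduct.map (a'.comp a) (sec.res K M (h'.trans h)) (x n) := fun n => by
    rw [← LinearMap.comp_apply, ← TensorProduct.map_comp]; rfl
  simp only [e]
  exact map_lim _ _ hx

theorem map_id (b : Cell K M W l) : map K LinearMap.id le_rfl b = b := by
  obtain ⟨x, hx⟩ := exists_lim b
  refine Lim.unique (map_lim _ _ hx) ?_
  have e : ∀ n, TensorProduct.map LinearMap.id (sec.res K M (le_refl W)) (x n) = x n := fun n => by
    have h : sec.res K M (le_refl W) = LinearMap.id := rfl
    rw [h, TensorProduct.map_id]; rfl
  simp only [e]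
  exact hx

variable (K)

/-- Multiplication by a function. -/
def smulFun (c : Γ(X, W)) : Cell K M W l →ₗ[K] Cell K M W l :=
  DirInv.Compl.map (TensorProduct.map LinearMap.id (sec.smulC K M W c))
    ((sec.isCont_smulC K c).tens LinearMap.id)

variable {K}

theorem smulFun_lim (c : Γ(X, W)) {x : ℕ → Sx K l ⊗[K] sec K M W} {b : Cell K M W l}
    (hx : Lim K x b) :
    Lim K (fun n => TensorProduct.map LinearMap.id (sec.smulC K M W c) (x n)) (smulFun K c b) :=
  DirInv.Lim.map _ hx

theorem smulFun_one (b : Cell K M W l) : smulFun K 1 b = b := by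
  obtain ⟨x, hx⟩ := exists_lim b
  refine Lim.unique (smulFun_lim 1 hx) ?_
  have e : ∀ n, TensorProduct.map LinearMap.id (sec.smulC K M W 1) (x n) = x n := fun n => by
    rw [map_one, Module.End.one_eq_id, TensorProduct.map_id]; rfl
  simp only [e]
  exact hx

theorem smulFun_zero (b : Cell K M W l) : smulFun K 0 b = 0 := by
  obtain ⟨x, hx⟩ := exists_lim b
  refine Lim.unique (smulFun_lim 0 hx) ?_
  have e : ∀ n, TensorProduct.map LinearMap.id (sec.smulC K M W 0) (x n) = 0 := fun n => by
    rw [map_zero, TensorProduct.map_zero_right]; rfl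
  simp only [e]
  exact DirInv.Lim.zero

theorem smulFun_add (c c' : Γ(X, W)) (b : Cell K M W l) :
    smulFun K (c + c') b = smulFun K c b + smulFun K c' b := by
  obtain ⟨x, hx⟩ := exists_lim b
  refine Lim.unique (smulFun_lim (c + c') hx) ?_
  have e : ∀ n, TensorProduct.map LinearMap.id (sec.smulC K M W (c + c')) (x n) =
      TensorProduct.map LinearMap.id (sec.smulC K M W c) (x n) +
      TensorProduct.map LinearMap.id (sec.smulC K M W c') (x n) := fun n => by
    rw [map_add, TensorProduct.map_add_right]; rfl
  simp only [e]
  exact DirInv.Lim.add (smulFun_lim c hx) (smulFun_lim c' hx)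

theorem smulFun_mul (c c' : Γ(X, W)) (b : Cell K M W l) :
    smulFun K (c * c') b = smulFun K c (smulFun K c' b) := by
  obtain ⟨x, hx⟩ := exists_lim b
  refine Lim.unique (smulFun_lim (c * c') hx) ?_
  have e : ∀ n, TensorProduct.map LinearMap.id (sec.smulC K M W (c * c')) (x n) =
      TensorProduct.map LinearMap.id (sec.smulC K M W c)
      (TensorProduct.map LinearMap.id (sec.smulC K M W c') (x n)) := fun n => by
    have h : sec.smulC K M W (c * c') =
        LinearMap.comp (sec.smulC K M W c) (sec.smulC K M W c') := map_mul _ c c'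
    rw [h, ← LinearMap.comp_apply, ← TensorProduct.map_comp]; rfl
  simp only [e]
  exact smulFun_lim c (x := fun n => TensorProduct.map LinearMap.id (sec.smulC K M W c') (x n))
    (smulFun_lim c' hx)

variable (K) in
/-- The action of functions. -/
def smulHom (M : X.Modules) (W : X.Opens) (l : ℕ) :
    Γ(X, W) →+* Module.End K (Cell K M W l) where
  toFun c := smulFun K c
  map_one' := LinearMap.ext smulFun_one
  map_zero' := LinearMap.ext smulFun_zero
  map_add' c c' := LinearMap.ext (smulFun_add c c')
  map_mul' c c' := LinearMap.ext (smulFun_mul c c')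

theorem map_smulHom (a : Sx K l →ₗ[K] Sx K k) (h : W' ≤ W) (c : Γ(X, W)) (b : Cell K M W l) :
    map K a h (smulHom K M W l c b) = smulHom K M W' k (resA K h c) (map K a h b) := by
  obtain ⟨x, hx⟩ := exists_lim b
  refine Lim.unique (map_lim a h (smulFun_lim c hx)) ?_
  have e : ∀ n, TensorProduct.map a (sec.res K M h)
      (TensorProduct.map LinearMap.id (sec.smulC K M W c) (x n)) =
      TensorProduct.map LinearMap.id (sec.smulC K M W' (resA K h c))
      (TensorProduct.map a (sec.res K M h) (x n)) := fun n => by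
    rw [← LinearMap.comp_apply, ← TensorProduct.map_comp, ← LinearMap.comp_apply,
      ← TensorProduct.map_comp]
    have h' : (sec.res K M h).comp (sec.smulC K M W c) =
        LinearMap.comp (sec.smulC K M W' (resA K h c)) (sec.res K M h) :=
      LinearMap.ext fun n => sec.res_smulC K h c n
    rw [h']; rfl
  simp only [e]
  exact smulFun_lim _ (map_lim a h hx)

variable (K M W l) in
/-- The elements of bidegree `(p, q)` of the tensor product: `q` is the degree of the form on the
simplex and `p` is the degree of the form on `X`. -/
def bideg (p q : ℕ) : Submodule K (Sx K l ⊗[K] sec K M W) :=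
  Submodule.map₂ (TensorProduct.mk K (Sx K l) (sec K M W)) (DR.deg K (SimplexRing K l) q)
    (sec.deg K M W p)

theorem map_bideg {p q : ℕ} (a : Sx K l →ₗ[K] Sx K k) (r : sec K M W →ₗ[K] sec K M W')
    (ha : ∀ x ∈ DR.deg K (SimplexRing K l) q, a x ∈ DR.deg K (SimplexRing K k) q)
    (hr : ∀ x ∈ sec.deg K M W p, r x ∈ sec.deg K M W' p) {x : Sx K l ⊗[K] sec K M W}
    (hx : x ∈ bideg K M W l p q) : TensorProduct.map a r x ∈ bideg K M W' k p q := by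
  refine (Submodule.map₂_le.2 ?_ : bideg K M W l p q ≤
    (bideg K M W' k p q).comap (TensorProduct.map a r)) hx
  intro w hw n hn
  exact Submodule.apply_mem_map₂ (TensorProduct.mk K _ _) (ha w hw) (hr n hn)

end Cell

end Mixed

section MixedSheaf

variable (K : Type u) [Field K] {X : Scheme.{u}} [X.Over (Spec (CommRingCat.of K))]
  {m : ℕ} (U : Fin (m + 1) → X.Opens)

/-- The multi-indices `i_0 ≤ ⋯ ≤ i_l` with values in `{0, …, m}`. -/
abbrev Idx (m l : ℕ) : Type := Fin (l + 1) →o Fin (m + 1)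

/-- The intersection of the open sets `U (i_0), …, U (i_l)`. -/
def inter {l : ℕ} (i : Idx m l) : X.Opens := ⨅ k, U (i k)

theorem inter_le {k l : ℕ} (α : Fin (k + 1) →o Fin (l + 1)) (i : Idx m l) :
    inter U i ≤ inter U (i.comp α) :=
  le_iInf fun j => iInf_le _ (α j)

/-- The product over all `l` of the completed tensor products of the forms on the `l`-simplex with
the `l`-cochains over `V` of the covering `U` with coefficients in `Ω ⊗ P ⊗ M`. -/
abbrev Amb (M : X.Modules) (V : X.Opens) : Type u :=
  ∀ (l : ℕ) (i : Idx m l), Cell K M (V ⊓ inter U i) l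

variable (M : X.Modules) (V : X.Opens)

/-- The submodule `Mix^{p,q}`: the compatible families of elements of bidegree `(p, q)`. -/
def bi (p q : ℕ) : Submodule K (Amb K U M V) where
  carrier := {u |
    (∀ (k l : ℕ) (α : Fin (k + 1) →o Fin (l + 1)) (i : Idx m l),
      Cell.map K LinearMap.id (inf_le_inf_left V (inter_le U α i)) (u k (i.comp α)) =
        Cell.map K (Sx.pull K α) le_rfl (u l i)) ∧
    ∀ (l : ℕ) (i : Idx m l), ∃ x, Cell.Lim K x (u l i) ∧
      ∀ n, x n ∈ Cell.bideg K M (V ⊓ inter U i) l p q}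
  zero_mem' := ⟨fun k l α i => by simp only [Pi.zero_apply, map_zero],
    fun l i => ⟨0, DirInv.Lim.zero, fun _ => Submodule.zero_mem _⟩⟩
  add_mem' := by
    rintro u v ⟨hu, hu'⟩ ⟨hv, hv'⟩
    refine ⟨fun k l α i => ?_, fun l i => ?_⟩
    · simp only [Pi.add_apply, map_add, hu, hv]
    · obtain ⟨x, hx, hx'⟩ := hu' l i
      obtain ⟨y, hy, hy'⟩ := hv' l i
      exact ⟨x + y, DirInv.Lim.add hx hy, fun n => Submodule.add_mem _ (hx' n) (hy' n)⟩
  smul_mem' := by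
    rintro c u ⟨hu, hu'⟩
    refine ⟨fun k l α i => ?_, fun l i => ?_⟩
    · simp only [Pi.smul_apply, map_smul, hu]
    · obtain ⟨x, hx, hx'⟩ := hu' l i
      exact ⟨c • x, DirInv.Lim.smul c hx, fun n => Submodule.smul_mem _ c (hx' n)⟩

/-- The sections over `V` of the mixed resolution `Mix_U(M)`: the sum of the `Mix^{p,q}`. -/
def Mix : Submodule K (Amb K U M V) := ⨆ (p : ℕ) (q : ℕ), bi K U M V p q

namespace Mix

/-- The part `Mix^i`: the sum of the `Mix^{p,q}` with `p + q = i`. -/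
def gr (i : ℕ) : Submodule K (Mix K U M V) :=
  (⨆ (p : ℕ) (q : ℕ) (_ : p + q = i), bi K U M V p q).comap (Mix K U M V).subtype

variable {K U M V}
variable {V' V'' : X.Opens}

/-- Restriction of families. -/
def ambRes (h : V' ≤ V) : Amb K U M V →ₗ[K] Amb K U M V' where
  toFun u l i := Cell.map K LinearMap.id (inf_le_inf_right _ h) (u l i)
  map_add' u v := by funext l i; exact map_add _ _ _
  map_smul' c u := by
    funext l i
    exact map_smul (Cell.map K LinearMap.id (inf_le_inf_right (inter U i) h)) c (u l i)

theorem ambRes_bi (h : V' ≤ V) (p q : ℕ) :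
    bi K U M V p q ≤ (bi K U M V' p q).comap (ambRes h) := by
  rintro u ⟨hu, hu'⟩
  refine ⟨fun k l α i => ?_, fun l i => ?_⟩
  · have h1 := hu k l α i
    have h2 := congrArg (Cell.map K LinearMap.id (inf_le_inf_right (inter U i) h)) h1
    rw [Cell.map_map, Cell.map_map] at h2
    change Cell.map K LinearMap.id _ (Cell.map K LinearMap.id _ (u k (i.comp α))) =
      Cell.map K (Sx.pull K α) _ (Cell.map K LinearMap.id _ (u l i))
    rw [Cell.map_map, Cell.map_map]
    exact h2
  · obtain ⟨x, hx, hx'⟩ := hu' l i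
    have hr : ∀ n ∈ sec.deg K M (V ⊓ inter U i) p,
        sec.res K M (inf_le_inf_right (inter U i) h) n ∈ sec.deg K M (V' ⊓ inter U i) p :=
      fun n hn W => hn ⟨W.1, W.2.trans (inf_le_inf_right _ h)⟩
    exact ⟨_, Cell.map_lim LinearMap.id (inf_le_inf_right _ h) hx, fun n =>
      Cell.map_bideg LinearMap.id (sec.res K M (inf_le_inf_right (inter U i) h))
        (fun _ hw => hw) hr (hx' n)⟩

theorem le_comap_mix {T : Amb K U M V →ₗ[K] Amb K U M V'}
    (hT : ∀ p q, bi K U M V p q ≤ (bi K U M V' p q).comap T) :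
    Mix K U M V ≤ (Mix K U M V').comap T :=
  iSup_le fun p => iSup_le fun q => (hT p q).trans
    (Submodule.comap_mono (le_iSup_of_le p (le_iSup_of_le q le_rfl)))

/-- Restriction of sections. -/
def res (h : V' ≤ V) : Mix K U M V →ₗ[K] Mix K U M V' :=
  (ambRes h).restrict (le_comap_mix (ambRes_bi h))

theorem res_apply (h : V' ≤ V) (u : Mix K U M V) (l : ℕ) (i : Idx m l) :
    (res h u).1 l i = Cell.map K LinearMap.id (inf_le_inf_right _ h) (u.1 l i) := rfl

theorem res_res (h : V' ≤ V) (h' : V'' ≤ V') (u : Mix K U M V) :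
    res h' (res h u) = res (h'.trans h) u := by
  refine Subtype.ext (funext fun l => funext fun i => ?_)
  rw [res_apply, res_apply, Cell.map_map]
  rfl

theorem res_self (u : Mix K U M V) : res le_rfl u = u := by
  refine Subtype.ext (funext fun l => funext fun i => ?_)
  exact Cell.map_id _

variable (K U M V) in
/-- The action of functions on families. -/
def ambSmul (c : Γ(X, V)) : Amb K U M V →ₗ[K] Amb K U M V where
  toFun u l i := Cell.smulHom K M (V ⊓ inter U i) l (resA K inf_le_left c) (u l i)
  map_add' u v := by funext l i; exact map_add _ _ _
  map_smul' k u := by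
    funext l i
    exact map_smul (Cell.smulHom K M (V ⊓ inter U i) l (resA K inf_le_left c)) k (u l i)

theorem smulC_deg {W : X.Opens} (c : Γ(X, W)) (p : ℕ) (n : sec K M W)
    (hn : n ∈ sec.deg K M W p) : sec.smulC K M W c n ∈ sec.deg K M W p :=
  fun V => Submodule.smul_mem _ _ (hn V)

theorem ambSmul_bi (c : Γ(X, V)) (p q : ℕ) :
    bi K U M V p q ≤ (bi K U M V p q).comap (ambSmul K U M V c) := by
  rintro u ⟨hu, hu'⟩
  refine ⟨fun k l α i => ?_, fun l i => ?_⟩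
  · change Cell.map K LinearMap.id _ (Cell.smulHom K M _ k _ (u k (i.comp α))) =
      Cell.map K (Sx.pull K α) _ (Cell.smulHom K M _ l _ (u l i))
    rw [Cell.map_smulHom, Cell.map_smulHom, hu, resA_resA, resA_resA]
  · obtain ⟨x, hx, hx'⟩ := hu' l i
    exact ⟨_, Cell.smulFun_lim _ hx, fun n =>
      Cell.map_bideg LinearMap.id _ (fun _ hw => hw) (smulC_deg _ p) (hx' n)⟩

/-- The right `𝒪`-module structure, given by `p₂^*`. -/
instance : Module Γ(X, V) (Mix K U M V) where
  smul c u := (ambSmul K U M V c).restrict (le_comap_mix (ambSmul_bi c)) u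
  one_smul u := Subtype.ext (funext fun l => funext fun i => by
    change Cell.smulHom K M _ l (resA K inf_le_left 1) (u.1 l i) = u.1 l i
    rw [map_one, map_one]; rfl)
  mul_smul c c' u := Subtype.ext (funext fun l => funext fun i => by
    change Cell.smulHom K M _ l (resA K inf_le_left (c * c')) (u.1 l i) = _
    rw [map_mul, map_mul]; rfl)
  smul_zero c := map_zero _
  smul_add c u v := map_add _ _ _
  add_smul c c' u := Subtype.ext (funext fun l => funext fun i => by
    change Cell.smulHom K M _ l (resA K inf_le_left (c + c')) (u.1 l i) = _
    rw [map_add, map_add]; rfl)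
  zero_smul u := Subtype.ext (funext fun l => funext fun i => by
    change Cell.smulHom K M _ l (resA K inf_le_left 0) (u.1 l i) = 0
    rw [map_zero, map_zero]; rfl)

theorem smul_apply (c : Γ(X, V)) (u : Mix K U M V) (l : ℕ) (i : Idx m l) :
    (c • u).1 l i = Cell.smulHom K M (V ⊓ inter U i) l (resA K inf_le_left c) (u.1 l i) := rfl

theorem res_smul (h : V' ≤ V) (c : Γ(X, V)) (u : Mix K U M V) :
    res h (c • u) = resA K h c • res h u := by
  refine Subtype.ext (funext fun l => funext fun i => ?_)
  rw [res_apply, smul_apply, smul_apply, Cell.map_smulHom, resA_resA, resA_resA, res_apply]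

variable (K U M)

/-- The underlying presheaf of abelian groups of `Mix_U(M)`. -/
def toAb : TopCat.Presheaf Ab.{u} X where
  obj V := AddCommGrpCat.of (Mix K U M V.unop)
  map f := AddCommGrpCat.ofHom (res (leOfHom f.unop)).toAddMonoidHom
  map_id V := by
    refine ConcreteCategory.hom_ext _ _ fun u => ?_
    exact res_self (K := K) (U := U) (M := M) u
  map_comp f g := by
    refine ConcreteCategory.hom_ext _ _ fun u => ?_
    exact (res_res (K := K) (U := U) (M := M) _ _ u).symm

/-- `Mix_U(M)` as a presheaf of `𝒪`-modules. -/
def toPre : X.PresheafOfModules :=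
  letI : ∀ V, Module (X.ringCatSheaf.obj.obj V) ((toAb K U M).obj V) :=
    fun V => inferInstanceAs (Module Γ(X, V.unop) (Mix K U M V.unop))
  PresheafOfModules.ofPresheaf (toAb K U M) (fun _ _ f c u => res_smul (leOfHom f.unop) c u)

end Mix

end MixedSheaf

/-! ## The structure of the mixed resolution -/

section Structure

variable (K : Type u) [Field K] {X : Scheme.{u}} [X.Over (Spec (CommRingCat.of K))]

/-- The projection of sections of `Ω ⊗ P ⊗ M` to the part of even degree. -/
def sec.even (M : X.Modules) (W : X.Opens) : sec K M W →ₗ[K] sec K M W :=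
  (2 : K)⁻¹ • (LinearMap.id + sec.sgn K M W)

/-- The projection of sections of `Ω ⊗ P ⊗ M` to the part of odd degree. -/
def sec.odd (M : X.Modules) (W : X.Opens) : sec K M W →ₗ[K] sec K M W :=
  (2 : K)⁻¹ • (LinearMap.id - sec.sgn K M W)

/-- The sign involution of the forms on the `l`-simplex: multiplication by `(-1)^q` in degree
`q`. -/
def Sx.sgn (l : ℕ) : Sx K l →ₗ[K] Sx K l :=
  (DR.sgn K (SimplexRing K l)).toLinearMap.restrictScalars K

/-- The product
`(ω ⊗ a) (ω' ⊗ n) = (-1)^(p q') (ω ω') ⊗ (a n)`, where `p` is the degree of `a` and `q'` is the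
degree of `ω'`. -/
def preMul (M : X.Modules) (W : X.Opens) (l : ℕ) :
    Sx K l ⊗[K] sec K (OX X) W →ₗ[K] Sx K l ⊗[K] sec K M W →ₗ[K] Sx K l ⊗[K] sec K M W :=
  TensorProduct.map₂ (LinearMap.mul K (Sx K l)) ((sec.act K M W).comp (sec.even K (OX X) W)) +
  TensorProduct.map₂ ((LinearMap.mul K (Sx K l)).compl₂ (Sx.sgn K l))
    ((sec.act K M W).comp (sec.odd K (OX X) W))

/-- The differential `d(ω ⊗ n) = dω ⊗ n + (-1)^q ω ⊗ ∇ n`, where `q` is the degree of `ω`. -/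
def preD [LocallyOfFiniteType (X ↘ Spec (CommRingCat.of K))] (M : X.Modules) (W : X.Opens)
    (l : ℕ) : Sx K l ⊗[K] sec K M W →ₗ[K] Sx K l ⊗[K] sec K M W :=
  TensorProduct.map (DR.d K (SimplexRing K l)) LinearMap.id +
  TensorProduct.map (Sx.sgn K l) (sec.nabla K M W)

variable {m : ℕ} (U : Fin (m + 1) → X.Opens)

/-- The family of products `μ` is the one induced, in each simplicial degree, by the product of the
forms on simplices and the product `Ω ⊗ P ⊗ 𝒪 × Ω ⊗ P ⊗ M → Ω ⊗ P ⊗ M`. -/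
def IsMixMul (M : X.Modules)
    (μ : ∀ V, Mix K U (OX X) V →ₗ[K] Mix K U M V →ₗ[K] Mix K U M V) : Prop :=
  ∀ (V : X.Opens) (u : Mix K U (OX X) V) (v : Mix K U M V) (l : ℕ) (i : Idx m l)
    (x : ℕ → Sx K l ⊗[K] sec K (OX X) (V ⊓ inter U i))
    (y : ℕ → Sx K l ⊗[K] sec K M (V ⊓ inter U i)),
    Cell.Lim K x (u.1 l i) → Cell.Lim K y (v.1 l i) →
      Cell.Lim K (fun n => preMul K M (V ⊓ inter U i) l (x n) (y n)) ((μ V u v).1 l i)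

/-- The family of operators `d` is the differential `∂ + (-1)^q ∇` of the mixed resolution. -/
def IsMixD [LocallyOfFiniteType (X ↘ Spec (CommRingCat.of K))] (M : X.Modules)
    (d : ∀ V, Mix K U M V →ₗ[K] Mix K U M V) : Prop :=
  ∀ (V : X.Opens) (u : Mix K U M V) (l : ℕ) (i : Idx m l)
    (x : ℕ → Sx K l ⊗[K] sec K M (V ⊓ inter U i)),
    Cell.Lim K x (u.1 l i) →
      Cell.Lim K (fun n => preD K M (V ⊓ inter U i) l (x n)) ((d V u).1 l i)

/-- The map `ι` is the embedding `m ↦ 1 ⊗ m` of `M` into `P ⊗ M`, followed by the embedding of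
`P ⊗ M` into `Mix(M)`. -/
def IsMixConst (M : X.Modules) (ι : ∀ V : X.Opens, Γ(M, V) → Mix K U M V) : Prop :=
  ∀ (V : X.Opens) (c : Γ(M, V)) (l : ℕ) (i : Idx m l),
    Cell.Lim K (fun _ => 1 ⊗ₜ[K] sec.const K M (V ⊓ inter U i) (resM (K := K) M inf_le_left c))
      ((ι V c).1 l i)

/-- The map `ι` is the homomorphism `p₁^* : 𝒪 → P`, followed by the embedding of `P` into
`Mix(𝒪)`. -/
def IsMixP₁ (ι : ∀ V : X.Opens, Γ(X, V) → Mix K U (OX X) V) : Prop :=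
  ∀ (V : X.Opens) (c : Γ(X, V)) (l : ℕ) (i : Idx m l),
    Cell.Lim K (fun _ => 1 ⊗ₜ[K] sec.const₁ K (V ⊓ inter U i) (resA K inf_le_left c))
      ((ι V c).1 l i)

/-- The map `ι` is the homomorphism `p₂^* : 𝒪 → P`, followed by the embedding of `P` into
`Mix(𝒪)`. -/
def IsMixP₂ (ι : ∀ V : X.Opens, Γ(X, V) → Mix K U (OX X) V) : Prop :=
  IsMixConst K U (OX X) ι

/-- A super-commutative associative unital DG `K`-algebra with grading `gr`, product `μ`, unit `e`
and differential `d`. -/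
structure IsSuperCommDGAlgebra {A : Type u} [AddCommGroup A] [Module K A]
    (gr : ℕ → Submodule K A) (μ : A →ₗ[K] A →ₗ[K] A) (e : A) (d : A →ₗ[K] A) : Prop where
  isInternal : DirectSum.IsInternal gr
  one_mem : e ∈ gr 0
  mul_mem : ∀ {i j : ℕ} {a b : A}, a ∈ gr i → b ∈ gr j → μ a b ∈ gr (i + j)
  one_mul : ∀ a, μ e a = a
  mul_one : ∀ a, μ a e = a
  mul_assoc : ∀ a b c, μ (μ a b) c = μ a (μ b c)
  comm : ∀ {i j : ℕ} {a b : A}, a ∈ gr i → b ∈ gr j → μ b a = (-1 : K) ^ (i * j) • μ a b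
  d_mem : ∀ {i : ℕ} {a : A}, a ∈ gr i → d a ∈ gr (i + 1)
  leibniz : ∀ {i : ℕ} {a : A} (b : A), a ∈ gr i → d (μ a b) = μ (d a) b + (-1 : K) ^ i • μ a (d b)
  d_d : ∀ a, d (d a) = 0

/-- A left DG module with grading `grN`, action `ν` and differential `dN` over the DG algebra with
grading `gr`, product `μ`, unit `e` and differential `d`. -/
structure IsDGModule {A : Type u} [AddCommGroup A] [Module K A]
    (gr : ℕ → Submodule K A) (μ : A →ₗ[K] A →ₗ[K] A) (e : A) (d : A →ₗ[K] A)
    {N : Type u} [AddCommGroup N] [Module K N]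
    (grN : ℕ → Submodule K N) (ν : A →ₗ[K] N →ₗ[K] N) (dN : N →ₗ[K] N) : Prop where
  isInternal : DirectSum.IsInternal grN
  smul_mem : ∀ {i j : ℕ} {a : A} {n : N}, a ∈ gr i → n ∈ grN j → ν a n ∈ grN (i + j)
  one_smul : ∀ n, ν e n = n
  mul_smul : ∀ a b n, ν (μ a b) n = ν a (ν b n)
  d_mem : ∀ {i : ℕ} {n : N}, n ∈ grN i → dN n ∈ grN (i + 1)
  leibniz : ∀ {i : ℕ} {a : A} (n : N), a ∈ gr i →
    dN (ν a n) = ν (d a) n + (-1 : K) ^ i • ν a (dN n)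
  d_d : ∀ n, dN (dN n) = 0

/-- A unital homomorphism of `K`-algebras from a commutative algebra `R` to the degree zero part of
a graded algebra with grading `gr`, product `μ` and unit `e`. -/
structure IsAlgHomZero {R : Type u} [CommRing R] [Algebra K R] {A : Type u} [AddCommGroup A]
    [Module K A] (gr : ℕ → Submodule K A) (μ : A →ₗ[K] A →ₗ[K] A) (e : A) (f : R →ₗ[K] A) :
    Prop where
  mem : ∀ r, f r ∈ gr 0
  map_one : f 1 = e
  map_mul : ∀ r s, f (r * s) = μ (f r) (f s)

/-- The sum of the `Mix^{p,q}` is direct. -/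
def IsBigraded (M : X.Modules) : Prop :=
  ∀ V : X.Opens, iSupIndep fun pq : ℕ × ℕ => bi K U M V pq.1 pq.2

/-- `M` is locally free of finite rank: locally there is a finite family of sections which is a basis
over every smaller open set. -/
def IsLocallyFreeFinite (M : X.Modules) : Prop :=
  ∀ x : X, ∃ V : X.Opens, x ∈ V ∧ ∃ (r : ℕ) (e : Fin r → Γ(M, V)),
    ∀ (W : X.Opens) (h : W ≤ V), Function.Bijective fun c : Fin r → Γ(X, W) =>
      ∑ j, c j • (M.presheaf.map (homOfLE h).op (e j) : Γ(M, W))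

/-- The sheaf of `𝒪`-modules `Mix_U(M)`. -/
def Mix.sheaf (M : X.Modules) (h : (Mix.toAb K U M).IsSheaf) : X.Modules :=
  SheafOfModules.mk (Mix.toPre K U M) h

/-- The presheaf `V ↦ Mix_U(𝒪)(V) ⊗ M(V)`, the tensor product being taken over `𝒪(V)`. -/
def Mix.tensorPre (M : X.Modules) : X.PresheafOfModules :=
  PresheafOfModules.Monoidal.tensorObj (R := X.presheaf) (Mix.toPre K U (OX X)) M.val

/-- The tensor product `Mix_U(𝒪) ⊗ M` of sheaves of `𝒪`-modules. -/
def Mix.tensor (M : X.Modules) : X.Modules :=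
  (PresheafOfModules.sheafification (𝟙 X.ringCatSheaf.obj)).obj (Mix.tensorPre K U M)

/-- The canonical map from the presheaf tensor product to the tensor product of sheaves. -/
def Mix.toTensor (M : X.Modules) : Mix.tensorPre K U M ⟶ (Mix.tensor K U M).val :=
  (PresheafOfModules.sheafificationAdjunction (𝟙 X.ringCatSheaf.obj)).unit.app _

end Structure

end MixRes

end

open MixRes

noncomputable section

namespace MixRes

/-! ## Completions of Noetherian rings -/

section CompletionNoetherian

theorem mem_pow_smul_span_range {R M : Type*} [CommRing R] [AddCommGroup M] [Module R M] {r : ℕ}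
    (e : Fin r → M) (J : Ideal R) (x : M)
    (hx : x ∈ J • Submodule.span R (Set.range e)) :
    ∃ a : Fin r → R, (∀ i, a i ∈ J) ∧ x = ∑ i, a i • e i := by
  obtain ⟨a, ha, rfl⟩ := (Submodule.mem_ideal_smul_span_iff_exists_sum J e x).1 hx
  refine ⟨a, ha, ?_⟩
  rw [Finsupp.sum_fintype _ _ (fun i => by simp)]

/-- The adic completion of a Noetherian ring is Noetherian. -/
theorem isNoetherianRing_adicCompletion {A : Type*} [CommRing A] [IsNoetherianRing A]
    (I : Ideal A) : IsNoetherianRing (AdicCompletion I A) := by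
  have hI : I.FG := IsNoetherian.noetherian I
  obtain ⟨r, a, ha⟩ := Submodule.fg_iff_exists_fin_generating_family.1 hI
  let f : MvPolynomial (Fin r) A →ₐ[A] A := MvPolynomial.aeval a
  have hX : ∀ i, f (MvPolynomial.X i) = a i := fun i => MvPolynomial.aeval_X a i
  have haI : ∀ i, a i ∈ I := fun i => ha ▸ Submodule.subset_span ⟨i, rfl⟩
  have hf : (MvPolynomial.idealOfVars (Fin r) A) ≤ I.comap f := by
    rw [MvPolynomial.idealOfVars, Ideal.span_le]
    rintro _ ⟨i, rfl⟩
    rw [SetLike.mem_coe, Ideal.mem_comap, hX]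
    exact haI i
  have hfn : ∀ n, (MvPolynomial.idealOfVars (Fin r) A) ^ n ≤ (I ^ n).comap f.toRingHom := by
    intro n
    rw [← Ideal.map_le_iff_le_comap, Ideal.map_pow]
    exact Ideal.pow_right_mono (Ideal.map_le_iff_le_comap.2 hf) n
  let φ : ∀ n, MvPowerSeries (Fin r) A →+* A ⧸ I ^ n := fun n =>
    (Ideal.quotientMap (I ^ n) f.toRingHom (hfn n)).comp
      (MvPowerSeries.truncTotalAlgHom (Fin r) A n).toRingHom
  have hφ : ∀ {m n : ℕ} (hle : m ≤ n), (Ideal.Quotient.factorPow I hle).comp (φ n) = φ m := by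
    intro m n hle
    ext x
    change Ideal.Quotient.mk (I ^ m) (f (x.truncTotal n)) =
      Ideal.Quotient.mk (I ^ m) (f (x.truncTotal m))
    rw [Ideal.Quotient.mk_eq_mk_iff_sub_mem, ← map_sub]
    exact hfn m (MvPowerSeries.truncTotal_sub_truncTotal_mem_pow_idealOfVars hle le_rfl x)
  let g : MvPowerSeries (Fin r) A →+* AdicCompletion I A := AdicCompletion.liftRingHom I φ hφ
  have hg : ∀ p : MvPolynomial (Fin r) A, g (p : MvPowerSeries (Fin r) A) =
      algebraMap A (AdicCompletion I A) (f p) := by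
    intro p
    refine AdicCompletion.ext_evalₐ fun n => ?_
    rw [AdicCompletion.evalₐ_liftRingHom]
    have h := (MvPowerSeries.truncTotalAlgHom (Fin r) A n).commutes p
    change Ideal.quotientMap (I ^ n) f.toRingHom (hfn n)
      (MvPowerSeries.truncTotalAlgHom (Fin r) A n p) = _
    have h' : MvPowerSeries.truncTotalAlgHom (Fin r) A n (p : MvPowerSeries (Fin r) A) =
      Ideal.Quotient.mk _ p := h
    rw [h', Ideal.quotientMap_mk, AlgHom.commutes]
    rfl
  let J : Ideal (MvPowerSeries (Fin r) A) := Ideal.span (Set.range MvPowerSeries.X)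
  have hJ : J.map g = I.map (algebraMap A (AdicCompletion I A)) := by
    refine Eq.trans ?_ (congrArg (Ideal.map (algebraMap A (AdicCompletion I A))) ha)
    refine Eq.trans ?_ (Ideal.map_span _ _).symm
    rw [Ideal.map_span, ← Set.range_comp, ← Set.range_comp]
    congr 2
    funext i
    have := hg (MvPolynomial.X i)
    rw [hX, MvPolynomial.coe_X] at this
    exact this
  have hc : IsAdicComplete (J.map g) (AdicCompletion I A) := by
    rw [hJ, IsAdicComplete.map_algebraMap_iff]
    exact AdicCompletion.isAdicComplete hI
  have hs : Function.Surjective g := by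
    refine surjective_of_mk_map_comp_surjective (I := J) g ?_
    intro y
    obtain ⟨x, rfl⟩ := Ideal.Quotient.mk_surjective y
    obtain ⟨b, hb⟩ := Ideal.Quotient.mk_surjective (AdicCompletion.evalOneₐ I x)
    refine ⟨(MvPolynomial.C b : MvPolynomial (Fin r) A), ?_⟩
    change Ideal.Quotient.mk _ (g _) = _
    rw [hg, Ideal.Quotient.mk_eq_mk_iff_sub_mem, hJ, ← AdicCompletion.ker_evalOneₐ_eq_map I hI]
    have hfC : f (MvPolynomial.C b) = b := MvPolynomial.aeval_C a b
    rw [hfC]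
    change AdicCompletion.evalOneₐ I (algebraMap A _ b - x) = 0
    rw [map_sub, ← hb, AlgHom.commutes]
    exact sub_self _
  exact isNoetherianRing_of_surjective _ _ g hs

theorem isAdicComplete_map {A : Type*} [CommRing A] {I : Ideal A} (hI : I.FG) :
    IsAdicComplete (I.map (algebraMap A (AdicCompletion I A))) (AdicCompletion I A) := by
  rw [IsAdicComplete.map_algebraMap_iff]
  exact AdicCompletion.isAdicComplete hI

theorem mem_map_pow_iff {A : Type*} [CommRing A] {I : Ideal A} (hI : I.FG) (n : ℕ)
    (x : AdicCompletion I A) :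
    x ∈ (I.map (algebraMap A (AdicCompletion I A))) ^ n ↔ AdicCompletion.evalₐ I n x = 0 := by
  have h := AdicCompletion.pow_smul_top_eq_ker_eval (M := A) (n := n) hI
  have h1 : x ∈ (I.map (algebraMap A (AdicCompletion I A))) ^ n ↔
      x ∈ (I ^ n • ⊤ : Submodule A (AdicCompletion I A)) := by
    rw [← Ideal.map_pow, Ideal.smul_top_eq_map]
    rfl
  rw [h1, h, LinearMap.mem_ker, AdicCompletion.eval_apply]
  obtain ⟨y, rfl⟩ := AdicCompletion.mk_surjective _ _ x
  rw [AdicCompletion.evalₐ_mk, Ideal.Quotient.eq_zero_iff_mem]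
  change Submodule.Quotient.mk (y n) = 0 ↔ _
  rw [Submodule.Quotient.mk_eq_zero]
  simp

variable {R M : Type*} [CommRing R] [AddCommGroup M] [Module R M] (I : Ideal R)
  [IsAdicComplete I R]

/-- A finitely generated submodule over a complete Noetherian ring is separated. -/
theorem eq_zero_of_forall_mem_pow_smul [IsNoetherianRing R] {L : Submodule R M} (hL : L.FG)
    {x : M} (hx : ∀ n, x ∈ I ^ n • L) : x = 0 := by
  have : Module.Finite R L := Module.Finite.iff_fg.2 hL
  have h := Ideal.iInf_pow_smul_eq_bot_of_le_jacobson (M := L) I (IsAdicComplete.le_jacobson_bot I)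
  have hxL : x ∈ L := Submodule.smul_le_right (hx 0)
  have : (⟨x, hxL⟩ : L) ∈ (⨅ i : ℕ, I ^ i • ⊤ : Submodule R L) := by
    rw [Submodule.mem_iInf]
    intro n
    have h2 : (I ^ n • ⊤ : Submodule R L).map L.subtype = I ^ n • L := by
      rw [Submodule.map_smul'', Submodule.map_top, Submodule.range_subtype]
    have h3 := hx n
    rw [← h2] at h3
    obtain ⟨y, hy, hyx⟩ := h3
    have : y = ⟨x, hxL⟩ := Subtype.ext hyx
    exact this ▸ hy
  rw [h, Submodule.mem_bot] at this
  exact congrArg Subtype.val this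

/-- A finitely generated submodule over a complete ring is complete. -/
theorem exists_limit_of_fg {L : Submodule R M} (hL : L.FG) (x : ℕ → M) (h0 : x 0 ∈ L)
    (hx : ∀ n, x (n + 1) - x n ∈ I ^ n • L) : ∃ y ∈ L, ∀ n, y - x n ∈ I ^ n • L := by
  obtain ⟨r, e, rfl⟩ := Submodule.fg_iff_exists_fin_generating_family.1 hL
  choose a ha hax using fun n => mem_pow_smul_span_range e (I ^ n) _ (hx n)
  obtain ⟨b, -, hb⟩ := mem_pow_smul_span_range e ⊤ (x 0) (by simpa using h0)
  let c : ℕ → Fin r → R := fun n i => b i + ∑ k ∈ Finset.range n, a k i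
  have hc : ∀ n, x n = ∑ i, c n i • e i := by
    intro n
    induction n with
    | zero => simpa [c] using hb
    | succ n ih =>
      have : x (n + 1) = x n + ∑ i, a n i • e i := by rw [← hax n]; abel
      rw [this, ih, ← Finset.sum_add_distrib]
      refine Finset.sum_congr rfl fun i _ => ?_
      rw [← add_smul]
      simp only [c, Finset.sum_range_succ, add_assoc]
  have hstep : ∀ i m d, c (m + d) i - c m i ∈ I ^ m := by
    intro i m d
    induction d with
    | zero => simp
    | succ d ih =>
      have : c (m + (d + 1)) i - c m i = (c (m + d) i - c m i) + a (m + d) i := by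
        rw [← add_assoc]; simp only [c, Finset.sum_range_succ]; ring
      rw [this]
      exact Ideal.add_mem _ ih (Ideal.pow_le_pow_right (Nat.le_add_right m d) (ha _ i))
  have hlim : ∀ i, ∃ l : R, ∀ n, l - c n i ∈ I ^ n := by
    intro i
    obtain ⟨l, hl⟩ := IsPrecomplete.prec (I := I) (M := R) inferInstance (f := fun n => c n i)
      (by
        intro m n h
        obtain ⟨d, rfl⟩ := Nat.exists_eq_add_of_le h
        rw [SModEq.comm, SModEq.sub_mem]
        simpa using hstep i m d)
    refine ⟨l, fun n => ?_⟩
    have := (hl n).symm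
    rw [SModEq.sub_mem] at this
    simpa using this
  choose l hl using hlim
  refine ⟨∑ i, l i • e i, Submodule.sum_mem _ fun i _ =>
    Submodule.smul_mem _ _ (Submodule.subset_span ⟨i, rfl⟩), fun n => ?_⟩
  rw [hc n, ← Finset.sum_sub_distrib]
  refine Submodule.sum_mem _ fun i _ => ?_
  rw [← sub_smul]
  exact Submodule.smul_mem_smul (hl i n) (Submodule.subset_span ⟨i, rfl⟩)

end CompletionNoetherian

/-! ## Formal localizations -/

section FormalLocalization

/-- The homomorphism `H` is, modulo each power of the ideal `I`, the localization at `s`. -/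
structure IsFormalLoc {B B' : Type*} [CommRing B] [CommRing B'] (H : B →+* B') (I : Ideal B)
    (s : B) : Prop where
  isUnit : IsUnit (H s)
  approx : ∀ (b' : B') (n : ℕ), ∃ (k : ℕ) (b : B), H s ^ k * b' - H b ∈ (I.map H) ^ n
  inj : ∀ (b : B) (n : ℕ), H b ∈ (I.map H) ^ n → ∃ k : ℕ, s ^ k * b ∈ I ^ n

namespace IsFormalLoc

variable {B B' : Type*} [CommRing B] [CommRing B'] [Algebra B B'] {I : Ideal B} {s : B}

theorem approx_tensor (h : IsFormalLoc (algebraMap B B') I s) {M : Type*} [AddCommGroup M]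
    [Module B M] (z : B' ⊗[B] M) (n : ℕ) :
    ∃ (k : ℕ) (x : M), algebraMap B B' s ^ k • z - 1 ⊗ₜ x ∈
      ((I.map (algebraMap B B')) ^ n • ⊤ : Submodule B' (B' ⊗[B] M)) := by
  induction z using TensorProduct.induction_on with
  | zero => exact ⟨0, 0, by simp⟩
  | tmul b' x =>
    obtain ⟨k, b, hb⟩ := h.approx b' n
    refine ⟨k, b • x, ?_⟩
    have e : algebraMap B B' s ^ k • (b' ⊗ₜ[B] x) - 1 ⊗ₜ (b • x) =
        (algebraMap B B' s ^ k * b' - algebraMap B B' b) • ((1 : B') ⊗ₜ[B] x) := by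
      refine Eq.trans ?_ (sub_smul _ _ ((1 : B') ⊗ₜ[B] x)).symm
      rw [TensorProduct.smul_tmul', TensorProduct.smul_tmul', TensorProduct.smul_tmul',
        ← TensorProduct.smul_tmul b]
      simp [Algebra.smul_def]
    rw [e]
    exact Submodule.smul_mem_smul hb trivial
  | add y z hy hz =>
    obtain ⟨k, x, hx⟩ := hy
    obtain ⟨k', x', hx'⟩ := hz
    refine ⟨k' + k, s ^ k' • x + s ^ k • x', ?_⟩
    have e : algebraMap B B' s ^ (k' + k) • (y + z) - 1 ⊗ₜ[B] (s ^ k' • x + s ^ k • x') =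
        algebraMap B B' s ^ k' • (algebraMap B B' s ^ k • y - 1 ⊗ₜ x) +
        algebraMap B B' s ^ k • (algebraMap B B' s ^ k' • z - 1 ⊗ₜ x') := by
      have e1 : ∀ (j : ℕ) (w : M), (1 : B') ⊗ₜ[B] (s ^ j • w) =
          algebraMap B B' s ^ j • ((1 : B') ⊗ₜ[B] w) := by
        intro j w
        rw [← map_pow, algebraMap_smul, TensorProduct.tmul_smul]
      rw [TensorProduct.tmul_add, e1, e1, smul_sub, smul_sub, ← mul_smul, ← mul_smul, ← pow_add,
        ← pow_add, smul_add, add_comm k k']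
      abel
    rw [e]
    exact Submodule.add_mem _ (Submodule.smul_mem _ _ hx) (Submodule.smul_mem _ _ hx')

/-- The multiplication `B' ⊗ J → B'`. -/
def mulIdeal (B' : Type*) [CommRing B'] [Algebra B B'] (J : Ideal B) : B' ⊗[B] J →ₗ[B'] B' :=
  (AlgebraTensorModule.rid B B' B').toLinearMap ∘ₗ
    (AlgebraTensorModule.lTensor B' B' (J.subtype : J →ₗ[B] B))

theorem mulIdeal_tmul (J : Ideal B) (b' : B') (j : J) :
    mulIdeal B' J (b' ⊗ₜ j) = algebraMap B B' j * b' := by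
  simp [mulIdeal, Algebra.smul_def]

theorem mem_of_smul_mem (h : IsFormalLoc (algebraMap B B') I s) {M' : Type*} [AddCommGroup M']
    [Module B' M'] (L : Submodule B' M') (k : ℕ) {z : M'}
    (hz : algebraMap B B' s ^ k • z ∈ L) : z ∈ L := by
  obtain ⟨u, hu⟩ := h.isUnit
  have := L.smul_mem ((u⁻¹ ^ k : B'ˣ) : B') hz
  rwa [← hu, ← mul_smul, ← Units.val_pow_eq_pow_val, ← Units.val_mul, ← mul_pow, inv_mul_cancel,
    one_pow, Units.val_one, one_smul] at this

/-- A formal localization of complete Noetherian rings is flat. -/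
theorem flat [IsNoetherianRing B] [IsNoetherianRing B']
    [IsAdicComplete (I.map (algebraMap B B')) B'] (h : IsFormalLoc (algebraMap B B') I s) :
    Module.Flat B B' := by
  rw [Module.Flat.iff_lTensor_injective]
  intro J hJ
  rw [injective_iff_map_eq_zero]
  intro z hz
  have hm : mulIdeal B' J z = 0 := by
    have : mulIdeal B' J z = (AlgebraTensorModule.rid B B' B') (LinearMap.lTensor B' J.subtype z) :=
      rfl
    rw [this, hz, map_zero]
  have : Module.Finite B J := Module.Finite.iff_fg.2 hJ
  have hbot := Ideal.iInf_pow_smul_eq_bot_of_le_jacobson (M := B' ⊗[B] J)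
    (I.map (algebraMap B B')) (IsAdicComplete.le_jacobson_bot _)
  rw [← Submodule.mem_bot B', ← hbot, Submodule.mem_iInf]
  intro n
  obtain ⟨c, hc⟩ := Ideal.exists_pow_inf_eq_pow_smul I (M := B) J
  obtain ⟨k, j, hj⟩ := h.approx_tensor z (n + c)
  have hj' : algebraMap B B' j ∈ (I.map (algebraMap B B')) ^ (n + c) := by
    have h1 := Submodule.mem_map_of_mem (f := mulIdeal B' J) hj
    rw [Submodule.map_smul''] at h1
    have h2 := (Submodule.smul_mono le_rfl le_top) h1
    rw [map_sub, map_smul, hm, mulIdeal_tmul, smul_zero, zero_sub, mul_one] at h2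
    simpa using h2
  obtain ⟨l, hl⟩ := h.inj _ _ hj'
  have hl' : s ^ l * (j : B) ∈ I ^ (n + c) • ⊤ ⊓ J :=
    ⟨by simpa using hl, J.mul_mem_left _ j.2⟩
  rw [hc _ (Nat.le_add_left c n), Nat.add_sub_cancel] at hl'
  have h3 : s ^ l * (j : B) ∈ I ^ n • J := Submodule.smul_mono le_rfl inf_le_right hl'
  have h4 : (1 : B') ⊗ₜ[B] (s ^ l • j) ∈
      ((I.map (algebraMap B B')) ^ n • ⊤ : Submodule B' (B' ⊗[B] J)) := by
    have key : ∀ y ∈ I ^ n • J, ∀ hy : y ∈ J, (1 : B') ⊗ₜ[B] (⟨y, hy⟩ : J) ∈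
        ((I.map (algebraMap B B')) ^ n • ⊤ : Submodule B' (B' ⊗[B] J)) := by
      intro y hy
      refine Submodule.smul_induction_on' hy ?_ ?_
      · intro r hr m hm' hy'
        have e : (⟨r • m, hy'⟩ : J) = r • ⟨m, hm'⟩ := rfl
        rw [e, TensorProduct.tmul_smul, ← algebraMap_smul B' r]
        have hr' : algebraMap B B' r ∈ (I.map (algebraMap B B')) ^ n := by
          rw [← Ideal.map_pow]
          exact Ideal.mem_map_of_mem _ hr
        exact Submodule.smul_mem_smul hr' trivial
      · intro y hy z hz h1 h2 hyz
        have e : (⟨y + z, hyz⟩ : J) = ⟨y, Submodule.smul_le_right hy⟩ +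
          ⟨z, Submodule.smul_le_right hz⟩ := rfl
        rw [e, TensorProduct.tmul_add]
        exact Submodule.add_mem _ (h1 _) (h2 _)
    exact key _ h3 _
  have hj2 : algebraMap B B' s ^ k • z - 1 ⊗ₜ j ∈
      ((I.map (algebraMap B B')) ^ n • ⊤ : Submodule B' (B' ⊗[B] J)) :=
    Submodule.smul_mono_left (Ideal.pow_le_pow_right (Nat.le_add_right n c)) hj
  refine h.mem_of_smul_mem _ (l + k) ?_
  have e : algebraMap B B' s ^ (l + k) • z =
      algebraMap B B' s ^ l • (algebraMap B B' s ^ k • z - 1 ⊗ₜ j) + 1 ⊗ₜ[B] (s ^ l • j) := by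
    rw [TensorProduct.tmul_smul, ← algebraMap_smul B' (s ^ l), map_pow, smul_sub, ← mul_smul,
      ← pow_add]
    abel
  rw [e]
  exact Submodule.add_mem _ (Submodule.smul_mem _ _ hj2) h4

/-- Descent of membership in a submodule along a formal localization. -/
theorem exists_pow_smul_mem [Module.Flat B B'] (h : IsFormalLoc (algebraMap B B') I s)
    {M : Type*} [AddCommGroup M] [Module B M] {L : Submodule B M} {x : M} {n : ℕ}
    (hn : ∀ b ∈ I ^ n, b • x ∈ L)
    (hx : (1 : B') ⊗ₜ[B] x ∈ Submodule.span B' ((fun l : M => (1 : B') ⊗ₜ[B] l) '' (L : Set M))) :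
    ∃ k : ℕ, s ^ k • x ∈ L := by
  let J : Ideal B := LinearMap.ker (LinearMap.toSpanSingleton B (M ⧸ L) (L.mkQ x))
  have hJ : ∀ b, b ∈ J ↔ b • x ∈ L := by
    intro b
    rw [LinearMap.mem_ker, LinearMap.toSpanSingleton_apply, ← map_smul, Submodule.mkQ_apply,
      Submodule.Quotient.mk_eq_zero]
  have hz : (1 : B') ⊗ₜ[B] L.mkQ x = 0 := by
    have h1 : Submodule.span B' ((fun l : M => (1 : B') ⊗ₜ[B] l) '' (L : Set M)) ≤
        LinearMap.ker (AlgebraTensorModule.lTensor B' B' L.mkQ) := by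
      rw [Submodule.span_le]
      rintro _ ⟨l, hl, rfl⟩
      change (1 : B') ⊗ₜ[B] L.mkQ l = 0
      rw [(Submodule.Quotient.mk_eq_zero L).2 hl |> (fun h => (h : L.mkQ l = 0)),
        TensorProduct.tmul_zero]
    exact h1 hx
  have hex : Function.Exact (J.subtype : J →ₗ[B] B)
      (LinearMap.toSpanSingleton B (M ⧸ L) (L.mkQ x)) := by
    rw [LinearMap.exact_iff, Submodule.range_subtype]
  have hex' := Module.Flat.lTensor_exact B' hex
  obtain ⟨z, hz'⟩ := (hex' ((1 : B') ⊗ₜ[B] (1 : B))).1 (by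
    rw [LinearMap.lTensor_tmul, LinearMap.toSpanSingleton_apply, one_smul, hz])
  have hz2 : mulIdeal B' J z = 1 := by
    have : mulIdeal B' J z = (AlgebraTensorModule.rid B B' B') (LinearMap.lTensor B' J.subtype z) :=
      rfl
    rw [this, hz']
    simp
  obtain ⟨k, j, hj⟩ := h.approx_tensor z n
  have hj' : algebraMap B B' (s ^ k - j) ∈ (I.map (algebraMap B B')) ^ n := by
    have h1 := Submodule.mem_map_of_mem (f := mulIdeal B' J) hj
    rw [Submodule.map_smul''] at h1
    have h2 := (Submodule.smul_mono le_rfl le_top) h1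
    rw [map_sub, map_smul, hz2, mulIdeal_tmul, mul_one] at h2
    rw [map_sub, map_pow]
    simpa using h2
  obtain ⟨l, hl⟩ := h.inj _ _ hj'
  refine ⟨l + k, ?_⟩
  rw [← hJ]
  have e : s ^ (l + k) = s ^ l * (s ^ k - j) + s ^ l * j := by ring
  rw [e]
  exact J.add_mem ((hJ _).2 (hn _ hl)) (J.mul_mem_left _ j.2)

end IsFormalLoc

end FormalLocalization

/-! ## Localization of rings and modules away from an element -/

section Away

/-- The homomorphism `φ` is the localization away from `f`. -/
structure AwayHom {C C' : Type*} [CommRing C] [CommRing C'] (φ : C →+* C') (f : C) : Prop where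
  isUnit : IsUnit (φ f)
  surj : ∀ c' : C', ∃ (k : ℕ) (c : C), φ f ^ k * c' = φ c
  inj : ∀ c : C, φ c = 0 → ∃ k : ℕ, f ^ k * c = 0

/-- The semilinear map `g` is the localization away from `f`. -/
structure AwayMod {C C' : Type*} [CommRing C] [CommRing C'] {φ : C →+* C'} (f : C)
    {N N' : Type*} [AddCommGroup N] [AddCommGroup N'] [Module C N] [Module C' N']
    (g : N →ₛₗ[φ] N') : Prop where
  surj : ∀ n' : N', ∃ (k : ℕ) (n : N), φ f ^ k • n' = g n
  inj : ∀ n : N, g n = 0 → ∃ k : ℕ, f ^ k • n = 0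

variable {C C' : Type*} [CommRing C] [CommRing C'] {φ : C →+* C'} {f : C}

theorem AwayHom.isLocalization (h : AwayHom φ f) :
    @IsLocalization.Away C _ f C' _ φ.toAlgebra := by
  let _ : Algebra C C' := φ.toAlgebra
  refine (isLocalization_iff _ _).2 ⟨?_, ?_, ?_⟩
  · rintro ⟨_, k, rfl⟩
    exact (map_pow φ f k) ▸ h.isUnit.pow k
  · intro z
    obtain ⟨k, c, hc⟩ := h.surj z
    refine ⟨(c, ⟨f ^ k, k, rfl⟩), ?_⟩
    rw [mul_comm]
    change φ (f ^ k) * z = φ c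
    rw [map_pow, hc]
  · intro x y hxy
    obtain ⟨k, hk⟩ := h.inj (x - y) (by rw [map_sub]; exact sub_eq_zero.2 hxy)
    exact ⟨⟨f ^ k, k, rfl⟩, by rw [← sub_eq_zero, ← mul_sub]; exact hk⟩

theorem AwayHom.of_isLocalization [Algebra C C'] [IsLocalization.Away f C'] :
    AwayHom (algebraMap C C') f where
  isUnit := IsLocalization.Away.algebraMap_isUnit f
  surj c' := by
    obtain ⟨⟨c, ⟨_, k, rfl⟩⟩, h⟩ := IsLocalization.surj (Submonoid.powers f) c'
    refine ⟨k, c, ?_⟩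
    rw [mul_comm, ← map_pow]
    exact h
  inj c hc := by
    obtain ⟨⟨_, k, rfl⟩, h⟩ := (IsLocalization.map_eq_zero_iff (Submonoid.powers f) C' c).1 hc
    exact ⟨k, h⟩

theorem pow_smul_cancel {R Q : Type*} [CommRing R] [AddCommGroup Q] [Module R Q] {r : R}
    (hr : IsUnit r) (k : ℕ) {x y : Q} (h : r ^ k • x = r ^ k • y) : x = y :=
  (hr.pow k).smul_left_cancel.1 h

/-- Extension of a semilinear map to a localization. -/
theorem AwayMod.exists_lift {N N' : Type*} [AddCommGroup N] [AddCommGroup N'] [Module C N]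
    [Module C' N'] {g : N →ₛₗ[φ] N'} (hg : AwayMod f g) (hφ : AwayHom φ f)
    {R Q : Type*} [CommRing R] [AddCommGroup Q] [Module R Q] (ρ' : C' →+* R) (t : N →+ Q)
    (ht : ∀ c n, t (c • n) = ρ' (φ c) • t n) :
    ∃ t' : N' →+ Q, (∀ n, t' (g n) = t n) ∧ ∀ c' n', t' (c' • n') = ρ' c' • t' n' := by
  have hu : IsUnit (ρ' (φ f)) := hφ.isUnit.map ρ'
  have ht' : ∀ k n, t (f ^ k • n) = ρ' (φ f) ^ k • t n := fun k n => by
    rw [ht, map_pow, map_pow]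
  have h0 : ∀ n, g n = 0 → t n = 0 := by
    intro n hn
    obtain ⟨k, hk⟩ := hg.inj n hn
    refine pow_smul_cancel hu k ?_
    rw [← ht', hk, map_zero, smul_zero]
  have ex : ∀ n' : N', ∃ q : Q, ∀ k n, φ f ^ k • n' = g n → ρ' (φ f) ^ k • q = t n := by
    intro n'
    obtain ⟨k, n, hn⟩ := hg.surj n'
    refine ⟨((hu.unit⁻¹ ^ k : Rˣ) : R) • t n, fun l m hm => ?_⟩
    refine pow_smul_cancel hu k ?_
    rw [smul_comm, ← mul_smul (ρ' (φ f) ^ k)]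
    have e : ρ' (φ f) ^ k * ((hu.unit⁻¹ ^ k : Rˣ) : R) = 1 := by
      rw [Units.val_pow_eq_pow_val, ← mul_pow, IsUnit.mul_val_inv, one_pow]
    rw [e, one_smul, ← ht', ← ht', ← sub_eq_zero, ← map_sub]
    refine h0 _ ?_
    rw [map_sub, LinearMap.map_smulₛₗ, LinearMap.map_smulₛₗ, ← hn, ← hm, map_pow, map_pow,
      smul_comm, sub_self]
  choose q hq using ex
  have hadd : ∀ x y, q (x + y) = q x + q y := by
    intro x y
    obtain ⟨k, n, hn⟩ := hg.surj x
    obtain ⟨l, m, hm⟩ := hg.surj y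
    refine pow_smul_cancel hu (k + l) ?_
    have h1 : φ f ^ (k + l) • (x + y) = g (f ^ l • n + f ^ k • m) := by
      rw [map_add, LinearMap.map_smulₛₗ, LinearMap.map_smulₛₗ, ← hn, ← hm, map_pow, map_pow,
        smul_add, ← mul_smul, ← mul_smul, ← pow_add, ← pow_add, add_comm l k]
    rw [hq _ _ _ h1, map_add, ht', ht', ← hq _ _ _ hn, ← hq _ _ _ hm, smul_add, ← mul_smul,
      ← mul_smul, ← pow_add, ← pow_add, add_comm l k]
  refine ⟨AddMonoidHom.mk' q hadd, fun n => ?_, fun c' n' => ?_⟩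
  · have := hq (g n) 0 n (by rw [pow_zero, one_smul])
    rwa [pow_zero, one_smul] at this
  · change q _ = ρ' c' • q _
    obtain ⟨k, n, hn⟩ := hg.surj n'
    obtain ⟨l, c, hc⟩ := hφ.surj c'
    refine pow_smul_cancel hu (l + k) ?_
    have h1 : φ f ^ (l + k) • c' • n' = g (c • n) := by
      rw [LinearMap.map_smulₛₗ, ← hn, ← hc, pow_add, mul_smul, mul_smul, smul_comm c']
    rw [hq _ _ _ h1, ht, ← hq _ _ _ hn, ← hc, map_mul, map_pow, pow_add, mul_smul, mul_smul,
      smul_comm (ρ' c')]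

end Away

/-! ## Forms and principal parts on a basic open set -/

section Forms

/-- The exterior algebra of a finitely generated module is finitely generated. -/
instance finite_exteriorAlgebra (R M : Type*) [CommRing R] [AddCommGroup M] [Module R M]
    [Module.Finite R M] : Module.Finite R (ExteriorAlgebra R M) := by
  obtain ⟨n, w, hw⟩ := Submodule.fg_iff_exists_fin_generating_family.1
    (Module.Finite.fg_top (R := R) (M := M))
  let e : ℕ → ExteriorAlgebra R M := fun k =>
    if h : k < n then ExteriorAlgebra.ι R (w ⟨k, h⟩) else 0
  have he : ∀ j k, e j * e k = -(e k * e j) := by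
    intro j k
    simp only [e]
    split_ifs
    · have h := ExteriorAlgebra.ι_add_mul_swap (R := R) (w ⟨j, ‹_›⟩) (w ⟨k, ‹_›⟩)
      exact eq_neg_of_add_eq_zero_left h
    all_goals simp
  have he0 : ∀ j, e j * e j = 0 := by
    intro j
    simp only [e]
    split_ifs
    · exact ExteriorAlgebra.ι_sq_zero _
    · simp
  let T : ℕ → Submodule R (ExteriorAlgebra R M) := fun k => Nat.rec (Submodule.span R {1})
    (fun k S => S ⊔ S.map (LinearMap.mulLeft R (e k))) k
  have hT : ∀ k, T (k + 1) = T k ⊔ (T k).map (LinearMap.mulLeft R (e k)) := fun k => rfl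
  have hfg : ∀ k, (T k).FG := by
    intro k
    induction k with
    | zero => exact Submodule.fg_span_singleton 1
    | succ k ih => rw [hT]; exact ih.sup (ih.map _)
  have h1 : ∀ k, (1 : ExteriorAlgebra R M) ∈ T k := by
    intro k
    induction k with
    | zero => exact Submodule.subset_span rfl
    | succ k ih => rw [hT]; exact Submodule.mem_sup_left ih
  have hmul : ∀ k, ∀ j < k, ∀ x ∈ T k, e j * x ∈ T k := by
    intro k
    induction k with
    | zero => intro j hj; exact absurd hj (Nat.not_lt_zero j)
    | succ k ih =>
      intro j hj x hx
      rw [hT] at hx ⊢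
      obtain ⟨y, hy, _, ⟨z, hz, rfl⟩, rfl⟩ := Submodule.mem_sup.1 hx
      rw [mul_add, LinearMap.mulLeft_apply]
      rcases Nat.lt_succ_iff_lt_or_eq.1 hj with hj | rfl
      · refine Submodule.add_mem _ (Submodule.mem_sup_left (ih j hj y hy)) ?_
        rw [← mul_assoc, he, neg_mul, mul_assoc]
        exact Submodule.neg_mem _ (Submodule.mem_sup_right ⟨_, ih j hj z hz, rfl⟩)
      · refine Submodule.add_mem _ (Submodule.mem_sup_right ⟨y, hy, rfl⟩) ?_
        rw [← mul_assoc, he0, zero_mul]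
        exact Submodule.zero_mem _
  have hι : ∀ m : M, ∀ x ∈ T n, ExteriorAlgebra.ι R m * x ∈ T n := by
    intro m x hx
    have hm : m ∈ Submodule.span R (Set.range w) := hw ▸ trivial
    induction hm using Submodule.span_induction with
    | mem y hy =>
      obtain ⟨i, rfl⟩ := hy
      have := hmul n i i.2 x hx
      simpa only [e, i.2, dif_pos] using this
    | zero => rw [map_zero, zero_mul]; exact Submodule.zero_mem _
    | add y z _ _ hy hz => rw [map_add, add_mul]; exact Submodule.add_mem _ hy hz
    | smul r y _ hy => rw [map_smul, smul_mul_assoc]; exact Submodule.smul_mem _ _ hy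
  have hall : ∀ a x : ExteriorAlgebra R M, x ∈ T n → a * x ∈ T n := by
    intro a
    induction a using ExteriorAlgebra.induction with
    | algebraMap r => intro x hx; rw [← Algebra.smul_def]; exact Submodule.smul_mem _ _ hx
    | ι m => exact hι m
    | mul a b ha hb => intro x hx; rw [mul_assoc]; exact ha _ (hb _ hx)
    | add a b ha hb => intro x hx; rw [add_mul]; exact Submodule.add_mem _ (ha _ hx) (hb _ hx)
  have h : T n = ⊤ := eq_top_iff.2 fun a _ => by simpa using hall a 1 (h1 n)
  exact ⟨h ▸ hfg n⟩

variable {K : Type*} [Field K] {C : Type*} [CommRing C] [Algebra K C]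
  {C' : Type*} [CommRing C'] [Algebra K C'] {φ : C →ₐ[K] C'} {f : C}

/-- Pullback of forms as a semilinear map. -/
def DR.mapₛ (φ : C →ₐ[K] C') : DR K C →ₛₗ[(φ : C →+* C')] DR K C' where
  toFun := DR.map φ
  map_add' := map_add _
  map_smul' := DR.map_smul' φ

theorem DR.map_inj_of_away (h : AwayHom (φ : C →+* C') f) (x : DR K C) (hx : DR.map φ x = 0) :
    ∃ k : ℕ, f ^ k • x = 0 := by
  let _ : Algebra C C' := (φ : C →+* C').toAlgebra
  have : IsScalarTower K C C' := IsScalarTower.of_algebraMap_eq fun k => (φ.commutes k).symm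
  have hl : IsLocalization.Away f C' := h.isLocalization
  have hΩ : IsLocalizedModule (Submonoid.powers f) (KaehlerDifferential.map K K C C') :=
    KaehlerDifferential.isLocalizedModule_map (R := K) (S := C) (T := C') (Submonoid.powers f)
  have hbc : IsBaseChange C' (KaehlerDifferential.map K K C C') :=
    IsLocalizedModule.isBaseChange (Submonoid.powers f) C' _
  let j : C' ⊗[C] Ω[C⁄K] →ₗ[C'] C' ⊗[C] DR K C :=
    AlgebraTensorModule.lTensor C' C' (ExteriorAlgebra.ι C)
  have hj : ∀ z y, j z * j y + j y * j z = 0 := by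
    intro z y
    induction z using TensorProduct.induction_on with
    | zero => simp
    | add z z' hz hz' => rw [map_add, add_mul, mul_add, add_add_add_comm, hz, hz', add_zero]
    | tmul c w =>
      induction y using TensorProduct.induction_on with
      | zero => simp
      | add y y' hy hy' => rw [map_add, mul_add, add_mul, add_add_add_comm, hy, hy', add_zero]
      | tmul c' w' =>
        change (c ⊗ₜ ExteriorAlgebra.ι C w) * (c' ⊗ₜ ExteriorAlgebra.ι C w') +
          (c' ⊗ₜ ExteriorAlgebra.ι C w') * (c ⊗ₜ ExteriorAlgebra.ι C w) = (0 : C' ⊗[C] DR K C)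
        rw [Algebra.TensorProduct.tmul_mul_tmul, Algebra.TensorProduct.tmul_mul_tmul, mul_comm c',
          ← TensorProduct.tmul_add, ExteriorAlgebra.ι_add_mul_swap, TensorProduct.tmul_zero]
  have hj2 : ∀ z, j z * j z = 0 := by
    intro z
    induction z using TensorProduct.induction_on with
    | zero => simp
    | tmul c w =>
      change (c ⊗ₜ ExteriorAlgebra.ι C w) * (c ⊗ₜ ExteriorAlgebra.ι C w) = (0 : C' ⊗[C] DR K C)
      rw [Algebra.TensorProduct.tmul_mul_tmul, ExteriorAlgebra.ι_sq_zero, TensorProduct.tmul_zero]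
    | add z y hz hy =>
      rw [map_add, add_mul, mul_add, mul_add, hz, hy, zero_add, add_zero, hj]
  let θ : DR K C' →ₐ[C'] C' ⊗[C] DR K C := ExteriorAlgebra.lift C'
    ⟨j ∘ₗ hbc.equiv.symm.toLinearMap, fun w => hj2 _⟩
  have hθι : ∀ w, θ (ExteriorAlgebra.ι C' w) = j (hbc.equiv.symm w) := fun w =>
    ExteriorAlgebra.lift_ι_apply C' _ _ w
  have hθ : ∀ y, θ (DR.map φ y) = 1 ⊗ₜ y := by
    intro y
    induction y using DR.induction' with
    | h0 r =>
      rw [DR.map_algebraMap, AlgHom.commutes, Algebra.TensorProduct.algebraMap_apply,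
        Algebra.algebraMap_eq_smul_one r, ← TensorProduct.smul_tmul, Algebra.smul_def, mul_one]
      rfl
    | h1 r =>
      rw [DR.map_ofD, hθι]
      have : hbc.equiv.symm (KaehlerDifferential.D K C' (φ r)) =
          1 ⊗ₜ KaehlerDifferential.D K C r := by
        rw [LinearEquiv.symm_apply_eq, IsBaseChange.equiv_tmul, one_smul,
          KaehlerDifferential.map_D]
        rfl
      rw [this]
      rfl
    | hm a b ha hb =>
      rw [map_mul, map_mul, ha, hb, Algebra.TensorProduct.tmul_mul_tmul, one_mul]
    | ha a b ha hb => rw [map_add, map_add, ha, hb, TensorProduct.tmul_add]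
  have h1 : (TensorProduct.mk C C' (DR K C) 1) x = 0 := by
    rw [TensorProduct.mk_apply, ← hθ, hx, map_zero]
  have hloc : IsLocalizedModule (Submonoid.powers f) (TensorProduct.mk C C' (DR K C) 1) :=
    (isLocalizedModule_iff_isBaseChange (Submonoid.powers f) C' _).2
      (TensorProduct.isBaseChange C (DR K C) C')
  obtain ⟨⟨_, k, rfl⟩, hk⟩ := (IsLocalizedModule.eq_zero_iff (Submonoid.powers f) _).1 h1
  exact ⟨k, hk⟩

theorem DR.mapₛ_away (h : AwayHom (φ : C →+* C') f) : AwayMod f (DR.mapₛ φ) where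
  inj x hx := DR.map_inj_of_away h x hx
  surj x' := by
    change ∃ (k : ℕ) (x : DR K C), φ f ^ k • x' = DR.map φ x
    induction x' using DR.induction' with
    | h0 r =>
      obtain ⟨k, c, hc⟩ := h.surj r
      refine ⟨k, algebraMap C _ c, ?_⟩
      rw [DR.map_algebraMap, Algebra.smul_def, ← map_mul]
      exact congrArg _ hc
    | h1 r =>
      obtain ⟨k, c, hc⟩ := h.surj r
      refine ⟨k + k, f ^ k • DR.ofD K c - c • DR.ofD K (f ^ k), ?_⟩
      have h1 : DR.ofD K (φ c) = φ f ^ k • DR.ofD K r + r • DR.ofD K (φ f ^ k) := by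
        rw [← show φ f ^ k * r = φ c from hc, DR.ofD, Derivation.leibniz, map_add, map_smul,
          map_smul]
      rw [map_sub, DR.map_smul', DR.map_smul', DR.map_ofD, DR.map_ofD, h1,
        ← show φ f ^ k * r = φ c from hc, map_pow, smul_add, ← mul_smul, ← mul_smul, pow_add,
        add_sub_cancel_right]
    | hm a b ha hb =>
      obtain ⟨k, x, hx⟩ := ha
      obtain ⟨l, y, hy⟩ := hb
      refine ⟨k + l, x * y, ?_⟩
      rw [map_mul, ← hx, ← hy, smul_mul_smul_comm, pow_add]
    | ha a b ha hb =>
      obtain ⟨k, x, hx⟩ := ha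
      obtain ⟨l, y, hy⟩ := hb
      refine ⟨k + l, f ^ l • x + f ^ k • y, ?_⟩
      rw [map_add, DR.map_smul', DR.map_smul', ← hx, ← hy, smul_add, ← mul_smul, ← mul_smul,
        map_pow, map_pow, ← pow_add, ← pow_add, add_comm l k]

theorem PP.ideal_eq_map (h : AwayHom (φ : C →+* C') f) :
    KaehlerDifferential.ideal K C' = (KaehlerDifferential.ideal K C).map (PP.sq φ) := by
  refine le_antisymm ?_ (PP.sq_map_le φ)
  rw [← KaehlerDifferential.span_range_eq_ideal K C', Ideal.span_le]
  rintro _ ⟨c', rfl⟩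
  obtain ⟨k, c, hc⟩ := h.surj c'
  have hc : φ f ^ k * c' = φ c := hc
  have hu : IsUnit ((φ f ^ k) ⊗ₜ[K] (φ f ^ k) : C' ⊗[K] C') := by
    obtain ⟨u, hu⟩ := h.isUnit.pow k
    have hu : (u : C') = φ f ^ k := hu
    refine IsUnit.of_mul_eq_one ((↑u⁻¹ : C') ⊗ₜ (↑u⁻¹ : C')) ?_
    rw [Algebra.TensorProduct.tmul_mul_tmul, ← hu, Units.mul_inv, Algebra.TensorProduct.one_def]
  rw [SetLike.mem_coe, ← Ideal.unit_mul_mem_iff_mem _ hu]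
  have e : ((φ f ^ k) ⊗ₜ[K] (φ f ^ k) : C' ⊗[K] C') * (1 ⊗ₜ c' - c' ⊗ₜ 1) =
      PP.sq φ ((f ^ k) ⊗ₜ 1 * (1 ⊗ₜ c - c ⊗ₜ 1) -
        c ⊗ₜ 1 * (1 ⊗ₜ (f ^ k) - (f ^ k) ⊗ₜ 1)) := by
    simp only [mul_sub, Algebra.TensorProduct.tmul_mul_tmul, map_sub,
      Algebra.TensorProduct.map_tmul, mul_one, one_mul, hc, map_pow, map_mul, map_one]
    rw [mul_comm (φ c) (φ f ^ k)]
    abel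
  rw [e]
  refine Ideal.mem_map_of_mem _ (Ideal.sub_mem _ (Ideal.mul_mem_left _ _ ?_)
    (Ideal.mul_mem_left _ _ ?_)) <;>
  exact KaehlerDifferential.one_smul_sub_smul_one_mem_ideal K _

theorem exists_pow_of_rTensor_eq_zero (h : AwayHom (φ : C →+* C') f) {D : Type*} [CommRing D]
    [Algebra K D] (x : C ⊗[K] D) (hx : LinearMap.rTensor D φ.toLinearMap x = 0) :
    ∃ k : ℕ, (f ^ k) ⊗ₜ 1 * x = 0 := by
  have h1 : x ∈ LinearMap.range (LinearMap.rTensor D (LinearMap.ker φ.toLinearMap).subtype) := by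
    exact (Module.Flat.rTensor_exact D (LinearMap.exact_subtype_ker_map φ.toLinearMap) x).1 hx
  obtain ⟨z, rfl⟩ := h1
  induction z using TensorProduct.induction_on with
  | zero => exact ⟨0, by simp⟩
  | tmul c d =>
    obtain ⟨k, hk⟩ := h.inj c c.2
    refine ⟨k, ?_⟩
    rw [LinearMap.rTensor_tmul, Algebra.TensorProduct.tmul_mul_tmul]
    exact (congrArg (fun y => y ⊗ₜ[K] (1 * d)) hk).trans (TensorProduct.zero_tmul _ _)
  | add y z hy hz =>
    have h0 : ∀ y, LinearMap.rTensor D φ.toLinearMap (LinearMap.rTensor D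
        (LinearMap.ker φ.toLinearMap).subtype y) = 0 := by
      intro y
      rw [← LinearMap.comp_apply, ← LinearMap.rTensor_comp, LinearMap.comp_ker_subtype,
        LinearMap.rTensor_zero, LinearMap.zero_apply]
    obtain ⟨k, hk⟩ := hy (h0 y)
    obtain ⟨l, hl⟩ := hz (h0 z)
    refine ⟨k + l, ?_⟩
    have e : ((f ^ (k + l)) ⊗ₜ 1 : C ⊗[K] D) = (f ^ k) ⊗ₜ 1 * (f ^ l) ⊗ₜ 1 := by
      rw [Algebra.TensorProduct.tmul_mul_tmul, pow_add, mul_one]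
    rw [map_add, mul_add, e, mul_assoc, mul_assoc, hl, mul_zero, add_zero, mul_left_comm, hk,
      mul_zero]

theorem AwayHom.sq (h : AwayHom (φ : C →+* C') f) :
    AwayHom (PP.sq φ : C ⊗[K] C →+* C' ⊗[K] C') (f ⊗ₜ[K] f) where
  isUnit := by
    obtain ⟨u, hu⟩ := h.isUnit
    have hu : (u : C') = φ f := hu
    refine IsUnit.of_mul_eq_one ((↑u⁻¹ : C') ⊗ₜ (↑u⁻¹ : C')) ?_
    change PP.sq φ (f ⊗ₜ f) * _ = 1
    rw [Algebra.TensorProduct.map_tmul, Algebra.TensorProduct.tmul_mul_tmul, ← hu, Units.mul_inv,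
      Algebra.TensorProduct.one_def]
  surj x' := by
    change ∃ (k : ℕ) (c : C ⊗[K] C), PP.sq φ (f ⊗ₜ f) ^ k * x' = PP.sq φ c
    induction x' using TensorProduct.induction_on with
    | zero => exact ⟨0, 0, by rw [mul_zero, map_zero]⟩
    | tmul c' d' =>
      obtain ⟨k, c, hc⟩ := h.surj c'
      obtain ⟨l, d, hd⟩ := h.surj d'
      have hc : φ f ^ k * c' = φ c := hc
      have hd : φ f ^ l * d' = φ d := hd
      refine ⟨k + l, (f ^ l * c) ⊗ₜ (f ^ k * d), ?_⟩
      rw [Algebra.TensorProduct.map_tmul, Algebra.TensorProduct.map_tmul,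
        Algebra.TensorProduct.tmul_pow, Algebra.TensorProduct.tmul_mul_tmul]
      change (φ f ^ (k + l) * c') ⊗ₜ (φ f ^ (k + l) * d') = φ (f ^ l * c) ⊗ₜ φ (f ^ k * d)
      rw [map_mul, map_mul, ← hc, ← hd, map_pow, map_pow, ← mul_assoc, ← mul_assoc, ← pow_add,
        ← pow_add, add_comm l k]
    | add x y hx hy =>
      obtain ⟨k, a, ha⟩ := hx
      obtain ⟨l, b, hb⟩ := hy
      refine ⟨k + l, (f ⊗ₜ f) ^ l * a + (f ⊗ₜ f) ^ k * b, ?_⟩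
      rw [map_add, map_mul, map_mul, ← ha, ← hb, map_pow, map_pow, mul_add, ← mul_assoc,
        ← mul_assoc, ← pow_add, ← pow_add, add_comm l k]
  inj x hx := by
    have hx : PP.sq φ x = 0 := hx
    let y : C' ⊗[K] C := LinearMap.rTensor C φ.toLinearMap x
    have h1 : LinearMap.rTensor C' φ.toLinearMap (TensorProduct.comm K C' C y) = 0 := by
      have e : LinearMap.rTensor C' φ.toLinearMap (TensorProduct.comm K C' C y) =
          TensorProduct.comm K C' C' (PP.sq φ x) := by
        simp only [y]
        induction x using TensorProduct.induction_on with
        | zero => simp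
        | tmul c d => rfl
        | add a b ha hb =>
          simp only [map_add] at *
          have : ∀ x : C ⊗[K] C, LinearMap.rTensor C' φ.toLinearMap (TensorProduct.comm K C' C
              (LinearMap.rTensor C φ.toLinearMap x)) = TensorProduct.comm K C' C' (PP.sq φ x) := by
            intro x
            induction x using TensorProduct.induction_on with
            | zero => simp
            | tmul c d => rfl
            | add a b ha hb => simp only [map_add, ha, hb]
          rw [this, this]
      rw [e, hx, map_zero]
    obtain ⟨k, hk⟩ := exists_pow_of_rTensor_eq_zero h _ h1
    have h2 : LinearMap.rTensor C φ.toLinearMap (1 ⊗ₜ (f ^ k) * x) = 0 := by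
      have e : ∀ x : C ⊗[K] C, TensorProduct.comm K C' C
          (LinearMap.rTensor C φ.toLinearMap (1 ⊗ₜ (f ^ k) * x)) =
          (f ^ k) ⊗ₜ 1 * TensorProduct.comm K C' C (LinearMap.rTensor C φ.toLinearMap x) := by
        intro x
        induction x using TensorProduct.induction_on with
        | zero => simp
        | tmul c d =>
          rw [Algebra.TensorProduct.tmul_mul_tmul, LinearMap.rTensor_tmul,
            LinearMap.rTensor_tmul, TensorProduct.comm_tmul, TensorProduct.comm_tmul,
            Algebra.TensorProduct.tmul_mul_tmul, one_mul, one_mul]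
        | add a b ha hb => simp only [map_add, mul_add, ha, hb]
      exact (TensorProduct.comm K C' C).injective (by rw [e, hk, map_zero])
    obtain ⟨l, hl⟩ := exists_pow_of_rTensor_eq_zero h _ h2
    refine ⟨k + l, ?_⟩
    have e : ((f ⊗ₜ[K] f) ^ (k + l) : C ⊗[K] C) =
        (f ^ k) ⊗ₜ (f ^ l) * ((f ^ l) ⊗ₜ 1 * 1 ⊗ₜ (f ^ k)) := by
      rw [Algebra.TensorProduct.tmul_pow, Algebra.TensorProduct.tmul_mul_tmul,
        Algebra.TensorProduct.tmul_mul_tmul, mul_one, one_mul, pow_add, ← pow_add f l k,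
        ← pow_add, add_comm l k]
    rw [e, mul_assoc, mul_assoc, hl, mul_zero]

theorem AwayHom.exists_mem_of_mem_map {R R' : Type*} [CommRing R] [CommRing R'] {ψ : R →+* R'}
    {s : R} (h : AwayHom ψ s) (I : Ideal R) (x' : R') (hx : x' ∈ I.map ψ) :
    ∃ (k : ℕ) (y : R), y ∈ I ∧ ψ s ^ k * x' = ψ y := by
  rw [Ideal.map] at hx
  induction hx using Submodule.span_induction with
  | mem x hx =>
    obtain ⟨y, hy, rfl⟩ := hx
    exact ⟨0, y, hy, by rw [pow_zero, one_mul]⟩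
  | zero => exact ⟨0, 0, I.zero_mem, by rw [mul_zero, map_zero]⟩
  | add x y _ _ hx hy =>
    obtain ⟨k, a, ha, ha'⟩ := hx
    obtain ⟨l, b, hb, hb'⟩ := hy
    refine ⟨k + l, s ^ l * a + s ^ k * b,
      I.add_mem (I.mul_mem_left _ ha) (I.mul_mem_left _ hb), ?_⟩
    rw [map_add, map_mul, map_mul, ← ha', ← hb', map_pow, map_pow, mul_add, ← mul_assoc,
      ← mul_assoc, ← pow_add, ← pow_add, add_comm l k]
  | smul r x _ hx =>
    obtain ⟨k, a, ha, ha'⟩ := hx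
    obtain ⟨l, b, hb⟩ := h.surj r
    refine ⟨l + k, b * a, I.mul_mem_left _ ha, ?_⟩
    rw [map_mul, ← ha', ← hb, smul_eq_mul, pow_add, mul_mul_mul_comm]

theorem AwayHom.exists_pow_mul_mem {R R' : Type*} [CommRing R] [CommRing R'] {ψ : R →+* R'}
    {s : R} (h : AwayHom ψ s) (I : Ideal R) (x : R) (hx : ψ x ∈ I.map ψ) :
    ∃ k : ℕ, s ^ k * x ∈ I := by
  obtain ⟨k, y, hy, e⟩ := h.exists_mem_of_mem_map I _ hx
  obtain ⟨l, hl⟩ := h.inj (s ^ k * x - y) (by rw [map_sub, map_mul, map_pow, e, sub_self])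
  refine ⟨l + k, ?_⟩
  rw [mul_sub, sub_eq_zero] at hl
  rw [pow_add, mul_assoc, hl]
  exact I.mul_mem_left _ hy

theorem PP.fg_ideal [Algebra.FiniteType K C] : (KaehlerDifferential.ideal K C).FG :=
  (isNoetherianRing_iff_ideal_fg _).1 inferInstance _

instance [Algebra.FiniteType K C] : IsNoetherianRing (PP K C) := isNoetherianRing_adicCompletion _

instance [Algebra.FiniteType K C] : IsAdicComplete (PP.aug K C) (PP K C) :=
  isAdicComplete_map PP.fg_ideal

theorem PP.mem_aug_pow [Algebra.FiniteType K C] (n : ℕ) (b : PP K C) :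
    b ∈ PP.aug K C ^ n ↔ AdicCompletion.evalₐ (KaehlerDifferential.ideal K C) n b = 0 :=
  mem_map_pow_iff PP.fg_ideal n b

theorem PP.eval_of (n : ℕ) (a : C ⊗[K] C) :
    AdicCompletion.evalₐ (KaehlerDifferential.ideal K C) n (PP.of K C a) =
      Ideal.Quotient.mk _ a := rfl

theorem PP.exists_of_sub_mem [Algebra.FiniteType K C] (n : ℕ) (b : PP K C) :
    ∃ a, b - PP.of K C a ∈ PP.aug K C ^ n := by
  obtain ⟨a, ha⟩ := Ideal.Quotient.mk_surjective
    (AdicCompletion.evalₐ (KaehlerDifferential.ideal K C) n b)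
  refine ⟨a, ?_⟩
  rw [PP.mem_aug_pow, map_sub, PP.eval_of, ha, sub_self]

theorem PP.of_mem_aug_pow [Algebra.FiniteType K C] (n : ℕ) (a : C ⊗[K] C) :
    PP.of K C a ∈ PP.aug K C ^ n ↔ a ∈ KaehlerDifferential.ideal K C ^ n := by
  rw [PP.mem_aug_pow, PP.eval_of, Ideal.Quotient.eq_zero_iff_mem]

theorem PP.map_aug_le (φ : C →ₐ[K] C') :
    (PP.aug K C).map (PP.map φ : PP K C →+* PP K C') ≤ PP.aug K C' := by
  rw [PP.aug, Ideal.map_map, Ideal.map_le_iff_le_comap]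
  intro a ha
  have e : (PP.map φ : PP K C →+* PP K C').comp (algebraMap (C ⊗[K] C) (PP K C)) a =
      PP.of K C' (PP.sq φ a) := PP.map_of φ a
  rw [Ideal.mem_comap, e]
  exact Ideal.mem_map_of_mem _ (PP.sq_mem φ ha)

theorem PP.map_aug (h : AwayHom (φ : C →+* C') f) :
    (PP.aug K C).map (PP.map φ : PP K C →+* PP K C') = PP.aug K C' := by
  refine le_antisymm (PP.map_aug_le φ) ?_
  rw [PP.aug, Ideal.map_le_iff_le_comap]
  intro a ha
  rw [PP.ideal_eq_map h] at ha
  rw [Ideal.mem_comap]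
  induction ha using Submodule.span_induction with
  | mem x hx =>
    obtain ⟨y, hy, rfl⟩ := hx
    have e : algebraMap (C' ⊗[K] C') (PP K C') (PP.sq φ y) =
        (PP.map φ : PP K C →+* PP K C') (PP.of K C y) := (PP.map_of φ y).symm
    rw [e]
    exact Ideal.mem_map_of_mem _ (Ideal.mem_map_of_mem _ hy)
  | zero => rw [map_zero]; exact Ideal.zero_mem _
  | add x y _ _ hx hy => rw [map_add]; exact Ideal.add_mem _ hx hy
  | smul r x _ hx => rw [smul_eq_mul, map_mul]; exact Ideal.mul_mem_left _ _ hx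

theorem PP.isFormalLoc [Algebra.FiniteType K C] [Algebra.FiniteType K C']
    (h : AwayHom (φ : C →+* C') f) :
    IsFormalLoc (PP.map φ : PP K C →+* PP K C') (PP.aug K C) (PP.of K C (f ⊗ₜ f)) where
  isUnit := by
    change IsUnit (PP.map φ (PP.of K C (f ⊗ₜ f)))
    rw [PP.map_of]
    exact h.sq.isUnit.map (PP.of K C')
  approx b' n := by
    obtain ⟨a', ha'⟩ := PP.exists_of_sub_mem n b'
    obtain ⟨k, a, ha⟩ := h.sq.surj a'
    have ha : PP.sq φ (f ⊗ₜ f) ^ k * a' = PP.sq φ a := ha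
    refine ⟨k, PP.of K C a, ?_⟩
    rw [PP.map_aug h]
    have e : (PP.map φ : PP K C →+* PP K C') (PP.of K C (f ⊗ₜ f)) ^ k * b' -
        (PP.map φ : PP K C →+* PP K C') (PP.of K C a) =
        PP.of K C' (PP.sq φ (f ⊗ₜ f)) ^ k * (b' - PP.of K C' a') := by
      change PP.map φ (PP.of K C (f ⊗ₜ f)) ^ k * b' - PP.map φ (PP.of K C a) = _
      rw [PP.map_of, PP.map_of, ← ha, map_mul, map_pow, mul_sub]
    rw [e]
    exact Ideal.mul_mem_left _ _ ha'
  inj b n hb := by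
    rw [PP.map_aug h] at hb
    obtain ⟨a, ha⟩ := PP.exists_of_sub_mem n b
    have h1 : PP.of K C' (PP.sq φ a) ∈ PP.aug K C' ^ n := by
      have h2 : PP.map φ (b - PP.of K C a) ∈ PP.aug K C' ^ n := by
        refine Ideal.pow_right_mono (PP.map_aug_le φ) n ?_
        rw [← Ideal.map_pow]
        exact Ideal.mem_map_of_mem _ ha
      rw [map_sub, PP.map_of] at h2
      exact (Submodule.sub_mem_iff_right _ hb).1 h2
    rw [PP.of_mem_aug_pow, PP.ideal_eq_map h, ← Ideal.map_pow] at h1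
    obtain ⟨k, hk⟩ := h.sq.exists_pow_mul_mem _ _ h1
    refine ⟨k, ?_⟩
    rw [← PP.of_mem_aug_pow, map_mul, map_pow] at hk
    have := Ideal.add_mem _ (Ideal.mul_mem_left _ (PP.of K C (f ⊗ₜ f) ^ k) ha) hk
    rwa [← mul_add, sub_add_cancel] at this

end Forms

/-! ## Sections of `Ω ⊗ P ⊗ M` on a basic open set -/

section Coefficients

variable {K : Type*} [Field K] {C : Type*} [CommRing C] [Algebra K C]
  {N : Type*} [AddCommGroup N] [Module C N]

namespace NN

theorem tmul_tmul_p₁ (c : C) (w : DR K C) (n : N) :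
    (tmul (OmegaP.tmul 1 (c • w)) n : NN K C N) =
      PP.p₁ K C c • tmul (OmegaP.tmul 1 w) n := by
  rw [OmegaP.tmul_smul, mul_one]
  change _ = tmul (PP.p₁ K C c • OmegaP.tmul 1 w) n
  rw [OmegaP.smul_tmul, mul_one]

theorem smul_tmulP (b : PP K C) (a : OmegaP K C) (n : N) : b • tmul a n = tmul (b • a) n := rfl

theorem tmul_p₂ (c : C) (a : OmegaP K C) (n : N) :
    (tmul a (c • n) : NN K C N) = PP.p₂ K C c • tmul a n := by
  rw [smul_tmulP, ← OmegaP.smul_def]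
  exact (TensorProduct.smul_tmul c a n).symm

theorem tmul_add (a : OmegaP K C) (n n' : N) :
    (tmul a (n + n') : NN K C N) = tmul a n + tmul a n' := TensorProduct.tmul_add _ _ _

theorem add_tmul (a a' : OmegaP K C) (n : N) :
    (tmul (a + a') n : NN K C N) = tmul a n + tmul a' n := TensorProduct.add_tmul _ _ _

theorem induction' {P : NN K C N → Prop} (h0 : P 0)
    (ht : ∀ (b : PP K C) w n, P (b • tmul (OmegaP.tmul 1 w) n))
    (ha : ∀ x y, P x → P y → P (x + y)) (x : NN K C N) : P x := by
  induction x using NN.induction with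
  | h0 => exact h0
  | ht a n =>
    induction a using OmegaP.induction with
    | h0 =>
      have : (tmul 0 n : NN K C N) = 0 := TensorProduct.zero_tmul _ _
      rw [this]; exact h0
    | ht b w =>
      have := ht b w n
      rwa [smul_tmulP, OmegaP.smul_tmul, mul_one] at this
    | ha x y hx hy => rw [add_tmul]; exact ha _ _ hx hy
  | ha x y hx hy => exact ha _ _ hx hy

/-- The `P`-linear maps out of `Ω ⊗ P ⊗ N`. -/
theorem exists_lift {Q : Type*} [AddCommGroup Q] [Module (PP K C) Q] (τ : DR K C →+ N →+ Q)
    (h1 : ∀ c w n, τ (c • w) n = PP.p₁ K C c • τ w n)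
    (h2 : ∀ c w n, τ w (c • n) = PP.p₂ K C c • τ w n) :
    ∃ T : NN K C N →ₗ[PP K C] Q, ∀ w n, T (tmul (OmegaP.tmul 1 w) n) = τ w n := by
  let S : N → OmegaP K C →+ Q := fun n =>
    TensorProduct.liftAddHom (R := C) (M := PP K C) (N := DR K C)
      (AddMonoidHom.mk' (fun b => AddMonoidHom.mk' (fun w => b • τ w n)
        (fun w w' => by rw [map_add, AddMonoidHom.add_apply, smul_add]))
        (fun b b' => by
          ext w
          change (b + b') • τ w n = b • τ w n + b' • τ w n
          exact add_smul _ _ _))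
      (fun c b w => by
        change (c • b) • τ w n = b • τ (c • w) n
        rw [h1, Algebra.smul_def, mul_comm, mul_smul]
        rfl)
  have hS : ∀ n b w, S n (OmegaP.tmul b w) = b • τ w n := fun _ _ _ => rfl
  let T₁ : N →+ OmegaP K C →+ Q := AddMonoidHom.mk' S (fun n n' => by
    clear_value S
    ext x
    rw [AddMonoidHom.add_apply]
    induction x using OmegaP.induction with
    | h0 => simp only [map_zero, add_zero]
    | ht b w => rw [hS, hS, hS, map_add, smul_add]
    | ha x y hx hy => rw [map_add, map_add, map_add, hx, hy, add_add_add_comm])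
  have hT₁ : ∀ n b w, T₁ n (OmegaP.tmul b w) = b • τ w n := fun _ _ _ => rfl
  have hb : ∀ n (b : PP K C) a, T₁ n (b • a) = b • T₁ n a := by
    intro n b a
    induction a using OmegaP.induction with
    | h0 => simp
    | ht b' w => rw [OmegaP.smul_tmul, hT₁, hT₁, mul_smul]
    | ha x y hx hy => rw [smul_add, map_add, hx, hy, map_add, smul_add]
  let T₂ : NN K C N →+ Q := TensorProduct.liftAddHom (R := C) (M := OmegaP K C) (N := N)
    T₁.flip (fun c a n => by
      change T₁ n (c • a) = T₁ (c • n) a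
      rw [OmegaP.smul_def, hb]
      induction a using OmegaP.induction with
      | h0 => simp
      | ht b w => rw [hT₁, hT₁, h2, smul_comm]
      | ha x y hx hy => rw [map_add, smul_add, hx, hy, map_add])
  have hT₂ : ∀ a n, T₂ (tmul a n) = T₁ n a := fun _ _ => rfl
  refine ⟨{ toFun := T₂, map_add' := map_add _, map_smul' := fun b x => ?_ }, fun w n => ?_⟩
  · rw [RingHom.id_apply]
    induction x using NN.induction with
    | h0 => simp
    | ht a n => rw [smul_tmulP, hT₂, hT₂, hb]
    | ha x y hx hy => rw [smul_add, map_add, hx, hy, map_add, smul_add]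
  · change T₂ (tmul (OmegaP.tmul 1 w) n) = _
    rw [hT₂, hT₁, one_smul]

variable {C' : Type*} [CommRing C'] [Algebra K C'] {N' : Type*} [AddCommGroup N'] [Module C' N']

theorem map_smulP (φ : C →ₐ[K] C') (g : N →ₛₗ[(φ : C →+* C')] N') (b : PP K C) (x : NN K C N) :
    map φ g (b • x) = PP.map φ b • map φ g x := by
  induction x using NN.induction with
  | h0 => simp
  | ht a n => rw [smul_tmulP, map_tmul, map_tmul, OmegaP.map_smulP, smul_tmulP]
  | ha x y hx hy => rw [smul_add, map_add, hx, hy, map_add, smul_add]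

theorem exists_lift_of_away {φ : C →ₐ[K] C'} {f : C} (hφ : AwayHom (φ : C →+* C') f)
    {g : N →ₛₗ[(φ : C →+* C')] N'} (hg : AwayMod f g) {Q : Type*} [AddCommGroup Q]
    [Module (PP K C') Q] (T : NN K C N →+ Q) (hT : ∀ b x, T (b • x) = PP.map φ b • T x) :
    ∃ T' : NN K C' N' →ₗ[PP K C'] Q, ∀ x, T' (map φ g x) = T x := by
  let r₁ : C' →+* PP K C' := (PP.p₁ K C' : C' →+* PP K C')
  let r₂ : C' →+* PP K C' := (PP.p₂ K C' : C' →+* PP K C')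
  let t : N →+ DR K C →+ Q := AddMonoidHom.mk' (fun n => AddMonoidHom.mk'
    (fun w => T (tmul (OmegaP.tmul 1 w) n))
      (fun w w' => by rw [OmegaP.tmul_add, add_tmul, map_add]))
    (fun n n' => by
      ext w
      change T _ = T _ + T _
      rw [tmul_add, map_add])
  have t_apply : ∀ n w, t n w = T (tmul (OmegaP.tmul 1 w) n) := fun _ _ => rfl
  obtain ⟨t₁, ht₁, ht₁'⟩ := hg.exists_lift hφ r₂ t (fun c n => by
    ext w
    change t (c • n) w = r₂ (φ c) • t n w
    rw [t_apply, t_apply, tmul_p₂, hT, PP.map_p₂]; rfl)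
  have ht₁c : ∀ n' c w, t₁ n' (c • w) = r₁ (φ c) • t₁ n' w := by
    intro n' c w
    obtain ⟨k, n, hn⟩ := hg.surj n'
    refine pow_smul_cancel (hφ.isUnit.map r₂) k ?_
    have e : ∀ w, r₂ (φ f) ^ k • t₁ n' w = t n w := by
      intro w
      rw [← ht₁, ← hn, ht₁', map_pow]; rfl
    change r₂ (φ f) ^ k • _ = r₂ (φ f) ^ k • _
    rw [e, smul_comm, e, t_apply, t_apply, tmul_tmul_p₁, hT, PP.map_p₁]; rfl
  obtain ⟨t₂, ht₂, ht₂'⟩ := (DR.mapₛ_away hφ).exists_lift hφ r₁ t₁.flip (fun c w => by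
    ext n'
    exact ht₁c n' c w)
  have ht₂c : ∀ w' c' n', t₂ w' (c' • n') = r₂ c' • t₂ w' n' := by
    intro w' c' n'
    obtain ⟨k, w, hw⟩ := (DR.mapₛ_away hφ).surj w'
    refine pow_smul_cancel (hφ.isUnit.map r₁) k ?_
    have e : ∀ n', r₁ (φ f) ^ k • t₂ w' n' = t₁ n' w := by
      intro n'
      have := DFunLike.congr_fun (ht₂ w) n'
      rw [← hw, ht₂', map_pow] at this
      exact this
    change r₁ (φ f) ^ k • _ = r₁ (φ f) ^ k • _
    rw [e, smul_comm, e, ht₁']; rfl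
  obtain ⟨T', hT'⟩ := exists_lift t₂ (fun c w n => by rw [ht₂']; rfl) (fun c w n => ht₂c w c n)
  refine ⟨T', fun x => ?_⟩
  induction x using NN.induction' with
  | h0 => simp
  | ht b w n =>
    rw [map_smulP, map_smul, map_tmul, OmegaP.map_tmul, map_one, hT', hT]
    have := DFunLike.congr_fun (ht₂ w) (g n)
    change t₂ (DR.map φ w) (g n) = t₁ (g n) w at this
    rw [this, ht₁]
    rfl
  | ha x y hx hy => rw [map_add, map_add, hx, hy, map_add]

/-- If the restriction of `x` to a basic open set belongs to the restriction of `L`, then a power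
of a function invertible there multiplies `x` into `L`. -/
theorem exists_pow_smul_mem [Algebra.FiniteType K C] [Algebra.FiniteType K C'] {φ : C →ₐ[K] C'}
    {f : C} (hφ : AwayHom (φ : C →+* C') f) {g : N →ₛₗ[(φ : C →+* C')] N'} (hg : AwayMod f g)
    {L : Submodule (PP K C) (NN K C N)} {x : NN K C N} {n : ℕ}
    (hn : ∀ b ∈ PP.aug K C ^ n, b • x ∈ L)
    (hx : map φ g x ∈ Submodule.span (PP K C') (map φ g '' (L : Set (NN K C N)))) :
    ∃ k : ℕ, PP.of K C (f ⊗ₜ f) ^ k • x ∈ L := by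
  let _ : Algebra (PP K C) (PP K C') := (PP.map φ : PP K C →+* PP K C').toAlgebra
  have hl : IsFormalLoc (algebraMap (PP K C) (PP K C')) (PP.aug K C) (PP.of K C (f ⊗ₜ f)) :=
    PP.isFormalLoc hφ
  have : IsAdicComplete ((PP.aug K C).map (algebraMap (PP K C) (PP K C'))) (PP K C') := by
    have := PP.map_aug hφ
    change (PP.aug K C).map (algebraMap (PP K C) (PP K C')) = _ at this
    rw [this]
    infer_instance
  have hf := hl.flat
  obtain ⟨T', hT'⟩ := exists_lift_of_away hφ hg (Q := PP K C' ⊗[PP K C] NN K C N)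
    (AddMonoidHom.mk' (fun x => 1 ⊗ₜ x) (fun x y => TensorProduct.tmul_add _ _ _))
    (fun b x => by
      change 1 ⊗ₜ (b • x) = PP.map φ b • (1 ⊗ₜ x)
      rw [← TensorProduct.smul_tmul, TensorProduct.smul_tmul', smul_eq_mul, mul_one,
        Algebra.smul_def, mul_one]
      rfl)
  have hT'' : ∀ x, T' (map φ g x) = 1 ⊗ₜ x := hT'
  refine hl.exists_pow_smul_mem hn ?_
  rw [← hT'']
  have := Submodule.mem_map_of_mem (f := T') hx
  rw [Submodule.map_span, Set.image_image] at this
  simpa only [hT''] using this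

end NN

end Coefficients

/-! ## Localization of sections of quasi-coherent modules -/

section QuasiCoherent

variable (K : Type u) [Field K] {X : Scheme.{u}} [X.Over (Spec (CommRingCat.of K))]

theorem resA_away {V : X.Opens} (hV : IsAffineOpen V) (f : Γ(X, V)) :
    AwayHom (resA K (X.basicOpen_le f) : Γ(X, V) →+* Γ(X, X.basicOpen f)) f := by
  have := hV.isLocalization_basicOpen f
  exact AwayHom.of_isLocalization (C := Γ(X, V)) (C' := Γ(X, X.basicOpen f)) (f := f)

/-- The restriction of sections of `M` from an affine open set to a basic open subset is the
localization. -/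
def IsLocMod (M : X.Modules) : Prop :=
  ∀ (V : X.affineOpens) (f : Γ(X, V.1)),
    AwayMod f (resM (K := K) M (X.basicOpen_le f))

theorem resA_affineBasicOpen_away (V : X.affineOpens) (f : Γ(X, V.1)) :
    AwayHom (resA K (X.affineBasicOpen_le f) : Γ(X, V.1) →+* Γ(X, (X.affineBasicOpen f).1)) f :=
  resA_away K V.2 f

variable {K} in
theorem IsLocMod.away {M : X.Modules} (hM : IsLocMod K M) (V : X.affineOpens) (f : Γ(X, V.1)) :
    AwayMod f (resM (K := K) M (X.affineBasicOpen_le f)) :=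
  hM V f

theorem isLocMod_unit : IsLocMod K (OX X) := fun V f =>
  { surj := (resA_away K V.2 f).surj
    inj := (resA_away K V.2 f).inj }

theorem fromSpec_appIso_inv {V : X.Opens} (hV : IsAffineOpen V) (U : (Spec Γ(X, V)).Opens)
    (h : hV.fromSpec ''ᵁ U ≤ V) (r : Γ(X, V)) :
    (hV.fromSpec.appIso U).inv ((Spec Γ(X, V)).presheaf.map U.leTop.op
      ((Scheme.ΓSpecIso Γ(X, V)).inv r)) = X.presheaf.map (homOfLE h).op r := by
  have h1 : (Scheme.ΓSpecIso Γ(X, V)).inv ≫ (Spec Γ(X, V)).presheaf.map U.leTop.op ≫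
      (hV.fromSpec.appIso U).inv = X.presheaf.map (homOfLE h).op := by
    rw [← Category.assoc, Iso.comp_inv_eq, Scheme.Hom.appIso_hom', Scheme.Hom.map_appLE,
      Scheme.Hom.appLE, hV.fromSpec_app_self, Category.assoc, ← Functor.map_comp]
    rfl
  rw [← h1]; rfl

theorem isLocMod_of_isQuasicoherent (M : X.Modules)
    (hM : SheafOfModules.IsQuasicoherent (R := X.ringCatSheaf) M) : IsLocMod K M := by
  intro V f
  have hV : IsAffineOpen V.1 := V.2
  have : M.IsQuasicoherent := hM
  let j := hV.fromSpec
  have : IsOpenImmersion j := hV.isOpenImmersion_fromSpec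
  have hl := (isIso_fromTildeΓ_iff_isLocalizing (M.restrict j)).1 inferInstance f
  have hle : ∀ U, j ''ᵁ U ≤ V.1 := fun U => by
    have := Scheme.Hom.image_le_opensRange j U
    rwa [hV.opensRange_fromSpec] at this
  have hsm : ∀ (U : (Spec Γ(X, V.1)).Opens) (r : Γ(X, V.1)) (x : Γ(M, j ''ᵁ U)),
      (r • (show Γ(M.restrict j, U) from x) : Γ(M.restrict j, U)) =
        (show Γ(M.restrict j, U) from X.presheaf.map (homOfLE (hle U)).op r • x) := by
    intro U r x
    rw [← fromSpec_appIso_inv hV U (hle U) r]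
    rfl
  have key : ∀ (U₀ U₁ : X.Opens) (h₀ : U₀ = V.1) (h₁ : U₁ = X.basicOpen f) (h : U₁ ≤ U₀),
      (∀ n' : Γ(M, U₁), ∃ (k : ℕ) (n : Γ(M, U₀)),
        X.presheaf.map (homOfLE (h.trans h₀.le)).op (f ^ k) • n' =
          M.presheaf.map (homOfLE h).op n) →
      (∀ n : Γ(M, U₀), M.presheaf.map (homOfLE h).op n = 0 →
        ∃ k : ℕ, X.presheaf.map (homOfLE h₀.le).op (f ^ k) • n = 0) →
      AwayMod f (resM (K := K) M (X.basicOpen_le f)) := by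
    rintro _ _ rfl rfl h hs hi
    refine ⟨fun n' => ?_, fun n hn => ?_⟩
    · obtain ⟨k, n, e⟩ := hs n'
      refine ⟨k, n, ?_⟩
      rw [← map_pow]
      exact e
    · obtain ⟨k, e⟩ := hi n hn
      refine ⟨k, ?_⟩
      have e' : X.presheaf.map (homOfLE (le_refl V.1)).op (f ^ k) = f ^ k := by
        have : (homOfLE (le_refl V.1)).op = 𝟙 _ := rfl
        rw [this, CategoryTheory.Functor.map_id]; rfl
      rwa [e'] at e
  have h₀ : j ''ᵁ ⊤ = V.1 := by
    rw [Scheme.Hom.image_top_eq_opensRange, hV.opensRange_fromSpec]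
  refine key (j ''ᵁ ⊤) (j ''ᵁ PrimeSpectrum.basicOpen f) h₀ (hV.fromSpec_image_basicOpen f)
    (Scheme.Hom.image_mono j le_top) (fun n' => ?_) (fun n hn => ?_)
  · obtain ⟨⟨n, ⟨_, k, rfl⟩⟩, e⟩ := hl.surj n'
    refine ⟨k, n, ?_⟩
    have := hsm _ (f ^ k) n'
    exact this.symm.trans e
  · obtain ⟨⟨_, k, rfl⟩, e⟩ := hl.exists_of_eq (x₁ := n) (x₂ := 0) (by rw [map_zero]; exact hn)
    refine ⟨k, ?_⟩
    have := hsm ⊤ (f ^ k) n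
    refine this.symm.trans ?_
    exact e.trans (smul_zero _)

end QuasiCoherent

section Functoriality

variable {K : Type*} [Field K] {C : Type*} [CommRing C] [Algebra K C]
  {C' : Type*} [CommRing C'] [Algebra K C'] {C'' : Type*} [CommRing C''] [Algebra K C'']
  (f : C →ₐ[K] C') (f' : C' →ₐ[K] C'')

theorem PP.map_map (b : PP K C) : PP.map f' (PP.map f b) = PP.map (f'.comp f) b := by
  refine AdicCompletion.ext_evalₐ fun n => ?_
  rw [PP.eval_map, PP.eval_map, PP.mapLevel, AlgHom.comp_apply, AlgHom.restrictScalars_apply,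
    PP.eval_map]
  obtain ⟨y, rfl⟩ := AdicCompletion.mk_surjective _ _ b
  rw [PP.mapLevel_mk, PP.mapLevel_mk]
  change Ideal.Quotient.mk _ (PP.sq f' (PP.sq f (y n))) = _
  rw [← AlgHom.comp_apply, ← Algebra.TensorProduct.map_comp]

theorem DR.map_map (w : DR K C) : DR.map f' (DR.map f w) = DR.map (f'.comp f) w := by
  induction w using DR.induction' with
  | h0 r => simp only [DR.map_algebraMap, AlgHom.comp_apply]
  | h1 r => simp only [DR.map_ofD, AlgHom.comp_apply]
  | hm a b ha hb => simp only [map_mul, ha, hb]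
  | ha a b ha hb => simp only [map_add, ha, hb]

theorem NN.map_map {N : Type*} [AddCommGroup N] [Module C N] {N' : Type*} [AddCommGroup N']
    [Module C' N'] {N'' : Type*} [AddCommGroup N''] [Module C'' N'']
    (g : N →ₛₗ[(f : C →+* C')] N') (g' : N' →ₛₗ[(f' : C' →+* C'')] N'')
    (g'' : N →ₛₗ[(f'.comp f : C →+* C'')] N'') (hg : ∀ n, g' (g n) = g'' n) (x : NN K C N) :
    NN.map f' g' (NN.map f g x) = NN.map (f'.comp f) g'' x := by
  induction x using NN.induction' with
  | h0 => simp only [map_zero]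
  | ht b w n =>
    simp only [NN.map_smulP, NN.map_tmul, OmegaP.map_tmul, PP.map_map, DR.map_map, hg, map_one]
  | ha x y hx hy => simp only [map_add, hx, hy]

end Functoriality

/-! ## Coherent submodules: local membership and gluing -/

section Gluing

variable {K : Type u} [Field K] {X : Scheme.{u}} [X.Over (Spec (CommRingCat.of K))]
  {M : X.Modules}

theorem NV.res_smulP {V V' : X.affineOpens} (h : V'.1 ≤ V.1) (b : PP K Γ(X, V.1))
    (x : NV K M V) : NV.res K M h (b • x) = PP.map (resA K h) b • NV.res K M h x :=
  NN.map_smulP _ _ b x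

theorem NV.res_res {V V' V'' : X.affineOpens} (h : V'.1 ≤ V.1) (h' : V''.1 ≤ V'.1)
    (x : NV K M V) : NV.res K M h' (NV.res K M h x) = NV.res K M (h'.trans h) x := by
  have e : (resA K h').comp (resA K h) = resA K (h'.trans h) :=
    AlgHom.ext fun c => resA_resA K h h' c
  have key : ∀ (a : Γ(X, V.1) →ₐ[K] Γ(X, V''.1)) (e : (resA K h').comp (resA K h) = a)
      (g : Γ(M, V.1) →ₛₗ[(a : Γ(X, V.1) →+* Γ(X, V''.1))] Γ(M, V''.1))
      (hg : ∀ n, resM (K := K) M h' (resM (K := K) M h n) = g n),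
      NV.res K M h' (NV.res K M h x) = NN.map a g x := by
    rintro _ rfl g hg
    exact NN.map_map _ _ _ _ g hg x
  exact key _ e _ (resM_resM K M h h')

theorem PP.map_resA_resA {V V' V'' : X.affineOpens} (h : V'.1 ≤ V.1) (h' : V''.1 ≤ V'.1)
    (b : PP K Γ(X, V.1)) :
    PP.map (resA K h') (PP.map (resA K h) b) = PP.map (resA K (h'.trans h)) b := by
  have e : (resA K h').comp (resA K h) = resA K (h'.trans h) :=
    AlgHom.ext fun c => resA_resA K h h' c
  rw [PP.map_map, e]

namespace Coh

variable (F : Coh K M)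

theorem res_mem {V V' : X.affineOpens} (h : V'.1 ≤ V.1) {x : NV K M V} (hx : x ∈ F.L V) :
    NV.res K M h x ∈ F.L V' := by
  rw [F.res_eq V V' h]
  exact Submodule.subset_span ⟨x, hx, rfl⟩

theorem res_pow_mem {V V' : X.affineOpens} (h : V'.1 ≤ V.1) {n : ℕ} {x : NV K M V}
    (hx : x ∈ F.pow V n) : NV.res K M h x ∈ F.pow V' n := by
  rw [pow] at hx
  induction hx using Submodule.smul_induction_on' with
  | smul a ha y hy =>
    rw [NV.res_smulP]
    refine Submodule.smul_mem_smul ?_ (F.res_mem h hy)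
    refine Ideal.pow_right_mono (PP.map_aug_le (resA K h)) n ?_
    rw [← Ideal.map_pow]
    exact Ideal.mem_map_of_mem _ ha
  | add x _ y _ hx hy => rw [map_add]; exact Submodule.add_mem _ hx hy

theorem pow_affineBasicOpen {V : X.affineOpens} (f : Γ(X, V.1)) (n : ℕ) :
    F.pow (X.affineBasicOpen f) n = Submodule.span (PP K Γ(X, (X.affineBasicOpen f).1))
      (NV.res K M (X.affineBasicOpen_le f) '' (F.pow V n : Set (NV K M V))) := by
  refine le_antisymm ?_ (Submodule.span_le.2 ?_)
  · have h := PP.map_aug (resA_affineBasicOpen_away K V f)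
    have h' : PP.aug K Γ(X, (X.affineBasicOpen f).1) ^ n =
        (PP.aug K Γ(X, V.1) ^ n).map (PP.map (resA K (X.affineBasicOpen_le f)) :
          PP K Γ(X, V.1) →+* PP K Γ(X, (X.affineBasicOpen f).1)) := by
      rw [Ideal.map_pow]
      exact congrArg (· ^ n) h.symm
    rw [pow, h', F.res_eq V _ (X.affineBasicOpen_le f), Ideal.map, Ideal.span,
      Submodule.span_smul_span]
    refine Submodule.span_mono ?_
    rintro _ ⟨_, ⟨a, ha, rfl⟩, _, ⟨y, hy, rfl⟩, rfl⟩
    exact ⟨a • y, Submodule.smul_mem_smul ha hy, NV.res_smulP _ a y⟩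
  · rintro _ ⟨x, hx, rfl⟩
    exact F.res_pow_mem _ hx

theorem res_of {V V' : X.affineOpens} (h : V'.1 ≤ V.1) (f : Γ(X, V.1)) :
    PP.map (resA K h) (PP.of K _ (f ⊗ₜ f)) = PP.of K _ (resA K h f ⊗ₜ resA K h f) := by
  rw [PP.map_of, Algebra.TensorProduct.map_tmul]

variable [LocallyOfFiniteType (X ↘ Spec (CommRingCat.of K))]

theorem exists_pow_smul_mem_pow (hM : IsLocMod K M) {V : X.affineOpens} (f : Γ(X, V.1)) {n : ℕ}
    {x : NV K M V} (hx : x ∈ F.L V)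
    (hx' : NV.res K M (X.affineBasicOpen_le f) x ∈ F.pow (X.affineBasicOpen f) n) :
    ∃ k₀ : ℕ, ∀ k, k₀ ≤ k → PP.of K _ (f ⊗ₜ f) ^ k • x ∈ F.pow V n := by
  rw [pow_affineBasicOpen] at hx'
  obtain ⟨k₀, h⟩ := NN.exists_pow_smul_mem (K := K) (C := Γ(X, V.1))
    (C' := Γ(X, (X.affineBasicOpen f).1)) (φ := resA K (X.affineBasicOpen_le f))
    (resA_affineBasicOpen_away K V f) (hM.away V f) (L := F.pow V n) (x := x) (n := n)
    (fun b hb => Submodule.smul_mem_smul hb hx) hx'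
  refine ⟨k₀, fun k hk => ?_⟩
  rw [← Nat.sub_add_cancel hk, pow_add, mul_smul]
  exact Submodule.smul_mem _ _ h

theorem exists_approx {V : X.affineOpens} (f : Γ(X, V.1)) (n : ℕ)
    {x : NV K M (X.affineBasicOpen f)} (hx : x ∈ F.L (X.affineBasicOpen f)) :
    ∃ k₀ : ℕ, ∀ k, k₀ ≤ k → ∃ z ∈ F.L V,
      PP.map (resA K (X.affineBasicOpen_le f)) (PP.of K _ (f ⊗ₜ f)) ^ k • x -
        NV.res K M (X.affineBasicOpen_le f) z ∈ F.pow (X.affineBasicOpen f) n := by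
  have key : ∃ k : ℕ, ∃ z ∈ F.L V,
      PP.map (resA K (X.affineBasicOpen_le f)) (PP.of K _ (f ⊗ₜ f)) ^ k • x -
        NV.res K M (X.affineBasicOpen_le f) z ∈ F.pow (X.affineBasicOpen f) n := by
    rw [F.res_eq V _ (X.affineBasicOpen_le f)] at hx
    induction hx using Submodule.span_induction with
    | mem y hy =>
      obtain ⟨z, hz, rfl⟩ := hy
      refine ⟨0, z, hz, ?_⟩
      rw [pow_zero, one_smul, sub_self]
      exact Submodule.zero_mem _
    | zero => exact ⟨0, 0, Submodule.zero_mem _, by simp⟩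
    | add y y' _ _ hy hy' =>
      obtain ⟨k, z, hz, h⟩ := hy
      obtain ⟨l, z', hz', h'⟩ := hy'
      refine ⟨k + l, PP.of K _ (f ⊗ₜ f) ^ l • z + PP.of K _ (f ⊗ₜ f) ^ k • z',
        Submodule.add_mem _ (Submodule.smul_mem _ _ hz) (Submodule.smul_mem _ _ hz'), ?_⟩
      have e := Submodule.add_mem _
        (Submodule.smul_mem _ (PP.map (resA K (X.affineBasicOpen_le f))
          (PP.of K _ (f ⊗ₜ f)) ^ l) h)
        (Submodule.smul_mem _ (PP.map (resA K (X.affineBasicOpen_le f))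
          (PP.of K _ (f ⊗ₜ f)) ^ k) h')
      rw [map_add, NV.res_smulP, NV.res_smulP, map_pow, map_pow, smul_add, add_sub_add_comm]
      rw [smul_sub, smul_sub, ← mul_smul, ← mul_smul, ← pow_add, ← pow_add, add_comm l k] at e
      exact e
    | smul b y _ hy =>
      obtain ⟨k, z, hz, h⟩ := hy
      obtain ⟨l, a, ha⟩ := (PP.isFormalLoc (resA_affineBasicOpen_away K V f)).approx b n
      rw [PP.map_aug (resA_affineBasicOpen_away K V f)] at ha
      refine ⟨l + k, a • z, Submodule.smul_mem _ _ hz, ?_⟩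
      have e : PP.map (resA K (X.affineBasicOpen_le f)) (PP.of K _ (f ⊗ₜ f)) ^ (l + k) • b • y -
          NV.res K M (X.affineBasicOpen_le f) (a • z) =
          (PP.map (resA K (X.affineBasicOpen_le f)) (PP.of K _ (f ⊗ₜ f)) ^ l * b) •
          (PP.map (resA K (X.affineBasicOpen_le f)) (PP.of K _ (f ⊗ₜ f)) ^ k • y -
            NV.res K M (X.affineBasicOpen_le f) z) +
          (PP.map (resA K (X.affineBasicOpen_le f)) (PP.of K _ (f ⊗ₜ f)) ^ l * b -
            PP.map (resA K (X.affineBasicOpen_le f)) a) •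
            NV.res K M (X.affineBasicOpen_le f) z := by
        rw [NV.res_smulP, smul_sub, sub_smul, sub_add_sub_cancel, pow_add, mul_smul, mul_smul,
          smul_comm b]
      rw [e]
      exact Submodule.add_mem _ (Submodule.smul_mem _ _ h)
        (Submodule.smul_mem_smul ha (F.res_mem _ hz))
  obtain ⟨k₀, z, hz, h⟩ := key
  refine ⟨k₀, fun k hk => ⟨PP.of K _ (f ⊗ₜ f) ^ (k - k₀) • z, Submodule.smul_mem _ _ hz, ?_⟩⟩
  obtain ⟨l, rfl⟩ := Nat.exists_eq_add_of_le' hk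
  rw [Nat.add_sub_cancel, pow_add, mul_smul, NV.res_smulP, map_pow, ← smul_sub]
  exact Submodule.smul_mem _ _ h

end Coh

end Gluing

theorem PP.span_of_pow_eq_top {K : Type*} [Field K] {C : Type*} [CommRing C] [Algebra K C]
    [Algebra.FiniteType K C] {ι : Type*} (f : ι → C) (hf : Ideal.span (Set.range f) = ⊤)
    (k : ι → ℕ) : Ideal.span (Set.range fun i => PP.of K C (f i ⊗ₜ f i) ^ k i) = ⊤ := by
  by_contra hne
  obtain ⟨m, hm, hle⟩ := Ideal.exists_le_maximal _ hne
  have haug : PP.aug K C ≤ m := by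
    refine (IsAdicComplete.le_jacobson_bot (PP.aug K C)).trans ?_
    exact sInf_le ⟨bot_le, hm⟩
  have hp := hm.isPrime
  have h2 : ∀ i, PP.p₂ K C (f i) ∈ m := by
    intro i
    have h := hp.mem_of_pow_mem _ (hle (Ideal.subset_span ⟨i, rfl⟩))
    have e : PP.of K C (f i ⊗ₜ f i) = PP.p₁ K C (f i) * PP.p₂ K C (f i) := by
      have e' : (f i ⊗ₜ[K] f i) = (f i ⊗ₜ 1) * (1 ⊗ₜ f i) := by
        rw [Algebra.TensorProduct.tmul_mul_tmul, mul_one, one_mul]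
      rw [e', map_mul]; rfl
    rw [e] at h
    rcases hp.mem_or_mem h with h | h
    · have h3 : PP.p₂ K C (f i) - PP.p₁ K C (f i) ∈ PP.aug K C :=
        Ideal.mem_map_of_mem (algebraMap (C ⊗[K] C) (PP K C))
          (KaehlerDifferential.one_smul_sub_smul_one_mem_ideal K (f i))
      exact (Submodule.sub_mem_iff_left _ h).1 (haug h3)
    · exact h
  have h3 : Ideal.span (Set.range f) ≤ m.comap (PP.p₂ K C) := by
    rw [Ideal.span_le]
    rintro _ ⟨i, rfl⟩
    exact h2 i
  rw [hf, top_le_iff, Ideal.comap_eq_top_iff] at h3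
  exact hm.ne_top h3

section Gluing

variable {K : Type u} [Field K] {X : Scheme.{u}} [X.Over (Spec (CommRingCat.of K))]
  {M : X.Modules}

/-- A covering of an affine open set is refined by a finite covering by basic open sets. -/
theorem exists_basicOpen_cover (V : X.affineOpens) {ι : Type*} (W : ι → X.Opens)
    (hW : V.1 ≤ ⨆ a, W a) : ∃ t : Finset Γ(X, V.1),
      Ideal.span (Set.range fun f : t => f.1) = ⊤ ∧ ∀ f : t, ∃ a, X.basicOpen f.1 ≤ W a := by
  have h : Ideal.span {f : Γ(X, V.1) | ∃ a, X.basicOpen f ≤ W a} = ⊤ := by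
    rw [← V.2.self_le_iSup_basicOpen_iff]
    intro x hx
    obtain ⟨a, ha⟩ := Opens.mem_iSup.1 (hW hx)
    obtain ⟨f, hf, hxf⟩ := V.2.exists_basicOpen_le ⟨x, ha⟩ hx
    exact Opens.mem_iSup.2 ⟨⟨f, a, hf⟩, hxf⟩
  obtain ⟨t, ht, ht'⟩ := (Ideal.span_eq_top_iff_finite _).1 h
  refine ⟨t, ?_, fun f => ht f.2⟩
  rw [← ht']
  congr 1
  exact Subtype.range_coe

variable [LocallyOfFiniteType (X ↘ Spec (CommRingCat.of K))]

namespace Coh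

variable (F : Coh K M)

theorem mem_pow_of_local (hM : IsLocMod K M) {V : X.affineOpens} {ι : Type*} [Finite ι]
    (f : ι → Γ(X, V.1)) (hf : Ideal.span (Set.range f) = ⊤) {n : ℕ} {x : NV K M V}
    (hx : x ∈ F.L V) (hx' : ∀ i, NV.res K M (X.affineBasicOpen_le (f i)) x ∈
      F.pow (X.affineBasicOpen (f i)) n) : x ∈ F.pow V n := by
  choose k hk using fun i => F.exists_pow_smul_mem_pow hM (f i) hx (hx' i)
  let J : Ideal (PP K Γ(X, V.1)) := (F.pow V n).comap (LinearMap.toSpanSingleton _ _ x)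
  have hJ : ∀ b, b ∈ J ↔ b • x ∈ F.pow V n := fun b => Iff.rfl
  have h : Ideal.span (Set.range fun i => PP.of K _ (f i ⊗ₜ f i) ^ k i) ≤ J := by
    rw [Ideal.span_le]
    rintro _ ⟨i, rfl⟩
    exact hk i _ le_rfl
  rw [PP.span_of_pow_eq_top f hf, top_le_iff, Ideal.eq_top_iff_one, hJ, one_smul] at h
  exact h

theorem eq_zero_of_forall_mem_pow {V : X.affineOpens} {x : NV K M V}
    (hx : ∀ n, x ∈ F.pow V n) : x = 0 :=
  eq_zero_of_forall_mem_pow_smul (PP.aug K Γ(X, V.1)) (F.fg V) hx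

theorem eq_zero_of_local (hM : IsLocMod K M) {V : X.affineOpens} {ι : Type*} [Finite ι]
    (f : ι → Γ(X, V.1)) (hf : Ideal.span (Set.range f) = ⊤) {x : NV K M V}
    (hx : x ∈ F.L V) (hx' : ∀ i, NV.res K M (X.affineBasicOpen_le (f i)) x = 0) : x = 0 :=
  F.eq_zero_of_forall_mem_pow fun n => F.mem_pow_of_local hM f hf hx fun i => by
    rw [hx' i]; exact Submodule.zero_mem _

theorem exists_glue (hM : IsLocMod K M) {V : X.affineOpens} {ι : Type*} [Finite ι]
    (f : ι → Γ(X, V.1)) (hf : Ideal.span (Set.range f) = ⊤)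
    (x : ∀ i, NV K M (X.affineBasicOpen (f i))) (hx : ∀ i, x i ∈ F.L _)
    (hxx : ∀ i j (V' : X.affineOpens) (h : V'.1 ≤ (X.affineBasicOpen (f i)).1)
      (h' : V'.1 ≤ (X.affineBasicOpen (f j)).1), NV.res K M h (x i) = NV.res K M h' (x j)) :
    ∃ y ∈ F.L V, ∀ i, NV.res K M (X.affineBasicOpen_le (f i)) y = x i := by
  cases nonempty_fintype ι
  let s : ι → PP K Γ(X, V.1) := fun i => PP.of K _ (f i ⊗ₜ f i)
  let H : ∀ j, PP K Γ(X, V.1) →ₐ[K] PP K Γ(X, (X.affineBasicOpen (f j)).1) := fun j =>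
    PP.map (resA K (X.affineBasicOpen_le (f j)))
  have step : ∀ n, ∃ y ∈ F.L V, ∀ j, NV.res K M (X.affineBasicOpen_le (f j)) y - x j ∈
      F.pow (X.affineBasicOpen (f j)) n := by
    intro n
    choose k hk using fun i => F.exists_approx (f i) n (hx i)
    obtain ⟨k₀, hk₀⟩ := Set.Finite.bddAbove (Set.finite_range k)
    choose z hz hz' using fun i => hk i k₀ (hk₀ ⟨i, rfl⟩)
    let e : ∀ i j, NV K M (X.affineBasicOpen (f j)) := fun i j =>
      H j (s i) ^ k₀ • x j - NV.res K M (X.affineBasicOpen_le (f j)) (z i)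
    have he : ∀ i j, e i j ∈ F.L _ := fun i j =>
      Submodule.sub_mem _ (Submodule.smul_mem _ _ (hx j)) (F.res_mem _ (hz i))
    have hN : ∀ ij : ι × ι, ∃ N₀ : ℕ, ∀ N, N₀ ≤ N →
        H ij.2 (s ij.1) ^ N • e ij.1 ij.2 ∈ F.pow (X.affineBasicOpen (f ij.2)) n := by
      rintro ⟨i, j⟩
      have := F.exists_pow_smul_mem_pow hM (resA K (X.affineBasicOpen_le (f j)) (f i))
        (n := n) (he i j) ?_
      · rwa [← res_of] at this
      · let V' := X.affineBasicOpen (resA K (X.affineBasicOpen_le (f j)) (f i))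
        have hV' : V'.1 ≤ (X.affineBasicOpen (f i)).1 := by
          change X.basicOpen (X.presheaf.map (homOfLE _).op (f i)) ≤ X.basicOpen (f i)
          rw [Scheme.basicOpen_res]
          exact inf_le_right
        have h := F.res_pow_mem hV' (hz' i)
        have e1 : NV.res K M hV' (PP.map (resA K (X.affineBasicOpen_le (f i)))
              (PP.of K Γ(X, V.1) (f i ⊗ₜ f i)) ^ k₀ • x i -
              NV.res K M (X.affineBasicOpen_le (f i)) (z i)) =
            NV.res K M (X.affineBasicOpen_le _) (e i j) := by
          rw [map_sub, map_sub, NV.res_smulP, NV.res_smulP, NV.res_res, NV.res_res,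
            hxx i j V' hV' (X.affineBasicOpen_le _), map_pow, map_pow, PP.map_resA_resA,
            PP.map_resA_resA]
        rw [e1] at h
        exact h
    choose N hN using hN
    obtain ⟨N₀, hN₀⟩ := Set.Finite.bddAbove (Set.finite_range N)
    have h1 : (1 : PP K Γ(X, V.1)) ∈ Ideal.span (Set.range fun i => s i ^ (N₀ + k₀)) := by
      rw [PP.span_of_pow_eq_top f hf]; trivial
    obtain ⟨g, hg⟩ := (Submodule.mem_span_range_iff_exists_fun _).1 h1
    refine ⟨∑ i, g i • s i ^ N₀ • z i, Submodule.sum_mem _ fun i _ =>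
      Submodule.smul_mem _ _ (Submodule.smul_mem _ _ (hz i)), fun j => ?_⟩
    have e2 : NV.res K M (X.affineBasicOpen_le (f j)) (∑ i, g i • s i ^ N₀ • z i) - x j =
        ∑ i, -(H j (g i) • H j (s i) ^ N₀ • e i j) := by
      have e3 : x j = ∑ i, H j (g i) • H j (s i) ^ N₀ • H j (s i) ^ k₀ • x j := by
        conv_lhs => rw [← one_smul (PP K Γ(X, (X.affineBasicOpen (f j)).1)) (x j), ← map_one (H j), ← hg, map_sum, Finset.sum_smul]
        refine Finset.sum_congr rfl fun i _ => ?_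
        rw [smul_eq_mul, map_mul, map_pow, pow_add, mul_smul, mul_smul]
      conv_lhs => rw [e3]
      rw [map_sum, ← Finset.sum_sub_distrib]
      refine Finset.sum_congr rfl fun i _ => ?_
      rw [NV.res_smulP, NV.res_smulP, map_pow, ← smul_sub, ← smul_sub, ← smul_neg, ← smul_neg,
        neg_sub]
    rw [e2]
    exact Submodule.sum_mem _ fun i _ => Submodule.neg_mem _ (Submodule.smul_mem _ _
      (hN (i, j) N₀ (hN₀ ⟨(i, j), rfl⟩)))
  choose y hy hy' using step
  obtain ⟨y₀, hy₀, h⟩ := exists_limit_of_fg (PP.aug K Γ(X, V.1)) (F.fg V) y (hy 0) (fun n => by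
    refine F.mem_pow_of_local hM f hf (Submodule.sub_mem _ (hy _) (hy _)) fun i => ?_
    have := Submodule.sub_mem _ (F.pow_anti _ (Nat.le_succ n) (hy' (n + 1) i)) (hy' n i)
    rwa [sub_sub_sub_cancel_right, ← map_sub] at this)
  refine ⟨y₀, hy₀, fun i => ?_⟩
  rw [← sub_eq_zero]
  refine F.eq_zero_of_forall_mem_pow fun n => ?_
  have := Submodule.add_mem _ (F.res_pow_mem (X.affineBasicOpen_le (f i)) (h n)) (hy' n i)
  rwa [map_sub, sub_add_sub_cancel] at this

end Coh

namespace sec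

variable (F : Coh K M) {W : X.Opens}

theorem eq_zero_of_forall_mem_pow {x : sec K M W}
    (hx : ∀ n, x ∈ within K M W fun V => F.pow V n) : x = 0 :=
  ext K fun V => F.eq_zero_of_forall_mem_pow fun n => hx n V

theorem exists_limit (x : ℕ → sec K M W) (h0 : x 0 ∈ within K M W F.L)
    (hx : ∀ n, x (n + 1) - x n ∈ within K M W fun V => F.pow V n) :
    ∃ y ∈ within K M W F.L, ∀ n, y - x n ∈ within K M W fun V => F.pow V n := by
  choose y hy hy' using fun V : AffIn W => exists_limit_of_fg (PP.aug K Γ(X, V.1.1)) (F.fg V.1)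
    (fun n => (x n).1 V) (h0 V) (fun n => hx n V)
  refine ⟨⟨y, fun V V' h => ?_⟩, hy, fun n V => hy' V n⟩
  rw [← sub_eq_zero]
  refine F.eq_zero_of_forall_mem_pow fun n => ?_
  have := Submodule.sub_mem _ (F.res_pow_mem h (hy' V n)) (hy' V' n)
  rwa [map_sub, (x n).2 V V' h, sub_sub_sub_cancel_right] at this

variable {ι : Type*} {W' : ι → X.Opens}

theorem mem_pow_of_local (hM : IsLocMod K M) (hle : ∀ a, W' a ≤ W) (hW : W ≤ ⨆ a, W' a) {n : ℕ}
    {x : sec K M W} (hx : x ∈ within K M W F.L)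
    (hx' : ∀ a, res K M (hle a) x ∈ within K M (W' a) fun V => F.pow V n) :
    x ∈ within K M W fun V => F.pow V n := by
  intro V
  obtain ⟨t, ht, ht'⟩ := exists_basicOpen_cover V.1 W' (V.2.trans hW)
  refine F.mem_pow_of_local hM (fun f : t => f.1) ht (hx V) fun f => ?_
  obtain ⟨a, ha⟩ := ht' f
  have h := hx' a ⟨X.affineBasicOpen f.1, ha⟩
  rw [x.2 V ⟨X.affineBasicOpen f.1, ha.trans (hle a)⟩]
  exact h

theorem eq_zero_of_local (hM : IsLocMod K M) (hle : ∀ a, W' a ≤ W) (hW : W ≤ ⨆ a, W' a)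
    {x : sec K M W} (hx : x ∈ within K M W F.L) (hx' : ∀ a, res K M (hle a) x = 0) : x = 0 :=
  eq_zero_of_forall_mem_pow F fun n => mem_pow_of_local F hM hle hW hx fun a => by
    rw [hx' a]; exact Submodule.zero_mem _

theorem exists_glue_aux (hM : IsLocMod K M) (x : ∀ a, sec K M (W' a))
    (hx : ∀ a, x a ∈ within K M (W' a) F.L)
    (hxx : ∀ a b (V : X.affineOpens) (h : V.1 ≤ W' a) (h' : V.1 ≤ W' b),
      (x a).1 ⟨V, h⟩ = (x b).1 ⟨V, h'⟩) {V : X.affineOpens} {κ : Type*} [Finite κ]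
    (f : κ → Γ(X, V.1)) (hf : Ideal.span (Set.range f) = ⊤)
    (a : κ → ι) (ha : ∀ i, (X.affineBasicOpen (f i)).1 ≤ W' (a i)) :
    ∃ y ∈ F.L V, ∀ i, NV.res K M (X.affineBasicOpen_le (f i)) y =
      (x (a i)).1 ⟨X.affineBasicOpen (f i), ha i⟩ := by
  let z : ∀ i, NV K M (X.affineBasicOpen (f i)) := fun i =>
    (x (a i)).1 ⟨X.affineBasicOpen (f i), ha i⟩
  have hz : ∀ i, z i ∈ F.L (X.affineBasicOpen (f i)) := fun i =>
    hx (a i) ⟨X.affineBasicOpen (f i), ha i⟩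
  refine Coh.exists_glue F hM f hf z hz (fun i j V' h h' => ?_)
  have e1 := (x (a i)).2 ⟨X.affineBasicOpen (f i), ha i⟩ ⟨V', h.trans (ha i)⟩ h
  have e2 := (x (a j)).2 ⟨X.affineBasicOpen (f j), ha j⟩ ⟨V', h'.trans (ha j)⟩ h'
  exact e1.trans ((hxx (a i) (a j) V' (h.trans (ha i)) (h'.trans (ha j))).trans e2.symm)

theorem res_eq_of_glue (hM : IsLocMod K M) (x : ∀ a, sec K M (W' a))
    (hx : ∀ a, x a ∈ within K M (W' a) F.L)
    (hxx : ∀ a b (V : X.affineOpens) (h : V.1 ≤ W' a) (h' : V.1 ≤ W' b),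
      (x a).1 ⟨V, h⟩ = (x b).1 ⟨V, h'⟩) {V : X.affineOpens} {κ : Type*} [Finite κ]
    (f : κ → Γ(X, V.1)) (hf : Ideal.span (Set.range f) = ⊤)
    (a : κ → ι) (ha : ∀ i, (X.affineBasicOpen (f i)).1 ≤ W' (a i)) {y : NV K M V} (hy : y ∈ F.L V)
    (hy' : ∀ i, NV.res K M (X.affineBasicOpen_le (f i)) y =
      (x (a i)).1 ⟨X.affineBasicOpen (f i), ha i⟩) (b : ι) (V' : X.affineOpens)
    (h' : V'.1 ≤ W' b) (h : V'.1 ≤ V.1) : NV.res K M h y = (x b).1 ⟨V', h'⟩ := by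
  let f' : κ → Γ(X, V'.1) := fun i => resA K h (f i)
  have hspan : Ideal.span (Set.range f') = ⊤ := by
    have := congrArg (Ideal.map (resA K h)) hf
    rw [Ideal.map_span, Ideal.map_top, ← Set.range_comp] at this
    exact this
  rw [← sub_eq_zero]
  refine F.eq_zero_of_local hM f' hspan (Submodule.sub_mem _ (F.res_mem h hy)
    (hx b ⟨V', h'⟩)) fun i => ?_
  have hle' : (X.affineBasicOpen (f' i)).1 ≤ (X.affineBasicOpen (f i)).1 := by
    change X.basicOpen (X.presheaf.map (homOfLE _).op (f i)) ≤ X.basicOpen (f i)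
    rw [Scheme.basicOpen_res]
    exact inf_le_right
  rw [map_sub, NV.res_res, sub_eq_zero]
  have e1 := (x b).2 ⟨V', h'⟩ ⟨X.affineBasicOpen (f' i), (X.basicOpen_le (f' i)).trans h'⟩
    (X.basicOpen_le (f' i))
  have e2 := congrArg (NV.res K M hle') (hy' i)
  have e3 := (x (a i)).2 ⟨X.affineBasicOpen (f i), ha i⟩
    ⟨X.affineBasicOpen (f' i), hle'.trans (ha i)⟩ hle'
  rw [NV.res_res] at e2
  exact (e2.trans e3).trans ((hxx (a i) b _ _ _).trans e1.symm)

theorem exists_glue (hM : IsLocMod K M) (hle : ∀ a, W' a ≤ W) (hW : W ≤ ⨆ a, W' a)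
    (x : ∀ a, sec K M (W' a)) (hx : ∀ a, x a ∈ within K M (W' a) F.L)
    (hxx : ∀ a b, res K M (inf_le_left : W' a ⊓ W' b ≤ W' a) (x a) =
      res K M (inf_le_right : W' a ⊓ W' b ≤ W' b) (x b)) :
    ∃ y ∈ within K M W F.L, ∀ a, res K M (hle a) y = x a := by
  have hxx' : ∀ a b (V : X.affineOpens) (h : V.1 ≤ W' a) (h' : V.1 ≤ W' b),
      (x a).1 ⟨V, h⟩ = (x b).1 ⟨V, h'⟩ := fun a b V h h' =>
    congrFun (congrArg Subtype.val (hxx a b)) ⟨V, le_inf h h'⟩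
  have uniq : ∀ (V : AffIn W) (y z : NV K M V.1), y ∈ F.L V.1 → z ∈ F.L V.1 →
      (∀ a (V' : X.affineOpens) (_ : V'.1 ≤ W' a) (h : V'.1 ≤ V.1.1),
        NV.res K M h y = NV.res K M h z) → y = z := by
    intro V y z hy hz h
    rw [← sub_eq_zero]
    obtain ⟨t, ht, ht'⟩ := exists_basicOpen_cover V.1 W' (V.2.trans hW)
    refine F.eq_zero_of_local hM (fun f : t => f.1) ht (Submodule.sub_mem _ hy hz) fun f => ?_
    obtain ⟨a, ha⟩ := ht' f
    rw [map_sub, sub_eq_zero]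
    exact h a _ ha _
  have ex : ∀ V : AffIn W, ∃ y ∈ F.L V.1, ∀ a (V' : X.affineOpens) (h' : V'.1 ≤ W' a)
      (h : V'.1 ≤ V.1.1), NV.res K M h y = (x a).1 ⟨V', h'⟩ := fun V => by
    obtain ⟨t, ht, ht'⟩ := exists_basicOpen_cover V.1 W' (V.2.trans hW)
    choose a ha using ht'
    obtain ⟨y, hy, hy'⟩ := exists_glue_aux F hM x hx hxx' (fun f : t => f.1) ht a ha
    exact ⟨y, hy, fun b V' h' h =>
      res_eq_of_glue F hM x hx hxx' (fun f : t => f.1) ht a ha hy hy' b V' h' h⟩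
  choose y hy hy' using ex
  refine ⟨⟨y, fun V V' h => uniq V' _ _ (F.res_mem h (hy V)) (hy V') fun a V'' h' i => ?_⟩, hy,
    fun a => ext K fun V => ?_⟩
  · rw [NV.res_res, hy' V a V'' h', hy' V' a V'' h']
  · refine uniq ⟨V.1, V.2.trans (hle a)⟩ _ _ (hy _) (hx a V) fun b V' h' h => ?_
    exact (hy' _ b V' h' h).trans ((hxx' b a V' h' (h.trans V.2)).trans
      ((x a).2 V ⟨V', h.trans V.2⟩ h).symm)

end sec

end Gluing

namespace DirInv

variable {K : Type*} [Field K] {B : Type*} [AddCommGroup B] [Module K B] {D : DirInv.{u} K B}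
  {B' : Type*} [AddCommGroup B'] [Module K B'] {D' : DirInv.{u} K B'}
  {B'' : Type*} [AddCommGroup B''] [Module K B''] {D'' : DirInv.{u} K B''}

/-! ## Continuous linear and bilinear maps -/

theorem IsCont.id : IsCont D D LinearMap.id := fun j => ⟨j, fun _ h => h, fun i => ⟨i, fun _ h => h⟩⟩

theorem IsCont.add {f g : B →ₗ[K] B'} (hf : IsCont D D' f) (hg : IsCont D D' g) :
    IsCont D D' (f + g) := by
  intro j
  obtain ⟨a, h, h'⟩ := hf j
  obtain ⟨b, k, k'⟩ := hg j
  obtain ⟨c, hac, hbc⟩ := D'.directed a b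
  refine ⟨c, fun x hx => Submodule.add_mem _ (D'.F_mono hac (h x hx)) (D'.F_mono hbc (k x hx)),
    fun i => ?_⟩
  obtain ⟨ia, hia⟩ := D'.fil_mono hac i
  obtain ⟨ib, hib⟩ := D'.fil_mono hbc i
  obtain ⟨m, hm⟩ := h' ia
  obtain ⟨n, hn⟩ := k' ib
  exact ⟨max m n, fun x hx => Submodule.add_mem _
    (hia (hm x (D.fil_anti j (le_max_left _ _) hx)))
    (hib (hn x (D.fil_anti j (le_max_right _ _) hx)))⟩

theorem IsCont.smul (c : K) {f : B →ₗ[K] B'} (hf : IsCont D D' f) : IsCont D D' (c • f) := by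
  intro j
  obtain ⟨a, h, h'⟩ := hf j
  refine ⟨a, fun x hx => Submodule.smul_mem _ _ (h x hx), fun i => ?_⟩
  obtain ⟨k, hk⟩ := h' i
  exact ⟨k, fun x hx => Submodule.smul_mem _ _ (hk x hx)⟩

/-- A continuous bilinear map of dir-inv modules. -/
def IsCont₂ (D : DirInv.{u} K B) (D' : DirInv.{u} K B') (D'' : DirInv.{u} K B'')
    (f : B →ₗ[K] B' →ₗ[K] B'') : Prop :=
  ∀ j j', ∃ j'', (∀ x ∈ D.F j, ∀ y ∈ D'.F j', f x y ∈ D''.F j'') ∧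
    ∀ i'', ∃ i, (∀ x ∈ D.fil j i, ∀ y ∈ D'.F j', f x y ∈ D''.fil j'' i'') ∧
      ∀ x ∈ D.F j, ∀ y ∈ D'.fil j' i, f x y ∈ D''.fil j'' i''

theorem IsCont₂.add {f g : B →ₗ[K] B' →ₗ[K] B''} (hf : IsCont₂ D D' D'' f)
    (hg : IsCont₂ D D' D'' g) : IsCont₂ D D' D'' (f + g) := by
  intro j j'
  obtain ⟨a, h, h'⟩ := hf j j'
  obtain ⟨b, k, k'⟩ := hg j j'
  obtain ⟨c, hac, hbc⟩ := D''.directed a b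
  refine ⟨c, fun x hx y hy => Submodule.add_mem _ (D''.F_mono hac (h x hx y hy))
    (D''.F_mono hbc (k x hx y hy)), fun i => ?_⟩
  obtain ⟨ia, hia⟩ := D''.fil_mono hac i
  obtain ⟨ib, hib⟩ := D''.fil_mono hbc i
  obtain ⟨m, hm, hm'⟩ := h' ia
  obtain ⟨n, hn, hn'⟩ := k' ib
  exact ⟨max m n, fun x hx y hy => Submodule.add_mem _
      (hia (hm x (D.fil_anti j (le_max_left _ _) hx) y hy))
      (hib (hn x (D.fil_anti j (le_max_right _ _) hx) y hy)),
    fun x hx y hy => Submodule.add_mem _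
      (hia (hm' x hx y (D'.fil_anti j' (le_max_left _ _) hy)))
      (hib (hn' x hx y (D'.fil_anti j' (le_max_right _ _) hy)))⟩

theorem IsCont₂.comp_left {B₀ : Type*} [AddCommGroup B₀] [Module K B₀] {D₀ : DirInv.{u} K B₀}
    {f : B →ₗ[K] B' →ₗ[K] B''} (hf : IsCont₂ D D' D'' f) {g : B₀ →ₗ[K] B}
    (hg : IsCont D₀ D g) : IsCont₂ D₀ D' D'' (f.comp g) := by
  intro j₀ j'
  obtain ⟨j, h, h'⟩ := hg j₀
  obtain ⟨j'', k, k'⟩ := hf j j'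
  refine ⟨j'', fun x hx y hy => k _ (h x hx) y hy, fun i'' => ?_⟩
  obtain ⟨i, hi, hi'⟩ := k' i''
  obtain ⟨i₀, hi₀⟩ := h' i
  exact ⟨max i i₀, fun x hx y hy => hi _ (hi₀ x (D₀.fil_anti j₀ (le_max_right _ _) hx)) y hy,
    fun x hx y hy => hi' _ (h x hx) y (D'.fil_anti j' (le_max_left _ _) hy)⟩

theorem map₂_range_lTensor {O O' O'' : Type*} [AddCommGroup O] [Module K O] [AddCommGroup O']
    [Module K O'] [AddCommGroup O''] [Module K O''] (a : O →ₗ[K] O' →ₗ[K] O'')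
    (f : B →ₗ[K] B' →ₗ[K] B'') {S : Submodule K B} {S' : Submodule K B'} {T : Submodule K B''}
    (h : ∀ x ∈ S, ∀ y ∈ S', f x y ∈ T) {x : O ⊗[K] B} {y : O' ⊗[K] B'}
    (hx : x ∈ LinearMap.range (LinearMap.lTensor O S.subtype))
    (hy : y ∈ LinearMap.range (LinearMap.lTensor O' S'.subtype)) :
    TensorProduct.map₂ a f x y ∈ LinearMap.range (LinearMap.lTensor O'' T.subtype) := by
  obtain ⟨x, rfl⟩ := hx
  obtain ⟨y, rfl⟩ := hy
  induction x using TensorProduct.induction_on with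
  | zero => simp
  | add x x' hx hx' => rw [map_add, map_add, LinearMap.add_apply]; exact Submodule.add_mem _ hx hx'
  | tmul o s =>
    induction y using TensorProduct.induction_on with
    | zero => simp
    | add y y' hy hy' => rw [map_add, map_add]; exact Submodule.add_mem _ hy hy'
    | tmul o' s' => exact ⟨a o o' ⊗ₜ ⟨f s s', h _ s.2 _ s'.2⟩, rfl⟩

theorem IsCont₂.tens {O O' O'' : Type*} [AddCommGroup O] [Module K O] [AddCommGroup O']
    [Module K O'] [AddCommGroup O''] [Module K O''] (a : O →ₗ[K] O' →ₗ[K] O'')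
    {f : B →ₗ[K] B' →ₗ[K] B''} (hf : IsCont₂ D D' D'' f) :
    IsCont₂ (D.tens O) (D'.tens O') (D''.tens O'') (TensorProduct.map₂ a f) := by
  intro j j'
  obtain ⟨j'', h, h'⟩ := hf j j'
  refine ⟨j'', fun x hx y hy => map₂_range_lTensor a f h hx hy, fun i'' => ?_⟩
  obtain ⟨i, hi, hi'⟩ := h' i''
  exact ⟨i, fun x hx y hy => map₂_range_lTensor a f hi hx hy,
    fun x hx y hy => map₂_range_lTensor a f hi' hx hy⟩

theorem IsCont₂.cauchy {f : B →ₗ[K] B' →ₗ[K] B''} (hf : IsCont₂ D D' D'' f) {x : ℕ → B}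
    {y : ℕ → B'} (hx : x ∈ D.cauchy) (hy : y ∈ D'.cauchy) :
    (fun n => f (x n) (y n)) ∈ D''.cauchy := by
  obtain ⟨j, hx⟩ := hx
  obtain ⟨j', hy⟩ := hy
  obtain ⟨j'', h, h'⟩ := hf j j'
  refine ⟨j'', fun n => h _ (hx.1 n) _ (hy.1 n), fun i'' => ?_⟩
  obtain ⟨i, hi, hi'⟩ := h' i''
  obtain ⟨n₀, h₀⟩ := hx.2 i
  obtain ⟨n₁, h₁⟩ := hy.2 i
  refine ⟨max n₀ n₁, fun n hn => ?_⟩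
  have hx' := Submodule.sub_mem _ (h₀ n (le_trans (le_max_left _ _) hn))
    (h₀ (max n₀ n₁) (le_max_left _ _))
  have hy' := Submodule.sub_mem _ (h₁ n (le_trans (le_max_right _ _) hn))
    (h₁ (max n₀ n₁) (le_max_right _ _))
  rw [sub_sub_sub_cancel_right] at hx' hy'
  have := Submodule.add_mem _ (hi _ hx' _ (hy.1 n)) (hi' _ (hx.1 (max n₀ n₁)) _ hy')
  rwa [map_sub, map_sub, LinearMap.sub_apply, sub_add_sub_cancel] at this

theorem IsCont₂.null_left {f : B →ₗ[K] B' →ₗ[K] B''} (hf : IsCont₂ D D' D'' f) {x : ℕ → B}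
    {y : ℕ → B'} (hx : x ∈ D.null) (hy : y ∈ D'.cauchy) :
    (fun n => f (x n) (y n)) ∈ D''.null := by
  obtain ⟨j, hx⟩ := hx
  obtain ⟨j', hy⟩ := hy
  obtain ⟨j'', h, h'⟩ := hf j j'
  refine ⟨j'', fun n => h _ (hx.1 n) _ (hy.1 n), fun i'' => ?_⟩
  obtain ⟨i, hi, -⟩ := h' i''
  obtain ⟨n₀, h₀⟩ := hx.2 i
  exact ⟨n₀, fun n hn => hi _ (h₀ n hn) _ (hy.1 n)⟩

theorem IsCont₂.null_right {f : B →ₗ[K] B' →ₗ[K] B''} (hf : IsCont₂ D D' D'' f) {x : ℕ → B}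
    {y : ℕ → B'} (hx : x ∈ D.cauchy) (hy : y ∈ D'.null) :
    (fun n => f (x n) (y n)) ∈ D''.null := by
  obtain ⟨j, hx⟩ := hx
  obtain ⟨j', hy⟩ := hy
  obtain ⟨j'', h, h'⟩ := hf j j'
  refine ⟨j'', fun n => h _ (hx.1 n) _ (hy.1 n), fun i'' => ?_⟩
  obtain ⟨i, -, hi⟩ := h' i''
  obtain ⟨n₀, h₀⟩ := hy.2 i
  exact ⟨n₀, fun n hn => hi _ (hx.1 n) _ (h₀ n hn)⟩

theorem Lim.mem {x : ℕ → B} {b : D.Compl} (h : D.Lim x b) : x ∈ D.cauchy := h.1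

theorem lim_of_sub_null {x y : ℕ → B} {b : D.Compl} (h : D.Lim x b) (hxy : y - x ∈ D.null)
    (hy : y ∈ D.cauchy) : D.Lim y b := by
  obtain ⟨hx, rfl⟩ := h
  refine ⟨hy, ?_⟩
  exact (Submodule.Quotient.eq _).2 hxy

theorem sub_mem_null {x y : ℕ → B} {b : D.Compl} (h : D.Lim x b) (h' : D.Lim y b) :
    x - y ∈ D.null := by
  obtain ⟨hx, rfl⟩ := h
  obtain ⟨hy, e⟩ := h'
  exact (Submodule.Quotient.eq (D.null.comap D.cauchy.subtype)).1 e.symm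

theorem exists_map₂ {f : B →ₗ[K] B' →ₗ[K] B''} (hf : IsCont₂ D D' D'' f) :
    ∃ g : D.Compl →ₗ[K] D'.Compl →ₗ[K] D''.Compl, ∀ x b y b', D.Lim x b → D'.Lim y b' →
      D''.Lim (fun n => f (x n) (y n)) (g b b') := by
  have ex : ∀ b b', ∃ c, ∀ x y, D.Lim x b → D'.Lim y b' → D''.Lim (fun n => f (x n) (y n)) c := by
    intro b b'
    obtain ⟨x₀, hx₀⟩ := exists_lim b
    obtain ⟨y₀, hy₀⟩ := exists_lim b'
    refine ⟨D''.cls ⟨_, hf.cauchy hx₀.mem hy₀.mem⟩, fun x y hx hy => ?_⟩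
    refine lim_of_sub_null ⟨hf.cauchy hx₀.mem hy₀.mem, rfl⟩ ?_ (hf.cauchy hx.mem hy.mem)
    have h := Submodule.add_mem _ (hf.null_left (sub_mem_null hx hx₀) hy.mem)
      (hf.null_right hx₀.mem (sub_mem_null hy hy₀))
    convert h using 1
    ext n
    simp only [Pi.add_apply, Pi.sub_apply, map_sub, LinearMap.sub_apply]
    abel
  choose g hg using ex
  refine ⟨LinearMap.mk₂ K g ?_ ?_ ?_ ?_, fun x b y b' hx hy => hg b b' x y hx hy⟩
  · intro b₁ b₂ b'
    obtain ⟨x₁, h₁⟩ := exists_lim b₁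
    obtain ⟨x₂, h₂⟩ := exists_lim b₂
    obtain ⟨y, hy⟩ := exists_lim b'
    refine (hg _ _ _ _ (h₁.add h₂) hy).unique ?_
    convert (hg _ _ _ _ h₁ hy).add (hg _ _ _ _ h₂ hy) using 1
    ext n
    simp only [Pi.add_apply, map_add, LinearMap.add_apply]
  · intro c b b'
    obtain ⟨x, h⟩ := exists_lim b
    obtain ⟨y, hy⟩ := exists_lim b'
    refine (hg _ _ _ _ (h.smul c) hy).unique ?_
    convert (hg _ _ _ _ h hy).smul c using 1
    ext n
    simp only [Pi.smul_apply, map_smul, LinearMap.smul_apply]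
  · intro b b₁ b₂
    obtain ⟨x₁, h₁⟩ := exists_lim b₁
    obtain ⟨x₂, h₂⟩ := exists_lim b₂
    obtain ⟨x, hx⟩ := exists_lim b
    refine (hg _ _ _ _ hx (h₁.add h₂)).unique ?_
    convert (hg _ _ _ _ hx h₁).add (hg _ _ _ _ hx h₂) using 1
    ext n
    simp only [Pi.add_apply, map_add]
  · intro c b b'
    obtain ⟨x, h⟩ := exists_lim b
    obtain ⟨y, hy⟩ := exists_lim b'
    refine (hg _ _ _ _ h (hy.smul c)).unique ?_
    convert (hg _ _ _ _ h hy).smul c using 1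
    ext n
    simp only [Pi.smul_apply, map_smul]

/-- The bilinear map of completions induced by a continuous bilinear map. -/
def Compl.map₂ (f : B →ₗ[K] B' →ₗ[K] B'') (hf : IsCont₂ D D' D'' f) :
    D.Compl →ₗ[K] D'.Compl →ₗ[K] D''.Compl := (exists_map₂ hf).choose

theorem Lim.map₂ {f : B →ₗ[K] B' →ₗ[K] B''} (hf : IsCont₂ D D' D'' f) {x : ℕ → B} {b : D.Compl}
    {y : ℕ → B'} {b' : D'.Compl} (hx : D.Lim x b) (hy : D'.Lim y b') :
    D''.Lim (fun n => f (x n) (y n)) (Compl.map₂ f hf b b') :=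
  (exists_map₂ hf).choose_spec x b y b' hx hy

/-! ## Coordinates in the completed tensor product -/

variable (D) in
/-- Each step of the direct system is separated and complete for its filtration. -/
structure IsGood : Prop where
  sep : ∀ j x, (∀ i, x ∈ D.fil j i) → x = 0
  complete : ∀ j (x : ℕ → B), (∀ n, x n ∈ D.F j) → (∀ n, x (n + 1) - x n ∈ D.fil j n) →
    ∃ y ∈ D.F j, ∀ n, y - x n ∈ D.fil j n

variable {O : Type*} [AddCommGroup O] [Module K O] {ι : Type*} (β : Module.Basis ι K O)

variable (B) in
/-- The coordinates of an element of the tensor product. -/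
abbrev crd : O ⊗[K] B ≃ₗ[K] ι →₀ B := by
  classical exact TensorProduct.equivFinsuppOfBasisLeft β

theorem mem_range_lTensor_iff (S : Submodule K B) (x : O ⊗[K] B) :
    x ∈ LinearMap.range (LinearMap.lTensor O S.subtype) ↔ ∀ k, crd B β x k ∈ S := by
  classical
  constructor
  · rintro ⟨z, rfl⟩ k
    induction z using TensorProduct.induction_on with
    | zero => simp
    | add x y hx hy => rw [map_add, map_add, Finsupp.add_apply]; exact Submodule.add_mem _ hx hy
    | tmul o s =>
      rw [LinearMap.lTensor_tmul, TensorProduct.equivFinsuppOfBasisLeft_apply_tmul_apply]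
      exact Submodule.smul_mem _ _ s.2
  · intro h
    rw [← (crd B β).symm_apply_apply x, TensorProduct.equivFinsuppOfBasisLeft_symm_apply]
    refine Submodule.sum_mem _ fun k _ => ?_
    exact ⟨β k ⊗ₜ ⟨crd B β x k, h k⟩, rfl⟩

/-- The family `c` consists of the coordinates of the element `u` of the completed tensor
product. -/
def HasCoord (u : (D.tens O).Compl) (c : ι → B) : Prop :=
  ∃ j, (∀ k, c k ∈ D.F j) ∧ (∀ i, {k | c k ∉ D.fil j i}.Finite) ∧
    ∃ x, (D.tens O).Lim x u ∧ (∀ n k, crd B β (x n) k ∈ D.F j) ∧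
      ∀ i, ∃ n₀, ∀ n, n₀ ≤ n → ∀ k, crd B β (x n) k - c k ∈ D.fil j i

theorem exists_hasCoord (hD : D.IsGood) (u : (D.tens O).Compl) : ∃ c, HasCoord β u c := by
  obtain ⟨x, hx, rfl⟩ := exists_lim u
  obtain ⟨j, hF, hC⟩ := hx
  have hF' : ∀ n k, crd B β (x n) k ∈ D.F j := fun n k => (mem_range_lTensor_iff β _ _).1 (hF n) k
  have hC' := hC
  choose n₀ hn₀ using hC'
  have hn₀' : ∀ i n, n₀ i ≤ n → ∀ k, crd B β (x n) k - crd B β (x (n₀ i)) k ∈ D.fil j i := by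
    intro i n hn k
    have := (mem_range_lTensor_iff β _ _).1 (hn₀ i n hn) k
    rwa [map_sub, Finsupp.sub_apply] at this
  let N : ℕ → ℕ := fun i => (Finset.range (i + 1)).sup n₀
  have hN : ∀ i, n₀ i ≤ N i := fun i => Finset.le_sup (f := n₀) (Finset.self_mem_range_succ i)
  have hN1 : ∀ i, n₀ i ≤ N (i + 1) := fun i =>
    Finset.le_sup (f := n₀) (Finset.mem_range.2 (by omega))
  have ex : ∀ k, ∃ y ∈ D.F j, ∀ i, y - crd B β (x (N i)) k ∈ D.fil j i := by
    intro k
    refine hD.complete j (fun i => crd B β (x (N i)) k) (fun i => hF' _ k) fun i => ?_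
    have := Submodule.sub_mem _ (hn₀' i _ (hN1 i) k) (hn₀' i _ (hN i) k)
    rwa [sub_sub_sub_cancel_right] at this
  choose c hc hc' using ex
  have hconv : ∀ i n, n₀ i ≤ n → ∀ k, crd B β (x n) k - c k ∈ D.fil j i := by
    intro i n hn k
    have h1 := Submodule.sub_mem _ (hn₀' i n hn k) (hn₀' i _ (hN i) k)
    rw [sub_sub_sub_cancel_right] at h1
    have h2 := Submodule.sub_mem _ h1 (hc' k i)
    rwa [sub_sub_sub_cancel_right] at h2
  refine ⟨c, j, hc, fun i => ?_, x, ⟨⟨j, hF, fun i => ⟨n₀ i, hn₀ i⟩⟩, rfl⟩, hF',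
    fun i => ⟨n₀ i, hconv i⟩⟩
  refine Set.Finite.subset (crd B β (x (n₀ i))).finite_support fun k hk => ?_
  rw [Function.mem_support]
  intro h0
  refine hk ?_
  have := hconv i _ le_rfl k
  rw [h0, zero_sub] at this
  exact (Submodule.neg_mem_iff _).1 this

theorem exists_of_coord (j : D.J) (c : ι → B) (hc : ∀ k, c k ∈ D.F j)
    (hc' : ∀ i, {k | c k ∉ D.fil j i}.Finite) : ∃ u : (D.tens O).Compl, HasCoord β u c := by
  classical
  let x : ℕ → O ⊗[K] B := fun n => (crd B β).symm
    (Finsupp.onFinset (hc' n).toFinset (fun k => if c k ∈ D.fil j n then 0 else c k)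
      (fun k hk => by
        rw [Set.Finite.mem_toFinset, Set.mem_ofPred_eq]
        intro h
        exact hk (if_pos h)))
  have hx : ∀ n k, crd B β (x n) k = if c k ∈ D.fil j n then 0 else c k := fun n k => by
    rw [LinearEquiv.apply_symm_apply]; rfl
  have hF : ∀ n k, crd B β (x n) k ∈ D.F j := by
    intro n k
    rw [hx]
    split_ifs
    · exact Submodule.zero_mem _
    · exact hc k
  have hconv : ∀ i n, i ≤ n → ∀ k, crd B β (x n) k - c k ∈ D.fil j i := by
    intro i n hn k
    rw [hx]
    split_ifs with h
    · rw [zero_sub]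
      exact Submodule.neg_mem _ (D.fil_anti j hn h)
    · rw [sub_self]; exact Submodule.zero_mem _
  have hcau : x ∈ (D.tens O).cauchy := by
    refine ⟨j, fun n => (mem_range_lTensor_iff β _ _).2 (hF n), fun i => ⟨i, fun n hn => ?_⟩⟩
    refine (mem_range_lTensor_iff β _ _).2 fun k => ?_
    have := Submodule.sub_mem _ (hconv i n hn k) (hconv i i le_rfl k)
    rwa [sub_sub_sub_cancel_right, ← Finsupp.sub_apply, ← map_sub] at this
  exact ⟨_, j, hc, hc', x, ⟨hcau, rfl⟩, hF, fun i => ⟨i, hconv i⟩⟩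

variable {β}

theorem HasCoord.mono {u : (D.tens O).Compl} {c : ι → B} (h : HasCoord β u c) :
    ∃ j, ∀ j', D.preorder.le j j' → (∀ k, c k ∈ D.F j') ∧ (∀ i, {k | c k ∉ D.fil j' i}.Finite) ∧
      ∃ x, (D.tens O).Lim x u ∧ (∀ n k, crd B β (x n) k ∈ D.F j') ∧
        ∀ i, ∃ n₀, ∀ n, n₀ ≤ n → ∀ k, crd B β (x n) k - c k ∈ D.fil j' i := by
  obtain ⟨j, h1, h2, x, hx, h3, h4⟩ := h
  refine ⟨j, fun j' hj => ⟨fun k => D.F_mono hj (h1 k), fun i => ?_, x, hx,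
    fun n k => D.F_mono hj (h3 n k), fun i => ?_⟩⟩
  · obtain ⟨i', hi'⟩ := D.fil_mono hj i
    exact (h2 i').subset fun k hk hk' => hk (hi' hk')
  · obtain ⟨i', hi'⟩ := D.fil_mono hj i
    obtain ⟨n₀, h⟩ := h4 i'
    exact ⟨n₀, fun n hn k => hi' (h n hn k)⟩

theorem HasCoord.unique {u v : (D.tens O).Compl} {c : ι → B} (hu : HasCoord β u c)
    (hv : HasCoord β v c) : u = v := by
  obtain ⟨j, hu⟩ := hu.mono
  obtain ⟨j', hv⟩ := hv.mono
  obtain ⟨l, hjl, hjl'⟩ := D.directed j j'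
  obtain ⟨-, -, x, hx, hxF, h⟩ := hu l hjl
  obtain ⟨-, -, y, hy, hyF, h'⟩ := hv l hjl'
  refine hx.unique (lim_of_sub_null hy ?_ hx.mem)
  refine ⟨l, fun n => (mem_range_lTensor_iff β _ _).2 fun k => ?_, fun i => ?_⟩
  · rw [Pi.sub_apply, map_sub, Finsupp.sub_apply]
    exact Submodule.sub_mem _ (hxF n k) (hyF n k)
  · obtain ⟨n₀, h₀⟩ := h i
    obtain ⟨n₁, h₁⟩ := h' i
    refine ⟨max n₀ n₁, fun n hn => (mem_range_lTensor_iff β _ _).2 fun k => ?_⟩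
    rw [Pi.sub_apply, map_sub, Finsupp.sub_apply]
    have := Submodule.sub_mem _ (h₀ n ((le_max_left _ _).trans hn) k)
      (h₁ n ((le_max_right _ _).trans hn) k)
    rwa [sub_sub_sub_cancel_right] at this

theorem HasCoord.coord_unique (hD : D.IsGood) {u : (D.tens O).Compl} {c c' : ι → B}
    (h : HasCoord β u c) (h' : HasCoord β u c') : c = c' := by
  obtain ⟨j, hu⟩ := h.mono
  obtain ⟨j', hv⟩ := h'.mono
  obtain ⟨l, hjl, hjl'⟩ := D.directed j j'
  obtain ⟨-, -, x, hx, hxF, h⟩ := hu l hjl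
  obtain ⟨-, -, y, hy, hyF, h'⟩ := hv l hjl'
  obtain ⟨m, hm⟩ := sub_mem_null hx hy
  obtain ⟨r, hmr, hlr⟩ := D.directed m l
  funext k
  rw [← sub_eq_zero]
  refine hD.sep r _ fun i => ?_
  obtain ⟨i₁, hi₁⟩ := D.fil_mono hmr i
  obtain ⟨i₂, hi₂⟩ := D.fil_mono hlr i
  obtain ⟨n₀, h₀⟩ := h i₂
  obtain ⟨n₁, h₁⟩ := h' i₂
  obtain ⟨n₂, h₂⟩ := hm.2 i₁
  let n := max n₀ (max n₁ n₂)
  have e0 := hi₂ (h₀ n (le_max_left _ _) k)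
  have e1 := hi₂ (h₁ n ((le_max_left _ _).trans (le_max_right _ _)) k)
  have e2 := hi₁ ((mem_range_lTensor_iff β _ _).1
    (h₂ n ((le_max_right _ _).trans (le_max_right _ _))) k)
  rw [Pi.sub_apply, map_sub, Finsupp.sub_apply] at e2
  have := Submodule.add_mem _ (Submodule.sub_mem _ e1 e0) e2
  convert this using 1
  abel

theorem crd_map (f : B →ₗ[K] B') (x : O ⊗[K] B) (k : ι) :
    crd B' β (TensorProduct.map LinearMap.id f x) k = f (crd B β x k) := by
  classical
  induction x using TensorProduct.induction_on with
  | zero => simp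
  | add x y hx hy => simp only [map_add, Finsupp.add_apply, hx, hy]
  | tmul o b =>
    rw [TensorProduct.map_tmul, TensorProduct.equivFinsuppOfBasisLeft_apply_tmul_apply,
      TensorProduct.equivFinsuppOfBasisLeft_apply_tmul_apply, map_smul]
    rfl

theorem HasCoord.map {f : B →ₗ[K] B'} (hf : IsCont D D' f) {u : (D.tens O).Compl} {c : ι → B}
    (h : HasCoord β u c) : HasCoord β
      (Compl.map (TensorProduct.map LinearMap.id f) (hf.tens (LinearMap.id : O →ₗ[K] O)) u)
      (fun k => f (c k)) := by
  obtain ⟨j, h1, h2, x, hx, h3, h4⟩ := h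
  obtain ⟨j', k, k'⟩ := hf j
  refine ⟨j', fun l => k _ (h1 l), fun i' => ?_, _, hx.map (hf.tens LinearMap.id), fun n l => ?_,
    fun i' => ?_⟩
  · obtain ⟨i, hi⟩ := k' i'
    exact (h2 i).subset fun l hl hl' => hl (hi _ hl')
  · rw [crd_map]
    exact k _ (h3 n l)
  · obtain ⟨i, hi⟩ := k' i'
    obtain ⟨n₀, h⟩ := h4 i
    refine ⟨n₀, fun n hn l => ?_⟩
    rw [crd_map, ← map_sub]
    exact hi _ (h n hn l)

theorem HasCoord.zero : HasCoord β (0 : (D.tens O).Compl) 0 := by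
  obtain ⟨j⟩ := D.nonempty
  refine ⟨j, fun k => Submodule.zero_mem _, fun i => ?_, 0, Lim.zero, fun n k => ?_,
    fun i => ⟨0, fun n _ k => ?_⟩⟩
  · convert Set.finite_empty (α := ι)
    ext k
    simp
  · simp
  · simp

end DirInv

section CellGluing

variable {K : Type u} [Field K] {X : Scheme.{u}} [X.Over (Spec (CommRingCat.of K))]
  [LocallyOfFiniteType (X ↘ Spec (CommRingCat.of K))]

theorem sec.dirInv_isGood (M : X.Modules) (W : X.Opens) : (sec.dirInv K M W).IsGood where
  sep F x hx := sec.eq_zero_of_forall_mem_pow F fun n V =>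
    F.pow_anti V.1 (Nat.le_succ n) (hx n V)
  complete F x hx hx' := by
    let z : ℕ → sec K M W := fun n => Nat.casesOn n (x 0) x
    obtain ⟨y, hy, hy'⟩ := sec.exists_limit F z (hx 0) (fun n => by
      cases n with
      | zero =>
        change x 0 - x 0 ∈ _
        rw [sub_self]
        exact Submodule.zero_mem _
      | succ n => exact hx' n)
    exact ⟨y, hy, fun n => hy' (n + 1)⟩

variable {M : X.Modules} {W : X.Opens} {l : ℕ} {ι : Type*} {W' : ι → X.Opens}

theorem Cell.hasCoord_map {ι : Type*} {β : Module.Basis ι K (Sx K l)} {W' : X.Opens} (h : W' ≤ W)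
    {b : Cell K M W l} {c : ι → sec K M W} (hc : DirInv.HasCoord (D := sec.dirInv K M W) β b c) :
    DirInv.HasCoord (D := sec.dirInv K M W') β (Cell.map K LinearMap.id h b)
      (fun k => sec.res K M h (c k)) :=
  DirInv.HasCoord.map (sec.isCont_res K h) hc

theorem Cell.eq_zero_of_local (hM : IsLocMod K M) (hle : ∀ a, W' a ≤ W) (hW : W ≤ ⨆ a, W' a)
    {b : Cell K M W l} (hb : ∀ a, Cell.map K LinearMap.id (hle a) b = 0) : b = 0 := by
  let β := Module.Basis.ofVectorSpace K (Sx K l)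
  obtain ⟨c, hc⟩ := DirInv.exists_hasCoord β (sec.dirInv_isGood M W) b
  have hc0 : c = 0 := by
    funext k
    have hc' := hc
    obtain ⟨F, hF, -⟩ := hc'
    refine sec.eq_zero_of_local F hM hle hW (hF k) fun a => ?_
    have h := Cell.hasCoord_map (hle a) hc
    rw [hb a] at h
    exact congrFun (h.coord_unique (sec.dirInv_isGood M _) DirInv.HasCoord.zero) k
  rw [hc0] at hc
  exact hc.unique DirInv.HasCoord.zero

theorem Cell.eq_of_local (hM : IsLocMod K M) (hle : ∀ a, W' a ≤ W) (hW : W ≤ ⨆ a, W' a)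
    {b b' : Cell K M W l}
    (hb : ∀ a, Cell.map K LinearMap.id (hle a) b = Cell.map K LinearMap.id (hle a) b') :
    b = b' :=
  sub_eq_zero.1 (Cell.eq_zero_of_local hM hle hW fun a => by rw [map_sub, hb a, sub_self])

theorem Coh.exists_ge [Finite ι] (F : ι → Coh K M) : ∃ G, ∀ a, F a ≤ G := by
  have : IsDirectedOrder (Coh K M) := ⟨fun F G => ⟨F ⊔ G, Coh.le_sup_left F G, Coh.le_sup_right F G⟩⟩
  have : Nonempty (Coh K M) := ⟨⊥⟩
  exact Finite.exists_le F

theorem Cell.exists_glue [Finite ι] (hM : IsLocMod K M) (hle : ∀ a, W' a ≤ W)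
    (hW : W ≤ ⨆ a, W' a) (b : ∀ a, Cell K M (W' a) l)
    (hb : ∀ a a', Cell.map K LinearMap.id (inf_le_left : W' a ⊓ W' a' ≤ W' a) (b a) =
      Cell.map K LinearMap.id (inf_le_right : W' a ⊓ W' a' ≤ W' a') (b a')) :
    ∃ b' : Cell K M W l, ∀ a, Cell.map K LinearMap.id (hle a) b' = b a := by
  let β := Module.Basis.ofVectorSpace K (Sx K l)
  choose c hc using fun a => DirInv.exists_hasCoord β (sec.dirInv_isGood M (W' a)) (b a)
  choose F' hF' using fun a => (hc a).mono
  obtain ⟨F, hF⟩ := Coh.exists_ge F'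
  have hxx : ∀ k a a', sec.res K M (inf_le_left : W' a ⊓ W' a' ≤ W' a) (c a k) =
      sec.res K M (inf_le_right : W' a ⊓ W' a' ≤ W' a') (c a' k) := by
    intro k a a'
    have h := Cell.hasCoord_map (inf_le_left : W' a ⊓ W' a' ≤ W' a) (hc a)
    have h' := Cell.hasCoord_map (inf_le_right : W' a ⊓ W' a' ≤ W' a') (hc a')
    rw [hb a a'] at h
    exact congrFun (h.coord_unique (sec.dirInv_isGood M _) h') k
  choose y hy hy' using fun k => sec.exists_glue F hM hle hW (fun a => c a k)
    (fun a => (hF' a F (hF a)).1 k) (hxx k)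
  obtain ⟨b', hb'⟩ := DirInv.exists_of_coord (D := sec.dirInv K M W) β F y hy fun i => by
    refine (Set.finite_iUnion fun a => (hF' a F (hF a)).2.1 i).subset fun k hk => ?_
    by_contra h
    rw [Set.mem_iUnion, not_exists] at h
    refine hk (sec.mem_pow_of_local F hM hle hW (hy k) fun a => ?_)
    rw [hy' k a]
    exact not_not.1 (h a)
  refine ⟨b', fun a => ?_⟩
  have h := Cell.hasCoord_map (hle a) hb'
  simp only [hy'] at h
  exact h.unique (hc a)

end CellGluing

namespace DR

section Basic

variable {K : Type*} [CommRing K] {R : Type*} [CommRing R] [Algebra K R]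

theorem sgn_sgn (a : DR K R) : sgn K R (sgn K R a) = a := CliffordAlgebra.involute_involute a

theorem d_sgn (a : DR K R) : d K R (sgn K R a) = -sgn K R (d K R a) := by
  induction a using induction' with
  | h0 r => rw [AlgHom.commutes, d_algebraMap, sgn_ι, neg_neg]
  | h1 r => rw [sgn_ι, map_neg, d_ofD, map_zero]
  | hm a b ha hb =>
    simp only [map_mul, d_mul, map_add, ha, hb, sgn_sgn, mul_neg, neg_mul, neg_add]
  | ha a b ha hb => simp only [map_add, ha, hb, neg_add]

theorem d_d (a : DR K R) : d K R (d K R a) = 0 := by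
  induction a using induction' with
  | h0 r => rw [d_algebraMap, d_ofD]
  | h1 r => rw [d_ofD, map_zero]
  | hm a b ha hb =>
    simp only [d_mul, map_add, ha, hb, d_sgn, zero_mul, mul_zero, neg_mul, zero_add, add_zero]
    exact add_neg_cancel _
  | ha a b ha hb => simp only [map_add, ha, hb, add_zero]

theorem sgn_of_mem {q : ℕ} {w : DR K R} (hw : w ∈ (⋀[R]^q Ω[R⁄K] : Submodule R (DR K R))) :
    sgn K R w = (-1 : R) ^ q • w := by
  induction hw using Submodule.pow_induction_on_left' with
  | algebraMap r => rw [AlgHom.commutes, pow_zero, one_smul]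
  | add x y i _ _ hx hy => rw [map_add, hx, hy, smul_add]
  | mem_mul v hv i x _ hx =>
    obtain ⟨w, rfl⟩ := hv
    rw [map_mul, sgn_ι, hx, pow_succ]
    simp

theorem mul_of_mem {q : ℕ} {w : DR K R} (hw : w ∈ (⋀[R]^q Ω[R⁄K] : Submodule R (DR K R)))
    (a : DR K R) : w * a = (sgn K R)^[q] a * w := by
  induction hw using Submodule.pow_induction_on_left' generalizing a with
  | algebraMap r => exact Algebra.commutes r a
  | add x y i _ _ hx hy => rw [add_mul, hx, hy, mul_add]
  | mem_mul v hv i x _ hx =>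
    obtain ⟨w, rfl⟩ := hv
    rw [mul_assoc, hx, ← mul_assoc, ι_mul, mul_assoc, Function.iterate_succ_apply']

theorem induction_deg {P : DR K R → Prop} (h : ∀ q, ∀ w ∈ (⋀[R]^q Ω[R⁄K] : Submodule R (DR K R)), P w)
    (ha : ∀ a b, P a → P b → P (a + b)) (a : DR K R) : P a := by
  have : a ∈ ⨆ q, (⋀[R]^q Ω[R⁄K] : Submodule R (DR K R)) := by
    rw [(DirectSum.Decomposition.isInternal
      (fun q : ℕ => (⋀[R]^q Ω[R⁄K] : Submodule R (DR K R)))).submodule_iSup_eq_top]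
    trivial
  induction this using Submodule.iSup_induction' with
  | mem q w hw => exact h q w hw
  | zero => exact h 0 0 (Submodule.zero_mem _)
  | add x y _ _ hx hy => exact ha x y hx hy

theorem two_mul_comm (a b : DR K R) :
    (2 : R) • (b * a) = a * b + a * sgn K R b + sgn K R a * b - sgn K R a * sgn K R b := by
  induction a using induction_deg with
  | ha a a' ha ha' => simp only [mul_add, smul_add, ha, ha', map_add, add_mul]; abel
  | h p a hp =>
    induction b using induction_deg with
    | ha b b' hb hb' => simp only [mul_add, smul_add, hb, hb', map_add, add_mul]; abel
    | h q b hq =>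
      have e : ∀ i, (sgn K R)^[i] a = (-1 : R) ^ (i * p) • a := by
        intro i
        induction i with
        | zero => simp
        | succ i ih =>
          rw [Function.iterate_succ_apply', ih, map_smul, sgn_of_mem hp, smul_smul, ← pow_add]
          congr 2; ring
      rw [mul_of_mem hq, e, sgn_of_mem hp, sgn_of_mem hq]
      simp only [smul_mul_assoc, mul_smul_comm, smul_smul]
      have h1 : a * b = (1 : R) • (a * b) := (one_smul _ _).symm
      nth_rewrite 2 [h1]
      rw [← add_smul, ← add_smul, ← sub_smul]
      congr 1
      rcases Nat.even_or_odd p with hp' | hp' <;> rcases Nat.even_or_odd q with hq' | hq'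
      · rw [(hq'.mul_right p).neg_one_pow, hp'.neg_one_pow, hq'.neg_one_pow]; ring
      · rw [(hp'.mul_left q).neg_one_pow, hp'.neg_one_pow, hq'.neg_one_pow]; ring
      · rw [(hq'.mul_right p).neg_one_pow, hp'.neg_one_pow, hq'.neg_one_pow]; ring
      · rw [(hq'.mul hp').neg_one_pow, hp'.neg_one_pow, hq'.neg_one_pow]; ring

variable (K R) in
/-- The projection to the forms of degree `q`. -/
def proj (q : ℕ) : DR K R →ₗ[R] DR K R :=
  GradedAlgebra.proj (fun q : ℕ => (⋀[R]^q Ω[R⁄K] : Submodule R (DR K R))) q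

theorem proj_mem (q : ℕ) (a : DR K R) : proj K R q a ∈ (⋀[R]^q Ω[R⁄K] : Submodule R (DR K R)) :=
  SetLike.coe_mem _

theorem proj_of_mem {q : ℕ} {a : DR K R} (ha : a ∈ (⋀[R]^q Ω[R⁄K] : Submodule R (DR K R))) :
    proj K R q a = a :=
  DirectSum.decompose_of_mem_same (fun q : ℕ => (⋀[R]^q Ω[R⁄K] : Submodule R (DR K R))) ha

theorem proj_of_mem_ne {q q' : ℕ} (h : q ≠ q') {a : DR K R}
    (ha : a ∈ (⋀[R]^q Ω[R⁄K] : Submodule R (DR K R))) : proj K R q' a = 0 :=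
  DirectSum.decompose_of_mem_ne (fun q : ℕ => (⋀[R]^q Ω[R⁄K] : Submodule R (DR K R))) ha h

theorem one_mem_deg : (1 : DR K R) ∈ (⋀[R]^0 Ω[R⁄K] : Submodule R (DR K R)) :=
  SetLike.GradedOne.one_mem (A := fun q : ℕ => (⋀[R]^q Ω[R⁄K] : Submodule R (DR K R)))

theorem mul_mem_deg {p q : ℕ} {a b : DR K R}
    (ha : a ∈ (⋀[R]^p Ω[R⁄K] : Submodule R (DR K R)))
    (hb : b ∈ (⋀[R]^q Ω[R⁄K] : Submodule R (DR K R))) :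
    a * b ∈ (⋀[R]^(p + q) Ω[R⁄K] : Submodule R (DR K R)) :=
  SetLike.GradedMul.mul_mem (A := fun q : ℕ => (⋀[R]^q Ω[R⁄K] : Submodule R (DR K R))) ha hb

theorem ι_mem_deg (w : Ω[R⁄K]) :
    ExteriorAlgebra.ι R w ∈ (⋀[R]^1 Ω[R⁄K] : Submodule R (DR K R)) := by
  change _ ∈ LinearMap.range (ExteriorAlgebra.ι R) ^ 1
  rw [pow_one]
  exact ⟨w, rfl⟩

theorem d_mem_deg {q : ℕ} {a : DR K R} (ha : a ∈ (⋀[R]^q Ω[R⁄K] : Submodule R (DR K R))) :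
    d K R a ∈ (⋀[R]^(q + 1) Ω[R⁄K] : Submodule R (DR K R)) := by
  have key : ∀ w : Ω[R⁄K], d K R (ExteriorAlgebra.ι R w) ∈ (⋀[R]^2 Ω[R⁄K] : Submodule R (DR K R)) := by
    intro w
    have hw : w ∈ Submodule.span R (Set.range (KaehlerDifferential.D K R)) := by
      rw [KaehlerDifferential.span_range_derivation]; trivial
    induction hw using Submodule.span_induction with
    | mem x hx => obtain ⟨r, rfl⟩ := hx; rw [d_ofD]; exact Submodule.zero_mem _
    | zero => rw [map_zero, map_zero]; exact Submodule.zero_mem _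
    | add x y _ _ hx hy => rw [map_add, map_add]; exact Submodule.add_mem _ hx hy
    | smul r x _ hx =>
      rw [map_smul, d_smul]
      exact Submodule.add_mem _ (mul_mem_deg (ι_mem_deg _) (ι_mem_deg _))
        (Submodule.smul_mem _ _ hx)
  induction ha using Submodule.pow_induction_on_left' with
  | algebraMap r => rw [d_algebraMap]; exact ι_mem_deg _
  | add x y i _ _ hx hy => rw [map_add]; exact Submodule.add_mem _ hx hy
  | mem_mul v hv i x hx' hx =>
    obtain ⟨w, rfl⟩ := hv
    rw [d_mul, sgn_ι, neg_mul]
    refine Submodule.add_mem _ ?_ (Submodule.neg_mem _ ?_)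
    · have := mul_mem_deg (key w) hx'
      rwa [show 2 + i = i + 1 + 1 by omega] at this
    · have := mul_mem_deg (ι_mem_deg w) hx
      rwa [show 1 + (i + 1) = i + 1 + 1 by omega] at this

end Basic

section Functoriality

variable {K : Type*} [CommRing K] {R : Type*} [CommRing R] [Algebra K R] {S : Type*} [CommRing S]
  [Algebra K S]

theorem map_mem_deg (f : R →ₐ[K] S) {q : ℕ} {a : DR K R}
    (ha : a ∈ (⋀[R]^q Ω[R⁄K] : Submodule R (DR K R))) :
    map f a ∈ (⋀[S]^q Ω[S⁄K] : Submodule S (DR K S)) := by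
  have key : ∀ w : Ω[R⁄K], map f (ExteriorAlgebra.ι R w) ∈ (⋀[S]^1 Ω[S⁄K] : Submodule S (DR K S)) := by
    intro w
    have hw : w ∈ Submodule.span R (Set.range (KaehlerDifferential.D K R)) := by
      rw [KaehlerDifferential.span_range_derivation]; trivial
    induction hw using Submodule.span_induction with
    | mem x hx => obtain ⟨r, rfl⟩ := hx; rw [map_ofD]; exact ι_mem_deg _
    | zero => rw [map_zero, map_zero]; exact Submodule.zero_mem _
    | add x y _ _ hx hy => rw [map_add, map_add]; exact Submodule.add_mem _ hx hy
    | smul r x _ hx => rw [map_smul, map_smul']; exact Submodule.smul_mem _ _ hx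
  induction ha using Submodule.pow_induction_on_left' with
  | algebraMap r =>
    rw [map_algebraMap, Algebra.algebraMap_eq_smul_one]
    exact Submodule.smul_mem _ _ one_mem_deg
  | add x y i _ _ hx hy => rw [map_add]; exact Submodule.add_mem _ hx hy
  | mem_mul v hv i x _ hx =>
    obtain ⟨w, rfl⟩ := hv
    rw [map_mul]
    have := mul_mem_deg (key w) hx
    rwa [add_comm] at this

theorem map_proj (f : R →ₐ[K] S) (q : ℕ) (a : DR K R) :
    map f (proj K R q a) = proj K S q (map f a) := by
  induction a using induction_deg with
  | ha a b ha hb => simp only [map_add, ha, hb]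
  | h p a hp =>
    rcases eq_or_ne p q with rfl | h
    · rw [proj_of_mem hp, proj_of_mem (map_mem_deg f hp)]
    · rw [proj_of_mem_ne h hp, proj_of_mem_ne h (map_mem_deg f hp), map_zero]

end Functoriality

end DR

section OmegaPAlgebra

variable {K : Type*} [Field K] {C : Type*} [CommRing C] [Algebra K C]

namespace OmegaP

theorem tmul_zero (b : PP K C) : tmul b (0 : DR K C) = 0 := TensorProduct.tmul_zero _ _

theorem tmul_neg (b : PP K C) (w : DR K C) : tmul b (-w) = -tmul b w := TensorProduct.tmul_neg _ _

theorem tmul_sub (b : PP K C) (w w' : DR K C) : tmul b (w - w') = tmul b w - tmul b w' :=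
  TensorProduct.tmul_sub _ _ _

theorem sgn_sgn (x : OmegaP K C) : sgn K C (sgn K C x) = x := by
  induction x using OmegaP.induction with
  | h0 => simp
  | ht b w => rw [sgn_tmul, sgn_tmul, DR.sgn_sgn]
  | ha x y hx hy => simp only [map_add, hx, hy]

theorem two_mul_comm (x y : OmegaP K C) :
    (2 : PP K C) • (y * x) = x * y + x * sgn K C y + sgn K C x * y - sgn K C x * sgn K C y := by
  induction x using OmegaP.induction with
  | h0 => simp
  | ha x x' hx hx' => simp only [mul_add, smul_add, hx, hx', map_add, add_mul]; abel
  | ht b w =>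
    induction y using OmegaP.induction with
    | h0 => simp
    | ha x x' hx hx' => simp only [mul_add, smul_add, hx, hx', map_add, add_mul]; abel
    | ht b' w' =>
      simp only [sgn_tmul, tmul_mul, mul_comm b' b]
      have h := DR.two_mul_comm w w'
      have h2 : (2 : PP K C) • tmul (b * b') (w' * w) = tmul (b * b') ((2 : C) • (w' * w)) := by
        rw [tmul_smul, map_ofNat, smul_tmul]
      rw [h2, h, tmul_sub, tmul_add, tmul_add]

theorem ofOne_mul (z : PP K C ⊗[C] Ω[C⁄K]) (w : DR K C) :
    ofOne K C z * tmul 1 w = tmul 1 (DR.sgn K C w) * ofOne K C z := by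
  induction z using TensorProduct.induction_on with
  | zero => simp
  | add x y hx hy => simp only [map_add, add_mul, mul_add, hx, hy]
  | tmul b v => rw [ofOne_tmul, tmul_mul, tmul_mul, DR.ι_mul, mul_comm]

theorem sgn_ofOne (z : PP K C ⊗[C] Ω[C⁄K]) : sgn K C (ofOne K C z) = -ofOne K C z := by
  induction z using TensorProduct.induction_on with
  | zero => simp
  | add x y hx hy => simp only [map_add, hx, hy, neg_add]
  | tmul b v => rw [ofOne_tmul, sgn_tmul, DR.sgn_ι]; exact tmul_neg _ _

end OmegaP

variable [Algebra.FiniteType K C]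

theorem PP.gradHat_mul (b b' : PP K C) :
    PP.gradHat K C (b * b') = b • PP.gradHat K C b' + b' • PP.gradHat K C b := by
  obtain ⟨y, rfl⟩ := AdicCompletion.mk_surjective _ _ b
  obtain ⟨y', rfl⟩ := AdicCompletion.mk_surjective _ _ b'
  refine AdicCompletion.ext fun n => ?_
  have h : ∀ y y' : AdicCompletion.AdicCauchySequence (KaehlerDifferential.ideal K C) (C ⊗[K] C),
      (AdicCompletion.mk (KaehlerDifferential.ideal K C) (C ⊗[K] C) y •
      PP.gradHat K C (AdicCompletion.mk _ _ y')).val n =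
      Submodule.Quotient.mk (y (n + 1) • PP.dOne K C (y' (n + 1))) := by
    intro y y'
    have hy := AdicCompletion.Ideal.mk_eq_mk (KaehlerDifferential.ideal K C) (Nat.le_succ n) y
    rw [Ideal.Quotient.mk_eq_mk_iff_sub_mem] at hy
    change Submodule.Quotient.mk (y n • PP.dOne K C (y' (n + 1))) = _
    refine (((Submodule.Quotient.eq _).2 ?_)).symm
    have h' := Submodule.smul_mem_smul hy (show PP.dOne K C (y' (n + 1)) ∈
      (⊤ : Submodule (C ⊗[K] C) _) from trivial)
    rwa [sub_smul] at h'
  rw [AdicCompletion.val_add_apply, h, h]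
  change PP.gradLevel K C n (Submodule.Quotient.mk (y (n + 1) * y' (n + 1))) = _
  rw [PP.gradLevel_mk, PP.dOne_mul]
  rfl

namespace OmegaP

theorem gradP_mul (b b' : PP K C) :
    gradP K C (b * b') = b • gradP K C b' + b' • gradP K C b := by
  simp only [gradP, LinearMap.comp_apply, LinearMap.restrictScalars_apply, PP.gradHat_mul,
    LinearEquiv.coe_coe, map_add, map_smul]

theorem gradP_mem_range (b : PP K C) : gradP K C b ∈ LinearMap.range (ofOne K C) := ⟨_, rfl⟩

theorem gradP_one : gradP K C 1 = 0 := by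
  have h := gradP_mul (K := K) (C := C) 1 1
  rw [one_mul, one_smul] at h
  simpa using h

theorem gradP_mul_tmul (b : PP K C) (w : DR K C) :
    gradP K C b * tmul 1 w = tmul 1 (DR.sgn K C w) * gradP K C b := ofOne_mul _ _

theorem sgn_gradP (b : PP K C) : sgn K C (gradP K C b) = -gradP K C b := sgn_ofOne _

theorem nabla_mul (x y : OmegaP K C) :
    nabla K C (x * y) = nabla K C x * y + sgn K C x * nabla K C y := by
  induction x using OmegaP.induction with
  | h0 => simp
  | ha x x' hx hx' => simp only [add_mul, map_add, hx, hx']; abel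
  | ht b w =>
    induction y using OmegaP.induction with
    | h0 => simp
    | ha y y' hy hy' => simp only [mul_add, map_add, hy, hy']; abel
    | ht b' w' =>
      rw [tmul_mul, nabla_tmul, nabla_tmul, nabla_tmul, gradP_mul, DR.d_mul, tmul_add, sgn_tmul,
        add_mul, add_mul, mul_add, tmul_mul, tmul_mul]
      have e1 : gradP K C b * tmul 1 w * tmul b' w' = b' • gradP K C b * tmul 1 (w * w') := by
        rw [mul_assoc, tmul_mul, one_mul, smul_mul_assoc, ← mul_smul_comm, smul_tmul, mul_one]
      have e2 : tmul b (DR.sgn K C w) * (gradP K C b' * tmul 1 w') =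
          b • gradP K C b' * tmul 1 (w * w') := by
        have : tmul b (DR.sgn K C w) = b • tmul 1 (DR.sgn K C w) := by rw [smul_tmul, mul_one]
        rw [this, smul_mul_assoc, ← mul_assoc, ← gradP_mul_tmul, mul_assoc, tmul_mul, one_mul,
          smul_mul_assoc]
      rw [e1, e2]
      abel

theorem nabla_sgn (x : OmegaP K C) : nabla K C (sgn K C x) = -sgn K C (nabla K C x) := by
  induction x using OmegaP.induction with
  | h0 => simp
  | ha x x' hx hx' => simp only [map_add, hx, hx', neg_add]
  | ht b w =>
    rw [sgn_tmul, nabla_tmul, nabla_tmul, map_add, _root_.map_mul, sgn_gradP, sgn_tmul, sgn_tmul,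
      DR.d_sgn, neg_mul, neg_add, neg_neg, tmul_neg]

theorem nabla_one : nabla K C (1 : OmegaP K C) = 0 := by
  have h : (1 : OmegaP K C) = tmul 1 1 := rfl
  have h' := DR.d_algebraMap K (R := C) 1
  rw [map_one, DR.ofD, Derivation.map_one_eq_zero, map_zero] at h'
  rw [h, nabla_tmul, gradP_one, zero_mul, zero_add, h', tmul_zero]

theorem nabla_smulP (b : PP K C) (x : OmegaP K C) :
    nabla K C (b • x) = gradP K C b * x + b • nabla K C x := by
  have h := nabla_mul (tmul b 1) x
  have e : ∀ y : OmegaP K C, tmul b 1 * y = b • y := fun y => by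
    have : tmul b (1 : DR K C) = b • 1 := by
      change _ = b • tmul 1 1
      rw [smul_tmul, mul_one]
    rw [this, smul_mul_assoc, one_mul]
  have e' : nabla K C (tmul b 1) = gradP K C b := by
    have h1 : tmul b (1 : DR K C) = b • (1 : OmegaP K C) := by
      change _ = b • tmul 1 1
      rw [smul_tmul, mul_one]
    have h' := DR.d_algebraMap K (R := C) 1
    rw [map_one, DR.ofD, Derivation.map_one_eq_zero, map_zero] at h'
    have h2 : tmul (1 : PP K C) (1 : DR K C) = 1 := rfl
    rw [nabla_tmul, h', tmul_zero, add_zero, h2, mul_one]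
  rwa [sgn_tmul, map_one, e, e, e'] at h

/-- The Leibniz rule bounds the effect of a derivation on powers of an ideal. -/
theorem _root_.MixRes.mem_pow_smul_of_leibniz {A N : Type*} [CommRing A] [AddCommGroup N]
    [Module A N] (I : Ideal A) (S : Submodule A N) (D : A →+ N)
    (hD : ∀ a b, D (a * b) = a • D b + b • D a) (hS : ∀ a, D a ∈ S) (n : ℕ) {a : A}
    (ha : a ∈ I ^ (n + 1)) : D a ∈ I ^ n • S := by
  induction n generalizing a with
  | zero => simpa using hS a
  | succ n ih =>
    rw [pow_succ] at ha
    induction ha using Submodule.mul_induction_on' with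
    | mem_mul_mem x hx y hy =>
      rw [hD]
      refine Submodule.add_mem _ (Submodule.smul_mem_smul hx (hS _)) ?_
      rw [pow_succ', ← smul_eq_mul, Submodule.smul_assoc]
      exact Submodule.smul_mem_smul hy (ih hx)
    | add x _ y _ hx hy => rw [map_add]; exact Submodule.add_mem _ hx hy

theorem gradP_mem_pow (n : ℕ) {b : PP K C} (hb : b ∈ PP.aug K C ^ (n + 1)) :
    gradP K C b ∈ (PP.aug K C ^ n • ⊤ : Submodule (PP K C) (OmegaP K C)) :=
  mem_pow_smul_of_leibniz _ _ (gradP K C).toAddMonoidHom gradP_mul (fun _ => Submodule.mem_top) n hb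

instance : Module.Finite (PP K C) (OmegaP K C) :=
  inferInstanceAs (Module.Finite (PP K C) (PP K C ⊗[C] DR K C))

theorem eq_zero_of_forall_mem_pow {x : OmegaP K C}
    (hx : ∀ n, x ∈ (PP.aug K C ^ n • ⊤ : Submodule (PP K C) (OmegaP K C))) : x = 0 :=
  eq_zero_of_forall_mem_pow_smul (PP.aug K C) Module.Finite.fg_top hx

theorem gradP_of (x y : C) :
    gradP K C (PP.of K C (x ⊗ₜ y)) = PP.p₂ K C y • tmul 1 (DR.ofD K x) := by
  have h : PP.of K C (x ⊗ₜ y) = PP.p₂ K C y * (PP.p₁ K C x * 1) := by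
    rw [mul_one]
    change _ = PP.of K C (1 ⊗ₜ y) * PP.of K C (x ⊗ₜ 1)
    rw [← _root_.map_mul, Algebra.TensorProduct.tmul_mul_tmul, one_mul, mul_one]
  rw [h, gradP_p₂_mul, gradP_p₁_mul, gradP_one, smul_zero, zero_add]

theorem nabla_gradP (b : PP K C) : nabla K C (gradP K C b) = 0 := by
  let D : PP K C →+ OmegaP K C := ((nabla K C).toAddMonoidHom).comp (gradP K C).toAddMonoidHom
  have hD : ∀ a b, D (a * b) = a • D b + b • D a := by
    intro a b
    change nabla K C (gradP K C (a * b)) = a • nabla K C (gradP K C b) + b • nabla K C (gradP K C a)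
    rw [gradP_mul, map_add, nabla_smulP, nabla_smulP]
    have h : gradP K C b * gradP K C a = - (gradP K C a * gradP K C b) := by
      obtain ⟨z, hz⟩ := gradP_mem_range b
      rw [← hz]
      clear hz
      induction z using TensorProduct.induction_on with
      | zero => simp
      | add x y hx hy => simp only [map_add, add_mul, mul_add, hx, hy, neg_add]
      | tmul c v =>
        have e : tmul c (ExteriorAlgebra.ι C v) = c • tmul 1 (ExteriorAlgebra.ι C v) := by
          rw [smul_tmul, mul_one]
        rw [ofOne_tmul, e, mul_smul_comm, gradP_mul_tmul, DR.sgn_ι, tmul_neg, smul_mul_assoc, neg_mul,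
          smul_neg, neg_neg]
    rw [h]
    abel
  have hof : ∀ a : C ⊗[K] C, D (PP.of K C a) = 0 := by
    intro a
    induction a using TensorProduct.induction_on with
    | zero => simp
    | add x y hx hy => simp only [map_add, hx, hy, add_zero]
    | tmul x y =>
      change nabla K C (gradP K C (PP.of K C (x ⊗ₜ y))) = 0
      rw [gradP_of, ← smul_def, map_smul, nabla_tmul, gradP_one, zero_mul, DR.d_ofD, zero_add, tmul_zero,
        smul_zero]
  refine eq_zero_of_forall_mem_pow fun n => ?_
  obtain ⟨a, ha⟩ := PP.exists_of_sub_mem (n + 1) b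
  have h := mem_pow_smul_of_leibniz _ ⊤ D hD (fun _ => Submodule.mem_top) n ha
  rwa [map_sub, hof, sub_zero] at h

theorem nabla_nabla (x : OmegaP K C) : nabla K C (nabla K C x) = 0 := by
  induction x using OmegaP.induction with
  | h0 => simp
  | ha x x' hx hx' => simp only [map_add, hx, hx', add_zero]
  | ht b w =>
    rw [nabla_tmul, map_add, nabla_mul, nabla_gradP, zero_mul, sgn_gradP, nabla_tmul, gradP_one,
      nabla_tmul, DR.d_d, tmul_zero, zero_mul, zero_add, zero_add, add_zero, neg_mul, neg_add_cancel]

end OmegaP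

end OmegaPAlgebra

section CoefficientAlgebra

variable {K : Type*} [Field K] {C : Type*} [CommRing C] [Algebra K C]
  {N : Type*} [AddCommGroup N] [Module C N]
  {C' : Type*} [CommRing C'] [Algebra K C'] {N' : Type*} [AddCommGroup N'] [Module C' N']

namespace OmegaP

theorem degP_induction {p : ℕ} {P : OmegaP K C → Prop}
    (ht : ∀ b, ∀ w ∈ (⋀[C]^p Ω[C⁄K] : Submodule C (DR K C)), P (tmul b w))
    (ha : ∀ x y, P x → P y → P (x + y)) {x : OmegaP K C} (hx : x ∈ degP K C p) : P x := by
  obtain ⟨z, rfl⟩ := hx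
  induction z using TensorProduct.induction_on with
  | zero =>
    rw [map_zero, ← tmul_zero 0]
    exact ht 0 0 (Submodule.zero_mem _)
  | add x y hx hy => rw [map_add]; exact ha _ _ hx hy
  | tmul b w => exact ht b w.1 w.2

theorem tmul_mem_degP {p : ℕ} (b : PP K C) {w : DR K C}
    (hw : w ∈ (⋀[C]^p Ω[C⁄K] : Submodule C (DR K C))) : tmul b w ∈ degP K C p :=
  ⟨b ⊗ₜ ⟨w, hw⟩, rfl⟩

variable (K C) in
/-- The projection `Ω ⊗ P → Ω^p ⊗ P`. -/
def proj (p : ℕ) : OmegaP K C →ₗ[C] OmegaP K C where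
  toFun := AlgebraTensorModule.lTensor (PP K C) (PP K C) (DR.proj K C p)
  map_add' := map_add _
  map_smul' c x := by
    rw [smul_def]
    exact (map_smul (AlgebraTensorModule.lTensor (PP K C) (PP K C) (DR.proj K C p))
      (PP.p₂ K C c) x).trans (smul_def K C c _).symm

theorem mul_mem_degP {p q : ℕ} {x y : OmegaP K C} (hx : x ∈ degP K C p) (hy : y ∈ degP K C q) :
    x * y ∈ degP K C (p + q) := by
  refine degP_induction (P := fun x => x * y ∈ degP K C (p + q)) (fun b w hw => ?_)
    (fun x x' h h' => by rw [add_mul]; exact Submodule.add_mem _ h h') hx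
  refine degP_induction (P := fun y => tmul b w * y ∈ degP K C (p + q)) (fun b' w' hw' => ?_)
    (fun x x' h h' => by rw [mul_add]; exact Submodule.add_mem _ h h') hy
  rw [tmul_mul]
  exact tmul_mem_degP _ (DR.mul_mem_deg hw hw')

theorem ofOne_mem_degP (z : PP K C ⊗[C] Ω[C⁄K]) : ofOne K C z ∈ degP K C 1 := by
  induction z using TensorProduct.induction_on with
  | zero => rw [map_zero]; exact Submodule.zero_mem _
  | add x y hx hy => rw [map_add]; exact Submodule.add_mem _ hx hy
  | tmul b v => exact tmul_mem_degP _ (DR.ι_mem_deg v)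

theorem one_mem_degP : (1 : OmegaP K C) ∈ degP K C 0 := tmul_mem_degP 1 DR.one_mem_deg

theorem nabla_mem_degP [Algebra.FiniteType K C] {p : ℕ} {x : OmegaP K C} (hx : x ∈ degP K C p) :
    nabla K C x ∈ degP K C (p + 1) := by
  refine degP_induction (P := fun x => nabla K C x ∈ degP K C (p + 1)) (fun b w hw => ?_)
    (fun x x' h h' => by rw [map_add]; exact Submodule.add_mem _ h h') hx
  rw [nabla_tmul]
  refine Submodule.add_mem _ ?_ (tmul_mem_degP _ (DR.d_mem_deg hw))
  have := mul_mem_degP (ofOne_mem_degP ((PP.eqv K C).symm (PP.gradHat K C b)))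
    (tmul_mem_degP 1 hw)
  rwa [add_comm] at this

end OmegaP

namespace NN

theorem smul_smulP (b : PP K C) (a : OmegaP K C) (x : NN K C N) : (b • a) • x = b • a • x := by
  induction x using NN.induction with
  | h0 => simp
  | ht a' n =>
    change tmul (b • a * a') n = tmul (b • (a * a')) n
    rw [smul_mul_assoc]
  | ha x y hx hy => simp only [smul_add, hx, hy]

theorem smulP_smul (b : PP K C) (a : OmegaP K C) (x : NN K C N) : a • b • x = b • a • x := by
  induction x using NN.induction with
  | h0 => simp
  | ht a' n =>
    change tmul (a * b • a') n = tmul (b • (a * a')) n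
    rw [mul_smul_comm]
  | ha x y hx hy => simp only [smul_add, hx, hy]

theorem smulP_eq (b : PP K C) (x : NN K C N) : b • x = (b • (1 : OmegaP K C)) • x := by
  rw [smul_smulP, one_smul]

theorem sgn_smul (a : OmegaP K C) (x : NN K C N) :
    sgn K C N (a • x) = OmegaP.sgn K C a • sgn K C N x := by
  induction x using NN.induction with
  | h0 => simp
  | ht a' n =>
    rw [smul_tmul, sgn_tmul, sgn_tmul, smul_tmul]
    exact congrArg (fun a => tmul a n) (map_mul (OmegaP.sgn K C) a a')
  | ha x y hx hy => simp only [smul_add, map_add, hx, hy]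

theorem sgn_smulP (b : PP K C) (x : NN K C N) : sgn K C N (b • x) = b • sgn K C N x := by
  rw [smulP_eq, sgn_smul, _root_.map_smul, map_one, ← smulP_eq]

theorem sgn_sgn (x : NN K C N) : sgn K C N (sgn K C N x) = x := by
  induction x using NN.induction with
  | h0 => simp
  | ht a' n => rw [sgn_tmul, sgn_tmul]; exact congrArg (fun a => tmul a n) (OmegaP.sgn_sgn a')
  | ha x y hx hy => simp only [map_add, hx, hy]

section Nabla

variable [Algebra.FiniteType K C]

theorem nabla_smul (a : OmegaP K C) (x : NN K C N) : nabla K C N (a • x) =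
    OmegaP.nabla K C a • x + OmegaP.sgn K C a • nabla K C N x := by
  induction x using NN.induction with
  | h0 => simp
  | ht a' n =>
    rw [smul_tmul, nabla_tmul, nabla_tmul, smul_tmul, smul_tmul, OmegaP.nabla_mul]
    exact TensorProduct.add_tmul _ _ _
  | ha x y hx hy => simp only [smul_add, map_add, hx, hy]; abel

theorem nabla_smulP (b : PP K C) (x : NN K C N) : nabla K C N (b • x) =
    OmegaP.gradP K C b • x + b • nabla K C N x := by
  rw [smulP_eq, nabla_smul, OmegaP.nabla_smulP, OmegaP.nabla_one, smul_zero, add_zero, mul_one,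
    _root_.map_smul, map_one, ← smulP_eq]

theorem nabla_sgn (x : NN K C N) : nabla K C N (sgn K C N x) = -sgn K C N (nabla K C N x) := by
  induction x using NN.induction with
  | h0 => simp
  | ht a' n =>
    rw [sgn_tmul, nabla_tmul, nabla_tmul, sgn_tmul]
    refine (congrArg (fun a => tmul a n) (OmegaP.nabla_sgn a')).trans ?_
    exact TensorProduct.neg_tmul _ _
  | ha x y hx hy => simp only [map_add, hx, hy, neg_add]

theorem nabla_nabla (x : NN K C N) : nabla K C N (nabla K C N x) = 0 := by
  induction x using NN.induction with
  | h0 => simp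
  | ht a' n =>
    rw [nabla_tmul, nabla_tmul, OmegaP.nabla_nabla]
    exact TensorProduct.zero_tmul _ _
  | ha x y hx hy => simp only [map_add, hx, hy, add_zero]

end Nabla

theorem deg_induction {p : ℕ} {P : NN K C N → Prop}
    (ht : ∀ b, ∀ w ∈ (⋀[C]^p Ω[C⁄K] : Submodule C (DR K C)), ∀ n, P (tmul (OmegaP.tmul b w) n))
    (ha : ∀ x y, P x → P y → P (x + y)) {x : NN K C N} (hx : x ∈ deg K C N p) : P x := by
  have h0 : P 0 := by
    have := ht 0 0 (Submodule.zero_mem _) 0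
    rwa [show tmul (OmegaP.tmul (0 : PP K C) (0 : DR K C)) (0 : N) = (0 : NN K C N) from
      TensorProduct.tmul_zero _ _] at this
  obtain ⟨z, rfl⟩ := hx
  induction z using TensorProduct.induction_on with
  | zero => rwa [map_zero]
  | add x y hx hy => rw [map_add]; exact ha _ _ hx hy
  | tmul a n =>
    change P (tmul a.1 n)
    refine OmegaP.degP_induction (P := fun a => P (tmul a n)) (fun b w hw => ht b w hw n)
      (fun x y hx hy => ?_) a.2
    rw [show tmul (x + y) n = tmul x n + tmul y n from TensorProduct.add_tmul _ _ _]
    exact ha _ _ hx hy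

theorem tmul_mem_deg {p : ℕ} {a : OmegaP K C} (ha : a ∈ OmegaP.degP K C p) (n : N) :
    tmul a n ∈ deg K C N p :=
  ⟨(⟨a, ha⟩ : OmegaP.degP K C p) ⊗ₜ n, rfl⟩

theorem smul_mem_deg {p q : ℕ} {a : OmegaP K C} (ha : a ∈ OmegaP.degP K C p) {x : NN K C N}
    (hx : x ∈ deg K C N q) : a • x ∈ deg K C N (p + q) := by
  refine deg_induction (P := fun x => a • x ∈ deg K C N (p + q)) (fun b w hw n => ?_)
    (fun x y h h' => by rw [smul_add]; exact Submodule.add_mem _ h h') hx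
  rw [smul_tmul]
  exact tmul_mem_deg (OmegaP.mul_mem_degP ha (OmegaP.tmul_mem_degP b hw)) n

theorem nabla_mem_deg [Algebra.FiniteType K C] {p : ℕ} {x : NN K C N} (hx : x ∈ deg K C N p) :
    nabla K C N x ∈ deg K C N (p + 1) := by
  refine deg_induction (P := fun x => nabla K C N x ∈ deg K C N (p + 1)) (fun b w hw n => ?_)
    (fun x y h h' => by rw [map_add]; exact Submodule.add_mem _ h h') hx
  rw [nabla_tmul]
  exact tmul_mem_deg (OmegaP.nabla_mem_degP (OmegaP.tmul_mem_degP b hw)) n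

theorem sgn_of_mem {p : ℕ} {x : NN K C N} (hx : x ∈ deg K C N p) :
    sgn K C N x = (-1 : K) ^ p • x := by
  refine deg_induction (P := fun x => sgn K C N x = (-1 : K) ^ p • x) (fun b w hw n => ?_)
    (fun x y h h' => by rw [map_add, h, h', smul_add]) hx
  rw [sgn_tmul]
  have e : OmegaP.sgnR K C (OmegaP.tmul b w) = (-1 : OmegaP K C) ^ p * OmegaP.tmul b w := by
    change OmegaP.tmul b (DR.sgn K C w) = _
    rw [DR.sgn_of_mem hw]
    rcases neg_one_pow_eq_or C p with h | h <;> rcases Nat.even_or_odd p with h' | h' <;>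
      simp [h'.neg_one_pow, OmegaP.tmul_neg]
  rw [e]
  rcases Nat.even_or_odd p with h' | h'
  · rw [h'.neg_one_pow, h'.neg_one_pow, one_mul, one_smul]
  · rw [h'.neg_one_pow, h'.neg_one_pow, neg_one_mul, neg_smul, one_smul]
    exact TensorProduct.neg_tmul _ _

variable (K C N) in
/-- The projection `Ω ⊗ P ⊗ M → Ω^p ⊗ P ⊗ M`. -/
def proj (p : ℕ) : NN K C N →ₗ[C] NN K C N := LinearMap.rTensor N (OmegaP.proj K C p)

theorem proj_tmul (p : ℕ) (b : PP K C) (w : DR K C) (n : N) :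
    proj K C N p (tmul (OmegaP.tmul b w) n) = tmul (OmegaP.tmul b (DR.proj K C p w)) n := rfl

theorem induction₃ {P : NN K C N → Prop} (h0 : P 0)
    (ht : ∀ b w n, P (tmul (OmegaP.tmul b w) n)) (ha : ∀ x y, P x → P y → P (x + y))
    (x : NN K C N) : P x := by
  induction x using NN.induction with
  | h0 => exact h0
  | ha x y hx hy => exact ha x y hx hy
  | ht a n =>
    induction a using OmegaP.induction with
    | h0 => rwa [show tmul (0 : OmegaP K C) n = 0 from TensorProduct.zero_tmul _ _]
    | ha x y hx hy =>
      rw [show tmul (x + y) n = tmul x n + tmul y n from TensorProduct.add_tmul _ _ _]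
      exact ha _ _ hx hy
    | ht b w => exact ht b w n

theorem proj_smulP (p : ℕ) (b : PP K C) (x : NN K C N) :
    proj K C N p (b • x) = b • proj K C N p x := by
  induction x using induction₃ with
  | h0 => simp
  | ha x y hx hy => simp only [smul_add, map_add, hx, hy]
  | ht b' w n => rfl

theorem proj_mem_deg (p : ℕ) (x : NN K C N) : proj K C N p x ∈ deg K C N p := by
  induction x using induction₃ with
  | h0 => rw [map_zero]; exact Submodule.zero_mem _
  | ha x y hx hy => rw [map_add]; exact Submodule.add_mem _ hx hy
  | ht b w n => exact tmul_mem_deg (OmegaP.tmul_mem_degP b (DR.proj_mem p w)) n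

theorem proj_of_mem {p : ℕ} {x : NN K C N} (hx : x ∈ deg K C N p) : proj K C N p x = x :=
  deg_induction (P := fun x => proj K C N p x = x)
    (fun b w hw n => by rw [proj_tmul, DR.proj_of_mem hw])
    (fun x y h h' => by rw [map_add, h, h']) hx

theorem proj_of_mem_ne {p q : ℕ} (h : p ≠ q) {x : NN K C N} (hx : x ∈ deg K C N p) :
    proj K C N q x = 0 :=
  deg_induction (P := fun x => proj K C N q x = 0)
    (fun b w hw n => by
      rw [proj_tmul, DR.proj_of_mem_ne h hw, OmegaP.tmul_zero]; exact TensorProduct.zero_tmul _ _)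
    (fun x y h h' => by rw [map_add, h, h', add_zero]) hx

theorem map_proj (f : C →ₐ[K] C') (g : N →ₛₗ[(f : C →+* C')] N') (p : ℕ) (x : NN K C N) :
    map f g (proj K C N p x) = proj K C' N' p (map f g x) := by
  induction x using induction₃ with
  | h0 => simp
  | ha x y hx hy => simp only [map_add, hx, hy]
  | ht b w n =>
    rw [proj_tmul, map_tmul, map_tmul, OmegaP.map_tmul, OmegaP.map_tmul, proj_tmul, DR.map_proj]

theorem toOmegaP_tmul (a : OmegaP K C) (c : C) : toOmegaP K C (tmul a c) = c • a := rfl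

theorem toOmegaP_injective : Function.Injective (toOmegaP K C) :=
  (TensorProduct.rid C (OmegaP K C)).injective

theorem toOmegaP_smul (a : OmegaP K C) (x : NN K C C) :
    toOmegaP K C (a • x) = a * toOmegaP K C x := by
  induction x using NN.induction with
  | h0 => simp
  | ha x y hx hy => simp only [smul_add, map_add, mul_add, hx, hy]
  | ht a' c => rw [smul_tmul, toOmegaP_tmul, toOmegaP_tmul, mul_smul_comm]

theorem toOmegaP_smulP (b : PP K C) (x : NN K C C) :
    toOmegaP K C (b • x) = b • toOmegaP K C x := by
  rw [smulP_eq, toOmegaP_smul, smul_mul_assoc, one_mul]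

theorem toOmegaP_sgn (x : NN K C C) : toOmegaP K C (sgn K C C x) = OmegaP.sgn K C (toOmegaP K C x) := by
  induction x using NN.induction with
  | h0 => simp
  | ha x y hx hy => simp only [map_add, hx, hy]
  | ht a' c =>
    rw [sgn_tmul, toOmegaP_tmul, toOmegaP_tmul]
    exact (_root_.map_smul (OmegaP.sgnR K C) c a').symm

theorem toOmegaP_nabla [Algebra.FiniteType K C] (x : NN K C C) :
    toOmegaP K C (nabla K C C x) = OmegaP.nabla K C (toOmegaP K C x) := by
  induction x using NN.induction with
  | h0 => simp
  | ha x y hx hy => simp only [map_add, hx, hy]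
  | ht a' c => rw [nabla_tmul, toOmegaP_tmul, toOmegaP_tmul, _root_.map_smul]

theorem toOmegaP_mem {p : ℕ} {x : NN K C C} (hx : x ∈ deg K C C p) :
    toOmegaP K C x ∈ OmegaP.degP K C p :=
  deg_induction (P := fun x => toOmegaP K C x ∈ OmegaP.degP K C p)
    (fun b w hw n => by
      rw [toOmegaP_tmul]; exact Submodule.smul_mem _ _ (OmegaP.tmul_mem_degP b hw))
    (fun x y h h' => by rw [map_add]; exact Submodule.add_mem _ h h') hx

theorem two_smul_comm (x y : NN K C C) : (2 : K) • (toOmegaP K C y • x) =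
    toOmegaP K C x • y + toOmegaP K C x • sgn K C C y + toOmegaP K C (sgn K C C x) • y -
      toOmegaP K C (sgn K C C x) • sgn K C C y := by
  refine toOmegaP_injective ?_
  have h := OmegaP.two_mul_comm (toOmegaP K C x) (toOmegaP K C y)
  rw [two_smul] at h
  rw [two_smul]
  simp only [map_add, map_sub, toOmegaP_smul, toOmegaP_sgn]
  exact h

end NN

end CoefficientAlgebra

section SectionAlgebra

variable {K : Type u} [Field K] {X : Scheme.{u}} [X.Over (Spec (CommRingCat.of K))]

namespace NV

variable {M : X.Modules} {V V' : X.affineOpens}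

theorem toOmegaP_act (a b : NV K (OX X) V) : NN.toOmegaP K Γ(X, V.1) (act K (OX X) V a b) =
    NN.toOmegaP K Γ(X, V.1) a * NN.toOmegaP K Γ(X, V.1) b :=
  NN.toOmegaP_smul (NN.toOmegaP K Γ(X, V.1) a) b

theorem toOmegaP_one : NN.toOmegaP K Γ(X, V.1) (const K (OX X) V (1 : Γ(X, V.1))) = 1 :=
  one_smul Γ(X, V.1) (1 : OmegaP K Γ(X, V.1))

variable (K M V) in
/-- The projection to the forms of degree `p`. -/
def proj (p : ℕ) : NV K M V →ₗ[K] NV K M V :=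
  (NN.proj K Γ(X, V.1) Γ(M, V.1) p).restrictScalars K

theorem res_proj (h : V'.1 ≤ V.1) (p : ℕ) (n : NV K M V) :
    res K M h (proj K M V p n) = proj K M V' p (res K M h n) :=
  NN.map_proj _ _ _ _

end NV

namespace sec

variable {M : X.Modules} {W W' : X.Opens}

theorem sgn_sgn (n : sec K M W) : sgn K M W (sgn K M W n) = n := ext K fun V => NN.sgn_sgn (n.1 V)

theorem act_act (a b : sec K (OX X) W) (n : sec K M W) :
    act K M W (act K (OX X) W a b) n = act K M W a (act K M W b n) := ext K fun V => by
  change NN.toOmegaP K Γ(X, V.1.1) (NV.act K (OX X) V.1 (a.1 V) (b.1 V)) • n.1 V = _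
  rw [NV.toOmegaP_act, mul_smul]
  rfl

theorem act_const (c : Γ(X, W)) (n : sec K M W) :
    act K M W (const K (OX X) W c) n = smulC K M W c n := ext K fun V => by
  change (resA K V.2 c • (1 : OmegaP K Γ(X, V.1.1))) • n.1 V = resA K V.2 c • n.1 V
  rw [NN.smul_eq, Algebra.smul_def, mul_one]

theorem two_smul_act (a b : sec K (OX X) W) : (2 : K) • act K (OX X) W b a =
    act K (OX X) W a b + act K (OX X) W a (sgn K (OX X) W b) +
      act K (OX X) W (sgn K (OX X) W a) b -
      act K (OX X) W (sgn K (OX X) W a) (sgn K (OX X) W b) := ext K fun V => by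
  exact NN.two_smul_comm (a.1 V) (b.1 V)

theorem act_one (a : sec K (OX X) W) : act K (OX X) W a (const K (OX X) W (1 : Γ(X, W))) = a :=
  ext K fun V => by
    refine NN.toOmegaP_injective ?_
    refine (NV.toOmegaP_act (a.1 V) (NV.const K (OX X) V.1 (resA K V.2 1))).trans ?_
    rw [map_one, NV.toOmegaP_one, mul_one]

theorem sgn_act (a : sec K (OX X) W) (n : sec K M W) :
    sgn K M W (act K M W a n) = act K M W (sgn K (OX X) W a) (sgn K M W n) := ext K fun V =>
  (NN.sgn_smul _ (n.1 V)).trans (congrArg (fun a => a • NN.sgn K _ _ (n.1 V))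
    (NN.toOmegaP_sgn (a.1 V)).symm)

theorem sgn_const (c : Γ(M, W)) : sgn K M W (const K M W c) = const K M W c := ext K fun V =>
  congrArg (fun a => NN.tmul a (resM (K := K) M V.2 c)) (map_one (OmegaP.sgn K Γ(X, V.1.1)))

theorem act_mem_deg {p q : ℕ} {a : sec K (OX X) W} {n : sec K M W} (ha : a ∈ deg K (OX X) W p)
    (hn : n ∈ deg K M W q) : act K M W a n ∈ deg K M W (p + q) := fun V =>
  NN.smul_mem_deg (NN.toOmegaP_mem (ha V)) (hn V)

theorem const_mem_deg (c : Γ(M, W)) : const K M W c ∈ deg K M W 0 := fun _ =>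
  NN.tmul_mem_deg OmegaP.one_mem_degP _

theorem const₁_mem_deg (c : Γ(X, W)) : const₁ K W c ∈ deg K (OX X) W 0 := fun _ =>
  NN.tmul_mem_deg (OmegaP.tmul_mem_degP _ DR.one_mem_deg) _

theorem sgn_of_mem {p : ℕ} {n : sec K M W} (hn : n ∈ deg K M W p) :
    sgn K M W n = (-1 : K) ^ p • n := ext K fun V => by
  have h : n.1 V ∈ NN.deg K Γ(X, V.1.1) Γ(M, V.1.1) p := hn V
  exact NN.sgn_of_mem (K := K) (C := Γ(X, V.1.1)) (N := Γ(M, V.1.1)) (p := p) (x := n.1 V) h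

theorem const₁_one : const₁ K W 1 = const K (OX X) W (1 : Γ(X, W)) := ext K fun V => by
  change NN.tmul (OmegaP.tmul (PP.p₁ K _ (resA K V.2 1)) 1) (1 : Γ(X, V.1.1)) =
    NN.tmul 1 (resA K V.2 1)
  rw [map_one, map_one]
  rfl

theorem const₁_mul (c c' : Γ(X, W)) :
    const₁ K W (c * c') = act K (OX X) W (const₁ K W c) (const₁ K W c') := ext K fun V => by
  change NN.tmul (OmegaP.tmul (PP.p₁ K _ (resA K V.2 (c * c'))) 1) (1 : Γ(X, V.1.1)) =
    NN.tmul (((1 : Γ(X, V.1.1)) • OmegaP.tmul (PP.p₁ K _ (resA K V.2 c)) 1) *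
      OmegaP.tmul (PP.p₁ K _ (resA K V.2 c')) 1) (1 : Γ(X, V.1.1))
  rw [map_mul, map_mul, one_smul, OmegaP.tmul_mul, mul_one]

variable (K M W) in
/-- The projection to the forms of degree `p`. -/
def proj (p : ℕ) : sec K M W →ₗ[K] sec K M W :=
  ofFamily K M W (fun V => NV.proj K M V.1 p) fun _ _ h n => NV.res_proj h p n

theorem proj_mem_deg (p : ℕ) (n : sec K M W) : proj K M W p n ∈ deg K M W p := fun V =>
  NN.proj_mem_deg p (n.1 V)

theorem proj_of_mem {p : ℕ} {n : sec K M W} (hn : n ∈ deg K M W p) : proj K M W p n = n :=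
  ext K fun V => by
    have h : n.1 V ∈ NN.deg K Γ(X, V.1.1) Γ(M, V.1.1) p := hn V
    exact NN.proj_of_mem (K := K) (C := Γ(X, V.1.1)) (N := Γ(M, V.1.1)) (p := p) (x := n.1 V) h

theorem proj_of_mem_ne {p q : ℕ} (h : p ≠ q) {n : sec K M W} (hn : n ∈ deg K M W p) :
    proj K M W q n = 0 :=
  ext K fun V => by
    have h' : n.1 V ∈ NN.deg K Γ(X, V.1.1) Γ(M, V.1.1) p := hn V
    exact NN.proj_of_mem_ne (K := K) (C := Γ(X, V.1.1)) (N := Γ(M, V.1.1)) (p := p) (x := n.1 V) h h'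

theorem res_const (h : W' ≤ W) (c : Γ(M, W)) :
    res K M h (const K M W c) = const K M W' (resM (K := K) M h c) := ext K fun V => by
  change NN.tmul 1 _ = NN.tmul 1 (resM M V.2 (resM M h c))
  rw [resM_resM]

theorem res_const₁ (h : W' ≤ W) (c : Γ(X, W)) :
    res K (OX X) h (const₁ K W c) = const₁ K W' (resA K h c) := ext K fun V => by
  change NV.const₁ K V.1 _ = NV.const₁ K V.1 (resA K V.2 (resA K h c))
  rw [resA_resA]

variable [LocallyOfFiniteType (X ↘ Spec (CommRingCat.of K))]

theorem nabla_act (a : sec K (OX X) W) (n : sec K M W) : nabla K M W (act K M W a n) =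
    act K M W (nabla K (OX X) W a) n + act K M W (sgn K (OX X) W a) (nabla K M W n) :=
  ext K fun V => (NN.nabla_smul _ (n.1 V)).trans (congrArg₂ (fun a b => a • n.1 V +
    b • NN.nabla K _ _ (n.1 V)) (NN.toOmegaP_nabla (a.1 V)).symm (NN.toOmegaP_sgn (a.1 V)).symm)

theorem nabla_sgn (n : sec K M W) : nabla K M W (sgn K M W n) = -sgn K M W (nabla K M W n) :=
  ext K fun V => NN.nabla_sgn (n.1 V)

theorem nabla_nabla (n : sec K M W) : nabla K M W (nabla K M W n) = 0 :=
  ext K fun V => NN.nabla_nabla (n.1 V)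

theorem nabla_mem_deg {p : ℕ} {n : sec K M W} (hn : n ∈ deg K M W p) :
    nabla K M W n ∈ deg K M W (p + 1) := fun V => NN.nabla_mem_deg (hn V)

end sec

end SectionAlgebra

/-! ## Tensor products of super algebras and modules -/

namespace Super

section Def

variable {K : Type*} [Field K] {O : Type*} [Ring O] [Algebra K O]
  {A : Type*} [AddCommGroup A] [Module K A] {N : Type*} [AddCommGroup N] [Module K N]
  {N' : Type*} [AddCommGroup N'] [Module K N']

/-- The product `(ω ⊗ a) (ω' ⊗ n) = (-1)^(p q') (ω ω') ⊗ (a n)`. -/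
def mul (σ : O →ₗ[K] O) (s : A →ₗ[K] A) (act : A →ₗ[K] N →ₗ[K] N') :
    O ⊗[K] A →ₗ[K] O ⊗[K] N →ₗ[K] O ⊗[K] N' :=
  TensorProduct.map₂ (LinearMap.mul K O) (act.comp ((2 : K)⁻¹ • (LinearMap.id + s))) +
  TensorProduct.map₂ ((LinearMap.mul K O).compl₂ σ) (act.comp ((2 : K)⁻¹ • (LinearMap.id - s)))

/-- The differential `d(ω ⊗ n) = dω ⊗ n + (-1)^q ω ⊗ ∇ n`. -/
def diff (σ d : O →ₗ[K] O) (D : N →ₗ[K] N) : O ⊗[K] N →ₗ[K] O ⊗[K] N :=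
  TensorProduct.map d LinearMap.id + TensorProduct.map σ D

theorem neg_one_pow_sign (p q : ℕ) :
    (1 : K) + (-1) ^ q + (-1) ^ p - (-1) ^ p * (-1) ^ q = 2 * (-1) ^ (p * q) := by
  rcases Nat.even_or_odd p with hp | hp <;> rcases Nat.even_or_odd q with hq | hq
  · rw [(hq.mul_left p).neg_one_pow, hp.neg_one_pow, hq.neg_one_pow]; ring
  · rw [(hp.mul_right q).neg_one_pow, hp.neg_one_pow, hq.neg_one_pow]; ring
  · rw [(hq.mul_left p).neg_one_pow, hp.neg_one_pow, hq.neg_one_pow]; ring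
  · rw [(hp.mul hq).neg_one_pow, hp.neg_one_pow, hq.neg_one_pow]; ring

theorem neg_one_pow_mul_self (p : ℕ) : ((-1 : K) ^ p) * ((-1 : K) ^ p) = 1 := by
  rw [← pow_add, Even.neg_one_pow ⟨_, rfl⟩]

theorem mul_def (σ : O →ₗ[K] O) (s : A →ₗ[K] A) (act : A →ₗ[K] N →ₗ[K] N') (w w' : O) (a : A)
    (n : N) : mul σ s act (w ⊗ₜ a) (w' ⊗ₜ n) =
      (w * w') ⊗ₜ act ((2 : K)⁻¹ • (a + s a)) n + (w * σ w') ⊗ₜ act ((2 : K)⁻¹ • (a - s a)) n :=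
  rfl

theorem diff_tmul (σ d : O →ₗ[K] O) (D : N →ₗ[K] N) (w : O) (n : N) :
    diff σ d D (w ⊗ₜ n) = d w ⊗ₜ n + σ w ⊗ₜ D n := rfl

theorem map_mul {O₁ : Type*} [Ring O₁] [Algebra K O₁] {A₁ : Type*} [AddCommGroup A₁] [Module K A₁]
    {N₁ : Type*} [AddCommGroup N₁] [Module K N₁] {N₁' : Type*} [AddCommGroup N₁'] [Module K N₁']
    {σ : O →ₗ[K] O} {s : A →ₗ[K] A} {act : A →ₗ[K] N →ₗ[K] N'}
    {σ₁ : O₁ →ₗ[K] O₁} {s₁ : A₁ →ₗ[K] A₁} {act₁ : A₁ →ₗ[K] N₁ →ₗ[K] N₁'} (f : O →ₗ[K] O₁)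
    (g : A →ₗ[K] A₁) (h : N →ₗ[K] N₁) (h' : N' →ₗ[K] N₁') (hf : ∀ w w', f (w * w') = f w * f w')
    (hσ : ∀ w, f (σ w) = σ₁ (f w)) (hs : ∀ a, g (s a) = s₁ (g a))
    (hact : ∀ a n, h' (act a n) = act₁ (g a) (h n)) (x : O ⊗[K] A) (y : O ⊗[K] N) :
    TensorProduct.map f h' (mul σ s act x y) =
      mul σ₁ s₁ act₁ (TensorProduct.map f g x) (TensorProduct.map f h y) := by
  induction x using TensorProduct.induction_on with
  | zero => simp
  | add x y hx hy => simp only [map_add, LinearMap.add_apply, hx, hy]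
  | tmul w a =>
    induction y using TensorProduct.induction_on with
    | zero => simp
    | add x y hx hy => simp only [map_add, hx, hy]
    | tmul w' n =>
      simp only [TensorProduct.map_tmul, mul_def, map_add, map_sub, map_smul, LinearMap.smul_apply,
        LinearMap.add_apply, LinearMap.sub_apply, hf, hσ, hact, hs]

theorem map_diff {O₁ : Type*} [Ring O₁] [Algebra K O₁] {N₁ : Type*} [AddCommGroup N₁]
    [Module K N₁] {σ d : O →ₗ[K] O} {D : N →ₗ[K] N} {σ₁ d₁ : O₁ →ₗ[K] O₁} {D₁ : N₁ →ₗ[K] N₁}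
    (f : O →ₗ[K] O₁) (h : N →ₗ[K] N₁) (hσ : ∀ w, f (σ w) = σ₁ (f w)) (hd : ∀ w, f (d w) = d₁ (f w))
    (hD : ∀ n, h (D n) = D₁ (h n)) (x : O ⊗[K] N) :
    TensorProduct.map f h (diff σ d D x) = diff σ₁ d₁ D₁ (TensorProduct.map f h x) := by
  induction x using TensorProduct.induction_on with
  | zero => simp
  | add x y hx hy => simp only [map_add, hx, hy]
  | tmul w n => simp only [TensorProduct.map_tmul, diff_tmul, map_add, hσ, hd, hD]

end Def

section Laws

variable {K : Type*} [Field K] [CharZero K] {O : Type*} [Ring O] [Algebra K O]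
  {A : Type*} [AddCommGroup A] [Module K A] {N : Type*} [AddCommGroup N] [Module K N]
  {σ d : O →ₗ[K] O} {s D : A →ₗ[K] A} {t E : N →ₗ[K] N} {mA : A →ₗ[K] A →ₗ[K] A}
  {act : A →ₗ[K] N →ₗ[K] N}

theorem parity_induction (ht : ∀ n, t (t n) = n) {P : N → Prop}
    (h : ∀ p : ℕ, ∀ n, t n = (-1 : K) ^ p • n → P n)
    (ha : ∀ x y, P x → P y → P (x + y)) (n : N) : P n := by
  have e : n = (2 : K)⁻¹ • (n + t n) + (2 : K)⁻¹ • (n - t n) := by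
    rw [← smul_add, add_add_sub_cancel, ← two_smul K, smul_smul, inv_mul_cancel₀ two_ne_zero,
      one_smul]
  rw [e]
  refine ha _ _ (h 0 _ ?_) (h 1 _ ?_)
  · rw [map_smul, map_add, ht, pow_zero, one_smul, add_comm]
  · rw [map_smul, map_sub, ht, pow_one, neg_smul, one_smul, ← smul_neg, neg_sub]

theorem tens_induction (hσ : ∀ w, σ (σ w) = w) (ht : ∀ n, t (t n) = n) {P : O ⊗[K] N → Prop}
    (h : ∀ (q p : ℕ), ∀ w, σ w = (-1 : K) ^ q • w → ∀ n, t n = (-1 : K) ^ p • n → P (w ⊗ₜ n))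
    (ha : ∀ x y, P x → P y → P (x + y)) (x : O ⊗[K] N) : P x := by
  induction x using TensorProduct.induction_on with
  | zero =>
    rw [← TensorProduct.zero_tmul (R := K) O (0 : N)]
    exact h 0 0 0 (by simp) 0 (by simp)
  | add x y hx hy => exact ha x y hx hy
  | tmul w n =>
    induction w using parity_induction hσ with
    | ha a b h h' => rw [TensorProduct.add_tmul]; exact ha _ _ h h'
    | h q w hw =>
      induction n using parity_induction ht with
      | ha a b h h' => rw [TensorProduct.tmul_add]; exact ha _ _ h h'
      | h p n hn => exact h q p w hw n hn

theorem mul_tmul {p q' : ℕ} (w : O) {a : A} (ha : s a = (-1 : K) ^ p • a) {w' : O}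
    (hw' : σ w' = (-1 : K) ^ q' • w') (n : N) :
    mul σ s act (w ⊗ₜ a) (w' ⊗ₜ n) = (-1 : K) ^ (p * q') • ((w * w') ⊗ₜ act a n) := by
  have e1 : (2 : K)⁻¹ • (a + s a) = ((2 : K)⁻¹ * (1 + (-1) ^ p)) • a := by
    rw [ha, mul_smul, add_smul, one_smul]
  have e2 : (2 : K)⁻¹ • (a - s a) = ((2 : K)⁻¹ * (1 - (-1) ^ p)) • a := by
    rw [ha, mul_smul, sub_smul, one_smul]
  rw [mul_def, e1, e2, hw', map_smul, map_smul, LinearMap.smul_apply, LinearMap.smul_apply,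
    mul_smul_comm, TensorProduct.tmul_smul, TensorProduct.tmul_smul, ← TensorProduct.smul_tmul',
    smul_smul, ← add_smul]
  congr 1
  have h := neg_one_pow_sign (K := K) p q'
  linear_combination (2 : K)⁻¹ * h + ((-1 : K) ^ (p * q')) * (inv_mul_cancel₀ (two_ne_zero (α := K)))

theorem sgn_act (hst : ∀ a n, t (act a n) = act (s a) (t n)) {p q : ℕ} {a : A} {n : N}
    (ha : s a = (-1 : K) ^ p • a) (hn : t n = (-1 : K) ^ q • n) :
    t (act a n) = (-1 : K) ^ (p + q) • act a n := by
  rw [hst, ha, hn, map_smul, map_smul, LinearMap.smul_apply, smul_smul, pow_add, mul_comm]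

theorem sgn_diff (hE : ∀ n, E (t n) = -t (E n)) {p : ℕ} {n : N} (hn : t n = (-1 : K) ^ p • n) :
    t (E n) = (-1 : K) ^ (p + 1) • E n := by
  have h := hE n
  rw [hn, map_smul] at h
  rw [pow_succ, mul_neg_one, neg_smul, h, neg_neg]

theorem mul_comm_of_sgn (hm : ∀ a b, (2 : K) • mA b a =
      mA a b + mA a (s b) + mA (s a) b - mA (s a) (s b)) {p q : ℕ} {a b : A}
    (ha : s a = (-1 : K) ^ p • a) (hb : s b = (-1 : K) ^ q • b) :
    mA b a = (-1 : K) ^ (p * q) • mA a b := by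
  have h := hm a b
  simp only [ha, hb, map_smul, LinearMap.smul_apply, smul_smul] at h
  have h' : (2 : K) • mA b a = (2 * (-1 : K) ^ (p * q)) • mA a b := by
    rw [h, ← neg_one_pow_sign, sub_smul, add_smul, add_smul, one_smul]
    congr 2
    rw [mul_comm]
  have := congrArg (fun x => (2 : K)⁻¹ • x) h'
  simpa only [smul_smul, ← mul_assoc, inv_mul_cancel₀ (two_ne_zero (α := K)), one_smul, one_mul]
    using this

theorem mul_assoc (hσ : ∀ w, σ (σ w) = w) (hs : ∀ n, s (s n) = n) (ht : ∀ n, t (t n) = n)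
    (hσm : ∀ w w', σ (w * w') = σ w * σ w') (hsm : ∀ a b, s (mA a b) = mA (s a) (s b))
    (hact : ∀ a b n, act (mA a b) n = act a (act b n))
    (x y : O ⊗[K] A) (z : O ⊗[K] N) :
    mul σ s act (mul σ s mA x y) z = mul σ s act x (mul σ s act y z) := by
  induction x using tens_induction hσ hs with
  | ha x x' h h' => simp only [map_add, LinearMap.add_apply, h, h']
  | h q p w hw a ha =>
  induction y using tens_induction hσ hs with
  | ha x x' h h' => simp only [map_add, LinearMap.add_apply, h, h']
  | h q' p' w' hw' a' ha' =>
  induction z using tens_induction hσ ht with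
  | ha x x' h h' => simp only [map_add, h, h']
  | h q'' p'' w'' hw'' n hn =>
    have hww : σ (w' * w'') = (-1 : K) ^ (q' + q'') • (w' * w'') := by
      rw [hσm, hw', hw'', smul_mul_smul_comm, pow_add]
    rw [mul_tmul w ha hw', mul_tmul w' ha' hw'', map_smul, map_smul, LinearMap.smul_apply,
      mul_tmul _ (sgn_act hsm ha ha') hw'', mul_tmul _ ha hww, smul_smul, smul_smul,
      _root_.mul_assoc, hact]
    congr 1
    ring

theorem one_mul (hσ : ∀ w, σ (σ w) = w) (ht : ∀ n, t (t n) = n) {a : A} (ha : s a = a)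
    (z : O ⊗[K] N) : mul σ s act (1 ⊗ₜ a) z = TensorProduct.map LinearMap.id (act a) z := by
  induction z using tens_induction hσ ht with
  | ha x x' h h' => simp only [map_add, h, h']
  | h q p w hw n hn =>
    rw [mul_tmul (p := 0) _ (by rw [ha, pow_zero, one_smul]) hw, _root_.one_mul, zero_mul, pow_zero,
      one_smul]
    rfl

theorem mul_one (hσ : ∀ w, σ (σ w) = w) (hs : ∀ n, s (s n) = n) (hσ1 : σ 1 = 1) {n : N}
    (z : O ⊗[K] A) : mul σ s act z (1 ⊗ₜ n) = TensorProduct.map LinearMap.id (act.flip n) z := by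
  induction z using tens_induction hσ hs with
  | ha x x' h h' => simp only [map_add, LinearMap.add_apply, h, h']
  | h q p w hw a ha =>
    rw [mul_tmul (q' := 0) _ ha (by rw [hσ1, pow_zero, one_smul]), _root_.mul_one, mul_zero,
      pow_zero, one_smul]
    rfl

theorem mul_comm_tmul {p q p' q' : ℕ} {w w' : O} {a b : A} (hw : σ w = (-1 : K) ^ q • w)
    (hw' : σ w' = (-1 : K) ^ q' • w') (ha : s a = (-1 : K) ^ p • a)
    (hb : s b = (-1 : K) ^ p' • b) (hww : w' * w = (-1 : K) ^ (q * q') • (w * w'))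
    (hab : mA b a = (-1 : K) ^ (p * p') • mA a b) : mul σ s mA (w' ⊗ₜ b) (w ⊗ₜ a) =
      (-1 : K) ^ ((p + q) * (p' + q')) • mul σ s mA (w ⊗ₜ a) (w' ⊗ₜ b) := by
  rw [mul_tmul w ha hw', mul_tmul w' hb hw, hww, hab,
    TensorProduct.tmul_smul, ← TensorProduct.smul_tmul', smul_smul, smul_smul, smul_smul]
  congr 1
  linear_combination (-(-1 : K) ^ (p * p' + q * p' + q * q')) *
    neg_one_pow_mul_self (K := K) (p * q')

theorem diff_diff (hσ : ∀ w, σ (σ w) = w) (ht : ∀ n, t (t n) = n)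
    (hσd : ∀ w, d (σ w) = -σ (d w)) (hd : ∀ w, d (d w) = 0) (hE : ∀ n, E (E n) = 0)
    (x : O ⊗[K] N) : diff σ d E (diff σ d E x) = 0 := by
  induction x using tens_induction hσ ht with
  | ha x x' h h' => simp only [map_add, h, h', add_zero]
  | h q p w hw n hn =>
    rw [diff_tmul, map_add, diff_tmul, diff_tmul, hd, hE, hσd, TensorProduct.zero_tmul,
      TensorProduct.tmul_zero, zero_add, add_zero, TensorProduct.neg_tmul, add_neg_cancel]

theorem diff_mul_tmul (hσm : ∀ w w', σ (w * w') = σ w * σ w') (hσd : ∀ w, d (σ w) = -σ (d w))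
    (hd : ∀ w w', d (w * w') = d w * w' + σ w * d w') (hsD : ∀ a, D (s a) = -s (D a))
    (hE : ∀ a n, E (act a n) = act (D a) n + act (s a) (E n)) (hσ : ∀ w, σ (σ w) = w)
    (ht : ∀ n, t (t n) = n) {p q : ℕ} {w : O} {a : A} (hw : σ w = (-1 : K) ^ q • w)
    (ha : s a = (-1 : K) ^ p • a) (y : O ⊗[K] N) :
    diff σ d E (mul σ s act (w ⊗ₜ a) y) = mul σ s act (diff σ d D (w ⊗ₜ a)) y +
      (-1 : K) ^ (p + q) • mul σ s act (w ⊗ₜ a) (diff σ d E y) := by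
  induction y using tens_induction hσ ht with
  | ha x x' h h' => simp only [map_add, h, h', smul_add]; abel
  | h q' p' w' hw' n hn =>
    have h := neg_one_pow_mul_self (K := K) p
    rw [mul_tmul w ha hw', diff_tmul, hw, diff_tmul, hw', map_add, map_add, map_smul, diff_tmul,
      LinearMap.add_apply, mul_tmul _ ha hw', mul_tmul _ (sgn_diff hsD ha) hw',
      mul_tmul _ ha (sgn_diff hσd hw'), hσm, hd, hw, hw', hE, ha, ← TensorProduct.smul_tmul',
      map_smul, map_smul, LinearMap.smul_apply, mul_tmul _ ha hw']
    simp only [smul_add, smul_smul, TensorProduct.add_tmul, TensorProduct.tmul_add,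
      TensorProduct.tmul_smul, ← TensorProduct.smul_tmul', smul_mul_assoc, mul_smul_comm]
    have e1 : (-1 : K) ^ (p * q') * (-1) ^ q = (-1) ^ (p + q) * (-1) ^ (p * (q' + 1)) := by
      linear_combination (-(-1 : K) ^ (p * q' + q)) * h
    have e2 : (-1 : K) ^ (p * q') * ((-1) ^ q' * (-1) ^ q) = (-1) ^ ((p + 1) * q') * (-1) ^ q := by
      ring
    have e3 : (-1 : K) ^ (p * q') * ((-1) ^ p * ((-1) ^ q' * (-1) ^ q)) =
        (-1) ^ (p + q) * ((-1) ^ q' * (-1) ^ (p * q')) := by ring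
    rw [e1, e2, e3]
    abel

end Laws

end Super

section TensorAlgebra

variable {K : Type u} [Field K]

namespace Sx

variable {l : ℕ}

theorem sgn_apply (w : Sx K l) : sgn K l w = DR.sgn K (SimplexRing K l) w := rfl

theorem sgn_of_mem {q : ℕ} {w : Sx K l} (hw : w ∈ DR.deg K (SimplexRing K l) q) :
    sgn K l w = (-1 : K) ^ q • w := by
  rw [sgn_apply, DR.sgn_of_mem hw, ← algebraMap_smul (SimplexRing K l) ((-1 : K) ^ q), map_pow,
    map_neg, map_one]

theorem mul_comm_of_mem {q q' : ℕ} {w w' : Sx K l} (hw : w ∈ DR.deg K (SimplexRing K l) q)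
    (hw' : w' ∈ DR.deg K (SimplexRing K l) q') : w' * w = (-1 : K) ^ (q * q') • (w * w') := by
  have e : ∀ i, (DR.sgn K (SimplexRing K l))^[i] w = (-1 : K) ^ (q * i) • w := by
    intro i
    induction i with
    | zero => simp
    | succ i ih =>
      rw [Function.iterate_succ_apply', ih, ← sgn_apply, map_smul, sgn_of_mem hw, smul_smul,
        ← pow_add]
      congr 2
  rw [DR.mul_of_mem hw', e, smul_mul_assoc]

variable (K l) in
/-- The projection to the forms of degree `q`. -/
def proj (q : ℕ) : Sx K l →ₗ[K] Sx K l := (DR.proj K (SimplexRing K l) q).restrictScalars K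

theorem proj_mem (q : ℕ) (w : Sx K l) : proj K l q w ∈ DR.deg K (SimplexRing K l) q :=
  DR.proj_mem (K := K) (R := SimplexRing K l) q w

theorem proj_of_mem {q : ℕ} {w : Sx K l} (hw : w ∈ DR.deg K (SimplexRing K l) q) :
    proj K l q w = w :=
  DR.proj_of_mem (K := K) (R := SimplexRing K l) (a := w) hw

theorem proj_of_mem_ne {q q' : ℕ} (h : q ≠ q') {w : Sx K l}
    (hw : w ∈ DR.deg K (SimplexRing K l) q) : proj K l q' w = 0 :=
  DR.proj_of_mem_ne (K := K) (R := SimplexRing K l) (a := w) h hw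

theorem sgn_sgn (w : Sx K l) : sgn K l (sgn K l w) = w := DR.sgn_sgn (R := SimplexRing K l) w

theorem sgn_mul (w w' : Sx K l) : sgn K l (w * w') = sgn K l w * sgn K l w' :=
  map_mul (DR.sgn K (SimplexRing K l)) w w'

theorem one_mem_deg : (1 : Sx K l) ∈ DR.deg K (SimplexRing K l) 0 :=
  DR.one_mem_deg (K := K) (R := SimplexRing K l)

theorem mul_mem_deg {q q' : ℕ} {w w' : Sx K l} (hw : w ∈ DR.deg K (SimplexRing K l) q)
    (hw' : w' ∈ DR.deg K (SimplexRing K l) q') : w * w' ∈ DR.deg K (SimplexRing K l) (q + q') :=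
  DR.mul_mem_deg (K := K) (R := SimplexRing K l) (a := w) (b := w') hw hw'

theorem d_mem_deg {q : ℕ} {w : Sx K l} (hw : w ∈ DR.deg K (SimplexRing K l) q) :
    DR.d K (SimplexRing K l) w ∈ DR.deg K (SimplexRing K l) (q + 1) :=
  DR.d_mem_deg (K := K) (R := SimplexRing K l) (a := w) hw

/-- A map of forms on simplices which is compatible with all the structure. -/
structure IsHom {k : ℕ} (a : Sx K l →ₗ[K] Sx K k) : Prop where
  mul : ∀ w w', a (w * w') = a w * a w'
  one : a 1 = 1
  sgn : ∀ w, a (sgn K l w) = Sx.sgn K k (a w)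
  d : ∀ w, a (DR.d K (SimplexRing K l) w) = DR.d K (SimplexRing K k) (a w)
  proj : ∀ q w, a (proj K l q w) = Sx.proj K k q (a w)

theorem isHom_id : IsHom (LinearMap.id : Sx K l →ₗ[K] Sx K l) where
  mul _ _ := rfl
  one := rfl
  sgn _ := rfl
  d _ := rfl
  proj _ _ := rfl

theorem isHom_pull {k : ℕ} (α : Fin (k + 1) →o Fin (l + 1)) : IsHom (pull K α) where
  mul := map_mul (DR.map (SimplexRing.pull K α))
  one := map_one (DR.map (SimplexRing.pull K α))
  sgn := DR.map_sgn (SimplexRing.pull K α)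
  d := DR.map_d (SimplexRing.pull K α)
  proj := DR.map_proj (SimplexRing.pull K α)

end Sx

variable {X : Scheme.{u}} [X.Over (Spec (CommRingCat.of K))]

variable {M : X.Modules} {W W' : X.Opens} {l k : ℕ}

variable (K M W l) in
/-- The projection to the part of bidegree `(p, q)`. -/
def projT (p q : ℕ) : Sx K l ⊗[K] sec K M W →ₗ[K] Sx K l ⊗[K] sec K M W :=
  TensorProduct.map (Sx.proj K l q) (sec.proj K M W p)

theorem bideg_induction {p q : ℕ} {P : Sx K l ⊗[K] sec K M W → Prop}
    (ht : ∀ w ∈ DR.deg K (SimplexRing K l) q, ∀ n ∈ sec.deg K M W p, P (w ⊗ₜ n))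
    (ha : ∀ x y, P x → P y → P (x + y)) {x : Sx K l ⊗[K] sec K M W}
    (hx : x ∈ Cell.bideg K M W l p q) : P x := by
  have h : ∃ z : (DR.deg K (SimplexRing K l) q) ⊗[K] (sec.deg K M W p),
      TensorProduct.map (Submodule.subtype _) (Submodule.subtype _) z = x := by
    refine (Submodule.map₂_le (p := DR.deg K (SimplexRing K l) q) (q := sec.deg K M W p)
      (f := TensorProduct.mk K (Sx K l) (sec K M W)) (r := LinearMap.range (TensorProduct.map
        (Submodule.subtype (DR.deg K (SimplexRing K l) q))
        (Submodule.subtype (sec.deg K M W p))))).2 ?_ hx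
    exact fun w hw n hn => ⟨(⟨w, hw⟩ : DR.deg K (SimplexRing K l) q) ⊗ₜ
      (⟨n, hn⟩ : sec.deg K M W p), rfl⟩
  clear hx
  obtain ⟨z, rfl⟩ := h
  induction z using TensorProduct.induction_on with
  | zero =>
    rw [map_zero, ← TensorProduct.zero_tmul (R := K) (Sx K l) (0 : sec K M W)]
    exact ht 0 (Submodule.zero_mem _) 0 (Submodule.zero_mem _)
  | add x y hx hy => rw [map_add]; exact ha _ _ hx hy
  | tmul w n => exact ht w.1 w.2 n.1 n.2

theorem tmul_mem_bideg {p q : ℕ} {w : Sx K l} (hw : w ∈ DR.deg K (SimplexRing K l) q)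
    {n : sec K M W} (hn : n ∈ sec.deg K M W p) : w ⊗ₜ n ∈ Cell.bideg K M W l p q :=
  Submodule.apply_mem_map₂ _ hw hn

theorem projT_mem (p q : ℕ) (x : Sx K l ⊗[K] sec K M W) :
    projT K M W l p q x ∈ Cell.bideg K M W l p q := by
  induction x using TensorProduct.induction_on with
  | zero => rw [map_zero]; exact Submodule.zero_mem _
  | add x y hx hy => rw [map_add]; exact Submodule.add_mem _ hx hy
  | tmul w n => exact tmul_mem_bideg (Sx.proj_mem q w) (sec.proj_mem_deg p n)

theorem projT_of_mem {p q : ℕ} {x : Sx K l ⊗[K] sec K M W} (hx : x ∈ Cell.bideg K M W l p q) :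
    projT K M W l p q x = x := by
  refine bideg_induction (P := fun x => projT K M W l p q x = x) (fun w hw n hn => ?_)
    (fun x y hx hy => by rw [map_add, hx, hy]) hx
  rw [projT, TensorProduct.map_tmul, sec.proj_of_mem hn, Sx.proj_of_mem hw]

theorem projT_of_mem_ne {p q p' q' : ℕ} (h : (p, q) ≠ (p', q')) {x : Sx K l ⊗[K] sec K M W}
    (hx : x ∈ Cell.bideg K M W l p q) : projT K M W l p' q' x = 0 := by
  refine bideg_induction (P := fun x => projT K M W l p' q' x = 0) (fun w hw n hn => ?_)
    (fun x y hx hy => by rw [map_add, hx, hy, add_zero]) hx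
  rw [projT, TensorProduct.map_tmul]
  rcases eq_or_ne p p' with rfl | hp
  · have hq : q ≠ q' := fun e => h (by rw [e])
    rw [Sx.proj_of_mem_ne hq hw, TensorProduct.zero_tmul]
  · rw [sec.proj_of_mem_ne hp hn, TensorProduct.tmul_zero]

theorem map_projT {a : Sx K l →ₗ[K] Sx K k} (ha : Sx.IsHom a) (h : W' ≤ W) (p q : ℕ)
    (x : Sx K l ⊗[K] sec K M W) : TensorProduct.map a (sec.res K M h) (projT K M W l p q x) =
      projT K M W' k p q (TensorProduct.map a (sec.res K M h) x) := by
  induction x using TensorProduct.induction_on with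
  | zero => simp
  | add x y hx hy => simp only [map_add, hx, hy]
  | tmul w n =>
    simp only [projT, TensorProduct.map_tmul]
    rw [ha.proj]
    rfl

theorem map_preMul {a : Sx K l →ₗ[K] Sx K k} (ha : Sx.IsHom a) (h : W' ≤ W)
    (x : Sx K l ⊗[K] sec K (OX X) W) (y : Sx K l ⊗[K] sec K M W) :
    TensorProduct.map a (sec.res K M h) (preMul K M W l x y) =
      preMul K M W' k (TensorProduct.map a (sec.res K (OX X) h) x)
        (TensorProduct.map a (sec.res K M h) y) := by
  exact Super.map_mul a (sec.res K (OX X) h) (sec.res K M h) (sec.res K M h) ha.mul ha.sgn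
    (fun _ => rfl) (fun _ _ => rfl) x y

theorem map_preD [LocallyOfFiniteType (X ↘ Spec (CommRingCat.of K))] {a : Sx K l →ₗ[K] Sx K k}
    (ha : Sx.IsHom a) (h : W' ≤ W) (x : Sx K l ⊗[K] sec K M W) :
    TensorProduct.map a (sec.res K M h) (preD K M W l x) =
      preD K M W' k (TensorProduct.map a (sec.res K M h) x) := by
  exact Super.map_diff a (sec.res K M h) ha.sgn ha.d (fun _ => rfl) x

variable [CharZero K]

theorem preMul_tmul {p q' : ℕ} (w : Sx K l) {a : sec K (OX X) W}
    (ha : sec.sgn K (OX X) W a = (-1 : K) ^ p • a) {w' : Sx K l}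
    (hw' : w' ∈ DR.deg K (SimplexRing K l) q') (n : sec K M W) :
    preMul K M W l (w ⊗ₜ a) (w' ⊗ₜ n) =
      (-1 : K) ^ (p * q') • ((w * w') ⊗ₜ sec.act K M W a n) :=
  Super.mul_tmul w ha (Sx.sgn_of_mem hw') n

theorem preMul_assoc (x y : Sx K l ⊗[K] sec K (OX X) W) (z : Sx K l ⊗[K] sec K M W) :
    preMul K M W l (preMul K (OX X) W l x y) z = preMul K M W l x (preMul K M W l y z) :=
  Super.mul_assoc Sx.sgn_sgn sec.sgn_sgn sec.sgn_sgn Sx.sgn_mul sec.sgn_act sec.act_act x y z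

theorem const_preMul (c : Γ(X, W)) (z : Sx K l ⊗[K] sec K M W) :
    preMul K M W l (1 ⊗ₜ sec.const K (OX X) W c) z =
      TensorProduct.map LinearMap.id (sec.smulC K M W c) z := by
  have e : sec.act K M W (sec.const K (OX X) W c) = sec.smulC K M W c :=
    LinearMap.ext (sec.act_const c)
  rw [← e]
  exact Super.one_mul Sx.sgn_sgn sec.sgn_sgn (sec.sgn_const (M := OX X) c) z

theorem preMul_one (z : Sx K l ⊗[K] sec K (OX X) W) :
    preMul K (OX X) W l z (1 ⊗ₜ sec.const K (OX X) W (1 : Γ(X, W))) = z := by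
  have e : (sec.act K (OX X) W).flip (sec.const K (OX X) W (1 : Γ(X, W))) = LinearMap.id :=
    LinearMap.ext sec.act_one
  refine (Super.mul_one (act := sec.act K (OX X) W) Sx.sgn_sgn sec.sgn_sgn
    (map_one (DR.sgn K (SimplexRing K l))) z).trans ?_
  rw [e, TensorProduct.map_id]
  rfl

theorem preMul_mem_bideg {p q p' q' : ℕ} {x : Sx K l ⊗[K] sec K (OX X) W}
    (hx : x ∈ Cell.bideg K (OX X) W l p q) {y : Sx K l ⊗[K] sec K M W}
    (hy : y ∈ Cell.bideg K M W l p' q') :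
    preMul K M W l x y ∈ Cell.bideg K M W l (p + p') (q + q') := by
  refine bideg_induction (P := fun x => preMul K M W l x y ∈ Cell.bideg K M W l (p + p') (q + q'))
    (fun w hw a ha => ?_)
    (fun x y hx hy => by rw [map_add]; exact Submodule.add_mem _ hx hy) hx
  refine bideg_induction (P := fun y => preMul K M W l (w ⊗ₜ a) y ∈
    Cell.bideg K M W l (p + p') (q + q')) (fun w' hw' n hn => ?_)
    (fun x y hx hy => by rw [map_add]; exact Submodule.add_mem _ hx hy) hy
  rw [preMul_tmul w (sec.sgn_of_mem ha) hw']
  exact Submodule.smul_mem _ _ (tmul_mem_bideg (Sx.mul_mem_deg hw hw') (sec.act_mem_deg ha hn))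

theorem preMul_comm {p q p' q' : ℕ} {x y : Sx K l ⊗[K] sec K (OX X) W}
    (hx : x ∈ Cell.bideg K (OX X) W l p q) (hy : y ∈ Cell.bideg K (OX X) W l p' q') :
    preMul K (OX X) W l y x = (-1 : K) ^ ((p + q) * (p' + q')) • preMul K (OX X) W l x y := by
  refine bideg_induction (P := fun x => preMul K (OX X) W l y x =
    (-1 : K) ^ ((p + q) * (p' + q')) • preMul K (OX X) W l x y)
    (fun w hw a ha => ?_)
    (fun x y hx hy => by simp only [map_add, LinearMap.add_apply, hx, hy, smul_add]) hx
  refine bideg_induction (P := fun y => preMul K (OX X) W l y (w ⊗ₜ a) =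
    (-1 : K) ^ ((p + q) * (p' + q')) • preMul K (OX X) W l (w ⊗ₜ a) y)
    (fun w' hw' b hb => ?_)
    (fun x y hx hy => by simp only [map_add, LinearMap.add_apply, hx, hy, smul_add]) hy
  exact Super.mul_comm_tmul (Sx.sgn_of_mem hw) (Sx.sgn_of_mem hw') (sec.sgn_of_mem ha)
    (sec.sgn_of_mem hb) (Sx.mul_comm_of_mem hw hw')
    (Super.mul_comm_of_sgn sec.two_smul_act (sec.sgn_of_mem ha) (sec.sgn_of_mem hb))

variable [LocallyOfFiniteType (X ↘ Spec (CommRingCat.of K))]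

theorem preD_preD (x : Sx K l ⊗[K] sec K M W) : preD K M W l (preD K M W l x) = 0 :=
  Super.diff_diff Sx.sgn_sgn sec.sgn_sgn (DR.d_sgn (K := K) (R := SimplexRing K l)) DR.d_d
    sec.nabla_nabla x

theorem preD_preMul {p q : ℕ} {x : Sx K l ⊗[K] sec K (OX X) W}
    (hx : x ∈ Cell.bideg K (OX X) W l p q) (y : Sx K l ⊗[K] sec K M W) :
    preD K M W l (preMul K M W l x y) = preMul K M W l (preD K (OX X) W l x) y +
      (-1 : K) ^ (p + q) • preMul K M W l x (preD K M W l y) := by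
  refine bideg_induction (P := fun x => preD K M W l (preMul K M W l x y) =
    preMul K M W l (preD K (OX X) W l x) y +
      (-1 : K) ^ (p + q) • preMul K M W l x (preD K M W l y))
    (fun w hw a ha => ?_)
    (fun x y hx hy => by simp only [map_add, LinearMap.add_apply, hx, hy, smul_add]; abel) hx
  exact Super.diff_mul_tmul Sx.sgn_mul (DR.d_sgn (K := K) (R := SimplexRing K l)) (DR.d_mul K)
    sec.nabla_sgn sec.nabla_act Sx.sgn_sgn sec.sgn_sgn (Sx.sgn_of_mem hw) (sec.sgn_of_mem ha) y

theorem preD_mem {p q : ℕ} {x : Sx K l ⊗[K] sec K M W} (hx : x ∈ Cell.bideg K M W l p q) :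
    TensorProduct.map (DR.d K (SimplexRing K l)) LinearMap.id x ∈ Cell.bideg K M W l p (q + 1) ∧
    TensorProduct.map (Sx.sgn K l) (sec.nabla K M W) x ∈ Cell.bideg K M W l (p + 1) q := by
  refine bideg_induction (P := fun x =>
    TensorProduct.map (DR.d K (SimplexRing K l)) LinearMap.id x ∈ Cell.bideg K M W l p (q + 1) ∧
    TensorProduct.map (Sx.sgn K l) (sec.nabla K M W) x ∈ Cell.bideg K M W l (p + 1) q)
    (fun w hw a ha => ⟨tmul_mem_bideg (Sx.d_mem_deg hw) ha, ?_⟩)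
    (fun x y hx hy => by
      rw [map_add, map_add]
      exact ⟨Submodule.add_mem _ hx.1 hy.1, Submodule.add_mem _ hx.2 hy.2⟩) hx
  rw [TensorProduct.map_tmul, Sx.sgn_of_mem hw, ← TensorProduct.smul_tmul']
  exact Submodule.smul_mem _ _ (tmul_mem_bideg hw (sec.nabla_mem_deg ha))

end TensorAlgebra

/-! ## Generation by fractions -/

section Fractions

/-- The elements of `N'` are fractions: up to powers of the elements `f` of `s`, which generate the
unit ideal of `C'`, they come from `N`. -/
structure FracOf {C C' : Type*} [CommRing C] [CommRing C'] {φ : C →+* C'} (s : Set C)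
    {N N' : Type*} [AddCommGroup N] [AddCommGroup N'] [Module C N] [Module C' N']
    (g : N →ₛₗ[φ] N') : Prop where
  span_eq : Ideal.span (φ '' s) = ⊤
  surj : ∀ f ∈ s, ∀ n' : N', ∃ (k : ℕ) (n : N), φ f ^ k • n' = g n

theorem FracOf.mem_of_pow_smul_mem {C C' : Type*} [CommRing C] [CommRing C'] {φ : C →+* C'}
    {s : Set C} (hs : Ideal.span (φ '' s) = ⊤) {N' : Type*} [AddCommGroup N'] [Module C' N']
    (S : Submodule C' N') (n' : N') (h : ∀ f ∈ s, ∃ k : ℕ, φ f ^ k • n' ∈ S) : n' ∈ S := by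
  refine Submodule.mem_of_span_eq_top_of_smul_pow_mem S _ hs n' ?_
  rintro ⟨_, f, hf, rfl⟩
  exact h f hf

theorem FracOf.span_range {C C' : Type*} [CommRing C] [CommRing C'] {φ : C →+* C'} {s : Set C}
    {N N' : Type*} [AddCommGroup N] [AddCommGroup N'] [Module C N] [Module C' N']
    {g : N →ₛₗ[φ] N'} (h : FracOf s g) : Submodule.span C' (Set.range g) = ⊤ := by
  refine eq_top_iff.2 fun n' _ => FracOf.mem_of_pow_smul_mem h.span_eq _ n' fun f hf => ?_
  obtain ⟨k, n, e⟩ := h.surj f hf n'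
  exact ⟨k, e ▸ Submodule.subset_span ⟨n, rfl⟩⟩

variable {K : Type*} [Field K] {C : Type*} [CommRing C] [Algebra K C]
  {C' : Type*} [CommRing C'] [Algebra K C']

theorem DR.span_range_map {φ : C →ₐ[K] C'} {s : Set C}
    (hs : Ideal.span ((φ : C →+* C') '' s) = ⊤)
    (h : ∀ f ∈ s, ∀ c' : C', ∃ (k : ℕ) (c : C), φ f ^ k * c' = φ c) :
    Submodule.span C' (Set.range (DR.map φ)) = ⊤ := by
  refine eq_top_iff.2 fun w _ => ?_
  induction w using DR.induction' with
  | h0 r =>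
    rw [Algebra.algebraMap_eq_smul_one]
    exact Submodule.smul_mem _ _ (Submodule.subset_span ⟨1, map_one _⟩)
  | h1 r =>
    refine FracOf.mem_of_pow_smul_mem hs _ _ fun f hf => ?_
    obtain ⟨k, c, e⟩ := h f hf r
    refine ⟨k, ?_⟩
    have e' := congrArg (DR.ofD K) e
    rw [← map_pow, DR.ofD, Derivation.leibniz, map_add, map_smul, map_smul] at e'
    have e'' : (φ f ^ k) • DR.ofD K r = DR.map φ (DR.ofD K c) - r • DR.map φ (DR.ofD K (f ^ k)) := by
      rw [DR.map_ofD, DR.map_ofD, ← map_pow]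
      exact eq_sub_of_add_eq e'
    change φ f ^ k • DR.ofD K r ∈ _
    rw [e'']
    exact Submodule.sub_mem _ (Submodule.subset_span ⟨_, rfl⟩)
      (Submodule.smul_mem _ _ (Submodule.subset_span ⟨_, rfl⟩))
  | hm a b ha hb =>
    clear * - ha hb
    replace ha := ha trivial
    replace hb := hb trivial
    induction ha, hb using Submodule.span_induction₂ with
    | mem_mem x y hx hy =>
      obtain ⟨x, rfl⟩ := hx
      obtain ⟨y, rfl⟩ := hy
      exact Submodule.subset_span ⟨x * y, map_mul _ _ _⟩
    | zero_left y hy => rw [zero_mul]; exact Submodule.zero_mem _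
    | zero_right y hy => rw [mul_zero]; exact Submodule.zero_mem _
    | add_left x y z _ _ _ h h' => rw [add_mul]; exact Submodule.add_mem _ h h'
    | add_right x y z _ _ _ h h' => rw [mul_add]; exact Submodule.add_mem _ h h'
    | smul_left r x y _ _ h => rw [smul_mul_assoc]; exact Submodule.smul_mem _ _ h
    | smul_right r x y _ _ h => rw [mul_smul_comm]; exact Submodule.smul_mem _ _ h
  | ha a b ha hb => exact Submodule.add_mem _ (ha trivial) (hb trivial)

variable {N : Type*} [AddCommGroup N] [Module C N] {N' : Type*} [AddCommGroup N'] [Module C' N']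

namespace NN

theorem span_image2_tmul {s : Set (DR K C)} (hs : Submodule.span C s = ⊤) {t : Set N}
    (ht : Submodule.span C t = ⊤) :
    Submodule.span (PP K C) (Set.image2 (fun w n => (tmul (OmegaP.tmul 1 w) n : NN K C N)) s t) =
      ⊤ := by
  refine Submodule.eq_top_iff'.2 fun x => ?_
  induction x using NN.induction' with
  | h0 => exact Submodule.zero_mem _
  | ha x y hx hy => exact Submodule.add_mem _ hx hy
  | ht b w n =>
    refine Submodule.smul_mem _ _ ?_
    have hw : w ∈ Submodule.span C s := hs ▸ Submodule.mem_top
    have hn : n ∈ Submodule.span C t := ht ▸ Submodule.mem_top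
    clear hs ht
    induction hw, hn using Submodule.span_induction₂ with
    | mem_mem x y hx hy => exact Submodule.subset_span ⟨x, hx, y, hy, rfl⟩
    | zero_left y hy =>
      rw [OmegaP.tmul_zero]
      have : (tmul 0 y : NN K C N) = 0 := TensorProduct.zero_tmul _ _
      rw [this]
      exact Submodule.zero_mem _
    | zero_right y hy =>
      have : (tmul (OmegaP.tmul 1 y) 0 : NN K C N) = 0 := TensorProduct.tmul_zero _ _
      rw [this]
      exact Submodule.zero_mem _
    | add_left x y z _ _ _ h h' =>
      rw [OmegaP.tmul_add, add_tmul]; exact Submodule.add_mem _ h h'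
    | add_right x y z _ _ _ h h' => rw [tmul_add]; exact Submodule.add_mem _ h h'
    | smul_left r x y _ _ h => rw [tmul_tmul_p₁]; exact Submodule.smul_mem _ _ h
    | smul_right r x y _ _ h => rw [tmul_p₂]; exact Submodule.smul_mem _ _ h

theorem finite [Algebra.FiniteType K C] [Module.Finite C N] :
    Module.Finite (PP K C) (NN K C N) := by
  obtain ⟨s, hs⟩ := (inferInstance : Module.Finite C (DR K C)).fg_top
  obtain ⟨t, ht⟩ := (inferInstance : Module.Finite C N).fg_top
  exact ⟨Submodule.fg_def.2 ⟨_, s.finite_toSet.image2 _ t.finite_toSet, span_image2_tmul hs ht⟩⟩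

theorem span_range_map {φ : C →ₐ[K] C'} {s : Set C} {g : N →ₛₗ[(φ : C →+* C')] N'}
    (hg : FracOf s g) (h : ∀ f ∈ s, ∀ c' : C', ∃ (k : ℕ) (c : C), φ f ^ k * c' = φ c) :
    Submodule.span (PP K C') (Set.range (map φ g)) = ⊤ := by
  refine eq_top_iff.2 ((span_image2_tmul (DR.span_range_map hg.span_eq h) hg.span_range).ge.trans
    (Submodule.span_mono ?_))
  rintro _ ⟨_, ⟨w, rfl⟩, _, ⟨n, rfl⟩, rfl⟩
  refine ⟨tmul (OmegaP.tmul 1 w) n, ?_⟩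
  change map φ g (tmul (OmegaP.tmul 1 w) n) = tmul (OmegaP.tmul 1 (DR.map φ w)) (g n)
  rw [map_tmul, OmegaP.map_tmul, map_one]

variable (K C N) in
/-- The product of `Ω ⊗ P ⊗ C` and `Ω ⊗ P ⊗ N`. -/
def actP : NN K C C →ₗ[PP K C] NN K C N →ₗ[PP K C] NN K C N :=
  LinearMap.mk₂ (PP K C) (fun a x => toOmegaP K C a • x)
    (fun a b x => by rw [map_add, add_smul])
    (fun b a x => by rw [toOmegaP_smulP, smul_smulP])
    (fun a x y => smul_add _ x y)
    (fun b a x => smulP_smul b _ x)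

theorem toOmegaP_surjective : Function.Surjective (toOmegaP K C) :=
  (TensorProduct.rid C (OmegaP K C)).surjective

variable [Algebra.FiniteType K C]

theorem span_nabla_sup (s : Set (NN K C N)) :
    Submodule.span (PP K C) (nabla K C N '' (Submodule.span (PP K C) s : Set (NN K C N))) ⊔
      Submodule.map₂ (actP K C N) ⊤ (Submodule.span (PP K C) s) =
    Submodule.span (PP K C) (nabla K C N '' s) ⊔
      Submodule.map₂ (actP K C N) ⊤ (Submodule.span (PP K C) s) := by
  refine le_antisymm (sup_le (Submodule.span_le.2 ?_) le_sup_right)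
    (sup_le_sup_right (Submodule.span_mono (Set.image_mono Submodule.subset_span)) _)
  rintro _ ⟨x, hx, rfl⟩
  have hx' : x ∈ Submodule.span (PP K C) s := hx
  clear hx
  induction hx' using Submodule.span_induction with
  | mem y hy => exact Submodule.mem_sup_left (Submodule.subset_span ⟨y, hy, rfl⟩)
  | zero => rw [map_zero]; exact Submodule.zero_mem _
  | add y z _ _ hy hz => rw [map_add]; exact Submodule.add_mem _ hy hz
  | smul b y h hy =>
    rw [nabla_smulP]
    refine Submodule.add_mem _ (Submodule.mem_sup_right ?_) (Submodule.smul_mem _ _ hy)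
    obtain ⟨a, ha⟩ := toOmegaP_surjective (OmegaP.gradP K C b)
    rw [← ha]
    exact Submodule.apply_mem_map₂ (actP K C N) Submodule.mem_top h

theorem nabla_mem_pow_smul (L L' : Submodule (PP K C) (NN K C N))
    (hL : ∀ x ∈ L, nabla K C N x ∈ L') (hL' : Submodule.map₂ (actP K C N) ⊤ L ≤ L') (n : ℕ)
    {x : NN K C N} (hx : x ∈ PP.aug K C ^ (n + 1) • L) :
    nabla K C N x ∈ PP.aug K C ^ n • L' := by
  induction hx using Submodule.smul_induction_on' with
  | smul b hb y hy =>
    rw [nabla_smulP]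
    refine Submodule.add_mem _ ?_ (Submodule.smul_mem_smul
      (Ideal.pow_le_pow_right n.le_succ hb) (hL y hy))
    have h := OmegaP.gradP_mem_pow n hb
    have key : ∀ a ∈ (PP.aug K C ^ n • ⊤ : Submodule (PP K C) (OmegaP K C)),
        a • y ∈ PP.aug K C ^ n • L' := fun a ha => by
      induction ha using Submodule.smul_induction_on' with
      | smul c hc a _ =>
        rw [smul_smulP]
        refine Submodule.smul_mem_smul hc (hL' ?_)
        obtain ⟨a, rfl⟩ := toOmegaP_surjective a
        exact Submodule.apply_mem_map₂ (actP K C N) Submodule.mem_top hy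
      | add a _ a' _ h h' => rw [add_smul]; exact Submodule.add_mem _ h h'
    exact key _ h
  | add x _ y _ hx hy => rw [map_add]; exact Submodule.add_mem _ hx hy

end NN

theorem AwayMod.exists_fg {φ : C →+* C'} {f : C} (hφ : AwayHom φ f) {g : N →ₛₗ[φ] N'}
    (h : AwayMod f g) [Module.Finite C' N'] :
    ∃ S : Submodule C N, S.FG ∧ ∀ n, ∃ k : ℕ, f ^ k • n ∈ S := by
  classical
  obtain ⟨t, ht⟩ := (inferInstance : Module.Finite C' N').fg_top
  choose k n hn using h.surj
  refine ⟨Submodule.span C (n '' t), ⟨t.image n, by rw [Finset.coe_image]⟩, fun y => ?_⟩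
  have key : ∀ y' ∈ Submodule.span C' (t : Set N'), ∃ (e : ℕ), ∃ z ∈ Submodule.span C (n '' t),
      φ f ^ e • y' = g z := fun y' hy' => by
    induction hy' using Submodule.span_induction with
    | mem x hx => exact ⟨k x, n x, Submodule.subset_span ⟨x, hx, rfl⟩, hn x⟩
    | zero => exact ⟨0, 0, Submodule.zero_mem _, by simp⟩
    | add x x' _ _ hx hx' =>
      obtain ⟨e, z, hz, h⟩ := hx
      obtain ⟨e', z', hz', h'⟩ := hx'
      refine ⟨e + e', f ^ e' • z + f ^ e • z', Submodule.add_mem _ (Submodule.smul_mem _ _ hz)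
        (Submodule.smul_mem _ _ hz'), ?_⟩
      rw [map_add, map_smulₛₗ, map_smulₛₗ, ← h, ← h', map_pow, map_pow, smul_smul, smul_smul,
        smul_add, ← pow_add, ← pow_add, add_comm e' e]
    | smul c x _ hx =>
      obtain ⟨e, z, hz, h⟩ := hx
      obtain ⟨e', c', hc⟩ := hφ.surj c
      refine ⟨e + e', c' • z, Submodule.smul_mem _ _ hz, ?_⟩
      rw [map_smulₛₗ, ← h, ← hc, pow_add, smul_smul, smul_smul]
      congr 1
      ring
  obtain ⟨e, z, hz, hz'⟩ := key (g y) (ht ▸ Submodule.mem_top)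
  obtain ⟨e', h'⟩ := h.inj (f ^ e • y - z) (by
    rw [map_sub, map_smulₛₗ, map_pow, hz', sub_self])
  rw [smul_sub, sub_eq_zero, smul_smul, ← pow_add] at h'
  exact ⟨e' + e, h' ▸ Submodule.smul_mem _ _ hz⟩

end Fractions

/-! ## Constructions of coherent submodules -/

section CohConstructions

variable (K : Type u) [Field K] {X : Scheme.{u}} [X.Over (Spec (CommRingCat.of K))]
  {M M' : X.Modules}

variable {K} in
theorem IsLocMod.exists_pow_smul_eq (hM : IsLocMod K M) {V V' : X.affineOpens} (h : V'.1 ≤ V.1)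
    (f : Γ(X, V.1)) (hf : X.basicOpen f ≤ V'.1) (n' : Γ(M, V'.1)) :
    ∃ (k : ℕ) (n : Γ(M, V.1)), resA K h f ^ k • n' = resM (K := K) M h n := by
  have hb : X.basicOpen (resA K h f) = X.basicOpen f :=
    (X.basicOpen_res f (homOfLE h).op).trans (inf_eq_right.2 hf)
  have key : ∀ (D : X.Opens) (hD : D ≤ V'.1) (hD' : D ≤ V.1),
      (∀ n' : Γ(M, D), ∃ (k : ℕ) (n : Γ(M, V.1)), resA K hD' f ^ k • n' = resM (K := K) M hD' n) →
      (∀ n : Γ(M, V'.1), resM (K := K) M hD n = 0 → ∃ k : ℕ, resA K h f ^ k • n = 0) →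
      ∃ (k : ℕ) (n : Γ(M, V.1)), resA K h f ^ k • n' = resM (K := K) M h n := by
    intro D hD hD' hs hi
    obtain ⟨k, n, e⟩ := hs (resM (K := K) M hD n')
    obtain ⟨j, e'⟩ := hi (resA K h f ^ k • n' - resM (K := K) M h n) (by
      rw [map_sub, map_smulₛₗ, resM_resM, ← e, map_pow]
      have : ((resA K hD : Γ(X, V'.1) →+* Γ(X, D)) (resA K h f)) = resA K hD' f :=
        resA_resA K h hD f
      rw [this, sub_self])
    refine ⟨j + k, f ^ j • n, ?_⟩
    rw [smul_sub, sub_eq_zero, smul_smul, ← pow_add] at e'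
    rw [e', map_smulₛₗ, map_pow]
    rfl
  have h1 : ∀ (D : X.Opens) (e : D = X.basicOpen (resA K h f)) (hD : D ≤ V'.1),
      ∀ n : Γ(M, V'.1), resM (K := K) M hD n = 0 → ∃ k : ℕ, resA K h f ^ k • n = 0 := by
    rintro _ rfl hD n hn
    exact (hM V' (resA K h f)).inj n hn
  exact key (X.basicOpen f) hf (X.basicOpen_le f) (hM V f).surj (h1 _ hb.symm hf)

theorem span_basicOpen_le {V V' : X.affineOpens} (h : V'.1 ≤ V.1) :
    Ideal.span ((resA K h : Γ(X, V.1) →+* Γ(X, V'.1)) '' {f | X.basicOpen f ≤ V'.1}) = ⊤ := by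
  rw [← V'.2.self_le_iSup_basicOpen_iff]
  intro x hx
  obtain ⟨f, hf, hxf⟩ := V.2.exists_basicOpen_le ⟨x, hx⟩ (h hx)
  rw [Opens.mem_iSup]
  refine ⟨⟨_, f, hf, rfl⟩, ?_⟩
  have hb : X.basicOpen (resA K h f) = X.basicOpen f :=
    (X.basicOpen_res f (homOfLE h).op).trans (inf_eq_right.2 hf)
  change x ∈ X.basicOpen (resA K h f)
  rw [hb]
  exact hxf

variable {K} in
theorem IsLocMod.fracOf (hM : IsLocMod K M) {V V' : X.affineOpens} (h : V'.1 ≤ V.1) :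
    FracOf {f | X.basicOpen f ≤ V'.1} (resM (K := K) M h) where
  span_eq := span_basicOpen_le K h
  surj := fun f hf n' => hM.exists_pow_smul_eq h f hf n'

variable {K} in
theorem NV.span_range_res (hM : IsLocMod K M) {V V' : X.affineOpens} (h : V'.1 ≤ V.1) :
    Submodule.span (PP K Γ(X, V'.1)) (Set.range (NV.res K M h)) = ⊤ :=
  NN.span_range_map (φ := resA K h) (hM.fracOf h)
    (fun f hf c' => (isLocMod_unit K (X := X)).exists_pow_smul_eq h f hf c')

theorem IsLocMod.finite_of_locally {K : Type u} [Field K] [X.Over (Spec (CommRingCat.of K))]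
    (hM : IsLocMod K M) (V : X.affineOpens)
    (h : ∀ x ∈ V.1, ∃ f : Γ(X, V.1), x ∈ X.basicOpen f ∧
      Module.Finite Γ(X, X.basicOpen f) Γ(M, X.basicOpen f)) :
    Module.Finite Γ(X, V.1) Γ(M, V.1) := by
  let s : Set Γ(X, V.1) := {f | Module.Finite Γ(X, X.basicOpen f) Γ(M, X.basicOpen f)}
  have hs : Ideal.span s = ⊤ := by
    rw [← V.2.self_le_iSup_basicOpen_iff]
    intro x hx
    obtain ⟨f, hf, hf'⟩ := h x hx
    exact (Opens.mem_iSup).2 ⟨⟨f, hf'⟩, hf⟩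
  obtain ⟨t, hts, ht⟩ := (Ideal.span_eq_top_iff_finite s).1 hs
  have h' : ∀ f : t, ∃ S : Submodule Γ(X, V.1) Γ(M, V.1), S.FG ∧
      ∀ n, ∃ k : ℕ, f.1 ^ k • n ∈ S := fun f => by
    have : Module.Finite Γ(X, X.basicOpen f.1) Γ(M, X.basicOpen f.1) := hts f.2
    exact (hM V f.1).exists_fg (resA_away K V.2 f.1)
  choose S hS hS' using h'
  refine ⟨?_⟩
  have e : (⊤ : Submodule Γ(X, V.1) Γ(M, V.1)) = ⨆ f, S f := by
    refine (eq_top_iff.2 fun n _ => Submodule.mem_of_span_eq_top_of_smul_pow_mem _ _ ht n ?_).symm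
    intro f
    obtain ⟨k, hk⟩ := hS' f n
    exact ⟨k, Submodule.mem_iSup_of_mem (p := S) f hk⟩
  rw [e]
  exact Submodule.fg_iSup _ hS

namespace NV

variable (M) in
/-- The product as a bilinear map over `P`. -/
def actP (V : X.affineOpens) :
    NV K (OX X) V →ₗ[PP K Γ(X, V.1)] NV K M V →ₗ[PP K Γ(X, V.1)] NV K M V :=
  NN.actP K Γ(X, V.1) Γ(M, V.1)

end NV

namespace Coh

variable {K}

/-- The image of a coherent submodule under a linear map. -/
def map (T : ∀ V : X.affineOpens, NV K M V →ₗ[PP K Γ(X, V.1)] NV K M' V)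
    (hT : ∀ (V V' : X.affineOpens) (h : V'.1 ≤ V.1) (n : NV K M V),
      NV.res K M' h (T V n) = T V' (NV.res K M h n)) (F : Coh K M) : Coh K M' where
  L V := (F.L V).map (T V)
  fg V := (F.fg V).map _
  res_eq V V' h := by
    rw [F.res_eq V V' h, Submodule.map_span]
    congr 1
    rw [Submodule.map_coe, Set.image_image, Set.image_image]
    exact Set.image_congr fun x _ => (hT V V' h x).symm

/-- The product of two coherent submodules. -/
def mul (F : Coh K (OX X)) (G : Coh K M) : Coh K M where
  L V := Submodule.map₂ (NV.actP K M V) (F.L V) (G.L V)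
  fg V := (F.fg V).map₂ _ (G.fg V)
  res_eq V V' h := by
    refine le_antisymm ?_ (Submodule.span_le.2 ?_)
    · rw [F.res_eq V V' h, G.res_eq V V' h, Submodule.map₂_span_span]
      refine Submodule.span_mono ?_
      rintro _ ⟨_, ⟨a, ha, rfl⟩, _, ⟨n, hn, rfl⟩, rfl⟩
      exact ⟨_, Submodule.apply_mem_map₂ (NV.actP K M V) ha hn, NV.res_act K M h a n⟩
    · rintro _ ⟨x, hx, rfl⟩
      have hx' : x ∈ Submodule.map₂ (NV.actP K M V) (F.L V) (G.L V) := hx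
      clear hx
      rw [Submodule.map₂_eq_span_image2] at hx'
      induction hx' using Submodule.span_induction with
      | mem x hx =>
        obtain ⟨a, ha, n, hn, rfl⟩ := hx
        have e := NV.res_act K M h a n
        change NV.res K M h (NV.act K M V a n) ∈ _
        rw [e]
        exact Submodule.apply_mem_map₂ (NV.actP K M V') (F.res_mem h ha) (G.res_mem h hn)
      | zero => rw [map_zero]; exact Submodule.zero_mem _
      | add x y _ _ hx hy => rw [map_add]; exact Submodule.add_mem _ hx hy
      | smul b x _ hx => rw [NV.res_smulP]; exact Submodule.smul_mem _ _ hx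

variable [LocallyOfFiniteType (X ↘ Spec (CommRingCat.of K))]

/-- The whole of `Ω ⊗ P ⊗ M`, for a finitely generated `M`. -/
def top (hM : IsLocMod K M) (hfin : ∀ V : X.affineOpens, Module.Finite Γ(X, V.1) Γ(M, V.1)) :
    Coh K M where
  L _ := ⊤
  fg V := (NN.finite (K := K) (C := Γ(X, V.1)) (N := Γ(M, V.1))).fg_top
  res_eq V V' h := by
    rw [Submodule.top_coe, Set.image_univ, NV.span_range_res hM h]

/-- The whole of `Ω ⊗ P`. -/
def topOX : Coh K (OX X) := top (isLocMod_unit K) fun V => by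
  change Module.Finite Γ(X, V.1) Γ(X, V.1)
  infer_instance

/-- The coherent submodule generated by `∇ F` and `(Ω ⊗ P) F`. -/
def nabla (F : Coh K M) : Coh K M where
  L V := Submodule.span (PP K Γ(X, V.1)) (NV.nabla K M V '' (F.L V : Set (NV K M V))) ⊔
    (topOX.mul F).L V
  fg V := by
    obtain ⟨t, ht⟩ := F.fg V
    have e := NN.span_nabla_sup (K := K) (C := Γ(X, V.1)) (N := Γ(M, V.1)) (t : Set (NV K M V))
    have h : (Submodule.span (PP K Γ(X, V.1))
        (NN.nabla K Γ(X, V.1) Γ(M, V.1) '' (t : Set (NV K M V)))).FG :=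
      Submodule.fg_def.2 ⟨_, t.finite_toSet.image _, rfl⟩
    rw [ht] at e
    have h' := h.sup ((topOX.mul F).fg V)
    exact e.symm ▸ h'
  res_eq V V' h := by
    refine le_antisymm ?_ (Submodule.span_le.2 ?_)
    · have e := NN.span_nabla_sup (K := K) (C := Γ(X, V'.1)) (N := Γ(M, V'.1))
        (NV.res K M h '' (F.L V : Set (NV K M V)))
      have hF := F.res_eq V V' h
      rw [← hF] at e
      refine e.le.trans (sup_le (Submodule.span_mono ?_) ?_)
      · rintro _ ⟨_, ⟨x, hx, rfl⟩, rfl⟩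
        exact ⟨NV.nabla K M V x, Submodule.mem_sup_left (Submodule.subset_span ⟨x, hx, rfl⟩),
          NV.res_nabla K M h x⟩
      · refine ((topOX.mul F).res_eq V V' h).le.trans (Submodule.span_mono (Set.image_mono ?_))
        exact fun x hx => Submodule.mem_sup_right hx
    · rintro _ ⟨x, hx, rfl⟩
      obtain ⟨y, hy, z, hz, rfl⟩ := Submodule.mem_sup.1 hx
      rw [map_add]
      refine Submodule.add_mem_sup ?_ ((topOX.mul F).res_mem h hz)
      clear hx
      induction hy using Submodule.span_induction with
      | mem y hy =>
        obtain ⟨x, hx, rfl⟩ := hy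
        refine Submodule.subset_span ⟨_, F.res_mem h hx, ?_⟩
        exact (NV.res_nabla K M h x).symm
      | zero => rw [map_zero]; exact Submodule.zero_mem _
      | add x y _ _ hx hy => rw [map_add]; exact Submodule.add_mem _ hx hy
      | smul b x _ hx => rw [NV.res_smulP]; exact Submodule.smul_mem _ _ hx

end Coh

namespace sec

variable {K} {W : X.Opens}

theorem isCont_of_linear (f : sec K M W →ₗ[K] sec K M' W)
    (T : ∀ V : AffIn W, NV K M V.1 →ₗ[PP K Γ(X, V.1.1)] NV K M' V.1)
    (hf : ∀ n V, (f n).1 V = T V (n.1 V))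
    (hT : ∀ F : Coh K M, ∃ G : Coh K M', ∀ V : AffIn W, (F.L V.1).map (T V) ≤ G.L V.1) :
    DirInv.IsCont (dirInv K M W) (dirInv K M' W) f := fun F => by
  let F : Coh K M := F
  obtain ⟨G, hG⟩ := hT F
  refine ⟨G, fun n hn V => ?_, fun i => ⟨i, fun n hn V => ?_⟩⟩
  · rw [hf]
    exact hG V ⟨_, hn V, rfl⟩
  · rw [hf]
    have h := Submodule.mem_map_of_mem (f := T V) (hn V)
    have e : (F.pow V.1 (i + 1)).map (T V) ≤ G.pow V.1 (i + 1) := by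
      exact (Submodule.map_smul'' _ (F.L V.1) (T V)).le.trans (Submodule.smul_mono le_rfl (hG V))
    exact e h

theorem isCont_ofFamily (T : ∀ V : X.affineOpens, NV K M V →ₗ[PP K Γ(X, V.1)] NV K M V)
    (hT : ∀ (V V' : X.affineOpens) (h : V'.1 ≤ V.1) (n : NV K M V),
      NV.res K M h (T V n) = T V' (NV.res K M h n)) (f : sec K M W →ₗ[K] sec K M W)
    (hf : ∀ n V, (f n).1 V = T V.1 (n.1 V)) :
    DirInv.IsCont (dirInv K M W) (dirInv K M W) f :=
  isCont_of_linear f (fun V => T V.1) hf fun F => ⟨F.map T hT, fun _ => le_rfl⟩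

theorem isCont_sgn : DirInv.IsCont (dirInv K M W) (dirInv K M W) (sgn K M W) :=
  isCont_ofFamily
    (fun V => { toFun := NV.sgn K M V
                map_add' := map_add _
                map_smul' := NN.sgn_smulP (K := K) (C := Γ(X, V.1)) (N := Γ(M, V.1)) })
    (fun _ _ h n => NV.res_sgn K M h n) _ fun _ _ => rfl

theorem isCont_proj (p : ℕ) :
    DirInv.IsCont (dirInv K M W) (dirInv K M W) (proj K M W p) :=
  isCont_ofFamily
    (fun V => { toFun := NV.proj K M V p
                map_add' := map_add _
                map_smul' := NN.proj_smulP (K := K) (C := Γ(X, V.1)) (N := Γ(M, V.1)) p })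
    (fun _ _ h n => NV.res_proj h p n) _ fun _ _ => rfl

theorem isCont_even : DirInv.IsCont (dirInv K M W) (dirInv K M W) (even K M W) :=
  (DirInv.IsCont.id.add isCont_sgn).smul _

theorem isCont_odd : DirInv.IsCont (dirInv K M W) (dirInv K M W) (odd K M W) := by
  have h := (DirInv.IsCont.id.add ((isCont_sgn (K := K) (M := M) (W := W)).smul (-1))).smul (2 : K)⁻¹
  have e : odd K M W = (2 : K)⁻¹ • (LinearMap.id + (-1 : K) • sgn K M W) :=
    LinearMap.ext fun n => by
      change (2 : K)⁻¹ • (n - sgn K M W n) = (2 : K)⁻¹ • (n + (-1 : K) • sgn K M W n)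
      exact congrArg _ ((sub_eq_add_neg n _).trans
        (congrArg _ (neg_one_smul K (sgn K M W n)).symm))
  rw [e]
  exact h

theorem isCont₂_act :
    DirInv.IsCont₂ (dirInv K (OX X) W) (dirInv K M W) (dirInv K M W) (act K M W) := fun F G => by
  refine ⟨F.mul G, fun a ha n hn V => ?_, fun i => ⟨i, fun a ha n hn V => ?_, fun a ha n hn V => ?_⟩⟩
  · exact Submodule.apply_mem_map₂ (NV.actP K M V.1) (ha V) (hn V)
  · have e : Submodule.map₂ (NV.actP K M V.1) (F.pow V.1 (i + 1)) (G.L V.1) ≤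
        (F.mul G).pow V.1 (i + 1) := by
      refine Submodule.map₂_le.2 fun x hx y hy => ?_
      induction hx using Submodule.smul_induction_on' with
      | smul b hb x hx =>
        rw [map_smul, LinearMap.smul_apply]
        exact Submodule.smul_mem_smul hb (Submodule.apply_mem_map₂ _ hx hy)
      | add x _ x' _ hx hx' => rw [map_add, LinearMap.add_apply]; exact Submodule.add_mem _ hx hx'
    exact e (Submodule.apply_mem_map₂ _ (ha V) (hn V))
  · have e : Submodule.map₂ (NV.actP K M V.1) (F.L V.1) (G.pow V.1 (i + 1)) ≤
        (F.mul G).pow V.1 (i + 1) := by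
      refine Submodule.map₂_le.2 fun x hx y hy => ?_
      induction hy using Submodule.smul_induction_on' with
      | smul b hb y hy =>
        rw [map_smul]
        exact Submodule.smul_mem_smul hb (Submodule.apply_mem_map₂ _ hx hy)
      | add y _ y' _ hy hy' => rw [map_add]; exact Submodule.add_mem _ hy hy'
    exact e (Submodule.apply_mem_map₂ _ (ha V) (hn V))

variable [LocallyOfFiniteType (X ↘ Spec (CommRingCat.of K))]

theorem isCont_nabla : DirInv.IsCont (dirInv K M W) (dirInv K M W) (nabla K M W) := fun F => by
  refine ⟨F.nabla, fun n hn V => Submodule.mem_sup_left (Submodule.subset_span ⟨_, hn V, rfl⟩),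
    fun i => ⟨i + 1, fun n hn V => ?_⟩⟩
  exact NN.nabla_mem_pow_smul (K := K) (C := Γ(X, V.1.1)) (N := Γ(M, V.1.1)) (F.L V.1)
    (F.nabla.L V.1) (fun x hx => Submodule.mem_sup_left (Submodule.subset_span ⟨_, hx, rfl⟩))
    le_sup_right (i + 1) (hn V)

end sec

variable {K} {W : X.Opens} {l : ℕ}

theorem isCont₂_preMul : DirInv.IsCont₂ ((sec.dirInv K (OX X) W).tens (Sx K l))
    ((sec.dirInv K M W).tens (Sx K l)) ((sec.dirInv K M W).tens (Sx K l)) (preMul K M W l) :=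
  ((sec.isCont₂_act.comp_left sec.isCont_even).tens _).add
    ((sec.isCont₂_act.comp_left sec.isCont_odd).tens _)

theorem isCont_projT (p q : ℕ) : DirInv.IsCont ((sec.dirInv K M W).tens (Sx K l))
    ((sec.dirInv K M W).tens (Sx K l)) (projT K M W l p q) :=
  (sec.isCont_proj p).tens _

theorem isCont_preD [LocallyOfFiniteType (X ↘ Spec (CommRingCat.of K))] :
    DirInv.IsCont ((sec.dirInv K M W).tens (Sx K l))
    ((sec.dirInv K M W).tens (Sx K l)) (preD K M W l) :=
  (DirInv.IsCont.id.tens _).add (sec.isCont_nabla.tens _)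

end CohConstructions

/-! ## Operations on the completed tensor products -/

section CellOperations

variable {K : Type u} [Field K] {X : Scheme.{u}} [X.Over (Spec (CommRingCat.of K))]
  {M : X.Modules} {W W' : X.Opens} {k l : ℕ}

theorem eq_add_of_projections {A : Type*} [AddCommGroup A] [Module K A] (P Q : A →ₗ[K] A) {u v : A}
    (hu : P u = u) (hu' : Q u = 0) (hv : Q v = v) (hv' : P v = 0) :
    u + v = P (u + v) + Q (u + v) := by
  rw [map_add, map_add, hu, hu', hv, hv', add_zero, zero_add]

theorem preD_eq [CharZero K] [LocallyOfFiniteType (X ↘ Spec (CommRingCat.of K))] {p q : ℕ}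
    {x : Sx K l ⊗[K] sec K M W} (hx : x ∈ Cell.bideg K M W l p q) :
    preD K M W l x = projT K M W l p (q + 1) (preD K M W l x) +
      projT K M W l (p + 1) q (preD K M W l x) := by
  obtain ⟨h₁, h₂⟩ := preD_mem hx
  have e := eq_add_of_projections (projT K M W l p (q + 1)) (projT K M W l (p + 1) q)
    (projT_of_mem h₁) (projT_of_mem_ne (by simp) h₁) (projT_of_mem h₂)
    (projT_of_mem_ne (by simp) h₂)
  exact e

namespace Cell

theorem Lim.add' {x y : ℕ → Sx K l ⊗[K] sec K M W} {b c : Cell K M W l} (hx : Lim K x b)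
    (hy : Lim K y c) : Lim K (fun n => x n + y n) (b + c) :=
  DirInv.Lim.add hx hy

theorem Lim.smul' (r : K) {x : ℕ → Sx K l ⊗[K] sec K M W} {b : Cell K M W l} (hx : Lim K x b) :
    Lim K (fun n => r • x n) (r • b) :=
  DirInv.Lim.smul r hx

variable (K M W l)

/-- The product. -/
def mul : Cell K (OX X) W l →ₗ[K] Cell K M W l →ₗ[K] Cell K M W l :=
  DirInv.Compl.map₂ (preMul K M W l) isCont₂_preMul

/-- The projection to the part of bidegree `(p, q)`. -/
def proj (p q : ℕ) : Cell K M W l →ₗ[K] Cell K M W l :=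
  DirInv.Compl.map (projT K M W l p q) (isCont_projT p q)

/-- The differential. -/
def diff [LocallyOfFiniteType (X ↘ Spec (CommRingCat.of K))] : Cell K M W l →ₗ[K] Cell K M W l :=
  DirInv.Compl.map (preD K M W l) isCont_preD

variable {K M W l}

theorem mul_lim {x : ℕ → Sx K l ⊗[K] sec K (OX X) W} {b : Cell K (OX X) W l}
    {y : ℕ → Sx K l ⊗[K] sec K M W} {c : Cell K M W l} (hx : Lim K x b) (hy : Lim K y c) :
    Lim K (fun n => preMul K M W l (x n) (y n)) (mul K M W l b c) :=
  DirInv.Lim.map₂ _ hx hy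

theorem proj_lim (p q : ℕ) {x : ℕ → Sx K l ⊗[K] sec K M W} {b : Cell K M W l} (hx : Lim K x b) :
    Lim K (fun n => projT K M W l p q (x n)) (proj K M W l p q b) :=
  DirInv.Lim.map _ hx

theorem diff_lim [LocallyOfFiniteType (X ↘ Spec (CommRingCat.of K))]
    {x : ℕ → Sx K l ⊗[K] sec K M W} {b : Cell K M W l} (hx : Lim K x b) :
    Lim K (fun n => preD K M W l (x n)) (diff K M W l b) :=
  DirInv.Lim.map _ hx

theorem map_mul {a : Sx K l →ₗ[K] Sx K k} (ha : Sx.IsHom a) (h : W' ≤ W)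
    (b : Cell K (OX X) W l) (c : Cell K M W l) :
    map K a h (mul K M W l b c) = mul K M W' k (map K a h b) (map K a h c) := by
  obtain ⟨x, hx⟩ := exists_lim b
  obtain ⟨y, hy⟩ := exists_lim c
  refine (map_lim a h (mul_lim hx hy)).unique ?_
  simp only [map_preMul ha h]
  exact mul_lim (map_lim a h hx) (map_lim a h hy)

theorem map_proj {a : Sx K l →ₗ[K] Sx K k} (ha : Sx.IsHom a) (h : W' ≤ W)
    (p q : ℕ) (b : Cell K M W l) :
    map K a h (proj K M W l p q b) = proj K M W' k p q (map K a h b) := by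
  obtain ⟨x, hx⟩ := exists_lim b
  refine (map_lim a h (proj_lim p q hx)).unique ?_
  simp only [map_projT ha h]
  exact proj_lim p q (map_lim a h hx)

theorem map_diff {a : Sx K l →ₗ[K] Sx K k} (ha : Sx.IsHom a) (h : W' ≤ W)
    [LocallyOfFiniteType (X ↘ Spec (CommRingCat.of K))] (b : Cell K M W l) :
    map K a h (diff K M W l b) = diff K M W' k (map K a h b) := by
  obtain ⟨x, hx⟩ := exists_lim b
  refine (map_lim a h (diff_lim hx)).unique ?_
  simp only [map_preD ha h]
  exact diff_lim (map_lim a h hx)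

/-- The element is a limit of elements of bidegree `(p, q)`. -/
def IsBideg (p q : ℕ) (b : Cell K M W l) : Prop :=
  ∃ x, Lim K x b ∧ ∀ n, x n ∈ bideg K M W l p q

theorem isBideg_iff {p q : ℕ} {b : Cell K M W l} :
    IsBideg p q b ↔ proj K M W l p q b = b := by
  constructor
  · rintro ⟨x, hx, hx'⟩
    refine (proj_lim p q hx).unique ?_
    simp only [fun n => projT_of_mem (hx' n)]
    exact hx
  · intro h
    obtain ⟨x, hx⟩ := exists_lim b
    exact ⟨_, h ▸ proj_lim p q hx, fun n => projT_mem p q (x n)⟩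

theorem IsBideg.proj_ne {p q p' q' : ℕ} {b : Cell K M W l} (hb : IsBideg p q b)
    (hne : (p, q) ≠ (p', q')) : proj K M W l p' q' b = 0 := by
  obtain ⟨x, hx, hx'⟩ := hb
  refine (proj_lim p' q' hx).unique ?_
  simp only [fun n => projT_of_mem_ne hne (hx' n)]
  exact DirInv.Lim.zero

theorem proj_proj (p q : ℕ) (b : Cell K M W l) :
    proj K M W l p q (proj K M W l p q b) = proj K M W l p q b := by
  obtain ⟨x, hx⟩ := exists_lim b
  exact isBideg_iff.1 ⟨_, proj_lim p q hx, fun n => projT_mem p q (x n)⟩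

theorem isBideg_proj (p q : ℕ) (b : Cell K M W l) : IsBideg p q (proj K M W l p q b) :=
  isBideg_iff.2 (proj_proj p q b)

variable [CharZero K]

theorem mul_assoc (b c : Cell K (OX X) W l) (e : Cell K M W l) :
    mul K M W l (mul K (OX X) W l b c) e = mul K M W l b (mul K M W l c e) := by
  obtain ⟨x, hx⟩ := exists_lim b
  obtain ⟨y, hy⟩ := exists_lim c
  obtain ⟨z, hz⟩ := exists_lim e
  refine (mul_lim (mul_lim hx hy) hz).unique ?_
  simp only [preMul_assoc]
  exact mul_lim hx (mul_lim hy hz)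

theorem IsBideg.mul {p q p' q' : ℕ} {b : Cell K (OX X) W l} {c : Cell K M W l}
    (hb : IsBideg p q b) (hc : IsBideg p' q' c) :
    IsBideg (p + p') (q + q') (Cell.mul K M W l b c) := by
  obtain ⟨x, hx, hx'⟩ := hb
  obtain ⟨y, hy, hy'⟩ := hc
  exact ⟨_, mul_lim hx hy, fun n => preMul_mem_bideg (hx' n) (hy' n)⟩

theorem mul_comm {p q p' q' : ℕ} {b c : Cell K (OX X) W l}
    (hb : IsBideg p q b) (hc : IsBideg p' q' c) :
    mul K (OX X) W l c b = (-1 : K) ^ ((p + q) * (p' + q')) • mul K (OX X) W l b c := by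
  obtain ⟨x, hx, hx'⟩ := hb
  obtain ⟨y, hy, hy'⟩ := hc
  refine (mul_lim hy hx).unique ?_
  simp only [fun n => preMul_comm (hx' n) (hy' n)]
  exact (mul_lim hx hy).smul' _

variable [LocallyOfFiniteType (X ↘ Spec (CommRingCat.of K))]

theorem diff_diff (b : Cell K M W l) : diff K M W l (diff K M W l b) = 0 := by
  obtain ⟨x, hx⟩ := exists_lim b
  refine (diff_lim (diff_lim hx)).unique ?_
  simp only [preD_preD]
  exact DirInv.Lim.zero

theorem diff_mul {p q : ℕ} {b : Cell K (OX X) W l} (hb : IsBideg p q b) (c : Cell K M W l) :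
    diff K M W l (mul K M W l b c) = mul K M W l (diff K (OX X) W l b) c +
      (-1 : K) ^ (p + q) • mul K M W l b (diff K M W l c) := by
  obtain ⟨x, hx, hx'⟩ := hb
  obtain ⟨y, hy⟩ := exists_lim c
  refine (diff_lim (mul_lim hx hy)).unique ?_
  simp only [fun n => preD_preMul (hx' n) (y n)]
  exact (mul_lim (diff_lim hx) hy).add' ((mul_lim hx (diff_lim hy)).smul' _)

theorem IsBideg.diff_eq {p q : ℕ} {b : Cell K M W l} (hb : IsBideg p q b) :
    diff K M W l b = proj K M W l p (q + 1) (diff K M W l b) +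
      proj K M W l (p + 1) q (diff K M W l b) := by
  obtain ⟨x, hx, hx'⟩ := hb
  have h := diff_lim hx
  refine h.unique ?_
  have e : ∀ n, preD K M W l (x n) = projT K M W l p (q + 1) (preD K M W l (x n)) +
      projT K M W l (p + 1) q (preD K M W l (x n)) := fun n => by
    exact preD_eq (hx' n)
  have h' := (proj_lim p (q + 1) h).add' (proj_lim (p + 1) q h)
  simp only [← e] at h'
  exact h'

end Cell

namespace Cell

/-- The constant sequence with value `1 ⊗ s` converges. -/
theorem exists_lim_const (F : Coh K M) (s : sec K M W) (hs : ∀ V : AffIn W, s.1 V ∈ F.L V.1) :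
    ∃ b, Lim K (fun _ => (1 : Sx K l) ⊗ₜ[K] s) b := by
  have h : (fun _ : ℕ => (1 : Sx K l) ⊗ₜ[K] s) ∈ ((sec.dirInv K M W).tens (Sx K l)).cauchy :=
    ⟨F, fun _ => ⟨(1 : Sx K l) ⊗ₜ (⟨s, hs⟩ : sec.within K M W F.L), rfl⟩, fun i => ⟨0, fun n _ => by
      rw [sub_self]; exact Submodule.zero_mem _⟩⟩
  exact ⟨_, h, rfl⟩

/-- The element `1 ⊗ s`. -/
def ofSec (F : Coh K M) (s : sec K M W) (hs : ∀ V : AffIn W, s.1 V ∈ F.L V.1) : Cell K M W l :=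
  (exists_lim_const F s hs).choose

theorem ofSec_lim (F : Coh K M) (s : sec K M W) (hs : ∀ V : AffIn W, s.1 V ∈ F.L V.1) :
    Lim K (fun _ => (1 : Sx K l) ⊗ₜ[K] s) (ofSec F s hs : Cell K M W l) :=
  (exists_lim_const F s hs).choose_spec

theorem mul_const [CharZero K] {e : Cell K (OX X) W l} {c : Γ(X, W)}
    (he : Lim K (fun _ => 1 ⊗ₜ[K] sec.const K (OX X) W c) e) (b : Cell K M W l) :
    mul K M W l e b = smulFun K c b := by
  obtain ⟨x, hx⟩ := exists_lim b
  refine (mul_lim he hx).unique ?_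
  simp only [const_preMul]
  exact smulFun_lim c hx

theorem mul_one [CharZero K] {e : Cell K (OX X) W l}
    (he : Lim K (fun _ => 1 ⊗ₜ[K] sec.const K (OX X) W (1 : Γ(X, W))) e) (b : Cell K (OX X) W l) :
    mul K (OX X) W l b e = b := by
  obtain ⟨x, hx⟩ := exists_lim b
  refine (mul_lim hx he).unique ?_
  simp only [preMul_one]
  exact hx

end Cell

end CellOperations

/-! ## Operations on the mixed resolution -/

section MixOperations

variable {K : Type u} [Field K] {X : Scheme.{u}} [X.Over (Spec (CommRingCat.of K))]
  {m : ℕ} {U : Fin (m + 1) → X.Opens} {M : X.Modules} {V V' : X.Opens}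

variable (K U M V) in
/-- The families which are compatible with the cosimplicial structure. -/
def compat : Submodule K (Amb K U M V) where
  carrier := {u | ∀ (k l : ℕ) (α : Fin (k + 1) →o Fin (l + 1)) (i : Idx m l),
      Cell.map K LinearMap.id (inf_le_inf_left V (inter_le U α i)) (u k (i.comp α)) =
        Cell.map K (Sx.pull K α) le_rfl (u l i)}
  zero_mem' k l α i := by simp only [Pi.zero_apply, map_zero]
  add_mem' := fun hu hv k l α i => by simp only [Pi.add_apply, map_add, hu k l α i, hv k l α i]
  smul_mem' := fun c u hu k l α i => by simp only [Pi.smul_apply, map_smul, hu k l α i]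

theorem mem_bi {p q : ℕ} {u : Amb K U M V} :
    u ∈ bi K U M V p q ↔ u ∈ compat K U M V ∧ ∀ l i, Cell.IsBideg p q (u l i) :=
  Iff.rfl

theorem bi_le_compat (p q : ℕ) : bi K U M V p q ≤ compat K U M V := fun _ h => h.1

theorem bi_le_mix (p q : ℕ) : bi K U M V p q ≤ Mix K U M V :=
  le_iSup_of_le p (le_iSup_of_le q le_rfl)

theorem mix_le_compat : Mix K U M V ≤ compat K U M V :=
  iSup_le fun _ => iSup_le fun _ => bi_le_compat _ _

variable (U V) in
/-- The operator on families given by operators on their members. -/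
def ambOp (f : ∀ (W : X.Opens) (l : ℕ), Cell K M W l →ₗ[K] Cell K M W l) :
    Amb K U M V →ₗ[K] Amb K U M V where
  toFun u l i := f _ l (u l i)
  map_add' u v := funext fun l => funext fun i => map_add (f _ l) (u l i) (v l i)
  map_smul' c u := funext fun l => funext fun i => map_smul (f _ l) c (u l i)

theorem ambOp_mem_compat {f : ∀ (W : X.Opens) (l : ℕ), Cell K M W l →ₗ[K] Cell K M W l}
    (hf : ∀ {W W' : X.Opens} {k l : ℕ} {a : Sx K l →ₗ[K] Sx K k} (_ : Sx.IsHom a) (h : W' ≤ W)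
      (b : Cell K M W l), Cell.map K a h (f W l b) = f W' k (Cell.map K a h b))
    {u : Amb K U M V} (hu : u ∈ compat K U M V) : ambOp U V f u ∈ compat K U M V := by
  intro k l α i
  refine (hf Sx.isHom_id _ _).trans (Eq.trans ?_ (hf (Sx.isHom_pull α) _ _).symm)
  exact congrArg (f _ k) (hu k l α i)

variable (K U M V) in
/-- The projection to the part of bidegree `(p, q)`. -/
def ambProj (p q : ℕ) : Amb K U M V →ₗ[K] Amb K U M V :=
  ambOp U V fun W l => Cell.proj K M W l p q

theorem ambProj_mem (p q : ℕ) {u : Amb K U M V} (hu : u ∈ compat K U M V) :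
    ambProj K U M V p q u ∈ bi K U M V p q :=
  mem_bi.2 ⟨ambOp_mem_compat (fun ha h b => Cell.map_proj ha h p q b) hu,
    fun l i => Cell.isBideg_proj p q (u l i)⟩

theorem ambProj_of_mem {p q : ℕ} {u : Amb K U M V} (hu : u ∈ bi K U M V p q) :
    ambProj K U M V p q u = u :=
  funext fun l => funext fun i => Cell.isBideg_iff.1 ((mem_bi.1 hu).2 l i)

theorem ambProj_of_mem_ne {p q p' q' : ℕ} (hne : (p, q) ≠ (p', q')) {u : Amb K U M V}
    (hu : u ∈ bi K U M V p q) : ambProj K U M V p' q' u = 0 :=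
  funext fun l => funext fun i => ((mem_bi.1 hu).2 l i).proj_ne hne

theorem ambRes_ambProj (h : V' ≤ V) (p q : ℕ) (u : Amb K U M V) :
    Mix.ambRes h (ambProj K U M V p q u) = ambProj K U M V' p q (Mix.ambRes h u) :=
  funext fun l => funext fun i => Cell.map_proj Sx.isHom_id _ p q (u l i)

theorem mem_mix_iff {u : Amb K U M V} : u ∈ Mix K U M V ↔ u ∈ compat K U M V ∧
    ∃ S : Finset (ℕ × ℕ), ∀ S', S ⊆ S' → ∑ a ∈ S', ambProj K U M V a.1 a.2 u = u := by
  constructor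
  · intro hu
    refine ⟨mix_le_compat hu, ?_⟩
    rw [Mix, iSup_prod'] at hu
    induction hu using Submodule.iSup_induction' with
    | mem a u hu =>
      refine ⟨{a}, fun S' hS' => ?_⟩
      rw [Finset.sum_eq_single_of_mem a (hS' (Finset.mem_singleton_self a))
        fun b _ hb => ambProj_of_mem_ne (Ne.symm hb) hu]
      exact ambProj_of_mem hu
    | zero => exact ⟨∅, fun S' _ => by simp⟩
    | add u v _ _ hu hv =>
      classical
      obtain ⟨S, hS⟩ := hu
      obtain ⟨S', hS'⟩ := hv
      refine ⟨S ∪ S', fun T hT => ?_⟩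
      simp only [map_add, Finset.sum_add_distrib]
      rw [hS T (Finset.union_subset_left hT), hS' T (Finset.union_subset_right hT)]
  · rintro ⟨hu, S, hS⟩
    rw [← hS S subset_rfl]
    exact Submodule.sum_mem _ fun a _ => bi_le_mix _ _ (ambProj_mem a.1 a.2 hu)

theorem iSupIndep_of_projections {R A B ι : Type*} [Ring R] [AddCommGroup A] [Module R A]
    [AddCommGroup B] [Module R B] (S : ι → Submodule R A) (P : ι → A →ₗ[R] B) (Q : A →ₗ[R] B)
    (hQ : Function.Injective Q) (h : ∀ i, ∀ x ∈ S i, P i x = Q x)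
    (h' : ∀ i j, i ≠ j → ∀ x ∈ S i, P j x = 0) : iSupIndep S := by
  refine iSupIndep_def.2 fun i => Submodule.disjoint_def.2 fun x hx hx' => hQ ?_
  have hle : (⨆ j, ⨆ (_ : j ≠ i), S j) ≤ LinearMap.ker (P i) :=
    iSup_le fun j => iSup_le fun hj y hy => h' j i hj y hy
  rw [← h i x hx, hle hx', map_zero]

theorem isBigraded : IsBigraded K U M := fun V =>
  iSupIndep_of_projections _ (fun a => ambProj K U M V a.1 a.2) LinearMap.id
    Function.injective_id (fun _ _ hx => ambProj_of_mem hx)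
    (fun _ _ hij _ hx => ambProj_of_mem_ne hij hx)

namespace Mix

theorem induction {P : Mix K U M V → Prop}
    (hb : ∀ p q (u : Mix K U M V), u.1 ∈ bi K U M V p q → P u) (h0 : P 0)
    (ha : ∀ u v, P u → P v → P (u + v)) (u : Mix K U M V) : P u := by
  obtain ⟨u, hu⟩ := u
  have hu' : u ∈ ⨆ a : ℕ × ℕ, bi K U M V a.1 a.2 := by rwa [Mix, iSup_prod'] at hu
  have key : ∀ h : u ∈ Mix K U M V, P ⟨u, h⟩ := by
    clear hu
    induction hu' using Submodule.iSup_induction' with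
    | mem a u hu => exact fun h => hb a.1 a.2 ⟨u, h⟩ hu
    | zero => exact fun _ => h0
    | add u v hu' hv' hu hv =>
      intro h
      have e : (⨆ a : ℕ × ℕ, bi K U M V a.1 a.2) = Mix K U M V := by rw [Mix, iSup_prod']
      exact ha ⟨u, e ▸ hu'⟩ ⟨v, e ▸ hv'⟩ (hu _) (hv _)
  exact key hu

theorem mem_gr {p q : ℕ} {u : Mix K U M V} (hu : u.1 ∈ bi K U M V p q) {i : ℕ} (h : p + q = i) :
    u ∈ gr K U M V i :=
  Submodule.mem_iSup_of_mem p (Submodule.mem_iSup_of_mem q (Submodule.mem_iSup_of_mem h hu))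

theorem gr_induction {i : ℕ} {P : Mix K U M V → Prop}
    (hb : ∀ p q (u : Mix K U M V), p + q = i → u.1 ∈ bi K U M V p q → P u) (h0 : P 0)
    (ha : ∀ u v, P u → P v → P (u + v)) {u : Mix K U M V} (hu : u ∈ gr K U M V i) : P u := by
  obtain ⟨u, hm⟩ := u
  have hle : (⨆ a : {a : ℕ × ℕ // a.1 + a.2 = i}, bi K U M V a.1.1 a.1.2) ≤ Mix K U M V :=
    iSup_le fun a => bi_le_mix _ _
  have hu' : u ∈ ⨆ a : {a : ℕ × ℕ // a.1 + a.2 = i}, bi K U M V a.1.1 a.1.2 := by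
    have h : u ∈ ⨆ (p : ℕ) (q : ℕ) (_ : p + q = i), bi K U M V p q := hu
    refine (iSup_le fun p => iSup_le fun q => iSup_le fun hpq => ?_ :
      (⨆ (p : ℕ) (q : ℕ) (_ : p + q = i), bi K U M V p q) ≤ _) h
    exact le_iSup (fun a : {a : ℕ × ℕ // a.1 + a.2 = i} => bi K U M V a.1.1 a.1.2) ⟨(p, q), hpq⟩
  have key : ∀ h : u ∈ Mix K U M V, P ⟨u, h⟩ := by
    clear hu hm
    induction hu' using Submodule.iSup_induction' with
    | mem a u hu => exact fun h => hb a.1.1 a.1.2 ⟨u, h⟩ a.2 hu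
    | zero => exact fun _ => h0
    | add u v hu' hv' hu hv =>
      intro h
      exact ha ⟨u, hle hu'⟩ ⟨v, hle hv'⟩ (hu _) (hv _)
  exact key hm

theorem isInternal_gr : DirectSum.IsInternal (gr K U M V) := by
  rw [DirectSum.isInternal_submodule_iff_iSupIndep_and_iSup_eq_top]
  constructor
  · refine iSupIndep_of_projections _ (fun i => (∑ a ∈ Finset.HasAntidiagonal.antidiagonal i,
      ambProj K U M V a.1 a.2).comp (Mix K U M V).subtype) (Mix K U M V).subtype
      Subtype.val_injective (fun i u hu => ?_) (fun i j hij u hu => ?_)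
    · refine gr_induction (P := fun u => _ = _) (fun p q u h hu => ?_) ?_ (fun u v hu hv => ?_) hu
      · change (∑ a ∈ Finset.HasAntidiagonal.antidiagonal i, ambProj K U M V a.1 a.2) u.1 = u.1
        rw [LinearMap.sum_apply, Finset.sum_eq_single_of_mem (p, q) (Finset.HasAntidiagonal.mem_antidiagonal.2 h)
          fun b _ hb => ambProj_of_mem_ne (Ne.symm hb) hu]
        exact ambProj_of_mem hu
      · rw [map_zero, map_zero]
      · rw [map_add, map_add, hu, hv]
    · refine gr_induction (P := fun u => _ = _) (fun p q u h hu => ?_) ?_ (fun u v hu hv => ?_) hu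
      · change (∑ a ∈ Finset.HasAntidiagonal.antidiagonal j, ambProj K U M V a.1 a.2) u.1 = 0
        rw [LinearMap.sum_apply]
        refine Finset.sum_eq_zero fun b hb => ambProj_of_mem_ne ?_ hu
        have hb' := Finset.HasAntidiagonal.mem_antidiagonal.1 hb
        intro e
        rw [Prod.mk.injEq] at e
        omega
      · rw [map_zero]
      · rw [map_add, hu, hv, add_zero]
  · refine eq_top_iff.2 fun u _ => ?_
    refine induction (P := fun u => u ∈ ⨆ i, gr K U M V i) (fun p q u hu => ?_)
      (Submodule.zero_mem _) (fun u v hu hv => Submodule.add_mem _ hu hv) u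
    exact Submodule.mem_iSup_of_mem (p + q) (mem_gr hu rfl)

theorem ext_lim {u v : Mix K U M V} (h : ∀ l i, ∃ x, Cell.Lim K x (u.1 l i) ∧
    Cell.Lim K x (v.1 l i)) : u = v :=
  Subtype.ext (funext fun l => funext fun i => by
    obtain ⟨x, hx, hx'⟩ := h l i
    exact hx.unique hx')

/-! ### The differential -/

section Differential

variable [CharZero K] [LocallyOfFiniteType (X ↘ Spec (CommRingCat.of K))]

theorem ambDiff_eq {p q : ℕ} {u : Amb K U M V} (hu : u ∈ bi K U M V p q) :
    ambOp U V (fun W l => Cell.diff K M W l) u =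
      ambProj K U M V p (q + 1) (ambOp U V (fun W l => Cell.diff K M W l) u) +
        ambProj K U M V (p + 1) q (ambOp U V (fun W l => Cell.diff K M W l) u) :=
  funext fun l => funext fun i => ((mem_bi.1 hu).2 l i).diff_eq

theorem ambDiff_mem_compat {u : Amb K U M V} (hu : u ∈ compat K U M V) :
    ambOp U V (fun W l => Cell.diff K M W l) u ∈ compat K U M V :=
  ambOp_mem_compat (fun ha h b => Cell.map_diff ha h b) hu

theorem ambDiff_mem_sup {p q : ℕ} {u : Amb K U M V} (hu : u ∈ bi K U M V p q) :
    ambOp U V (fun W l => Cell.diff K M W l) u ∈ bi K U M V p (q + 1) ⊔ bi K U M V (p + 1) q := by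
  have h := ambDiff_mem_compat (bi_le_compat _ _ hu)
  rw [ambDiff_eq hu]
  exact Submodule.add_mem_sup (ambProj_mem _ _ h) (ambProj_mem _ _ h)

theorem ambDiff_mem :
    Mix K U M V ≤ (Mix K U M V).comap (ambOp U V (fun W l => Cell.diff K M W l)) :=
  iSup_le fun p => iSup_le fun q => fun _ hu =>
    (sup_le (bi_le_mix p (q + 1)) (bi_le_mix (p + 1) q) :
      bi K U M V p (q + 1) ⊔ bi K U M V (p + 1) q ≤ Mix K U M V) (ambDiff_mem_sup hu)

variable (K U M V) in
/-- The differential. -/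
def diff : Mix K U M V →ₗ[K] Mix K U M V :=
  (ambOp U V (fun W l => Cell.diff K M W l)).restrict ambDiff_mem

theorem isMixD : IsMixD K U M (fun V => diff K U M V) := fun _ _ _ _ _ hx => Cell.diff_lim hx

theorem diff_mem_gr {i : ℕ} {u : Mix K U M V} (hu : u ∈ gr K U M V i) :
    diff K U M V u ∈ gr K U M V (i + 1) := by
  refine gr_induction (P := fun u => diff K U M V u ∈ gr K U M V (i + 1)) (fun p q u h hu => ?_) ?_
    (fun u v hu hv => ?_) hu
  · obtain ⟨x, hx, y, hy, e⟩ := Submodule.mem_sup.1 (ambDiff_mem_sup hu)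
    have e' : diff K U M V u = ⟨x, bi_le_mix _ _ hx⟩ + ⟨y, bi_le_mix _ _ hy⟩ := Subtype.ext e.symm
    rw [e']
    exact Submodule.add_mem _ (mem_gr hx (by omega)) (mem_gr hy (by omega))
  · rw [map_zero]; exact Submodule.zero_mem _
  · rw [map_add]; exact Submodule.add_mem _ hu hv

theorem diff_diff (u : Mix K U M V) : diff K U M V (diff K U M V u) = 0 :=
  Subtype.ext (funext fun l => funext fun i => Cell.diff_diff (u.1 l i))

theorem res_diff (h : V' ≤ V) (u : Mix K U M V) :
    res h (diff K U M V u) = diff K U M V' (res h u) :=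
  Subtype.ext (funext fun l => funext fun i => Cell.map_diff Sx.isHom_id _ (u.1 l i))

end Differential

/-! ### The product -/

section Product

variable [CharZero K]

variable (K U M V) in
/-- The product of families. -/
def ambMul : Amb K U (OX X) V →ₗ[K] Amb K U M V →ₗ[K] Amb K U M V :=
  LinearMap.mk₂ K (fun u v l i => Cell.mul K M _ l (u l i) (v l i))
    (fun u u' v => funext fun l => funext fun i =>
      LinearMap.map_add₂ (Cell.mul K M _ l) (u l i) (u' l i) (v l i))
    (fun c u v => funext fun l => funext fun i =>
      LinearMap.map_smul₂ (Cell.mul K M _ l) c (u l i) (v l i))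
    (fun u v v' => funext fun l => funext fun i =>
      map_add (Cell.mul K M _ l (u l i)) (v l i) (v' l i))
    (fun c u v => funext fun l => funext fun i =>
      map_smul (Cell.mul K M _ l (u l i)) c (v l i))

theorem ambMul_mem_bi {p q p' q' : ℕ} {u : Amb K U (OX X) V} (hu : u ∈ bi K U (OX X) V p q)
    {v : Amb K U M V} (hv : v ∈ bi K U M V p' q') :
    ambMul K U M V u v ∈ bi K U M V (p + p') (q + q') := by
  refine mem_bi.2 ⟨fun k l α i => ?_, fun l i => ((mem_bi.1 hu).2 l i).mul ((mem_bi.1 hv).2 l i)⟩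
  refine (Cell.map_mul Sx.isHom_id _ _ _).trans
    (Eq.trans ?_ (Cell.map_mul (Sx.isHom_pull α) _ _ _).symm)
  rw [hu.1 k l α i, hv.1 k l α i]

theorem ambMul_mem {u : Amb K U (OX X) V} (hu : u ∈ Mix K U (OX X) V)
    {v : Amb K U M V} (hv : v ∈ Mix K U M V) : ambMul K U M V u v ∈ Mix K U M V := by
  refine induction (P := fun u => ambMul K U M V u.1 v ∈ Mix K U M V) (fun p q u hu => ?_) ?_
    (fun u u' h h' => ?_) ⟨u, hu⟩
  · refine induction (P := fun v => ambMul K U M V u.1 v.1 ∈ Mix K U M V) (fun p' q' v hv => ?_) ?_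
      (fun v v' h h' => ?_) ⟨v, hv⟩
    · exact bi_le_mix _ _ (ambMul_mem_bi hu hv)
    · rw [ZeroMemClass.coe_zero, map_zero]; exact Submodule.zero_mem _
    · rw [Submodule.coe_add, map_add]; exact Submodule.add_mem _ h h'
  · rw [ZeroMemClass.coe_zero, map_zero]; exact Submodule.zero_mem _
  · rw [Submodule.coe_add, map_add]; exact Submodule.add_mem _ h h'

variable (K U M V) in
/-- The product. -/
def mul : Mix K U (OX X) V →ₗ[K] Mix K U M V →ₗ[K] Mix K U M V :=
  LinearMap.mk₂ K (fun u v => ⟨ambMul K U M V u.1 v.1, ambMul_mem u.2 v.2⟩)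
    (fun u u' v => Subtype.ext (LinearMap.map_add₂ (ambMul K U M V) u.1 u'.1 v.1))
    (fun c u v => Subtype.ext (LinearMap.map_smul₂ (ambMul K U M V) c u.1 v.1))
    (fun u v v' => Subtype.ext (map_add (ambMul K U M V u.1) v.1 v'.1))
    (fun c u v => Subtype.ext (map_smul (ambMul K U M V u.1) c v.1))

theorem mul_apply (u : Mix K U (OX X) V) (v : Mix K U M V) (l : ℕ) (i : Idx m l) :
    (mul K U M V u v).1 l i = Cell.mul K M _ l (u.1 l i) (v.1 l i) := rfl

theorem isMixMul : IsMixMul K U M (fun V => mul K U M V) := fun _ _ _ _ _ _ _ hx hy => Cell.mul_lim hx hy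

theorem mul_mem_gr {i j : ℕ} {u : Mix K U (OX X) V} (hu : u ∈ gr K U (OX X) V i)
    {v : Mix K U M V} (hv : v ∈ gr K U M V j) : mul K U M V u v ∈ gr K U M V (i + j) := by
  refine gr_induction (P := fun u => mul K U M V u v ∈ gr K U M V (i + j)) (fun p q u h hu => ?_) ?_
    (fun u u' h h' => ?_) hu
  · refine gr_induction (P := fun v => mul K U M V u v ∈ gr K U M V (i + j))
      (fun p' q' v h' hv => ?_) ?_ (fun v v' h h' => ?_) hv
    · exact mem_gr (ambMul_mem_bi hu hv) (by omega)
    · rw [map_zero]; exact Submodule.zero_mem _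
    · rw [map_add]; exact Submodule.add_mem _ h h'
  · rw [map_zero]; exact Submodule.zero_mem _
  · rw [map_add]; exact Submodule.add_mem _ h h'

theorem mul_assoc (u v : Mix K U (OX X) V) (w : Mix K U M V) :
    mul K U M V (mul K U (OX X) V u v) w = mul K U M V u (mul K U M V v w) :=
  Subtype.ext (funext fun l => funext fun i => Cell.mul_assoc _ _ _)

theorem mul_comm {i j : ℕ} {u v : Mix K U (OX X) V} (hu : u ∈ gr K U (OX X) V i)
    (hv : v ∈ gr K U (OX X) V j) :
    mul K U (OX X) V v u = (-1 : K) ^ (i * j) • mul K U (OX X) V u v := by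
  refine gr_induction (P := fun u => mul K U (OX X) V v u =
    (-1 : K) ^ (i * j) • mul K U (OX X) V u v) (fun p q u h hu' => ?_) ?_ (fun u u' h h' => ?_) hu
  · refine gr_induction (P := fun v => mul K U (OX X) V v u =
      (-1 : K) ^ (i * j) • mul K U (OX X) V u v) (fun p' q' v h' hv' => ?_) ?_
      (fun u u' h h' => ?_) hv
    · subst h h'
      exact Subtype.ext (funext fun l => funext fun i =>
        Cell.mul_comm ((mem_bi.1 hu').2 l i) ((mem_bi.1 hv').2 l i))
    · simp
    · simp only [map_add, LinearMap.add_apply, h, h', smul_add]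
  · simp
  · simp only [map_add, LinearMap.add_apply, h, h', smul_add]

theorem res_mul (h : V' ≤ V) (u : Mix K U (OX X) V) (v : Mix K U M V) :
    res h (mul K U M V u v) = mul K U M V' (res h u) (res h v) :=
  Subtype.ext (funext fun l => funext fun i => Cell.map_mul Sx.isHom_id _ _ _)

theorem diff_mul [LocallyOfFiniteType (X ↘ Spec (CommRingCat.of K))] {i : ℕ}
    {u : Mix K U (OX X) V} (hu : u ∈ gr K U (OX X) V i) (v : Mix K U M V) :
    diff K U M V (mul K U M V u v) = mul K U M V (diff K U (OX X) V u) v +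
      (-1 : K) ^ i • mul K U M V u (diff K U M V v) := by
  refine gr_induction (P := fun u => diff K U M V (mul K U M V u v) =
    mul K U M V (diff K U (OX X) V u) v + (-1 : K) ^ i • mul K U M V u (diff K U M V v))
    (fun p q u h hu' => ?_) ?_ (fun u u' h h' => ?_) hu
  · subst h
    exact Subtype.ext (funext fun l => funext fun i =>
      Cell.diff_mul ((mem_bi.1 hu').2 l i) _)
  · simp
  · simp only [map_add, LinearMap.add_apply, h, h', smul_add]; abel

end Product

end Mix

end MixOperations

/-! ## The sheaf property and the constant sections -/

section MixSheaf

variable {K : Type u} [Field K] {X : Scheme.{u}} [X.Over (Spec (CommRingCat.of K))]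
  {m : ℕ} {U : Fin (m + 1) → X.Opens} {M : X.Modules} {V V' : X.Opens}

theorem le_iSup_inf {ι : Sort*} {W : ι → X.Opens} (hV : V ≤ ⨆ a, W a) (I : X.Opens) :
    V ⊓ I ≤ ⨆ a, W a ⊓ I := by
  rw [← iSup_inf_eq]
  exact inf_le_inf_right I hV

namespace Mix

section Local

variable [LocallyOfFiniteType (X ↘ Spec (CommRingCat.of K))] {ι : Type*} {W : ι → X.Opens}

theorem cell_eq_of_local (hM : IsLocMod K M) (hle : ∀ a, W a ≤ V) (hV : V ≤ ⨆ a, W a)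
    {l : ℕ} {I : X.Opens} {b b' : Cell K M (V ⊓ I) l}
    (h : ∀ a, Cell.map K LinearMap.id (inf_le_inf_right I (hle a)) b =
      Cell.map K LinearMap.id (inf_le_inf_right I (hle a)) b') : b = b' :=
  Cell.eq_of_local hM (fun a => inf_le_inf_right I (hle a)) (le_iSup_inf hV I) h

theorem eq_of_local (hM : IsLocMod K M) (hle : ∀ a, W a ≤ V) (hV : V ≤ ⨆ a, W a)
    {u v : Mix K U M V} (h : ∀ a, res (hle a) u = res (hle a) v) : u = v :=
  Subtype.ext (funext fun l => funext fun i => cell_eq_of_local hM hle hV fun a =>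
    congrFun (congrFun (congrArg Subtype.val (h a)) l) i)

theorem exists_glue_of_finite [Finite ι] (hM : IsLocMod K M) (hle : ∀ a, W a ≤ V)
    (hV : V ≤ ⨆ a, W a) (s : ∀ a, Mix K U M (W a))
    (hs : ∀ a b, res (inf_le_left : W a ⊓ W b ≤ W a) (s a) =
      res (inf_le_right : W a ⊓ W b ≤ W b) (s b)) :
    ∃ u : Mix K U M V, ∀ a, res (hle a) u = s a := by
  have h1 : ∀ (l : ℕ) (i : Idx m l), ∃ b : Cell K M (V ⊓ inter U i) l, ∀ a,
      Cell.map K LinearMap.id (inf_le_inf_right _ (hle a)) b = (s a).1 l i := fun l i => by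
    refine Cell.exists_glue hM (fun a => inf_le_inf_right (inter U i) (hle a))
      (le_iSup_inf hV (inter U i)) (fun a => (s a).1 l i) fun a b => ?_
    have e := congrFun (congrFun (congrArg Subtype.val (hs a b)) l) i
    have hI : (W a ⊓ inter U i) ⊓ (W b ⊓ inter U i) ≤ (W a ⊓ W b) ⊓ inter U i :=
      le_inf (inf_le_inf inf_le_left inf_le_left) (inf_le_left.trans inf_le_right)
    have e' := congrArg (Cell.map K LinearMap.id hI) e
    rw [res_apply, res_apply, Cell.map_map, Cell.map_map] at e'
    exact e'
  choose u hu using h1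
  have hr : ∀ a, ambRes (hle a) u = (s a).1 := fun a =>
    funext fun l => funext fun i => hu l i a
  have hc : u ∈ compat K U M V := fun k l α i => by
    refine cell_eq_of_local hM hle hV fun a => ?_
    have h := mix_le_compat (s a).2 k l α i
    rw [← hu l i a, ← hu k (i.comp α) a, Cell.map_map, Cell.map_map] at h
    rw [Cell.map_map, Cell.map_map]
    exact h
  have hS : ∃ S : Finset (ℕ × ℕ), ∀ a, ∑ b ∈ S, ambProj K U M (W a) b.1 b.2 (s a).1 = (s a).1 := by
    classical
    choose S hS using fun a => (mem_mix_iff.1 (s a).2).2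
    have := Fintype.ofFinite ι
    exact ⟨Finset.univ.biUnion S, fun a => hS a _ (Finset.subset_biUnion_of_mem S (Finset.mem_univ a))⟩
  obtain ⟨S, hS⟩ := hS
  have hmem : u ∈ Mix K U M V := by
    have e : ∑ b ∈ S, ambProj K U M V b.1 b.2 u = u :=
      funext fun l => funext fun i => cell_eq_of_local hM hle hV fun a => by
        have h : ambRes (hle a) (∑ b ∈ S, ambProj K U M V b.1 b.2 u) = ambRes (hle a) u := by
          rw [map_sum]
          simp only [ambRes_ambProj]
          rw [hr a, hS a]
        exact congrFun (congrFun h l) i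
    rw [← e]
    exact Submodule.sum_mem _ fun a _ => bi_le_mix _ _ (ambProj_mem a.1 a.2 hc)
  exact ⟨⟨u, hmem⟩, fun a => Subtype.ext (hr a)⟩

theorem exists_glue [NoetherianSpace X] (hM : IsLocMod K M) (W : ι → X.Opens)
    (s : ∀ a, Mix K U M (W a))
    (hs : ∀ a b, res (inf_le_left : W a ⊓ W b ≤ W a) (s a) =
      res (inf_le_right : W a ⊓ W b ≤ W b) (s b)) :
    ∃ u : Mix K U M (⨆ a, W a), ∀ a, res (le_iSup W a) u = s a := by
  obtain ⟨t, ht⟩ := (NoetherianSpace.isCompact ((⨆ a, W a : X.Opens) : Set X)).elim_finite_subcover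
    (fun a => (W a : Set X)) (fun a => (W a).isOpen) (by rw [Opens.coe_iSup])
  have ht' : (⨆ a, W a) ≤ ⨆ a : t, W a.1 := by
    intro x hx
    obtain ⟨a, ha, hxa⟩ := Set.mem_iUnion₂.1 (ht hx)
    exact Opens.mem_iSup.2 ⟨⟨a, ha⟩, hxa⟩
  obtain ⟨u, hu⟩ := exists_glue_of_finite hM (W := fun a : t => W a.1) (fun a => le_iSup W a.1) ht'
    (fun a => s a.1) (fun a b => hs a.1 b.1)
  refine ⟨u, fun a => ?_⟩
  refine eq_of_local hM (W := fun b : t => W a ⊓ W b.1) (fun b => inf_le_left) ?_ fun b => ?_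
  · rw [← inf_iSup_eq]
    exact le_inf le_rfl ((le_iSup W a).trans ht')
  · rw [hs a b.1, ← hu b, res_res, res_res]

variable (U) in
theorem isSheaf [NoetherianSpace X] (hM : IsLocMod K M) : (Mix.toAb K U M).IsSheaf := by
  rw [TopCat.Presheaf.isSheaf_iff_isSheafUniqueGluing]
  intro ι W s hs
  obtain ⟨u, hu⟩ := exists_glue (K := K) (U := U) hM W s hs
  exact ⟨u, hu, fun v hv => eq_of_local hM (fun a => le_iSup W a) le_rfl fun a =>
    (hv a).trans (hu a).symm⟩

end Local

theorem noetherianSpace (K : Type u) [Field K] (X : Scheme.{u}) [X.Over (Spec (CommRingCat.of K))]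
    [LocallyOfFiniteType (X ↘ Spec (CommRingCat.of K))]
    [QuasiCompact (X ↘ Spec (CommRingCat.of K))] : NoetherianSpace X := by
  have h : IsLocallyNoetherian X :=
    LocallyOfFiniteType.isLocallyNoetherian (X ↘ Spec (CommRingCat.of K))
  have : CompactSpace X := QuasiCompact.compactSpace_of_compactSpace (X ↘ Spec (CommRingCat.of K))
  have : IsNoetherian X := {}
  infer_instance

/-! ### Sections of degree zero -/

variable (U) in
theorem exists_of_sec (F : Coh K M) (s : ∀ W : X.Opens, W ≤ V → sec K M W)
    (hs : ∀ (W W' : X.Opens) (h : W ≤ V) (h' : W' ≤ W),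
      sec.res K M h' (s W h) = s W' (h'.trans h))
    (hF : ∀ (W : X.Opens) (h : W ≤ V) (V' : AffIn W), (s W h).1 V' ∈ F.L V'.1)
    (h0 : ∀ (W : X.Opens) (h : W ≤ V), s W h ∈ sec.deg K M W 0) :
    ∃ e : Mix K U M V, e.1 ∈ bi K U M V 0 0 ∧
      ∀ l i, Cell.Lim K (fun _ => 1 ⊗ₜ s _ inf_le_left) (e.1 l i) := by
  let e : Amb K U M V := fun l i => Cell.ofSec F (s (V ⊓ inter U i) inf_le_left) (hF _ _)
  have he : ∀ l i, Cell.Lim K (fun _ => 1 ⊗ₜ s _ inf_le_left) (e l i) :=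
    fun l i => Cell.ofSec_lim F _ (hF _ _)
  have hm : e ∈ bi K U M V 0 0 := by
    refine mem_bi.2 ⟨fun k l α i => ?_, fun l i => ⟨_, he l i, fun _ =>
      tmul_mem_bideg Sx.one_mem_deg (h0 _ _)⟩⟩
    have h1 := Cell.map_lim LinearMap.id (inf_le_inf_left V (inter_le U α i)) (he k (i.comp α))
    have h2 := Cell.map_lim (Sx.pull K α) (le_refl (V ⊓ inter U i)) (he l i)
    simp only [TensorProduct.map_tmul, hs, (Sx.isHom_pull α).one, LinearMap.id_apply] at h1 h2
    exact h1.unique h2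
  exact ⟨⟨e, bi_le_mix _ _ hm⟩, hm, he⟩

end Mix

namespace sec

variable {W : X.Opens}

theorem const_add (n n' : Γ(M, W)) :
    const K M W (n + n') = const K M W n + const K M W n' := ext K fun V => by
  change NV.const K M V.1 (resM (K := K) M V.2 (n + n')) =
    NV.const K M V.1 (resM (K := K) M V.2 n) + NV.const K M V.1 (resM (K := K) M V.2 n')
  rw [map_add]
  exact NN.tmul_add _ _ _

theorem const_smul (c : Γ(X, W)) (n : Γ(M, W)) :
    const K M W (c • n) = smulC K M W c (const K M W n) := ext K fun V => by
  change NV.const K M V.1 (resM (K := K) M V.2 (c • n)) =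
    resA K V.2 c • NV.const K M V.1 (resM (K := K) M V.2 n)
  rw [map_smulₛₗ]
  exact TensorProduct.tmul_smul (resA K V.2 c) _ _

theorem smulC_algebraMap (k : K) (n : sec K M W) :
    smulC K M W (algebraMap K Γ(X, W) k) n = k • n := ext K fun V => by
  change resA K V.2 (algebraMap K Γ(X, W) k) • n.1 V = k • n.1 V
  rw [AlgHom.commutes]
  rfl

theorem const₁_add (c c' : Γ(X, W)) :
    const₁ K W (c + c') = const₁ K W c + const₁ K W c' := ext K fun V => by
  change NN.tmul (OmegaP.tmul (PP.p₁ K _ (resA K V.2 (c + c'))) 1) (1 : Γ(X, V.1.1)) =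
    NN.tmul (OmegaP.tmul (PP.p₁ K _ (resA K V.2 c)) 1) (1 : Γ(X, V.1.1)) +
    NN.tmul (OmegaP.tmul (PP.p₁ K _ (resA K V.2 c')) 1) (1 : Γ(X, V.1.1))
  rw [map_add, map_add, OmegaP.add_tmul, NN.add_tmul]

theorem const₁_smul (k : K) (c : Γ(X, W)) :
    const₁ K W (k • c) = k • const₁ K W c := ext K fun V => by
  change NN.tmul (OmegaP.tmul (PP.p₁ K _ (resA K V.2 (k • c))) 1) (1 : Γ(X, V.1.1)) =
    k • NN.tmul (OmegaP.tmul (PP.p₁ K _ (resA K V.2 c)) 1) (1 : Γ(X, V.1.1))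
  rw [map_smul, map_smul]
  have e : (OmegaP.tmul (k • PP.p₁ K Γ(X, V.1.1) (resA K V.2 c)) 1 : OmegaP K Γ(X, V.1.1)) =
      algebraMap K Γ(X, V.1.1) k • OmegaP.tmul (PP.p₁ K Γ(X, V.1.1) (resA K V.2 c)) 1 := by
    rw [algebraMap_smul]
    rfl
  rw [e]
  rfl

end sec

end MixSheaf

section Constants

variable {K : Type u} [Field K] {X : Scheme.{u}} [X.Over (Spec (CommRingCat.of K))]
  [LocallyOfFiniteType (X ↘ Spec (CommRingCat.of K))]
  {m : ℕ} {U : Fin (m + 1) → X.Opens} {M : X.Modules} {V V' : X.Opens}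

namespace Mix

variable (U) in
theorem exists_const (hM : IsLocMod K M)
    (hfin : ∀ V : X.affineOpens, Module.Finite Γ(X, V.1) Γ(M, V.1)) (n : Γ(M, V)) :
    ∃ e : Mix K U M V, e.1 ∈ bi K U M V 0 0 ∧ ∀ (l : ℕ) (i : Idx m l),
      Cell.Lim K (fun _ => 1 ⊗ₜ sec.const K M (V ⊓ inter U i) (resM (K := K) M inf_le_left n))
        (e.1 l i) := by
  refine exists_of_sec U (Coh.top hM hfin) (fun W h => sec.const K M W (resM (K := K) M h n))
    (fun W W' h h' => ?_) (fun W h V' => Submodule.mem_top) (fun W h => sec.const_mem_deg _)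
  rw [sec.res_const, resM_resM]

variable (U) in
/-- The constant section `1 ⊗ n`, for a finitely generated `M`. -/
def const (hM : IsLocMod K M)
    (hfin : ∀ V : X.affineOpens, Module.Finite Γ(X, V.1) Γ(M, V.1)) (V : X.Opens) (n : Γ(M, V)) :
    Mix K U M V :=
  (exists_const U hM hfin n).choose

section Const

variable (hM : IsLocMod K M)
  (hfin : ∀ V : X.affineOpens, Module.Finite Γ(X, V.1) Γ(M, V.1))

theorem const_mem_bi (n : Γ(M, V)) : (const U hM hfin V n).1 ∈ bi K U M V 0 0 :=
  (exists_const U hM hfin n).choose_spec.1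

theorem const_lim (n : Γ(M, V)) (l : ℕ) (i : Idx m l) :
    Cell.Lim K (fun _ => 1 ⊗ₜ sec.const K M (V ⊓ inter U i) (resM (K := K) M inf_le_left n))
      ((const U hM hfin V n).1 l i) :=
  (exists_const U hM hfin n).choose_spec.2 l i

theorem const_add (n n' : Γ(M, V)) :
    const U hM hfin V (n + n') = const U hM hfin V n + const U hM hfin V n' :=
  ext_lim fun l i => ⟨_, const_lim hM hfin (n + n') l i, by
    have h := (const_lim (U := U) hM hfin n l i).add' (const_lim hM hfin n' l i)
    simp only [← TensorProduct.tmul_add, ← sec.const_add, ← map_add] at h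
    exact h⟩

theorem const_smul (c : Γ(X, V)) (n : Γ(M, V)) :
    const U hM hfin V (c • n) = c • const U hM hfin V n :=
  ext_lim fun l i => ⟨_, const_lim hM hfin (c • n) l i, by
    have h := Cell.smulFun_lim (resA K inf_le_left c) (const_lim (U := U) hM hfin n l i)
    have e : resM (K := K) M (inf_le_left : V ⊓ inter U i ≤ V) (c • n) =
      resA K inf_le_left c • resM (K := K) M inf_le_left n := map_smulₛₗ _ _ _
    rw [e]
    simp only [TensorProduct.map_tmul, ← sec.const_smul, LinearMap.id_apply] at h
    exact h⟩

theorem res_const (h : V' ≤ V) (n : Γ(M, V)) :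
    res h (const U hM hfin V n) = const U hM hfin V' (resM (K := K) M h n) :=
  ext_lim fun l i => ⟨_, Cell.map_lim LinearMap.id (inf_le_inf_right _ h)
    (const_lim hM hfin n l i), by
      have h' := const_lim (U := U) hM hfin (resM (K := K) M h n) l i
      rw [resM_resM] at h'
      simp only [TensorProduct.map_tmul, sec.res_const, resM_resM, LinearMap.id_apply]
      exact h'⟩

end Const

theorem finite_OX (V : X.affineOpens) : Module.Finite Γ(X, V.1) Γ(OX X, V.1) := by
  change Module.Finite Γ(X, V.1) Γ(X, V.1)
  infer_instance

theorem algebraMap_smul (k : K) (u : Mix K U M V) : algebraMap K Γ(X, V) k • u = k • u :=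
  ext_lim fun l i => by
    obtain ⟨x, hx⟩ := Cell.exists_lim (u.1 l i)
    refine ⟨_, ?_, hx.smul' k⟩
    have h := Cell.smulFun_lim (resA K (inf_le_left : V ⊓ inter U i ≤ V)
      (algebraMap K Γ(X, V) k)) hx
    have e : sec.smulC K M (V ⊓ inter U i) (algebraMap K Γ(X, V ⊓ inter U i) k) =
        k • LinearMap.id := LinearMap.ext fun n => sec.smulC_algebraMap k n
    rw [AlgHom.commutes, e, TensorProduct.map_smul_right, TensorProduct.map_id] at h
    rw [smul_apply]
    have e' : resA K (inf_le_left : V ⊓ inter U i ≤ V) (algebraMap K Γ(X, V) k) =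
      algebraMap K Γ(X, V ⊓ inter U i) k := AlgHom.commutes _ _
    rw [e']
    exact h

variable (K U V) in
/-- The homomorphism `p₂^*`. -/
def p₂ : Γ(X, V) →ₗ[K] Mix K U (OX X) V where
  toFun c := const U (isLocMod_unit K) finite_OX V (show Γ(OX X, V) from c)
  map_add' c c' := const_add (M := OX X) (isLocMod_unit K) finite_OX c c'
  map_smul' k c := by
    have h := const_smul (U := U) (M := OX X) (isLocMod_unit K) finite_OX (V := V)
      (algebraMap K Γ(X, V) k) (show Γ(OX X, V) from c)
    rw [algebraMap_smul] at h
    refine Eq.trans ?_ h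
    congr 1

theorem isMixP₂ : IsMixP₂ K U (fun V => p₂ K U V) := fun _ c l i =>
  const_lim (M := OX X) (isLocMod_unit K) finite_OX c l i

theorem p₂_mem_bi (c : Γ(X, V)) : (p₂ K U V c).1 ∈ bi K U (OX X) V 0 0 :=
  const_mem_bi (M := OX X) (isLocMod_unit K) finite_OX c

theorem res_p₂ (h : V' ≤ V) (c : Γ(X, V)) : res h (p₂ K U V c) = p₂ K U V' (resA K h c) :=
  res_const (M := OX X) (isLocMod_unit K) finite_OX h c

variable (U) in
theorem exists_const₁ (c : Γ(X, V)) :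
    ∃ e : Mix K U (OX X) V, e.1 ∈ bi K U (OX X) V 0 0 ∧ ∀ (l : ℕ) (i : Idx m l),
      Cell.Lim K (fun _ => 1 ⊗ₜ sec.const₁ K (V ⊓ inter U i) (resA K inf_le_left c))
        (e.1 l i) := by
  refine exists_of_sec U Coh.topOX (fun W h => sec.const₁ K W (resA K h c))
    (fun W W' h h' => ?_) (fun W h V' => Submodule.mem_top) (fun W h => sec.const₁_mem_deg _)
  rw [sec.res_const₁, resA_resA]

theorem const₁_lim (c : Γ(X, V)) (l : ℕ) (i : Idx m l) :
    Cell.Lim K (fun _ => 1 ⊗ₜ sec.const₁ K (V ⊓ inter U i) (resA K inf_le_left c))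
      ((exists_const₁ U c).choose.1 l i) :=
  (exists_const₁ U c).choose_spec.2 l i

variable (K U V) in
/-- The homomorphism `p₁^*`. -/
def p₁ : Γ(X, V) →ₗ[K] Mix K U (OX X) V where
  toFun c := (exists_const₁ U c).choose
  map_add' c c' := ext_lim fun l i => ⟨_, const₁_lim (c + c') l i, by
    have h := (const₁_lim (K := K) (U := U) c l i).add' (const₁_lim c' l i)
    simp only [← TensorProduct.tmul_add, ← sec.const₁_add, ← map_add] at h
    exact h⟩
  map_smul' k c := ext_lim fun l i => ⟨_, const₁_lim (k • c) l i, by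
    have h := (const₁_lim (K := K) (U := U) c l i).smul' k
    simp only [← TensorProduct.tmul_smul, ← sec.const₁_smul, ← map_smul] at h
    exact h⟩

theorem isMixP₁ : IsMixP₁ K U (fun V => p₁ K U V) := fun _ c l i => const₁_lim c l i

theorem p₁_mem_bi (c : Γ(X, V)) : (p₁ K U V c).1 ∈ bi K U (OX X) V 0 0 :=
  (exists_const₁ U c).choose_spec.1

theorem res_p₁ (h : V' ≤ V) (c : Γ(X, V)) : res h (p₁ K U V c) = p₁ K U V' (resA K h c) :=
  ext_lim fun l i => ⟨_, Cell.map_lim LinearMap.id (inf_le_inf_right _ h) (const₁_lim c l i), by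
    have h' := isMixP₁ (K := K) (U := U) V' (resA K h c) l i
    rw [resA_resA] at h'
    simp only [TensorProduct.map_tmul, sec.res_const₁, resA_resA, LinearMap.id_apply]
    exact h'⟩

theorem p₁_one : p₁ K U V 1 = p₂ K U V 1 :=
  ext_lim fun l i => ⟨_, const₁_lim 1 l i, by
    have h := isMixP₂ (K := K) (U := U) V (1 : Γ(X, V)) l i
    have e : sec.const₁ K (V ⊓ inter U i) (resA K inf_le_left (1 : Γ(X, V))) =
        sec.const K (OX X) (V ⊓ inter U i) (resM (K := K) (OX X) inf_le_left (1 : Γ(X, V))) := by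
      rw [map_one, sec.const₁_one]
      exact congrArg (sec.const K (OX X) (V ⊓ inter U i)) (map_one (resA K inf_le_left)).symm
    rw [e]
    exact h⟩

variable [CharZero K]

theorem p₂_mul_apply (c : Γ(X, V)) (v : Mix K U M V) : mul K U M V (p₂ K U V c) v = c • v :=
  Subtype.ext (funext fun l => funext fun i =>
    Cell.mul_const (isMixP₂ (K := K) (U := U) V c l i) (v.1 l i))

theorem one_mul (v : Mix K U M V) : mul K U M V (p₂ K U V 1) v = v := by
  rw [p₂_mul_apply, one_smul]

theorem mul_one (v : Mix K U (OX X) V) : mul K U (OX X) V v (p₂ K U V 1) = v :=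
  Subtype.ext (funext fun l => funext fun i => by
    have h := isMixP₂ (K := K) (U := U) V (1 : Γ(X, V)) l i
    have e : resM (K := K) (OX X) (inf_le_left : V ⊓ inter U i ≤ V) (1 : Γ(X, V)) =
      (1 : Γ(X, V ⊓ inter U i)) := map_one (resA K (inf_le_left : V ⊓ inter U i ≤ V))
    rw [e] at h
    exact Cell.mul_one h (v.1 l i))

theorem p₂_mul (c c' : Γ(X, V)) :
    p₂ K U V (c * c') = mul K U (OX X) V (p₂ K U V c) (p₂ K U V c') := by
  rw [p₂_mul_apply]
  exact const_smul (M := OX X) (isLocMod_unit K) finite_OX c c'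

theorem p₁_mul (c c' : Γ(X, V)) :
    p₁ K U V (c * c') = mul K U (OX X) V (p₁ K U V c) (p₁ K U V c') :=
  ext_lim fun l i => ⟨_, const₁_lim (c * c') l i, by
    have h := Cell.mul_lim (const₁_lim (K := K) (U := U) c l i) (const₁_lim c' l i)
    have hs := sec.sgn_of_mem (sec.const₁_mem_deg (K := K)
      (resA K (inf_le_left : V ⊓ inter U i ≤ V) c))
    simp only [preMul_tmul _ hs Sx.one_mem_deg, _root_.mul_one, zero_mul, pow_zero, one_smul,
      ← sec.const₁_mul, ← map_mul] at h
    exact h⟩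

end Mix

end Constants

/-! ## Coefficients with respect to a frame -/

section Coefficients

variable {K : Type*} [Field K] {C : Type*} [CommRing C] [Algebra K C]
  {C' : Type*} [CommRing C'] [Algebra K C']
  {N : Type*} [AddCommGroup N] [Module C N] {N' : Type*} [AddCommGroup N'] [Module C' N']

namespace NN

variable (K) in
/-- The map `Ω ⊗ P ⊗ N → Ω ⊗ P ⊗ C` given by a linear form on `N`, as a map of `C`-modules. -/
def coeffAux (f : N →ₗ[C] C) : NN K C N →+ NN K C C :=
  (LinearMap.lTensor (OmegaP K C) f).toAddMonoidHom

variable (K) in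
/-- The map `Ω ⊗ P ⊗ N → Ω ⊗ P ⊗ C` given by a linear form on `N`. -/
def coeff (f : N →ₗ[C] C) : NN K C N →ₗ[PP K C] NN K C C where
  __ := coeffAux K f
  map_smul' b x := by
    change coeffAux K f (b • x) = b • coeffAux K f x
    induction x using NN.induction with
    | h0 => simp only [smul_zero, map_zero]
    | ht a n => rfl
    | ha x y hx hy => rw [smul_add, map_add, map_add, hx, hy, smul_add]

theorem coeff_tmul (f : N →ₗ[C] C) (a : OmegaP K C) (n : N) :
    coeff K f (tmul a n) = tmul a (f n) := rfl

theorem map_coeff {φ : C →ₐ[K] C'} {g : N →ₛₗ[(φ : C →+* C')] N'}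
    {g₁ : C →ₛₗ[(φ : C →+* C')] C'} (f : N →ₗ[C] C) (f' : N' →ₗ[C'] C')
    (h : ∀ n, g₁ (f n) = f' (g n)) (x : NN K C N) :
    map φ g₁ (coeff K f x) = coeff K f' (map φ g x) := by
  induction x using NN.induction with
  | h0 => simp only [map_zero]
  | ht a n => rw [coeff_tmul, map_tmul, map_tmul, coeff_tmul, h]
  | ha x y hx hy => simp only [map_add, hx, hy]

theorem coeff_smul_tmul_one (f : N →ₗ[C] C) (a : NN K C C) (n : N) :
    coeff K f (toOmegaP K C a • tmul 1 n) = f n • a := by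
  induction a using NN.induction with
  | h0 => rw [map_zero, zero_smul, map_zero, smul_zero]
  | ht a c =>
    rw [smul_tmul, mul_one, coeff_tmul]
    change (c • a) ⊗ₜ[C] (f n) = f n • (a ⊗ₜ[C] c)
    rw [TensorProduct.smul_tmul, ← TensorProduct.tmul_smul, smul_eq_mul, smul_eq_mul, mul_comm]
  | ha x y hx hy => rw [map_add, add_smul, map_add, hx, hy, smul_add]

theorem sum_coeff_smul {ι : Type*} [Fintype ι] (e : ι → N) (f : ι → N →ₗ[C] C)
    (h : ∀ n, ∑ j, f j n • e j = n) (x : NN K C N) :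
    ∑ j, toOmegaP K C (coeff K (f j) x) • (tmul 1 (e j) : NN K C N) = x := by
  induction x using NN.induction with
  | h0 => simp only [map_zero, zero_smul, Finset.sum_const_zero]
  | ht a n =>
    have e' : ∀ j, toOmegaP K C (coeff K (f j) (tmul a n)) • (tmul 1 (e j) : NN K C N) =
        a ⊗ₜ[C] (f j n • e j) := fun j => by
      have h1 : toOmegaP K C (tmul a (f j n)) = f j n • a := rfl
      rw [coeff_tmul, h1, smul_tmul, mul_one]
      exact TensorProduct.smul_tmul _ _ _
    simp only [e']
    refine (TensorProduct.tmul_sum a Finset.univ fun j => f j n • e j).symm.trans ?_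
    rw [h]
    rfl
  | ha x y hx hy => simp only [map_add, add_smul, Finset.sum_add_distrib, hx, hy]

end NN

end Coefficients

/-! ## Frames -/

theorem NN.proj_coeff {K : Type*} [Field K] {C : Type*} [CommRing C] [Algebra K C]
    {N : Type*} [AddCommGroup N] [Module C N] (f : N →ₗ[C] C) (p : ℕ) (x : NN K C N) :
    NN.proj K C C p (NN.coeff K f x) = NN.coeff K f (NN.proj K C N p x) := by
  induction x using NN.induction with
  | h0 => simp only [map_zero]
  | ht a n => rfl
  | ha x y hx hy => simp only [map_add, hx, hy]

section Frames

variable {K : Type u} [Field K] {X : Scheme.{u}} [X.Over (Spec (CommRingCat.of K))]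
  {M : X.Modules} {V₀ : X.Opens} {r : ℕ} {e : Fin r → Γ(M, V₀)}

variable (K) in
/-- The sections `e j` form a basis of the sections of `M` over every smaller open set. -/
def IsFrame (e : Fin r → Γ(M, V₀)) : Prop :=
  ∀ (W : X.Opens) (h : W ≤ V₀), Function.Bijective fun c : Fin r → Γ(X, W) =>
    ∑ j, c j • resM (K := K) M h (e j)

namespace IsFrame

variable (he : IsFrame K e) {W W' : X.Opens}

/-- The isomorphism given by a frame. -/
def equiv (h : W ≤ V₀) : (Fin r → Γ(X, W)) ≃ₗ[Γ(X, W)] Γ(M, W) :=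
  LinearEquiv.ofBijective (Fintype.linearCombination Γ(X, W) fun j => resM (K := K) M h (e j))
    (he W h)

/-- The coordinates with respect to a frame. -/
def coord (h : W ≤ V₀) (j : Fin r) : Γ(M, W) →ₗ[Γ(X, W)] Γ(X, W) :=
  (LinearMap.proj j).comp (he.equiv h).symm.toLinearMap

theorem sum_coord (h : W ≤ V₀) (n : Γ(M, W)) :
    ∑ j, he.coord h j n • resM (K := K) M h (e j) = n :=
  (he.equiv h).apply_symm_apply n

theorem coord_sum (h : W ≤ V₀) (c : Fin r → Γ(X, W)) (j : Fin r) :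
    he.coord h j (∑ j, c j • resM (K := K) M h (e j)) = c j :=
  congrFun ((he.equiv h).symm_apply_apply c) j

theorem resA_coord (h : W ≤ V₀) (h' : W' ≤ W) (j : Fin r) (n : Γ(M, W)) :
    resA K h' (he.coord h j n) = he.coord (h'.trans h) j (resM (K := K) M h' n) := by
  conv_rhs => rw [← he.sum_coord h n, map_sum]
  simp only [map_smulₛₗ, resM_resM]
  exact (he.coord_sum (h'.trans h) (fun j => resA K h' (he.coord h j n)) j).symm

theorem finite (he : IsFrame K e) (h : W ≤ V₀) : Module.Finite Γ(X, W) Γ(M, W) :=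
  Module.Finite.equiv (he.equiv h)

end IsFrame

theorem IsLocMod.finite_of_frame (hM : IsLocMod K M)
    (h : ∀ x : X, ∃ V : X.Opens, x ∈ V ∧ ∃ (r : ℕ) (e : Fin r → Γ(M, V)), IsFrame K e)
    (V : X.affineOpens) : Module.Finite Γ(X, V.1) Γ(M, V.1) := by
  refine hM.finite_of_locally V fun x hx => ?_
  obtain ⟨V', hx', r, e, he⟩ := h x
  obtain ⟨f, hf, hxf⟩ := V.2.exists_basicOpen_le (V := V') ⟨x, hx'⟩ hx
  exact ⟨f, hxf, he.finite hf⟩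

namespace NV

/-- The map `Ω ⊗ P ⊗ M → Ω ⊗ P ⊗ 𝒪` given by a linear form. -/
def coeff {V : X.affineOpens} (f : Γ(M, V.1) →ₗ[Γ(X, V.1)] Γ(X, V.1)) :
    NV K M V →ₗ[PP K Γ(X, V.1)] NV K (OX X) V := NN.coeff K f

theorem res_coeff {V V' : X.affineOpens} (h : V'.1 ≤ V.1)
    (f : Γ(M, V.1) →ₗ[Γ(X, V.1)] Γ(X, V.1)) (f' : Γ(M, V'.1) →ₗ[Γ(X, V'.1)] Γ(X, V'.1))
    (hf : ∀ n, resA K h (f n) = f' (resM (K := K) M h n)) (x : NV K M V) :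
    res K (OX X) h (coeff f x) = coeff f' (res K M h x) :=
  NN.map_coeff (φ := resA K h) (g := resM M h) (g₁ := resM (OX X) h) f f' hf x

theorem coeff_act_const {V : X.affineOpens} (f : Γ(M, V.1) →ₗ[Γ(X, V.1)] Γ(X, V.1))
    (a : NV K (OX X) V) (n : Γ(M, V.1)) :
    coeff f (act K M V a (const K M V n)) = f n • a :=
  NN.coeff_smul_tmul_one (K := K) (C := Γ(X, V.1)) (N := Γ(M, V.1)) f a n

theorem sum_act_coeff {V : X.affineOpens} (f : Fin r → Γ(M, V.1) →ₗ[Γ(X, V.1)] Γ(X, V.1))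
    (e : Fin r → Γ(M, V.1)) (h : ∀ n, ∑ j, f j n • e j = n) (x : NV K M V) :
    ∑ j, act K M V (coeff (f j) x) (const K M V (e j)) = x :=
  NN.sum_coeff_smul (K := K) (C := Γ(X, V.1)) (N := Γ(M, V.1)) e f h x

theorem proj_coeff {V : X.affineOpens} (f : Γ(M, V.1) →ₗ[Γ(X, V.1)] Γ(X, V.1)) (p : ℕ)
    (x : NV K M V) : proj K (OX X) V p (coeff f x) = coeff f (proj K M V p x) :=
  NN.proj_coeff (K := K) (C := Γ(X, V.1)) (N := Γ(M, V.1)) f p x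

end NV

namespace sec

variable (he : IsFrame K e) {W W' : X.Opens}

/-- The coefficients of a section of `Ω ⊗ P ⊗ M` with respect to a frame of `M`. -/
def coeff (hW : W ≤ V₀) (j : Fin r) : sec K M W →ₗ[K] sec K (OX X) W where
  toFun n := ⟨fun V => NV.coeff (he.coord (V.2.trans hW) j) (n.1 V), fun V V' h => by
    rw [NV.res_coeff h _ (he.coord (V'.2.trans hW) j) fun n => he.resA_coord _ h j n, n.2 V V' h]⟩
  map_add' x y := ext K fun V => map_add (NV.coeff (he.coord (V.2.trans hW) j)) (x.1 V) (y.1 V)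
  map_smul' k x := ext K fun V => by
    have h := map_smul (NV.coeff (K := K) (he.coord (V.2.trans hW) j))
      (PP.p₂ K Γ(X, V.1.1) (algebraMap K _ k)) (x.1 V)
    rw [← NV.smul_eq_p₂, ← NV.smul_eq_p₂] at h
    exact h

theorem isCont_coeff [LocallyOfFiniteType (X ↘ Spec (CommRingCat.of K))] (hW : W ≤ V₀) (j : Fin r) :
    DirInv.IsCont (dirInv K M W) (dirInv K (OX X) W) (coeff he hW j) :=
  isCont_of_linear _ (fun V => NV.coeff (he.coord (V.2.trans hW) j)) (fun _ _ => rfl)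
    fun _ => ⟨Coh.topOX, fun _ => le_top⟩

theorem res_coeff (hW : W ≤ V₀) (h : W' ≤ W) (j : Fin r) (n : sec K M W) :
    res K (OX X) h (coeff he hW j n) = coeff he (h.trans hW) j (res K M h n) := rfl

theorem proj_coeff (hW : W ≤ V₀) (j : Fin r) (p : ℕ) (n : sec K M W) :
    proj K (OX X) W p (coeff he hW j n) = coeff he hW j (proj K M W p n) :=
  ext K fun V => NV.proj_coeff _ p (n.1 V)

theorem coeff_act_const (hW : W ≤ V₀) (j : Fin r) (a : sec K (OX X) W) (n : Γ(M, W)) :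
    coeff he hW j (act K M W a (const K M W n)) = smulC K (OX X) W (he.coord hW j n) a :=
  ext K fun V => by
    refine (NV.coeff_act_const (K := K) (he.coord (V.2.trans hW) j) (a.1 V)
      (resM (K := K) M V.2 n)).trans ?_
    rw [← he.resA_coord hW V.2 j n]
    rfl

theorem sum_act_coeff (hW : W ≤ V₀) (n : sec K M W) :
    ∑ j, act K M W (coeff he hW j n) (const K M W (resM (K := K) M hW (e j))) = n :=
  ext K fun V => by
    have h := NV.sum_act_coeff (K := K) (fun j => he.coord (V.2.trans hW) j) _
      (he.sum_coord (V.2.trans hW)) (n.1 V)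
    refine Eq.trans ?_ h
    have h1 := map_sum ((LinearMap.proj V).comp (sec K M W).subtype : sec K M W →ₗ[K] NV K M V.1)
      (fun j => act K M W (coeff he hW j n) (const K M W (resM (K := K) M hW (e j)))) Finset.univ
    refine h1.trans (Finset.sum_congr rfl fun j _ => ?_)
    change NV.act K M V.1 _ (NV.const K M V.1 _) = NV.act K M V.1 _ (NV.const K M V.1 _)
    rw [resM_resM]
    rfl

end sec

end Frames

theorem tensorMap_comm {K O O' N N' P P' : Type*} [CommRing K] [AddCommGroup O] [Module K O]
    [AddCommGroup O'] [Module K O'] [AddCommGroup N] [Module K N] [AddCommGroup N'] [Module K N']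
    [AddCommGroup P] [Module K P] [AddCommGroup P'] [Module K P'] (a : O →ₗ[K] O') {f : N →ₗ[K] N'}
    {f' : P →ₗ[K] P'} {g : N →ₗ[K] P} {g' : N' →ₗ[K] P'} (h : ∀ n, g' (f n) = f' (g n))
    (z : O ⊗[K] N) : TensorProduct.map a g' (TensorProduct.map LinearMap.id f z) =
      TensorProduct.map LinearMap.id f' (TensorProduct.map a g z) := by
  induction z using TensorProduct.induction_on with
  | zero => simp only [map_zero]
  | tmul w n => simp only [TensorProduct.map_tmul, h, LinearMap.id_apply]
  | add y z hy hz => simp only [map_add, hy, hz]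

section FrameCoefficients

variable {K : Type u} [Field K] {X : Scheme.{u}} [X.Over (Spec (CommRingCat.of K))]
  {M : X.Modules} {V₀ : X.Opens} {r : ℕ} {e : Fin r → Γ(M, V₀)}

namespace Cell

variable {W W' : X.Opens} {k l : ℕ}

theorem Lim.sum {ι : Type*} (s : Finset ι) {x : ι → ℕ → Sx K l ⊗[K] sec K M W}
    {b : ι → Cell K M W l} (h : ∀ j ∈ s, Lim K (x j) (b j)) :
    Lim K (fun n => ∑ j ∈ s, x j n) (∑ j ∈ s, b j) := by
  classical
  induction s using Finset.induction_on with
  | empty => simp only [Finset.sum_empty]; exact DirInv.Lim.zero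
  | insert a s ha ih =>
    simp only [Finset.sum_insert ha]
    exact (h a (Finset.mem_insert_self a s)).add' (ih fun j hj => h j (Finset.mem_insert_of_mem hj))

theorem preMul_const [CharZero K] (z : Sx K l ⊗[K] sec K (OX X) W) (n : sec K M W) :
    preMul K M W l z (1 ⊗ₜ n) =
      TensorProduct.map LinearMap.id ((sec.act K M W).flip n) z :=
  Super.mul_one (act := sec.act K M W) Sx.sgn_sgn sec.sgn_sgn
    (map_one (DR.sgn K (SimplexRing K l))) z

variable [LocallyOfFiniteType (X ↘ Spec (CommRingCat.of K))] (he : IsFrame K e)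

/-- The coefficients with respect to a frame. -/
def coeff (hW : W ≤ V₀) (l : ℕ) (j : Fin r) : Cell K M W l →ₗ[K] Cell K (OX X) W l :=
  DirInv.Compl.map (TensorProduct.map LinearMap.id (sec.coeff he hW j))
    ((sec.isCont_coeff he hW j).tens LinearMap.id)

theorem coeff_lim (hW : W ≤ V₀) (j : Fin r) {x : ℕ → Sx K l ⊗[K] sec K M W} {b : Cell K M W l}
    (hx : Lim K x b) : Lim K (fun n => TensorProduct.map LinearMap.id (sec.coeff he hW j) (x n))
      (coeff he hW l j b) :=
  DirInv.Lim.map _ hx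

theorem map_coeff (hW : W ≤ V₀) (j : Fin r) (a : Sx K l →ₗ[K] Sx K k) (h : W' ≤ W)
    (b : Cell K M W l) :
    map K a h (coeff he hW l j b) = coeff he (h.trans hW) k j (map K a h b) := by
  obtain ⟨x, hx⟩ := exists_lim b
  refine (map_lim a h (coeff_lim he hW j hx)).unique ?_
  have e' := fun n => tensorMap_comm a (sec.res_coeff he hW h j) (x n)
  simp only [e']
  exact coeff_lim he _ j (map_lim a h hx)

theorem IsBideg.coeff (hW : W ≤ V₀) (j : Fin r) {p q : ℕ} {b : Cell K M W l}
    (hb : IsBideg p q b) : IsBideg p q (Cell.coeff he hW l j b) := by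
  refine isBideg_iff.2 ?_
  obtain ⟨x, hx⟩ := exists_lim b
  conv_rhs => rw [← isBideg_iff.1 hb]
  refine (proj_lim p q (coeff_lim he hW j hx)).unique ?_
  have e' := fun n => tensorMap_comm (Sx.proj K l q) (sec.proj_coeff he hW j p) (x n)
  simp only [projT, e']
  exact coeff_lim he hW j (proj_lim p q hx)

variable [CharZero K]

theorem coeff_mul_const (hW : W ≤ V₀) (j : Fin r) {n : Γ(M, W)} {c : Cell K M W l}
    (hc : Lim K (fun _ => 1 ⊗ₜ sec.const K M W n) c) (b : Cell K (OX X) W l) :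
    coeff he hW l j (mul K M W l b c) = smulFun K (he.coord hW j n) b := by
  obtain ⟨x, hx⟩ := exists_lim b
  refine (coeff_lim he hW j (mul_lim hx hc)).unique ?_
  have e' : ∀ i, TensorProduct.map LinearMap.id (sec.coeff he hW j)
      (preMul K M W l (x i) (1 ⊗ₜ sec.const K M W n)) =
      TensorProduct.map LinearMap.id (sec.smulC K (OX X) W (he.coord hW j n)) (x i) := fun i => by
    rw [preMul_const, ← LinearMap.comp_apply, ← TensorProduct.map_comp]
    have h1 : (sec.coeff he hW j).comp ((sec.act K M W).flip (sec.const K M W n)) =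
      sec.smulC K (OX X) W (he.coord hW j n) :=
      LinearMap.ext fun a => sec.coeff_act_const he hW j a n
    rw [h1]
    rfl
  simp only [e']
  exact smulFun_lim _ hx

theorem sum_mul_coeff (hW : W ≤ V₀) {c : Fin r → Cell K M W l}
    (hc : ∀ j, Lim K (fun _ => 1 ⊗ₜ sec.const K M W (resM (K := K) M hW (e j))) (c j))
    (b : Cell K M W l) :
    ∑ j, mul K M W l (coeff he hW l j b) (c j) = b := by
  obtain ⟨x, hx⟩ := exists_lim b
  refine (Lim.sum Finset.univ fun j _ => mul_lim (coeff_lim he hW j hx) (hc j)).unique ?_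
  have e' : ∀ i, ∑ j, preMul K M W l (TensorProduct.map LinearMap.id (sec.coeff he hW j) (x i))
      (1 ⊗ₜ sec.const K M W (resM (K := K) M hW (e j))) = x i := fun i => by
    simp only [preMul_const]
    generalize x i = z
    induction z using TensorProduct.induction_on with
    | zero => simp only [map_zero, Finset.sum_const_zero]
    | add y z hy hz => simp only [map_add, Finset.sum_add_distrib, hy, hz]
    | tmul w n =>
      simp only [TensorProduct.map_tmul, LinearMap.id_apply, LinearMap.flip_apply]
      refine (TensorProduct.tmul_sum w Finset.univ fun j =>
        sec.act K M W (sec.coeff he hW j n)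
          (sec.const K M W (resM (K := K) M hW (e j)))).symm.trans ?_
      exact congrArg (fun n => w ⊗ₜ[K] n) (sec.sum_act_coeff he hW n)
  simp only [e']
  exact hx

end Cell

namespace Mix

variable [LocallyOfFiniteType (X ↘ Spec (CommRingCat.of K))]
  {m : ℕ} (U : Fin (m + 1) → X.Opens) {V V' : X.Opens} (he : IsFrame K e)

/-- The coefficients of a family with respect to a frame. -/
def ambCoeff (hV : V ≤ V₀) (j : Fin r) : Amb K U M V →ₗ[K] Amb K U (OX X) V where
  toFun u l i := Cell.coeff he (inf_le_left.trans hV) l j (u l i)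
  map_add' u v := funext fun l => funext fun i => map_add (Cell.coeff he _ l j) (u l i) (v l i)
  map_smul' c u := funext fun l => funext fun i => map_smul (Cell.coeff he _ l j) c (u l i)

theorem ambCoeff_mem_bi (hV : V ≤ V₀) (j : Fin r) {p q : ℕ} {u : Amb K U M V}
    (hu : u ∈ bi K U M V p q) : ambCoeff U he hV j u ∈ bi K U (OX X) V p q := by
  refine mem_bi.2 ⟨fun k l α i => ?_, fun l i => ((mem_bi.1 hu).2 l i).coeff he _ j⟩
  refine (Cell.map_coeff he _ j _ _ _).trans (Eq.trans ?_ (Cell.map_coeff he _ j _ _ _).symm)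
  rw [hu.1 k l α i]

theorem ambCoeff_mem (hV : V ≤ V₀) (j : Fin r) :
    Mix K U M V ≤ (Mix K U (OX X) V).comap (ambCoeff U he hV j) :=
  iSup_le fun p => iSup_le fun q => fun _ hu => bi_le_mix p q (ambCoeff_mem_bi U he hV j hu)

/-- The coefficients with respect to a frame. -/
def coeff (hV : V ≤ V₀) (j : Fin r) : Mix K U M V →ₗ[K] Mix K U (OX X) V :=
  (ambCoeff U he hV j).restrict (ambCoeff_mem U he hV j)

variable {U} [CharZero K] (hM : IsLocMod K M)
  (hfin : ∀ V : X.affineOpens, Module.Finite Γ(X, V.1) Γ(M, V.1))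

theorem coeff_mul_const (hV : V ≤ V₀) (j : Fin r) (u : Mix K U (OX X) V) (n : Γ(M, V)) :
    coeff U he hV j (mul K U M V u (const U hM hfin V n)) = he.coord hV j n • u :=
  Subtype.ext (funext fun l => funext fun i => by
    refine (Cell.coeff_mul_const he _ j (const_lim (U := U) hM hfin n l i) (u.1 l i)).trans ?_
    rw [← he.resA_coord hV]
    rfl)

theorem sum_mul_coeff (hV : V ≤ V₀) (v : Mix K U M V) :
    ∑ j, mul K U M V (coeff U he hV j v) (const U hM hfin V (resM (K := K) M hV (e j))) = v :=
  Subtype.ext (funext fun l => funext fun i => by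
    have h := Cell.sum_mul_coeff he (inf_le_left.trans hV : V ⊓ inter U i ≤ V₀)
      (c := fun j => (const U hM hfin V (resM (K := K) M hV (e j))).1 l i) (fun j => by
        have h := const_lim (U := U) hM hfin (resM (K := K) M hV (e j)) l i
        rw [resM_resM] at h
        exact h) (v.1 l i)
    refine Eq.trans ?_ h
    exact map_sum (((LinearMap.proj i : _ →ₗ[K] Cell K M (V ⊓ inter U i) l).comp
      (LinearMap.proj l)).comp (Mix K U M V).subtype)
      (fun j => mul K U M V (coeff U he hV j v) (const U hM hfin V (resM (K := K) M hV (e j))))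
      Finset.univ)

end Mix

end FrameCoefficients

/-! ## The multiplication map -/

section MultiplicationMap

variable {K : Type u} [Field K] {X : Scheme.{u}} [X.Over (Spec (CommRingCat.of K))]
  [LocallyOfFiniteType (X ↘ Spec (CommRingCat.of K))] [CharZero K]
  {m : ℕ} {U : Fin (m + 1) → X.Opens} {M : X.Modules} {V V' : X.Opens}

namespace Mix

theorem mul_p₂ (c : Γ(X, V)) (u : Mix K U (OX X) V) : mul K U (OX X) V u (p₂ K U V c) = c • u := by
  rw [← p₂_mul_apply]
  refine induction (P := fun u => mul K U (OX X) V u (p₂ K U V c) =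
    mul K U (OX X) V (p₂ K U V c) u) (fun p q u hu => ?_) ?_ (fun u v hu hv => ?_) u
  · have h := mul_comm (mem_gr (p₂_mem_bi (K := K) (U := U) c) (zero_add 0)) (mem_gr hu rfl)
    rwa [zero_mul, pow_zero, one_smul] at h
  · rw [map_zero, map_zero, LinearMap.zero_apply]
  · rw [map_add, map_add, LinearMap.add_apply, hu, hv]

theorem smul_mul (c : Γ(X, V)) (u : Mix K U (OX X) V) (v : Mix K U M V) :
    mul K U M V (c • u) v = c • mul K U M V u v := by
  rw [← p₂_mul_apply, ← p₂_mul_apply, mul_assoc]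

theorem mul_smul (c : Γ(X, V)) (u : Mix K U (OX X) V) (v : Mix K U M V) :
    mul K U M V u (c • v) = c • mul K U M V u v := by
  rw [← p₂_mul_apply, ← mul_assoc, mul_p₂, smul_mul]

variable (U) (hM : IsLocMod K M)
  (hfin : ∀ V : X.affineOpens, Module.Finite Γ(X, V.1) Γ(M, V.1))

variable (V) in
/-- The multiplication map `u ⊗ n ↦ u · (1 ⊗ n)`. -/
def mulConst : Mix K U (OX X) V ⊗[Γ(X, V)] Γ(M, V) →ₗ[Γ(X, V)] Mix K U M V :=
  TensorProduct.lift (LinearMap.mk₂ Γ(X, V) (fun u n => mul K U M V u (const U hM hfin V n))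
    (fun u u' n => LinearMap.map_add₂ (mul K U M V) u u' _) (fun c u n => smul_mul c u _)
    (fun u n n' => by rw [const_add, map_add]) (fun c u n => by rw [const_smul, mul_smul]))

theorem mulConst_tmul (u : Mix K U (OX X) V) (n : Γ(M, V)) :
    mulConst U V hM hfin (u ⊗ₜ n) = mul K U M V u (const U hM hfin V n) := rfl

theorem mulConst_bijective {V₀ : X.Opens} {r : ℕ} {e : Fin r → Γ(M, V₀)} (he : IsFrame K e)
    (hV : V ≤ V₀) : Function.Bijective (mulConst U V hM hfin) := by
  refine ⟨Function.LeftInverse.injective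
    (g := fun v => ∑ j, coeff U he hV j v ⊗ₜ[Γ(X, V)] resM (K := K) M hV (e j)) fun t => ?_,
    fun v => ⟨∑ j, coeff U he hV j v ⊗ₜ[Γ(X, V)] resM (K := K) M hV (e j), ?_⟩⟩
  · induction t using TensorProduct.induction_on with
    | zero => simp only [map_zero, TensorProduct.zero_tmul, Finset.sum_const_zero]
    | add s t hs ht => simp only [map_add, TensorProduct.add_tmul, Finset.sum_add_distrib, hs, ht]
    | tmul u n =>
      simp only [mulConst_tmul, coeff_mul_const, TensorProduct.smul_tmul, ← TensorProduct.tmul_sum,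
        he.sum_coord]
  · rw [map_sum]
    exact sum_mul_coeff he hM hfin hV v

/-- The multiplication map on presheaves. -/
def preTensorHom : tensorPre K U M ⟶ toPre K U M where
  app V := by
    exact ModuleCat.ofHom (R := Γ(X, V.unop))
      (X := Mix K U (OX X) V.unop ⊗[Γ(X, V.unop)] Γ(M, V.unop)) (Y := Mix K U M V.unop)
      (mulConst U V.unop hM hfin)
  naturality {V V'} f := by
    refine ModuleCat.MonoidalCategory.tensor_ext fun u n => ?_
    exact ((res_mul (leOfHom f.unop) u (const U hM hfin V.unop n)).trans
      (congrArg _ (res_const hM hfin (leOfHom f.unop) n))).symm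

end Mix

end MultiplicationMap

/-- A morphism of sheaves of modules is an isomorphism if it becomes locally bijective after
composition with a locally bijective morphism. -/
theorem isIso_of_isLocallyBijective_fac {C : Type*} [Category C] {J : GrothendieckTopology C}
    {R : Sheaf J RingCat.{u}} [J.WEqualsLocallyBijective AddCommGrpCat.{u}]
    [J.HasSheafCompose (forget AddCommGrpCat.{u})] {P : PresheafOfModules.{u} R.obj}
    {F G : SheafOfModules.{u} R} (t : P ⟶ F.val) (φ : F ⟶ G) (ψ : P ⟶ G.val)
    (fac : (PresheafOfModules.toPresheaf _).map t ≫ (PresheafOfModules.toPresheaf _).map φ.val =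
      (PresheafOfModules.toPresheaf _).map ψ)
    (h1 : Presheaf.IsLocallyInjective J ((PresheafOfModules.toPresheaf _).map ψ))
    (h2 : Presheaf.IsLocallySurjective J ((PresheafOfModules.toPresheaf _).map ψ))
    (h3 : Presheaf.IsLocallySurjective J ((PresheafOfModules.toPresheaf _).map t)) :
    IsIso φ := by
  have h4 := Presheaf.isLocallyInjective_of_isLocallyInjective_of_isLocallySurjective_fac J _ fac
  have h5 := Presheaf.isLocallySurjective_of_isLocallySurjective_fac J fac
  have h6 : IsIso ((SheafOfModules.toSheaf R).map φ) :=
    (Sheaf.isLocallyBijective_iff_isIso _).1 ⟨h4, h5⟩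
  exact isIso_of_reflects_iso φ (SheafOfModules.toSheaf R)

section SheafMultiplicationMap

variable {K : Type u} [Field K] {X : Scheme.{u}} [X.Over (Spec (CommRingCat.of K))]
  [LocallyOfFiniteType (X ↘ Spec (CommRingCat.of K))] [CharZero K]
  {m : ℕ} (U : Fin (m + 1) → X.Opens) {M : X.Modules} (hM : IsLocMod K M)
  (hfin : ∀ V : X.affineOpens, Module.Finite Γ(X, V.1) Γ(M, V.1))
  (hS : (Mix.toAb K U M).IsSheaf)

namespace Mix

/-- The multiplication map on sheaves. -/
def tensorHom : tensor K U M ⟶ sheaf K U M hS :=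
  ((PresheafOfModules.sheafificationAdjunction (𝟙 X.ringCatSheaf.obj)).homEquiv
    (tensorPre K U M) (sheaf K U M hS)).symm (preTensorHom U hM hfin)

theorem toTensor_tensorHom :
    (PresheafOfModules.toPresheaf _).map (toTensor K U M) ≫
      (PresheafOfModules.toPresheaf _).map (tensorHom U hM hfin hS).val =
        (PresheafOfModules.toPresheaf _).map (preTensorHom U hM hfin) := by
  have h := (PresheafOfModules.sheafificationAdjunction (𝟙 X.ringCatSheaf.obj)).homEquiv
    (tensorPre K U M) (sheaf K U M hS) |>.apply_symm_apply (preTensorHom U hM hfin)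
  exact congrArg (PresheafOfModules.toPresheaf _).map h

theorem tensorHom_apply (V : X.Opens) (u : Mix K U (OX X) V) (n : Γ(M, V)) :
    ((tensorHom U hM hfin hS).val.app (.op V)).hom
      (((toTensor K U M).app (.op V)).hom (u ⊗ₜ[Γ(X, V)] n)) =
        mul K U M V u (const U hM hfin V n) := by
  have h := congrArg (fun f => (f.app (.op V)).hom (u ⊗ₜ[Γ(X, V)] n))
    (toTensor_tensorHom U hM hfin hS)
  exact h

variable {U}

theorem isLocallyInjective_preTensorHom
    (hloc : ∀ x : X, ∃ V : X.Opens, x ∈ V ∧ ∃ (r : ℕ) (e : Fin r → Γ(M, V)), IsFrame K e) :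
    Presheaf.IsLocallyInjective (Opens.grothendieckTopology X)
      ((PresheafOfModules.toPresheaf _).map (preTensorHom U hM hfin)) where
  equalizerSieve_mem {V} s t h x hx := by
    obtain ⟨V', hxV', r, e, he⟩ := hloc x
    let i : V.unop ⊓ V' ⟶ V.unop := homOfLE inf_le_left
    refine ⟨V.unop ⊓ V', i, ?_, hx, hxV'⟩
    apply (mulConst_bijective U hM hfin he (inf_le_right : V.unop ⊓ V' ≤ V')).1
    have h1 := fun s => ConcreteCategory.congr_hom (((PresheafOfModules.toPresheaf _).map
      (preTensorHom U hM hfin)).naturality i.op) s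
    exact (h1 s).trans ((congrArg (res (inf_le_left : V.unop ⊓ V' ≤ V.unop)) h).trans (h1 t).symm)

theorem isLocallySurjective_preTensorHom
    (hloc : ∀ x : X, ∃ V : X.Opens, x ∈ V ∧ ∃ (r : ℕ) (e : Fin r → Γ(M, V)), IsFrame K e) :
    Presheaf.IsLocallySurjective (Opens.grothendieckTopology X)
      ((PresheafOfModules.toPresheaf _).map (preTensorHom U hM hfin)) where
  imageSieve_mem {V} s x hx := by
    obtain ⟨V', hxV', r, e, he⟩ := hloc x
    let i : V ⊓ V' ⟶ V := homOfLE inf_le_left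
    refine ⟨V ⊓ V', i, ?_, hx, hxV'⟩
    exact (mulConst_bijective U hM hfin he (inf_le_right : V ⊓ V' ≤ V')).2 _

theorem isIso_tensorHom
    (hloc : ∀ x : X, ∃ V : X.Opens, x ∈ V ∧ ∃ (r : ℕ) (e : Fin r → Γ(M, V)), IsFrame K e) :
    IsIso (tensorHom U hM hfin hS) := by
  refine isIso_of_isLocallyBijective_fac (R := X.ringCatSheaf) (toTensor K U M) _ _
    (toTensor_tensorHom U hM hfin hS) (isLocallyInjective_preTensorHom hM hfin hloc)
    (isLocallySurjective_preTensorHom hM hfin hloc) ?_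
  exact ((Opens.grothendieckTopology X).W_toSheafify
    (tensorPre K U M).presheaf).isLocallySurjective

end Mix

end SheafMultiplicationMap

end MixRes

end

theorem mainTheorem10 (K : Type u) [Field K] [CharZero K] (X : Scheme.{u})
    [X.Over (Spec (CommRingCat.of K))] [LocallyOfFiniteType (X ↘ Spec (CommRingCat.of K))]
    [QuasiCompact (X ↘ Spec (CommRingCat.of K))]
    (m : ℕ) (U : Fin (m + 1) → X.Opens) (hU : ∀ i, IsAffineOpen (U i)) (hcov : ⨆ i, U i = ⊤) :
    ∃ (μ : ∀ V : X.Opens, Mix K U (OX X) V →ₗ[K] Mix K U (OX X) V →ₗ[K] Mix K U (OX X) V)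
      (d : ∀ V : X.Opens, Mix K U (OX X) V →ₗ[K] Mix K U (OX X) V)
      (p₁ p₂ : ∀ V : X.Opens, Γ(X, V) →ₗ[K] Mix K U (OX X) V),
      -- the product, the differential and the two homomorphisms are the ones of the definition
      IsMixMul K U (OX X) μ ∧ IsMixD K U (OX X) d ∧
      IsMixP₁ K U (fun V => p₁ V) ∧ IsMixP₂ K U (fun V => p₂ V) ∧
      -- `Mix(𝒪)` is a sheaf of super-commutative associative unital DG algebras
      IsBigraded K U (OX X) ∧ (Mix.toAb K U (OX X)).IsSheaf ∧
      (∀ V, IsSuperCommDGAlgebra K (Mix.gr K U (OX X) V) (μ V) (p₂ V 1) (d V)) ∧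
      (∀ (V W : X.Opens) (h : W ≤ V) (u v : Mix K U (OX X) V),
        Mix.res h (μ V u v) = μ W (Mix.res h u) (Mix.res h v) ∧
        Mix.res h (d V u) = d W (Mix.res h u)) ∧
      -- `p₁^*` and `p₂^*` are homomorphisms of sheaves of algebras from `𝒪` to `Mix^0(𝒪)`
      (∀ V, IsAlgHomZero K (Mix.gr K U (OX X) V) (μ V) (p₂ V 1) (p₁ V) ∧
        IsAlgHomZero K (Mix.gr K U (OX X) V) (μ V) (p₂ V 1) (p₂ V)) ∧
      (∀ (V W : X.Opens) (h : W ≤ V) (c : Γ(X, V)),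
        Mix.res h (p₁ V c) = p₁ W (resA K h c) ∧ Mix.res h (p₂ V c) = p₂ W (resA K h c)) ∧
      -- the modules `Mix(M)`
      ∀ (M : X.Modules), SheafOfModules.IsQuasicoherent (R := X.ringCatSheaf) M →
        ∃ (ν : ∀ V : X.Opens, Mix K U (OX X) V →ₗ[K] Mix K U M V →ₗ[K] Mix K U M V)
          (dM : ∀ V : X.Opens, Mix K U M V →ₗ[K] Mix K U M V)
          (hM : (Mix.toAb K U M).IsSheaf),
          IsMixMul K U M ν ∧ IsMixD K U M dM ∧ IsBigraded K U M ∧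
          (∀ V, IsDGModule K (Mix.gr K U (OX X) V) (μ V) (p₂ V 1) (d V)
            (Mix.gr K U M V) (ν V) (dM V)) ∧
          (∀ (V W : X.Opens) (h : W ≤ V) (u : Mix K U (OX X) V) (v : Mix K U M V),
            Mix.res h (ν V u v) = ν W (Mix.res h u) (Mix.res h v) ∧
            Mix.res h (dM V v) = dM W (Mix.res h v)) ∧
          (∀ (V : X.Opens) (c : Γ(X, V)) (v : Mix K U M V), ν V (p₂ V c) v = c • v) ∧
          -- for `M` locally free of finite rank the multiplication map is an isomorphism
          (IsLocallyFreeFinite M →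
            ∃ (ι : ∀ V : X.Opens, Γ(M, V) → Mix K U M V)
              (Φ : Mix.tensor K U M ⟶ Mix.sheaf K U M hM),
              IsMixConst K U M ι ∧
              (∀ (V : X.Opens) (u : Mix K U (OX X) V) (n : Γ(M, V)),
                (Φ.val.app (.op V)).hom
                  (((Mix.toTensor K U M).app (.op V)).hom (u ⊗ₜ[Γ(X, V)] n)) =
                    ν V u (ι V n)) ∧
              IsIso Φ) := by
  have := Mix.noetherianSpace K X
  have hX : IsLocMod K (OX X) := isLocMod_unit K
  have hp₁ : ∀ {V : X.Opens} (c : Γ(X, V)), Mix.p₁ K U V c ∈ Mix.gr K U (OX X) V 0 :=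
    fun c => Mix.mem_gr (Mix.p₁_mem_bi c) (zero_add 0)
  have hp₂ : ∀ {V : X.Opens} (c : Γ(X, V)), Mix.p₂ K U V c ∈ Mix.gr K U (OX X) V 0 :=
    fun c => Mix.mem_gr (Mix.p₂_mem_bi c) (zero_add 0)
  refine ⟨fun V => Mix.mul K U (OX X) V, fun V => Mix.diff K U (OX X) V, fun V => Mix.p₁ K U V,
    fun V => Mix.p₂ K U V, Mix.isMixMul, Mix.isMixD, Mix.isMixP₁, Mix.isMixP₂, isBigraded,
    Mix.isSheaf U hX, fun V => ?_, fun V W h u v => ⟨Mix.res_mul h u v, Mix.res_diff h u⟩,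
    fun V => ⟨⟨hp₁, Mix.p₁_one, Mix.p₁_mul⟩, ⟨hp₂, rfl, Mix.p₂_mul⟩⟩,
    fun V W h c => ⟨Mix.res_p₁ h c, Mix.res_p₂ h c⟩, fun M hqc => ?_⟩
  · exact ⟨Mix.isInternal_gr, hp₂ 1, fun ha hb => Mix.mul_mem_gr ha hb, Mix.one_mul, Mix.mul_one, Mix.mul_assoc,
      Mix.mul_comm, Mix.diff_mem_gr, fun b ha => Mix.diff_mul ha b, Mix.diff_diff⟩
  have hM : IsLocMod K M := isLocMod_of_isQuasicoherent K M hqc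
  refine ⟨fun V => Mix.mul K U M V, fun V => Mix.diff K U M V, Mix.isSheaf U hM, Mix.isMixMul,
    Mix.isMixD, isBigraded, fun V => ?_,
    fun V W h u v => ⟨Mix.res_mul h u v, Mix.res_diff h v⟩,
    fun V c v => Mix.p₂_mul_apply c v, fun hlf => ?_⟩
  · exact ⟨Mix.isInternal_gr, fun ha hb => Mix.mul_mem_gr ha hb, Mix.one_mul, Mix.mul_assoc, Mix.diff_mem_gr,
      fun n ha => Mix.diff_mul ha n, Mix.diff_diff⟩
  have hfin := hM.finite_of_frame hlf
  exact ⟨fun V => Mix.const U hM hfin V, Mix.tensorHom U hM hfin (Mix.isSheaf U hM),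
    fun V c l i => Mix.const_lim hM hfin c l i, Mix.tensorHom_apply U hM hfin (Mix.isSheaf U hM),
    Mix.isIso_tensorHom hM hfin (Mix.isSheaf U hM) hlf⟩
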